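/- **Setting.** Let $\bigwedge_\infty=\bigwedge_\infty^0\oplus\bigwedge_\infty^1$ be the complex Grassmann algebra of formal sums of monomials $\zeta_{i_1}\cdots\zeta_{i_m}$ ($i_1<\dots<i_m$) in anticommuting generators $\zeta_0,\zeta_1,\zeta_2,\dots$. For an even variable $x$ and an odd variable $\varphi$ put, for $n\in\mathbb Z$, $$L_n=-\Bigl(x^{n+1}\tfrac{\partial}{\partial x}+\tfrac{n+1}{2}\,\varphi x^n\tfrac{\partial}{\partial\varphi}\Bigr),\qquad G_{n-\frac12}=-x^n\Bigl(\tfrac{\partial}{\partial\varphi}-\varphi\tfrac{\partial}{\partial x}\Bigr),$$ where odd derivatives are left derivatives; let $a^{-2L_0}$ be the operator $\varphi^mx^n\mapsto a^{2n+m}\varphi^mx^n$, and let $$\tilde E(A,M)=\exp\Bigl(-\sum_{j\ge1}(A_jL_j+M_{j-\frac12}G_{j-\frac12})\Bigr)\cdot(x,\varphi),\qquad \hat E(a,A,M)=\exp\Bigl(-\sum_{j\ge1}(A_jL_j+M_{j-\frac12}G_{j-\frac12})\Bigr)\cdot a^{-2L_0}\cdot(x,\varphi).$$ Let $\mathcal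 H$ be the set of pairs of sequences $A_j\in\bigwedge_\infty^0$, $M_{j-\frac12}\in\bigwedge_\infty^1$ ($j\ge1$) such that $\tilde E(A,M)$ converges absolutely in a neighborhood of $0$ (that is, for some $r>0$ all the component power series in $x$ of its coefficients converge absolutely for $|x|\le r$). The moduli space of superspheres with $1+1$ tubes is $SK(1)=\mathcal H\times\bigl((\bigwedge_\infty^0)^\times\times\mathcal H\bigr)$, with points $Q=\bigl((A^{(0)},M^{(0)}),(a,A^{(1)},M^{(1)})\bigr)$ and identity $e=(\mathbf 0,(1,\mathbf 0))$. Let $SD(1)$ be the algebra of functions $F:SK(1)\to\bigwedge_\infty$ that are polynomials, with coefficients in $\bigwedge_\infty$, in $a,a^{-1},A^{(k)}_j,M^{(k)}_{j-\frac12}$ ($k=0,1$, $j\ge1$). An even (odd) tangent vector at $e$ is a linear map $\mathcal L:SD(1)\to\bigwedge_\infty$, right linear over the constants in $\bigwedge_\infty$, with $\mathcal L(F_1F_2)=\mathcal L F_1\cdot F_2(e)+F_1(e)\cdot\mathcal L F_2$ (respectively, for $F_1$ homogeneous of sign $\eta(F_1)$, $\mathcal L(F_1F_2)=\mathcal L F_1\cdot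 F_2(e)+(-1)^{\eta(F_1)}F_1(e)\cdot\mathcal L F_2$). Even and odd tangent vectors span $T_eSK(1)$. The partial derivatives $\frac{\partial}{\partial a}|_e$, $\frac{\partial}{\partial A^{(k)}_j}|_e$ (even) and $\frac{\partial}{\partial M^{(k)}_{j-1/2}}|_e$ (odd) are the unique tangent vectors of the indicated parity with value $1$ on the coordinate in question and $0$ on the other coordinates. Let $\hat T_eSK(1)\subset T_eSK(1)$ be the space of finite complex linear combinations of the $-\frac{\partial}{\partial a}|_e$, $-\frac{\partial}{\partial A^{(k)}_j}|_e$, $-\frac{\partial}{\partial M^{(k)}_{j-1/2}}|_e$. **Formal sewing.** Let $\mathcal A^{(k)}_j,\mathcal B^{(k)}_j$ be even and $\mathcal M^{(k)}_{j-\frac12},\mathcal N^{(k)}_{j-\frac12}$ odd formal variables ($k=0,1$, $j\ge1$), and $\alpha=\alpha_0^{1/2}$, $\beta=\beta_0^{1/2}$ invertible even variables. There are superseries $\Psi_j$ ($j\in\frac12\mathbb Z$) in these variables (Laurent polynomial in $\alpha$ for each monomial in the others; even for $j\in\mathbb Z$ and odd otherwise; without constant term; each monomial occurring in finitely many $\Psi_j$)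 which solve the formal sewing equation $\bar F^{(1)}=\bar F^{(2)}\circ W\circ H_1$, where $$\bar F^{(1)}=\exp\Bigl(\sum_{j\ge1}(\Psi_{-j}L_{-j}+\Psi_{-j+\frac12}G_{-j+\frac12})\Bigr)(x,\varphi),\quad \bar F^{(2)}=e^{-2\Psi_0L_0}\,\alpha^{2L_0}\exp\Bigl(-\sum_{j\ge1}(\Psi_jL_j+\Psi_{j-\frac12}G_{j-\frac12})\Bigr)(x,\varphi),$$ $$H_1=\hat E(\alpha,\mathcal A^{(1)},\mathcal M^{(1)}),\qquad W=\exp\Bigl(-\sum_{j\ge1}(\mathcal B^{(0)}_jL_{-j}+\mathcal N^{(0)}_{j-\frac12}G_{-j+\frac12})\Bigr)(x,\varphi);$$ and there are superseries $\Phi^{(01)}=\bigl((\Phi^{(0)}_j,\Phi^{(0)}_{j-\frac12})_{j\ge1},(\lambda_0^{1/2},(\Phi^{(1)}_j,\Phi^{(1)}_{j-\frac12})_{j\ge1})\bigr)$ of the same kind (Laurent polynomial in $\alpha,\beta$ for each monomial; $\lambda_0^{1/2}$ may have a constant term), the coordinates of the sewn supersphere, with $$\tilde E\bigl(\Phi^{(0)}_j,-i\Phi^{(0)}_{j-\frac12}\bigr)=\tilde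 E\bigl(\mathcal A^{(0)},-i\mathcal M^{(0)}\bigr)\circ\tilde E\bigl(\{-\Psi_{-j},\,i\Psi_{-j+\frac12}\}_{j\ge1}\bigr),$$ $$\hat E\bigl(\lambda_0^{1/2},\Phi^{(1)}_j,\Phi^{(1)}_{j-\frac12}\bigr)=\hat E\bigl(\beta,\mathcal B^{(1)},\mathcal N^{(1)}\bigr)\circ\hat E\bigl(\alpha e^{-\Psi_0},\{-\Psi_j,-\Psi_{j-\frac12}\}_{j\ge1}\bigr).$$ For $F\in SD(1)$ let $F(\Phi^{(01)})$ be obtained by substituting $\lambda_0^{1/2},\Phi^{(k)}_j,\Phi^{(k)}_{j-\frac12}$ for $a,A^{(k)}_j,M^{(k)}_{j-\frac12}$; $|_e$ means setting all formal variables to $0$ and $\alpha=\beta=1$. **The bracket.** Write $\partial_{\mathcal A}$ etc. for (left) partial derivatives, and suppress $|_e$. Define a bilinear bracket on $\hat T_eSK(1)$ by requiring, for $F\in SD(1)$ and $j,k\ge1$, that $[\cdot,\cdot]F$ be the following operator applied to $F(\Phi^{(01)})$ and evaluated at $e$: - $[\partial_{A^{(k)}_i},\partial_{A^{(k)}_j}]$: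 $\partial_{\mathcal A^{(k)}_i}\partial_{\mathcal B^{(k)}_j}-\partial_{\mathcal A^{(k)}_j}\partial_{\mathcal B^{(k)}_i}$, for $k=0,1$ and $i,j\ge1$; - $[\partial_a,\partial_{A^{(0)}_j}]$: $\partial_\alpha\partial_{\mathcal B^{(0)}_j}-\partial_{\mathcal A^{(0)}_j}\partial_\alpha$; $[\partial_a,\partial_{A^{(1)}_j}]$: $\partial_\alpha\partial_{\mathcal B^{(1)}_j}-\partial_{\mathcal A^{(1)}_j}\partial_\beta$; - $[\partial_{A^{(1)}_j},\partial_{A^{(0)}_k}]$: $\partial_{\mathcal A^{(1)}_j}\partial_{\mathcal B^{(0)}_k}-\partial_{\mathcal B^{(0)}_k}\partial_{\mathcal B^{(1)}_j}$ if $j\ge k$, and $\partial_{\mathcal A^{(1)}_j}\partial_{\mathcal B^{(0)}_k}-\partial_{\mathcal A^{(0)}_k}\partial_{\mathcal A^{(1)}_j}$ if $j<k$; - $[\partial_{M^{(k)}_{i-1/2}},\partial_{M^{(k)}_{j-1/2}}]$: $\partial_{\mathcal M^{(k)}_{i-1/2}}\partial_{\mathcal N^{(k)}_{j-1/2}}+\partial_{\mathcal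 M^{(k)}_{j-1/2}}\partial_{\mathcal N^{(k)}_{i-1/2}}$, for $k=0,1$ and $i,j\ge1$; - $[\partial_{M^{(1)}_{j-1/2}},\partial_{M^{(0)}_{k-1/2}}]$: $\partial_{\mathcal M^{(1)}_{j-1/2}}\partial_{\mathcal N^{(0)}_{k-1/2}}+\partial_{\mathcal M^{(0)}_{k-1/2}}\partial_{\mathcal M^{(1)}_{j-1/2}}$; - $[\partial_{A^{(k)}_i},\partial_{M^{(k)}_{j-1/2}}]$: $\partial_{\mathcal A^{(k)}_i}\partial_{\mathcal N^{(k)}_{j-1/2}}-\partial_{\mathcal M^{(k)}_{j-1/2}}\partial_{\mathcal B^{(k)}_i}$, for $k=0,1$ and $i,j\ge1$; - $[\partial_a,\partial_{M^{(0)}_{j-1/2}}]$: $\partial_\alpha\partial_{\mathcal N^{(0)}_{j-1/2}}-\partial_{\mathcal M^{(0)}_{j-1/2}}\partial_\alpha$; $[\partial_a,\partial_{M^{(1)}_{j-1/2}}]$: $\partial_\alpha\partial_{\mathcal N^{(1)}_{j-1/2}}-\partial_{\mathcal M^{(1)}_{j-1/2}}\partial_\beta$; - $[\partial_{A^{(1)}_j},\partial_{M^{(0)}_{k-1/2}}]$: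 $\partial_{\mathcal A^{(1)}_j}\partial_{\mathcal N^{(0)}_{k-1/2}}-\partial_{\mathcal N^{(0)}_{k-1/2}}\partial_{\mathcal B^{(1)}_j}$ if $j\ge k$, and $\partial_{\mathcal A^{(1)}_j}\partial_{\mathcal N^{(0)}_{k-1/2}}-\partial_{\mathcal M^{(0)}_{k-1/2}}\partial_{\mathcal A^{(1)}_j}$ if $j<k$; - $[\partial_{M^{(1)}_{j-1/2}},\partial_{A^{(0)}_k}]$: $\partial_{\mathcal M^{(1)}_{j-1/2}}\partial_{\mathcal B^{(0)}_k}-\partial_{\mathcal B^{(0)}_k}\partial_{\mathcal N^{(1)}_{j-1/2}}$ if $j\ge k$, and $\partial_{\mathcal M^{(1)}_{j-1/2}}\partial_{\mathcal B^{(0)}_k}-\partial_{\mathcal A^{(0)}_k}\partial_{\mathcal M^{(1)}_{j-1/2}}$ if $j<k$; the brackets in the opposite order are given by super-skew-symmetry $[u,v]=-(-1)^{\eta(u)\eta(v)}[v,u]$, and $[\partial_a,\partial_a]=0$. **Proposition.** The superseries $\Psi_j$ and $\Phi^{(01)}$, the partial derivatives at $e$, and the substitution homomorphism $F\mapsto F(\Phi^{(01)})$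 exist (the last two uniquely), the formulas above define a bilinear bracket $\hat T_eSK(1)\times\hat T_eSK(1)\to\hat T_eSK(1)$ (for every solution $\Psi_j,\Phi^{(01)}$ of the above equations), and $\hat T_eSK(1)\subset T_eSK(1)$, graded by even and odd tangent vectors, is a Lie superalgebra under it. It is isomorphic to the Neveu–Schwarz algebra with central charge zero: for $j\ge1$ put $$\mathcal L(-j)=-\frac{\partial}{\partial A^{(0)}_j}\Big|_e,\quad \mathcal L(j)=-\frac{\partial}{\partial A^{(1)}_j}\Big|_e,\quad \mathcal L(0)=-\frac12\frac{\partial}{\partial a}\Big|_e,\quad \mathcal G(-j+\tfrac12)=-\frac{\partial}{\partial M^{(0)}_{j-1/2}}\Big|_e,\quad \mathcal G(j-\tfrac12)=-\frac{\partial}{\partial M^{(1)}_{j-1/2}}\Big|_e;$$ then the $\mathcal L(n)$ and $\mathcal G(n+\frac12)$, $n\in\mathbb Z$, form a basis of $\hat T_eSK(1)$, and for all $m,n\in\mathbb Z$ $$[\mathcal L(m),\mathcal L(n)]=(m-n)\mathcal L(m+n),\quad [\mathcal G(m+\tfrac12),\mathcal L(n)]=\Bigl(m-\frac{n-1}{2}\Bigr)\mathcal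 G(m+n+\tfrac12),\quad [\mathcal G(m+\tfrac12),\mathcal G(n-\tfrac12)]=2\mathcal L(m+n).$$ -/

import Mathlib

noncomputable section

/-! ## Superalgebras of formal sums of ordered monomials in odd generators -/

/-- The number of pairs `(s, t)` in `S × T` with `t < s`. -/
def inversions {τ : Type} [LinearOrder τ] (S T : Finset τ) : ℕ :=
  ((S ×ˢ T).filter (fun p => p.2 < p.1)).card

/-- The sign produced by reordering the ordered monomial of `S` times the ordered monomial of
`T` (for disjoint `S` and `T`) into the ordered monomial of `S ∪ T`. -/
def shuffleSign {τ : Type} [LinearOrder τ] (S T : Finset τ) : ℤ := (-1) ^ inversions S T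

/-- The Grassmann algebra of all formal sums `∑_S f(S) θ_S`, where `S` runs over the finite
subsets of `τ`, and `θ_S = θ_{s₁} ⋯ θ_{s_m}` if `S = {s₁ < ⋯ < s_m}`; the generators `θ_s`,
for `s` in `τ`, anticommute and square to zero, and the coefficients lie in `K`. -/
def Gr (τ K : Type) : Type := Finset τ → K

namespace Gr

variable {τ K : Type}

instance instAddCommGroup [AddCommGroup K] : AddCommGroup (Gr τ K) :=
  inferInstanceAs (AddCommGroup (Finset τ → K))

instance instModule {R : Type} [Semiring R] [AddCommGroup K] [Module R K] : Module R (Gr τ K) :=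
  inferInstanceAs (Module R (Finset τ → K))

@[ext] theorem ext {f g : Gr τ K} (h : ∀ S, f S = g S) : f = g := funext h

theorem add_apply [AddCommGroup K] (f g : Gr τ K) (S : Finset τ) : (f + g) S = f S + g S := rfl

theorem zero_apply [AddCommGroup K] (S : Finset τ) : (0 : Gr τ K) S = 0 := rfl

theorem smul_apply {R : Type} [Semiring R] [AddCommGroup K] [Module R K] (c : R) (f : Gr τ K)
    (S : Finset τ) : (c • f) S = c • f S := rfl

/-- The monomial `k θ_S`. -/
def mono [DecidableEq τ] [Zero K] (S : Finset τ) (k : K) : Gr τ K := fun T => if T = S then k else 0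

/-- The generator `θ_s`. -/
def gen [DecidableEq τ] [Zero K] [One K] (s : τ) : Gr τ K := mono {s} 1

section Ring

variable [LinearOrder τ] [CommRing K]

instance instOne : One (Gr τ K) := ⟨mono ∅ 1⟩

instance instMul : Mul (Gr τ K) :=
  ⟨fun f g S => ∑ T ∈ S.powerset, (shuffleSign T (S \ T) : K) * (f T * g (S \ T))⟩

theorem one_apply (S : Finset τ) : (1 : Gr τ K) S = if S = ∅ then 1 else 0 := rfl

theorem mul_apply (f g : Gr τ K) (S : Finset τ) :
    (f * g) S = ∑ T ∈ S.powerset, (shuffleSign T (S \ T) : K) * (f T * g (S \ T)) := rfl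


theorem inversions_empty_left (S : Finset τ) : inversions ∅ S = 0 := by
  simp [inversions]

theorem inversions_empty_right (S : Finset τ) : inversions S ∅ = 0 := by
  simp [inversions]

theorem inversions_union_left {S T : Finset τ} (h : Disjoint S T) (U : Finset τ) :
    inversions (S ∪ T) U = inversions S U + inversions T U := by
  unfold inversions
  rw [Finset.union_product, Finset.filter_union, Finset.card_union_of_disjoint]
  apply Finset.disjoint_filter_filter
  exact Finset.disjoint_product.mpr (Or.inl h)

theorem inversions_union_right {S T : Finset τ} (h : Disjoint S T) (U : Finset τ) :
    inversions U (S ∪ T) = inversions U S + inversions U T := by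
  unfold inversions
  rw [Finset.product_union, Finset.filter_union, Finset.card_union_of_disjoint]
  apply Finset.disjoint_filter_filter
  exact Finset.disjoint_product.mpr (Or.inr h)

theorem shuffleSign_assoc {S T U : Finset τ} (hST : Disjoint S T) (hTU : Disjoint T U) :
    shuffleSign S T * shuffleSign (S ∪ T) U = shuffleSign S (T ∪ U) * shuffleSign T U := by
  unfold shuffleSign
  rw [inversions_union_left hST, inversions_union_right hTU, ← pow_add, ← pow_add]
  congr 1
  omega

theorem mul_assoc_aux (f g h : Gr τ K) : f * g * h = f * (g * h) := by
  ext S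
  simp only [mul_apply, Finset.sum_mul, Finset.mul_sum]
  rw [Finset.sum_sigma', Finset.sum_sigma']
  refine Finset.sum_bij' (fun p _ => ⟨p.2, p.1 \ p.2⟩) (fun p _ => ⟨p.1 ∪ p.2, p.1⟩) ?_ ?_ ?_ ?_ ?_
  · rintro ⟨T, U⟩ hp
    simp only [Finset.mem_sigma, Finset.mem_powerset] at hp ⊢
    exact ⟨hp.2.trans hp.1, Finset.sdiff_subset_sdiff hp.1 (Finset.Subset.refl _)⟩
  · rintro ⟨U, V⟩ hp
    simp only [Finset.mem_sigma, Finset.mem_powerset] at hp ⊢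
    exact ⟨Finset.union_subset hp.1 (hp.2.trans Finset.sdiff_subset), Finset.subset_union_left⟩
  · rintro ⟨T, U⟩ hp
    simp only [Finset.mem_sigma, Finset.mem_powerset] at hp
    simp only [Finset.union_sdiff_of_subset hp.2]
  · rintro ⟨U, V⟩ hp
    simp only [Finset.mem_sigma, Finset.mem_powerset] at hp
    have : Disjoint U V := (Finset.subset_sdiff.mp hp.2).2.symm
    simp only [Finset.union_sdiff_cancel_left this]
  · rintro ⟨T, U⟩ hp
    simp only [Finset.mem_sigma, Finset.mem_powerset] at hp
    have h1 : S \ U = (T \ U) ∪ (S \ T) := by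
      ext x
      have h3 := @hp.1 x
      have h4 := @hp.2 x
      simp only [Finset.mem_union, Finset.mem_sdiff]
      tauto
    have h2 : (S \ U) \ (T \ U) = S \ T := by
      ext x
      have h3 := @hp.1 x
      have h4 := @hp.2 x
      simp only [Finset.mem_sdiff]
      tauto
    have h5 : U ∪ (T \ U) = T := Finset.union_sdiff_of_subset hp.2
    have hd1 : Disjoint U (T \ U) := Finset.disjoint_sdiff
    have hd2 : Disjoint (T \ U) (S \ T) :=
      (Finset.disjoint_sdiff (s := T) (t := S)).mono_left Finset.sdiff_subset
    have key := shuffleSign_assoc hd1 hd2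
    rw [h5, ← h1] at key
    have key2 := congrArg (Int.cast : ℤ → K) key
    push_cast at key2
    simp only [h2]
    linear_combination (f U * g (T \ U) * h (S \ T)) * key2

theorem one_mul_aux (f : Gr τ K) : 1 * f = f := by
  ext S
  rw [mul_apply, Finset.sum_eq_single ∅]
  · simp [one_apply, shuffleSign, inversions_empty_left]
  · intro T _ hT
    simp [one_apply, hT]
  · simp

theorem mul_one_aux (f : Gr τ K) : f * 1 = f := by
  ext S
  rw [mul_apply, Finset.sum_eq_single S]
  · simp [one_apply, shuffleSign, inversions_empty_right]
  · intro T hT hTS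
    have : S \ T ≠ ∅ := fun h =>
      hTS (Finset.Subset.antisymm (Finset.mem_powerset.mp hT) (Finset.sdiff_eq_empty_iff_subset.mp h))
    simp [one_apply, this]
  · simp

instance instRing : Ring (Gr τ K) :=
  { Gr.instAddCommGroup, Gr.instOne, Gr.instMul with
    left_distrib := by
      intro f g h
      ext S
      simp only [mul_apply, add_apply, mul_add, Finset.sum_add_distrib]
    right_distrib := by
      intro f g h
      ext S
      simp only [mul_apply, add_apply, mul_add, add_mul, Finset.sum_add_distrib]
    zero_mul := by
      intro f
      ext S
      simp [mul_apply, zero_apply]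
    mul_zero := by
      intro f
      ext S
      simp [mul_apply, zero_apply]
    mul_assoc := mul_assoc_aux
    one_mul := one_mul_aux
    mul_one := mul_one_aux }

instance instAlgebra {R : Type} [CommRing R] [Algebra R K] : Algebra R (Gr τ K) :=
  Algebra.ofModule
    (by
      intro r f g
      ext S
      simp only [mul_apply, smul_apply, Finset.smul_sum, smul_mul_assoc, mul_smul_comm])
    (by
      intro r f g
      ext S
      simp only [mul_apply, smul_apply, Finset.smul_sum, mul_smul_comm])

end Ring

end Gr

/-- An element of a Grassmann algebra is even if it involves only monomials of even length. -/
def Gr.IsEven {τ K : Type} [Zero K] (f : Gr τ K) : Prop := ∀ S, f S ≠ 0 → Even S.card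

/-- An element of a Grassmann algebra is odd if it involves only monomials of odd length. -/
def Gr.IsOdd {τ K : Type} [Zero K] (f : Gr τ K) : Prop := ∀ S, f S ≠ 0 → Odd S.card

/-- The left derivative with respect to the odd generator `θ_p`. -/
def Gr.leftDeriv {τ K : Type} [LinearOrder τ] [CommRing K] (p : τ) (f : Gr τ K) : Gr τ K :=
  fun S => if p ∈ S then 0 else (shuffleSign {p} S : K) * f (insert p S)

/-- The infinite-dimensional Grassmann algebra `⋀_∞` over `ℂ` on generators `ζ_0, ζ_1, …`. -/
abbrev Lam : Type := Gr ℕ ℂ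

/-- The two punctures `∞` and `0` of a canonical supersphere with `1 + 1` tubes. -/
inductive Puncture
  | infty
  | zero

/-- The two superspheres being sewn: the variables of the left one are
`𝒜, ℳ, α₀^{1/2}`, the variables of the right one are `ℬ, 𝒩, β₀^{1/2}`. -/
inductive Side
  | left
  | right

/-- The odd generators in use: the generators `ζ_i` of `⋀_∞`, the odd formal variables
`ℳ^{(k)}_{j-1/2}` (side `left`) and `𝒩^{(k)}_{j-1/2}` (side `right`), and the odd
coordinate `φ`. -/
inductive OddVar
  | zeta (i : ℕ)
  | formal (s : Side) (k : Puncture) (j : ℕ+)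
  | phi

/-- The even formal variables `𝒜^{(k)}_j` (side `left`) and `ℬ^{(k)}_j` (side `right`). -/
abbrev EvenVar : Type := Side × Puncture × ℕ+

def Puncture.code : Puncture → ℕ
  | .infty => 0
  | .zero => 1

def Side.code : Side → ℕ
  | .left => 0
  | .right => 1

/-- An injection into a linearly ordered set, used only to order the odd generators. -/
def OddVar.code : OddVar → ℕ ×ₗ ℕ ×ₗ ℕ ×ₗ ℕ
  | .zeta i => toLex (0, toLex (i, toLex (0, 0)))
  | .formal s k j => toLex (1, toLex (s.code, toLex (k.code, (j : ℕ))))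
  | .phi => toLex (2, toLex (0, toLex (0, 0)))

theorem OddVar.code_injective : Function.Injective OddVar.code := by
  rintro (i | ⟨s, k, j⟩ | _) (i' | ⟨s', k', j'⟩ | _) h <;>
    simp only [OddVar.code, EmbeddingLike.apply_eq_iff_eq, Prod.mk.injEq] at h <;>
    first
    | rfl
    | (obtain ⟨_, hs, hk, hj⟩ := h
       have hj' : j = j' := PNat.eq hj
       cases s <;> cases s' <;> cases k <;> cases k' <;> simp_all [Side.code, Puncture.code])
    | simp_all

instance OddVar.instLinearOrder : LinearOrder OddVar :=
  LinearOrder.lift' OddVar.code OddVar.code_injective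

theorem OddVar.zeta_injective : Function.Injective OddVar.zeta := by
  intro i j h
  cases h
  rfl

def OddVar.zetaEmb : ℕ ↪ OddVar := ⟨OddVar.zeta, OddVar.zeta_injective⟩

open scoped Classical in
/-- The inclusion of `⋀_∞` into a Grassmann algebra on all the odd generators. -/
def Lam.incl (K : Type) [CommRing K] [Algebra ℂ K] (c : Lam) : Gr OddVar K := fun S =>
  if ∀ p ∈ S, ∃ i, p = OddVar.zeta i then
    algebraMap ℂ K (c (S.preimage OddVar.zeta OddVar.zeta_injective.injOn))
  else 0

/-- The sum of a family, coefficient by coefficient. -/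
def csum {ι τ σ R : Type} [CommRing R] (F : ι → Gr τ (MvPowerSeries σ R)) :
    Gr τ (MvPowerSeries σ R) :=
  fun S => (fun d => ∑ᶠ i, MvPowerSeries.coeff d (F i S) : (σ →₀ ℕ) → R)

/-- The exponential series `∑_n T^n f / n!` of an operator `T`, applied to `f`. -/
def expOp {τ σ R : Type} [CommRing R] [Algebra ℂ R]
    (T : Gr τ (MvPowerSeries σ R) → Gr τ (MvPowerSeries σ R)) (f : Gr τ (MvPowerSeries σ R)) :
    Gr τ (MvPowerSeries σ R) :=
  csum fun n : ℕ => ((n.factorial : ℂ)⁻¹) • T^[n] f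

/-! ## The superderivations `L_n` and `G_{n-1/2}` -/

/-- An even coordinate `x` in the coefficient ring `K`: its powers and the derivative `∂/∂x`. -/
structure XCoord (K : Type) where
  xpow : ℤ → K
  dx : K → K

section Operators

variable {K : Type} [CommRing K] [Algebra ℂ K] (X : XCoord K)

/-- The monomial `x^n`. -/
def sx (n : ℤ) : Gr OddVar K := Gr.mono ∅ (X.xpow n)

/-- The odd coordinate `φ`. -/
def sphi (K : Type) [CommRing K] : Gr OddVar K := Gr.gen OddVar.phi

/-- The derivative `∂/∂x`. -/
def sdx (f : Gr OddVar K) : Gr OddVar K := fun S => X.dx (f S)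

/-- The derivative `∂/∂φ`. -/
def sdphi (f : Gr OddVar K) : Gr OddVar K := Gr.leftDeriv OddVar.phi f

/-- `L_n = -(x^{n+1} ∂/∂x + ((n+1)/2) φ x^n ∂/∂φ)`. -/
def opL (n : ℤ) (f : Gr OddVar K) : Gr OddVar K :=
  -(sx X (n + 1) * sdx X f + (((n : ℂ) + 1) / 2) • (sphi K * (sx X n * sdphi f)))

/-- `opG n` is `G_{n-1/2} = -x^n (∂/∂φ - φ ∂/∂x)`. -/
def opG (n : ℤ) (f : Gr OddVar K) : Gr OddVar K :=
  -(sx X n * (sdphi f - sphi K * sdx X f))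

end Operators

section Series

variable {σ R : Type} [CommRing R] [Algebra ℂ R] (X : XCoord (MvPowerSeries σ R))

/-- `∑_{j ≥ 1} (A_j L_j + M_{j-1/2} G_{j-1/2})`; here `M j` stands for `M_{j-1/2}`. -/
def posOp (A M : ℕ+ → Gr OddVar (MvPowerSeries σ R)) (f : Gr OddVar (MvPowerSeries σ R)) :
    Gr OddVar (MvPowerSeries σ R) :=
  csum fun j : ℕ+ => A j * opL X (j : ℤ) f + M j * opG X (j : ℤ) f

/-- `∑_{j ≥ 1} (A_j L_{-j} + M_{j-1/2} G_{-j+1/2})`; here `M j` stands for `M_{j-1/2}`. -/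
def negOp (A M : ℕ+ → Gr OddVar (MvPowerSeries σ R)) (f : Gr OddVar (MvPowerSeries σ R)) :
    Gr OddVar (MvPowerSeries σ R) :=
  csum fun j : ℕ+ => A j * opL X (-(j : ℤ)) f + M j * opG X (1 - (j : ℤ)) f

/-- A pair of superfunctions of `(x, φ)`: the even and the odd component of a map. -/
abbrev SPair (σ R : Type) : Type := Gr OddVar (MvPowerSeries σ R) × Gr OddVar (MvPowerSeries σ R)

/-- The identity `(x, φ)`. -/
def xphi : SPair σ R := (sx X 1, sphi _)

/-- `Ẽ(A, M)(x, φ) = exp(-∑_{j ≥ 1} (A_j L_j + M_{j-1/2} G_{j-1/2})) · (x, φ)`. -/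
def Etilde (A M : ℕ+ → Gr OddVar (MvPowerSeries σ R)) : SPair σ R :=
  (expOp (fun f => -posOp X A M f) (xphi X).1, expOp (fun f => -posOp X A M f) (xphi X).2)

end Series

/-! ## The moduli space `SK(1)` -/

/-- The coordinate `x` on formal power series in `x` (only nonnegative powers are used). -/
def powX : XCoord (PowerSeries ℂ) where
  xpow n := PowerSeries.X ^ n.toNat
  dx := PowerSeries.derivative ℂ

/-- `Ẽ(A, M)` for sequences `A`, `M` in `⋀_∞`, a pair of power series in `(x, φ)` with
coefficients in `⋀_∞`. -/
def EtildeLam (A M : ℕ+ → Lam) : SPair Unit ℂ :=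
  Etilde powX (fun j => Lam.incl _ (A j)) (fun j => Lam.incl _ (M j))

/-- Absolute convergence, in a neighborhood of `0`, of a power series in `(x, φ)` with
coefficients in `⋀_∞`: for every finite set `S` of odd generators, the power series in `x`
that is the coefficient of the monomial of `S` converges absolutely for `|x| ≤ r`, with the
same `r > 0` for all `S`. -/
def ConvergesNearZero (f : Gr OddVar (PowerSeries ℂ)) : Prop :=
  ∃ r : ℝ, 0 < r ∧ ∀ S : Finset OddVar, Summable fun n : ℕ => ‖PowerSeries.coeff n (f S)‖ * r ^ n

/-- The set `ℋ`: sequences `A_j` in `⋀_∞^0` and `M_{j-1/2}` in `⋀_∞^1`, for `j ≥ 1`, such that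
`Ẽ(A, M)(x, φ)` is absolutely convergent in a neighborhood of `0`. -/
def InH (A M : ℕ+ → Lam) : Prop :=
  (∀ j, (A j).IsEven) ∧ (∀ j, (M j).IsOdd) ∧
    ConvergesNearZero (EtildeLam A M).1 ∧ ConvergesNearZero (EtildeLam A M).2

/-- The moduli space `SK(1)` of superspheres with `1 + 1` tubes: `a` in `(⋀_∞^0)^×` and the
pairs of sequences `(A^{(k)}, M^{(k)})` in `ℋ` for the punctures `k = ∞` and `k = 0`. -/
structure SK1 where
  a : Lam
  A : Puncture → ℕ+ → Lam
  M : Puncture → ℕ+ → Lam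
  a_even : a.IsEven
  a_unit : IsUnit a
  mem_H : ∀ k, InH (A k) (M k)

theorem csum_zero {ι τ σ R : Type} [CommRing R] :
    csum (fun _ : ι => (0 : Gr τ (MvPowerSeries σ R))) = 0 := by
  ext S d
  change (∑ᶠ i : ι, MvPowerSeries.coeff d ((0 : Gr τ (MvPowerSeries σ R)) S)) = 0
  simp only [Gr.zero_apply, map_zero, finsum_zero]

theorem expOp_zero {τ σ R : Type} [CommRing R] [Algebra ℂ R] (f : Gr τ (MvPowerSeries σ R)) :
    expOp (fun _ => 0) f = f := by
  ext S d
  change (∑ᶠ n : ℕ, MvPowerSeries.coeff d ((((n.factorial : ℂ)⁻¹) •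
    (fun _ : Gr τ (MvPowerSeries σ R) => (0 : Gr τ (MvPowerSeries σ R)))^[n] f) S)) = f S d
  rw [finsum_eq_single _ 0]
  · simp only [Nat.factorial_zero, Nat.cast_one, inv_one, one_smul, Function.iterate_zero, id_eq]
    rfl
  · intro n hn
    obtain ⟨m, rfl⟩ := Nat.exists_eq_succ_of_ne_zero hn
    rw [Function.iterate_succ_apply']
    simp [Gr.zero_apply]

theorem Lam.incl_zero (K : Type) [CommRing K] [Algebra ℂ K] : Lam.incl K 0 = 0 := by
  ext S
  simp [Lam.incl, Gr.zero_apply]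

theorem convergesNearZero_mono (T : Finset OddVar) (p : PowerSeries ℂ)
    (hp : ∃ n, ∀ m, m ≠ n → PowerSeries.coeff m p = 0) :
    ConvergesNearZero (Gr.mono T p) := by
  obtain ⟨n, hn⟩ := hp
  refine ⟨1, one_pos, fun S => summable_of_ne_finset_zero (s := {n}) ?_⟩
  intro m hm
  have hm' : m ≠ n := by simpa using hm
  unfold Gr.mono
  split_ifs
  · simp [hn m hm']
  · simp

theorem inH_zero : InH 0 0 := by
  have h : ∀ f : Gr OddVar (PowerSeries ℂ),
      -posOp powX (fun j => Lam.incl _ ((0 : ℕ+ → Lam) j)) (fun j => Lam.incl _ ((0 : ℕ+ → Lam) j)) f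
        = 0 := by
    intro f
    simp only [posOp, Pi.zero_apply, Lam.incl_zero, zero_mul, add_zero, csum_zero, neg_zero]
  refine ⟨fun j S hS => absurd rfl hS, fun j S hS => absurd rfl hS, ?_, ?_⟩
  · simp only [EtildeLam, Etilde, h, expOp_zero]
    refine convergesNearZero_mono _ _ ⟨1, fun m hm => ?_⟩
    simp [powX, PowerSeries.coeff_X, hm]
  · simp only [EtildeLam, Etilde, h, expOp_zero]
    refine convergesNearZero_mono _ _ ⟨0, fun m hm => ?_⟩
    simp [PowerSeries.coeff_one, hm]

/-- The identity `e` of `SK(1)`: all `A^{(k)}_j` and `M^{(k)}_{j-1/2}` vanish, and `a = 1`. -/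
def SK1.e : SK1 where
  a := 1
  A := 0
  M := 0
  a_even := by
    intro S hS
    rw [Gr.one_apply] at hS
    split_ifs at hS with h
    · simp [h]
    · exact absurd rfl hS
  a_unit := isUnit_one
  mem_H := fun _ => inH_zero

/-! ## Supermeromorphic superfunctions and tangent vectors -/

/-- The coordinates on `SK(1)`; `M k j` stands for `M^{(k)}_{j-1/2}`. -/
inductive Coord
  | a
  | A (k : Puncture) (j : ℕ+)
  | M (k : Puncture) (j : ℕ+)

/-- The parity of a coordinate. -/
def Coord.IsOdd : Coord → Prop
  | .a => False
  | .A _ _ => False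
  | .M _ _ => True

/-- A coordinate as a superfunction on `SK(1)`. -/
def Coord.fn : Coord → SK1 → Lam
  | .a => fun Q => Q.a
  | .A k j => fun Q => Q.A k j
  | .M k j => fun Q => Q.M k j

/-- The supermeromorphic superfunctions on `SK(1)`: polynomials, with coefficients in `⋀_∞`, in
`a`, `a⁻¹`, the `A^{(k)}_j` and the `M^{(k)}_{j-1/2}`. -/
def SD1 : Subalgebra ℂ (SK1 → Lam) :=
  Algebra.adjoin ℂ
    (Set.range (fun (c : Lam) (_ : SK1) => c) ∪ Set.range Coord.fn ∪ {fun Q => Ring.inverse Q.a})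

namespace SD1

/-- The constant superfunctions. -/
def const (c : Lam) : SD1 :=
  ⟨fun _ => c, Algebra.subset_adjoin (Or.inl (Or.inl ⟨c, rfl⟩))⟩

/-- The coordinate superfunctions. -/
def coord (p : Coord) : SD1 :=
  ⟨p.fn, Algebra.subset_adjoin (Or.inl (Or.inr ⟨p, rfl⟩))⟩

/-- The superfunction `a⁻¹`. -/
def aInv : SD1 :=
  ⟨fun Q => Ring.inverse Q.a, Algebra.subset_adjoin (Or.inr rfl)⟩

/-- The value `F(Q)`. -/
def eval (F : SD1) (Q : SK1) : Lam := F.1 Q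

def IsEven (F : SD1) : Prop := ∀ Q, (eval F Q).IsEven

def IsOdd (F : SD1) : Prop := ∀ Q, (eval F Q).IsOdd

end SD1

/-- The even supermeromorphic tangent vectors at `e`. The scalars are the constants in `⋀_∞`,
acting on superfunctions by multiplication on the right. -/
def evenTangent : Submodule ℂ (SD1 →ₗ[ℂ] Lam) where
  carrier := {D | (∀ F c, D (F * SD1.const c) = D F * c) ∧
    ∀ F₁ F₂, D (F₁ * F₂) = D F₁ * SD1.eval F₂ SK1.e + SD1.eval F₁ SK1.e * D F₂}
  zero_mem' := by simp
  add_mem' := by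
    rintro D E ⟨h1, h2⟩ ⟨h3, h4⟩
    refine ⟨fun F c => ?_, fun F₁ F₂ => ?_⟩
    · simp only [LinearMap.add_apply, h1, h3, add_mul]
    · simp only [LinearMap.add_apply, h2, h4, add_mul, mul_add]
      abel
  smul_mem' := by
    rintro r D ⟨h1, h2⟩
    refine ⟨fun F c => ?_, fun F₁ F₂ => ?_⟩
    · simp only [LinearMap.smul_apply, h1, smul_mul_assoc]
    · simp only [LinearMap.smul_apply, h2, smul_mul_assoc, mul_smul_comm, smul_add]

/-- The odd supermeromorphic tangent vectors at `e`. -/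
def oddTangent : Submodule ℂ (SD1 →ₗ[ℂ] Lam) where
  carrier := {D | (∀ F c, D (F * SD1.const c) = D F * c) ∧
    (∀ F₁ F₂, SD1.IsEven F₁ → D (F₁ * F₂) = D F₁ * SD1.eval F₂ SK1.e + SD1.eval F₁ SK1.e * D F₂) ∧
    ∀ F₁ F₂, SD1.IsOdd F₁ → D (F₁ * F₂) = D F₁ * SD1.eval F₂ SK1.e - SD1.eval F₁ SK1.e * D F₂}
  zero_mem' := by simp
  add_mem' := by
    rintro D E ⟨h1, h2, h3⟩ ⟨h4, h5, h6⟩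
    refine ⟨fun F c => ?_, fun F₁ F₂ hF => ?_, fun F₁ F₂ hF => ?_⟩
    · simp only [LinearMap.add_apply, h1, h4, add_mul]
    · simp only [LinearMap.add_apply, h2 _ _ hF, h5 _ _ hF, add_mul, mul_add]
      abel
    · simp only [LinearMap.add_apply, h3 _ _ hF, h6 _ _ hF, add_mul, mul_add]
      abel
  smul_mem' := by
    rintro r D ⟨h1, h2, h3⟩
    refine ⟨fun F c => ?_, fun F₁ F₂ hF => ?_, fun F₁ F₂ hF => ?_⟩
    · simp only [LinearMap.smul_apply, h1, smul_mul_assoc]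
    · simp only [LinearMap.smul_apply, h2 _ _ hF, smul_mul_assoc, mul_smul_comm, smul_add]
    · simp only [LinearMap.smul_apply, h3 _ _ hF, smul_mul_assoc, mul_smul_comm, smul_sub]

/-- The supermeromorphic tangent space `T_e SK(1)`. -/
def tangentSpace : Submodule ℂ (SD1 →ₗ[ℂ] Lam) := evenTangent ⊔ oddTangent

open scoped Classical in
/-- `pd p` is the partial derivative `∂/∂p|_e` for every coordinate `p`: the tangent vector, of
the parity of `p`, that takes the value `1` on `p` and `0` on the other coordinates. -/
def IsPartial (pd : Coord → (SD1 →ₗ[ℂ] Lam)) : Prop :=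
  (∀ p, ¬ p.IsOdd → pd p ∈ evenTangent) ∧ (∀ p, p.IsOdd → pd p ∈ oddTangent) ∧
    ∀ p q, pd p (SD1.coord q) = if p = q then 1 else 0

/-- `T̂_e SK(1)`: the finite linear combinations of the `-∂/∂p|_e`. -/
def hatTangent (pd : Coord → (SD1 →ₗ[ℂ] Lam)) : Submodule ℂ (SD1 →ₗ[ℂ] Lam) :=
  Submodule.span ℂ (Set.range fun p => -pd p)

/-- The element `∂/∂p|_e` of `T̂_e SK(1)`. -/
def hatPartial (pd : Coord → (SD1 →ₗ[ℂ] Lam)) (p : Coord) : hatTangent pd :=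
  ⟨pd p, by simpa using (hatTangent pd).neg_mem (Submodule.subset_span ⟨p, rfl⟩)⟩

/-! ## Formal sewing of superspheres -/

/-- Laurent polynomials over `ℂ` in `α₀^{1/2}`, `β₀^{1/2}` and `x`; the triple `(l, m, n)` is the
exponent of `(α₀^{1/2})^l (β₀^{1/2})^m x^n`. -/
abbrev Laurent : Type := AddMonoidAlgebra ℂ (ℤ × ℤ × ℤ)

/-- The derivative of a Laurent polynomial with respect to the variable with exponent vector `u`,
where `n` reads off the exponent of that variable. -/
def Laurent.deriv (u : ℤ × ℤ × ℤ) (n : ℤ × ℤ × ℤ → ℤ) (f : Laurent) : Laurent :=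
  f.coeff.sum fun w c => AddMonoidAlgebra.single (w - u) ((n w : ℂ) * c)

/-- The coefficient of `x^k`. -/
def Laurent.coeffX (k : ℤ) (f : Laurent) : Laurent :=
  f.coeff.sum fun w c => if w.2.2 = k then AddMonoidAlgebra.single (w.1, w.2.1, 0) c else 0

/-- The value at `α₀^{1/2} = β₀^{1/2} = 1` of a Laurent polynomial free of `x`. -/
def Laurent.evalOne (f : Laurent) : ℂ := f.coeff.sum fun _ c => c

/-- Power series in the even formal variables, with Laurent polynomial coefficients. -/
abbrev FormalCoeff : Type := MvPowerSeries EvenVar Laurent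

/-- Formal superseries in `x`, `φ`, `α₀^{1/2}`, `β₀^{1/2}` and the formal variables
`𝒜, ℳ, ℬ, 𝒩`, with coefficients in `⋀_∞`. -/
abbrev Formal : Type := Gr OddVar FormalCoeff

namespace Formal

/-- Apply an operation to the Laurent polynomial coefficients of all monomials. -/
def mapCoeff (g : Laurent → Laurent) (f : FormalCoeff) : FormalCoeff :=
  (fun d => g (MvPowerSeries.coeff d f) : (EvenVar →₀ ℕ) → Laurent)

/-- A Laurent monomial as a formal superseries. -/
def laurentMono (w : ℤ × ℤ × ℤ) : Formal :=
  Gr.mono ∅ (MvPowerSeries.C (AddMonoidAlgebra.single w 1))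

/-- The coordinate `x` on formal superseries. -/
def X : XCoord FormalCoeff where
  xpow n := MvPowerSeries.C (AddMonoidAlgebra.single (0, 0, n) 1)
  dx := mapCoeff (Laurent.deriv (0, 0, 1) fun w => w.2.2)

/-- The power `α₀^{n/2}`. -/
def alpha (n : ℤ) : Formal := laurentMono (n, 0, 0)

/-- The power `β₀^{n/2}`. -/
def beta (n : ℤ) : Formal := laurentMono (0, n, 0)

/-- The even formal variables `𝒜^{(k)}_j` and `ℬ^{(k)}_j`. -/
def evenVar (s : Side) (k : Puncture) (j : ℕ+) : Formal :=
  Gr.mono ∅ (MvPowerSeries.X (s, k, j))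

/-- The odd formal variables `ℳ^{(k)}_{j-1/2}` and `𝒩^{(k)}_{j-1/2}`. -/
def oddVar (s : Side) (k : Puncture) (j : ℕ+) : Formal := Gr.gen (OddVar.formal s k j)

/-- Integral powers of a (possibly invertible) superseries. -/
def zpow (f : Formal) (k : ℤ) : Formal :=
  if 0 ≤ k then f ^ k.toNat else Ring.inverse f ^ (-k).toNat

/-- The coefficient of `x^k`. -/
def coeffX (k : ℤ) (f : Formal) : Formal := fun S => mapCoeff (Laurent.coeffX k) (f S)

/-- The part of a superseries that does not involve `φ`. -/
def noPhi (f : Formal) : Formal := fun S => if OddVar.phi ∈ S then 0 else f S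

/-- The substitution `f(x', φ')` of an even `x'` and an odd `φ'` for `x` and `φ`: if
`f = ∑_k (u_k x^k + φ v_k x^k)`, this is `∑_k (u_k x'^k + φ' v_k x'^k)`. -/
def comp (f x' φ' : Formal) : Formal :=
  csum fun k : ℤ => coeffX k (noPhi f) * zpow x' k + φ' * (coeffX k (sdphi f) * zpow x' k)

/-- The composition `f ∘ g` of pairs of superseries in `(x, φ)`. -/
def compPair (f g : SPair EvenVar Laurent) : SPair EvenVar Laurent :=
  (comp f.1 g.1 g.2, comp f.2 g.1 g.2)

/-- The operator `λ^{-2L_0}`, that is `φ^m x^n ↦ λ^{2n+m} φ^m x^n`, for an even `λ`. -/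
def scale (lam f : Formal) : Formal := comp f (lam ^ 2 * sx X 1) (lam * sphi _)

/-- `exp f` for a superseries `f` without constant term. -/
def exp (f : Formal) : Formal := expOp (fun g => f * g) 1

/-- Apply an operator to both components of a pair. -/
def applyPair (T : Formal → Formal) (f : SPair EvenVar Laurent) : SPair EvenVar Laurent :=
  (T f.1, T f.2)

/-- `Ê(λ, A, M)(x, φ) = exp(-∑_{j ≥ 1} (A_j L_j + M_{j-1/2} G_{j-1/2})) · λ^{-2L_0} · (x, φ)`. -/
def Ehat (lam : Formal) (A M : ℕ+ → Formal) : SPair EvenVar Laurent :=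
  applyPair (fun f => expOp (fun g => -posOp X A M g) (scale lam f)) (xphi X)

/-- `f` is free of `x`, of `φ` and of the `ζ_i`: a superseries in the formal variables alone. -/
def IsFormal (f : Formal) : Prop :=
  (∀ S, f S ≠ 0 → ∀ p ∈ S, ∃ s k j, p = OddVar.formal s k j) ∧
    ∀ S d w, (MvPowerSeries.coeff d (f S)).coeff w ≠ 0 → w.2.2 = 0

/-- `f` has no term free of the formal variables `𝒜, ℳ, ℬ, 𝒩` (for `f` as above). -/
def NoConstantTerm (f : Formal) : Prop := MvPowerSeries.coeff 0 (f ∅) = 0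

/-- Every monomial in the formal variables occurs in finitely many members of the family. -/
def LocallyFinite {ι : Type} (f : ι → Formal) : Prop :=
  ∀ S d, {i | MvPowerSeries.coeff d (f i S) ≠ 0}.Finite

/-- A family of superseries in the formal variables of a given parity, without constant terms. -/
structure IsFamily {ι : Type} (parity : Formal → Prop) (f : ι → Formal) : Prop where
  formal : ∀ i, IsFormal (f i)
  parity : ∀ i, parity (f i)
  noConstantTerm : ∀ i, NoConstantTerm (f i)
  locallyFinite : LocallyFinite f

end Formal

/-- The superseries occurring in the formal sewing of the puncture `0` of the first supersphere
to the puncture `∞` of the second one: `Ψ_j` and `Ψ_{j-1/2}` for `j ∈ ℤ`, and the components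
`λ₀^{1/2}`, `Φ^{(k)}_j`, `Φ^{(k)}_{j-1/2}` of `Φ^{(01)}`. Here `psiOdd j` stands for
`Ψ_{j-1/2}`, and `phiOdd k j` for `Φ^{(k)}_{j-1/2}`. -/
structure SewingData where
  psiEven : ℤ → Formal
  psiOdd : ℤ → Formal
  lam : Formal
  phiEven : Puncture → ℕ+ → Formal
  phiOdd : Puncture → ℕ+ → Formal

namespace SewingData

open Formal

variable (S : SewingData)

/-- The local coordinate at the puncture `0` of the first supersphere. -/
def H1 : SPair EvenVar Laurent := Ehat (alpha 1) (evenVar .left .zero) (oddVar .left .zero)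

/-- The inverse of the local coordinate at the puncture `∞` of the second supersphere, composed
with `(x, φ) ↦ (1/x, iφ/x)`. -/
def W : SPair EvenVar Laurent :=
  applyPair (expOp fun f => -negOp X (evenVar .right .infty) (oddVar .right .infty) f) (xphi X)

/-- `F̄^{(1)} = exp(∑_{j ≥ 1} (Ψ_{-j} L_{-j} + Ψ_{-j+1/2} G_{-j+1/2})) · (x, φ)`. -/
def F1 : SPair EvenVar Laurent :=
  applyPair (expOp (negOp X (fun j => S.psiEven (-(j : ℤ))) fun j => S.psiOdd (1 - (j : ℤ))))
    (xphi X)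

/-- `F̄^{(2)} = exp(-2Ψ_0 L_0) · α₀^{L_0} · exp(-∑_{j ≥ 1} (Ψ_j L_j + Ψ_{j-1/2} G_{j-1/2})) · (x, φ)`,
where `α₀^{L_0} = (α₀^{1/2})^{2L_0}`. -/
def F2 : SPair EvenVar Laurent :=
  applyPair
    (fun f => expOp (fun g => -((2 : ℂ) • (S.psiEven 0 * opL X 0 g)))
      (scale (alpha (-1))
        (expOp (fun g => -posOp X (fun j => S.psiEven (j : ℤ)) (fun j => S.psiOdd (j : ℤ)) g) f)))
    (xphi X)

/-- The superseries `Ψ` and `Φ^{(01)}` solve the formal sewing problem: `F̄^{(1)}` and `F̄^{(2)}`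
solve the formal sewing equation, and `Φ^{(01)}` gives the local coordinates at `∞` and at `0` of
the sewn supersphere. -/
structure IsSewing : Prop where
  psiEven : IsFamily Gr.IsEven S.psiEven
  psiOdd : IsFamily Gr.IsOdd S.psiOdd
  phiEven : ∀ k, IsFamily Gr.IsEven (S.phiEven k)
  phiOdd : ∀ k, IsFamily Gr.IsOdd (S.phiOdd k)
  lam_formal : IsFormal S.lam
  lam_even : S.lam.IsEven
  sewing : S.F1 = compPair S.F2 (compPair W H1)
  at_infty : Etilde X (S.phiEven .infty) (fun j => -(Complex.I • S.phiOdd .infty j)) =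
    compPair
      (Etilde X (evenVar .left .infty) fun j => -(Complex.I • oddVar .left .infty j))
      (Etilde X (fun j => -S.psiEven (-(j : ℤ))) fun j => Complex.I • S.psiOdd (1 - (j : ℤ)))
  at_zero : Ehat S.lam (S.phiEven .zero) (S.phiOdd .zero) =
    compPair
      (Ehat (beta 1) (evenVar .right .zero) (oddVar .right .zero))
      (Ehat (alpha 1 * Formal.exp (-S.psiEven 0)) (fun j => -S.psiEven (j : ℤ))
        fun j => -S.psiOdd (j : ℤ))

end SewingData

/-- `sub F = F(Φ^{(01)})`: the substitution of the components of `Φ^{(01)}` for the coordinates in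
the polynomial expression of `F`. -/
structure IsSubstitution (S : SewingData) (sub : SD1 →ₐ[ℂ] Formal) : Prop where
  const : ∀ c, sub (SD1.const c) = Lam.incl _ c
  a : sub (SD1.coord .a) = S.lam
  A : ∀ k j, sub (SD1.coord (.A k j)) = S.phiEven k j
  M : ∀ k j, sub (SD1.coord (.M k j)) = S.phiOdd k j
  aInv : sub SD1.aInv = Ring.inverse S.lam

/-! ## The bracket on `T̂_e SK(1)` -/

namespace Formal

/-- The (left) partial derivative with respect to the formal variable of the side `s` that
corresponds to a coordinate. -/
def partialDeriv : Side → Coord → Formal → Formal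
  | .left, .a, f => fun S => mapCoeff (Laurent.deriv (1, 0, 0) fun w => w.1) (f S)
  | .right, .a, f => fun S => mapCoeff (Laurent.deriv (0, 1, 0) fun w => w.2.1) (f S)
  | s, .A k j, f => fun S =>
      (fun d => (d (s, k, j) + 1) • MvPowerSeries.coeff (d + Finsupp.single (s, k, j) 1) (f S) :
        (EvenVar →₀ ℕ) → Laurent)
  | s, .M k j, f => Gr.leftDeriv (OddVar.formal s k j) f

/-- The value in `⋀_∞` at `𝒜ℳ^{(01)} = ℬ𝒩^{(01)} = e`. -/
def atE (f : Formal) : Lam := fun S =>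
  Laurent.evalOne (MvPowerSeries.coeff 0 (f (S.map OddVar.zetaEmb)))

/-- `(∂/∂p)(∂/∂q) f |_e`, with `p` a variable of the side `s` and `q` one of the side `t`. -/
def deriv2 (f : Formal) (s : Side) (p : Coord) (t : Side) (q : Coord) : Lam :=
  atE (partialDeriv s p (partialDeriv t q f))

end Formal

open Formal in
/-- The bracket `[∂/∂p|_e, ∂/∂q|_e] F` of two partial derivatives, in terms of `f = F(Φ^{(01)})`. -/
def coordBracket (f : Formal) : Coord → Coord → Lam
  | .A .infty j, .A .infty k =>
      deriv2 f .left (.A .infty j) .right (.A .infty k)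
        - deriv2 f .left (.A .infty k) .right (.A .infty j)
  | .a, .A .infty j =>
      deriv2 f .left .a .right (.A .infty j) - deriv2 f .left (.A .infty j) .left .a
  | .A .infty j, .a =>
      -(deriv2 f .left .a .right (.A .infty j) - deriv2 f .left (.A .infty j) .left .a)
  | .A .zero j, .A .infty k => zeroInfty j k
  | .A .infty k, .A .zero j => -zeroInfty j k
  | .a, .A .zero j =>
      deriv2 f .left .a .right (.A .zero j) - deriv2 f .left (.A .zero j) .right .a
  | .A .zero j, .a =>
      -(deriv2 f .left .a .right (.A .zero j) - deriv2 f .left (.A .zero j) .right .a)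
  | .a, .a => 0
  | .A .zero j, .A .zero k =>
      deriv2 f .left (.A .zero j) .right (.A .zero k)
        - deriv2 f .left (.A .zero k) .right (.A .zero j)
  | .M .infty j, .M .infty k =>
      deriv2 f .left (.M .infty j) .right (.M .infty k)
        + deriv2 f .left (.M .infty k) .right (.M .infty j)
  | .M .zero j, .M .infty k =>
      deriv2 f .left (.M .zero j) .right (.M .infty k)
        + deriv2 f .left (.M .infty k) .left (.M .zero j)
  | .M .infty k, .M .zero j =>
      deriv2 f .left (.M .zero j) .right (.M .infty k)
        + deriv2 f .left (.M .infty k) .left (.M .zero j)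
  | .M .zero j, .M .zero k =>
      deriv2 f .left (.M .zero j) .right (.M .zero k)
        + deriv2 f .left (.M .zero k) .right (.M .zero j)
  | .A .infty j, .M .infty k =>
      deriv2 f .left (.A .infty j) .right (.M .infty k)
        - deriv2 f .left (.M .infty k) .right (.A .infty j)
  | .M .infty k, .A .infty j =>
      -(deriv2 f .left (.A .infty j) .right (.M .infty k)
        - deriv2 f .left (.M .infty k) .right (.A .infty j))
  | .a, .M .infty j =>
      deriv2 f .left .a .right (.M .infty j) - deriv2 f .left (.M .infty j) .left .a
  | .M .infty j, .a =>
      -(deriv2 f .left .a .right (.M .infty j) - deriv2 f .left (.M .infty j) .left .a)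
  | .A .zero j, .M .infty k => zeroInftyM j k
  | .M .infty k, .A .zero j => -zeroInftyM j k
  | .M .zero j, .A .infty k => zeroMInfty j k
  | .A .infty k, .M .zero j => -zeroMInfty j k
  | .a, .M .zero j =>
      deriv2 f .left .a .right (.M .zero j) - deriv2 f .left (.M .zero j) .right .a
  | .M .zero j, .a =>
      -(deriv2 f .left .a .right (.M .zero j) - deriv2 f .left (.M .zero j) .right .a)
  | .A .zero j, .M .zero k =>
      deriv2 f .left (.A .zero j) .right (.M .zero k)
        - deriv2 f .left (.M .zero k) .right (.A .zero j)
  | .M .zero k, .A .zero j =>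
      -(deriv2 f .left (.A .zero j) .right (.M .zero k)
        - deriv2 f .left (.M .zero k) .right (.A .zero j))
where
  /-- `[∂/∂A^{(1)}_j|_e, ∂/∂A^{(0)}_k|_e] F`. -/
  zeroInfty (j k : ℕ+) : Lam :=
    if k ≤ j then
      deriv2 f .left (.A .zero j) .right (.A .infty k)
        - deriv2 f .right (.A .infty k) .right (.A .zero j)
    else
      deriv2 f .left (.A .zero j) .right (.A .infty k)
        - deriv2 f .left (.A .infty k) .left (.A .zero j)
  /-- `[∂/∂A^{(1)}_j|_e, ∂/∂M^{(0)}_{k-1/2}|_e] F`. -/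
  zeroInftyM (j k : ℕ+) : Lam :=
    if k ≤ j then
      deriv2 f .left (.A .zero j) .right (.M .infty k)
        - deriv2 f .right (.M .infty k) .right (.A .zero j)
    else
      deriv2 f .left (.A .zero j) .right (.M .infty k)
        - deriv2 f .left (.M .infty k) .left (.A .zero j)
  /-- `[∂/∂M^{(1)}_{j-1/2}|_e, ∂/∂A^{(0)}_k|_e] F`. -/
  zeroMInfty (j k : ℕ+) : Lam :=
    if k ≤ j then
      deriv2 f .left (.M .zero j) .right (.A .infty k)
        - deriv2 f .right (.A .infty k) .right (.M .zero j)
    else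
      deriv2 f .left (.M .zero j) .right (.A .infty k)
        - deriv2 f .left (.A .infty k) .left (.M .zero j)

/-! ## Lie superalgebras and the Neveu–Schwarz algebra of central charge zero -/

/-- `V = V^0 ⊕ V^1` with the bilinear operation `br` is a Lie superalgebra. -/
structure IsLieSuperalgebra {V : Type} [AddCommGroup V] [Module ℂ V]
    (grade : ZMod 2 → Submodule ℂ V) (br : V →ₗ[ℂ] V →ₗ[ℂ] V) : Prop where
  isCompl : IsCompl (grade 0) (grade 1)
  graded : ∀ i j, ∀ u ∈ grade i, ∀ v ∈ grade j, br u v ∈ grade (i + j)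
  skew : ∀ i j, ∀ u ∈ grade i, ∀ v ∈ grade j,
    br u v = -((-1 : ℂ) ^ (i.val * j.val) • br v u)
  jacobi : ∀ i j k, ∀ u ∈ grade i, ∀ v ∈ grade j, ∀ w ∈ grade k,
    (-1 : ℂ) ^ (i.val * k.val) • br (br u v) w + (-1 : ℂ) ^ (j.val * i.val) • br (br v w) u
      + (-1 : ℂ) ^ (k.val * j.val) • br (br w u) v = 0

/-- The `ℤ/2`-grading of `T̂_e SK(1)` into even and odd tangent vectors. -/
def hatGrade (pd : Coord → (SD1 →ₗ[ℂ] Lam)) (i : ZMod 2) : Submodule ℂ (hatTangent pd) :=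
  (if i = 0 then evenTangent else oddTangent).comap (hatTangent pd).subtype

/-- The basis of the Neveu–Schwarz algebra of central charge zero: `L n` is `L_n`, and `G n` is
`G_{n+1/2}`. -/
inductive NSIndex
  | L (n : ℤ)
  | G (n : ℤ)

/-- The Neveu–Schwarz algebra of central charge zero, as a vector space. -/
abbrev NS0 : Type := NSIndex →₀ ℂ

namespace NS0

/-- The basis elements `L_n`. -/
def L (n : ℤ) : NS0 := Finsupp.single (.L n) 1

/-- The basis elements `G_{n+1/2}`. -/
def G (n : ℤ) : NS0 := Finsupp.single (.G n) 1

/-- The relations `[L_m, L_n] = (m - n) L_{m+n}`,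
`[G_{m+1/2}, L_n] = (m - (n-1)/2) G_{m+n+1/2}` and `[G_{m+1/2}, G_{n-1/2}] = 2 L_{m+n}`. -/
def basisBracket : NSIndex → NSIndex → NS0
  | .L m, .L n => ((m : ℂ) - n) • L (m + n)
  | .G m, .L n => ((m : ℂ) - ((n : ℂ) - 1) / 2) • G (m + n)
  | .L n, .G m => -(((m : ℂ) - ((n : ℂ) - 1) / 2) • G (m + n))
  | .G m, .G n => (2 : ℂ) • L (m + (n + 1))

/-- The bracket of the Neveu–Schwarz algebra of central charge zero. -/
def bracket : NS0 →ₗ[ℂ] NS0 →ₗ[ℂ] NS0 :=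
  Finsupp.linearCombination ℂ fun i => Finsupp.linearCombination ℂ fun j => basisBracket i j

end NS0

/-- `𝓛(0) = -½ ∂/∂a|_e`, and for `n ≥ 1`, `𝓛(n) = -∂/∂A^{(1)}_n|_e`, `𝓛(-n) = -∂/∂A^{(0)}_n|_e`. -/
def calL (pd : Coord → (SD1 →ₗ[ℂ] Lam)) : ℤ → hatTangent pd
  | .ofNat 0 => -((1 / 2 : ℂ) • hatPartial pd .a)
  | .ofNat (n + 1) => -hatPartial pd (.A .zero n.succPNat)
  | .negSucc n => -hatPartial pd (.A .infty n.succPNat)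

/-- `calG pd n` is `𝓖(n + 1/2)`: for `j ≥ 1`, `𝓖(j - 1/2) = -∂/∂M^{(1)}_{j-1/2}|_e` and
`𝓖(-j + 1/2) = -∂/∂M^{(0)}_{j-1/2}|_e`. -/
def calG (pd : Coord → (SD1 →ₗ[ℂ] Lam)) : ℤ → hatTangent pd
  | .ofNat n => -hatPartial pd (.M .zero n.succPNat)
  | .negSucc n => -hatPartial pd (.M .infty n.succPNat)

end

/-! ## Supercommutativity and left derivatives in Grassmann algebras -/

namespace Gr

section Signs

variable {τ : Type} [LinearOrder τ]

lemma inversions_add_swap {S T : Finset τ} (h : Disjoint S T) :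
    inversions S T + inversions T S = S.card * T.card := by
  classical
  have h1 : inversions T S = ((S ×ˢ T).filter (fun p => p.1 < p.2)).card := by
    unfold inversions
    refine Finset.card_bij (fun p _ => (p.2, p.1)) ?_ ?_ ?_
    · simp +contextual
    · rintro ⟨a, b⟩ _ ⟨c, d⟩ _ h
      simp only [Prod.mk.injEq] at h ⊢
      exact ⟨h.2, h.1⟩
    · rintro ⟨a, b⟩ h
      simp only [Finset.mem_filter, Finset.mem_product] at h
      exact ⟨(b, a), by simpa using ⟨⟨h.1.2, h.1.1⟩, h.2⟩, rfl⟩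
  rw [h1, ← Finset.card_product]
  unfold inversions
  rw [← Finset.card_union_of_disjoint]
  · congr 1
    ext ⟨a, b⟩
    simp only [Finset.mem_union, Finset.mem_filter, Finset.mem_product]
    constructor
    · rintro (h | h) <;> exact h.1
    · intro hab
      have : a ≠ b := fun e => Finset.disjoint_left.mp h hab.1 (e ▸ hab.2)
      rcases lt_or_gt_of_ne this with h | h
      · exact Or.inr ⟨hab, h⟩
      · exact Or.inl ⟨hab, h⟩
  · rw [Finset.disjoint_left]
    rintro ⟨a, b⟩ h1 h2
    simp only [Finset.mem_filter] at h1 h2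
    exact lt_asymm h1.2 h2.2

lemma shuffleSign_mul_self (S T : Finset τ) : shuffleSign S T * shuffleSign S T = 1 := by
  unfold shuffleSign
  rw [← pow_add, ← two_mul, pow_mul]
  simp

lemma shuffleSign_swap {S T : Finset τ} (h : Disjoint S T) :
    shuffleSign S T = (-1) ^ (S.card * T.card) * shuffleSign T S := by
  have h1 : shuffleSign S T * shuffleSign T S = (-1) ^ (S.card * T.card) := by
    unfold shuffleSign
    rw [← pow_add, inversions_add_swap h]
  rw [← h1, mul_assoc, shuffleSign_mul_self, mul_one]

lemma shuffleSign_empty_left (S : Finset τ) : shuffleSign ∅ S = 1 := by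
  simp [shuffleSign, inversions_empty_left]

lemma shuffleSign_empty_right (S : Finset τ) : shuffleSign S ∅ = 1 := by
  simp [shuffleSign, inversions_empty_right]

lemma shuffleSign_union_left {S T : Finset τ} (h : Disjoint S T) (U : Finset τ) :
    shuffleSign (S ∪ T) U = shuffleSign S U * shuffleSign T U := by
  unfold shuffleSign
  rw [inversions_union_left h, pow_add]

lemma shuffleSign_union_right {S T : Finset τ} (h : Disjoint S T) (U : Finset τ) :
    shuffleSign U (S ∪ T) = shuffleSign U S * shuffleSign U T := by
  unfold shuffleSign
  rw [inversions_union_right h, pow_add]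

lemma shuffleSign_insert_left {p : τ} {S : Finset τ} (h : p ∉ S) (U : Finset τ) :
    shuffleSign (insert p S) U = shuffleSign {p} U * shuffleSign S U := by
  rw [Finset.insert_eq, shuffleSign_union_left (by simpa using h)]

lemma shuffleSign_insert_right {p : τ} {S : Finset τ} (h : p ∉ S) (U : Finset τ) :
    shuffleSign U (insert p S) = shuffleSign U {p} * shuffleSign U S := by
  rw [Finset.insert_eq, shuffleSign_union_right (by simpa using h)]

lemma shuffleSign_singleton_comm {p q : τ} (h : p ≠ q) :
    shuffleSign {p} {q} = -shuffleSign {q} {p} := by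
  rw [shuffleSign_swap (by simpa using h)]
  simp

end Signs

section Parity

variable {τ K : Type} [LinearOrder τ] [CommRing K]

/-- The parity involution: it multiplies even elements by `1` and odd elements by `-1`. -/
def parityAut : Gr τ K →+* Gr τ K where
  toFun f := fun S => (-1) ^ S.card * f S
  map_one' := by
    ext S
    simp only [one_apply]
    split_ifs with h <;> simp [h]
  map_mul' f g := by
    ext S
    simp only [mul_apply, Finset.mul_sum]
    refine Finset.sum_congr rfl fun T hT => ?_
    have h : S.card = T.card + (S \ T).card := by
      rw [← Finset.card_sdiff_add_card_eq_card (Finset.mem_powerset.mp hT), add_comm]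
    rw [h, pow_add]
    ring_nf
  map_zero' := by
    ext S
    simp [zero_apply]
  map_add' f g := by
    ext S
    simp only [add_apply]
    exact mul_add _ _ _

lemma parityAut_apply (f : Gr τ K) (S : Finset τ) : parityAut f S = (-1) ^ S.card * f S := rfl

lemma parityAut_parityAut (f : Gr τ K) : parityAut (parityAut f) = f := by
  ext S
  rw [parityAut_apply, parityAut_apply, ← mul_assoc, ← pow_add, ← two_mul, pow_mul]
  simp

lemma parityAut_smul {R : Type} [CommRing R] [Algebra R K] (r : R) (f : Gr τ K) :
    parityAut (r • f) = r • parityAut f := by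
  ext S
  simp only [parityAut_apply, smul_apply, mul_smul_comm]

lemma parityAut_of_isEven {f : Gr τ K} (hf : f.IsEven) : parityAut f = f := by
  ext S
  rw [parityAut_apply]
  by_cases h : f S = 0
  · simp [h]
  · simp [(hf S h).neg_one_pow]

lemma parityAut_of_isOdd {f : Gr τ K} (hf : f.IsOdd) : parityAut f = -f := by
  ext S
  rw [parityAut_apply]
  change _ = -f S
  by_cases h : f S = 0
  · simp [h]
  · simp [(hf S h).neg_one_pow]

lemma eq_zero_of_neg_eq [Algebra ℂ K] {k : K} (h : -k = k) : k = 0 := by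
  have h2 : (2 : ℂ) • k = 0 := by
    rw [two_smul]
    nth_rewrite 1 [← h]
    simp
  have := congrArg (fun y => (2 : ℂ)⁻¹ • y) h2
  simpa [smul_smul] using this

lemma isEven_iff [Algebra ℂ K] {f : Gr τ K} : f.IsEven ↔ parityAut f = f := by
  refine ⟨parityAut_of_isEven, fun h S hS => ?_⟩
  by_contra hc
  have h1 := congrFun h S
  rw [parityAut_apply, (Nat.not_even_iff_odd.mp hc).neg_one_pow, neg_one_mul] at h1
  exact hS (eq_zero_of_neg_eq h1)

lemma isOdd_iff [Algebra ℂ K] {f : Gr τ K} : f.IsOdd ↔ parityAut f = -f := by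
  refine ⟨parityAut_of_isOdd, fun h S hS => ?_⟩
  by_contra hc
  have h1 := congrFun h S
  rw [parityAut_apply, (Nat.not_odd_iff_even.mp hc).neg_one_pow, one_mul] at h1
  exact hS (eq_zero_of_neg_eq h1.symm)

lemma mul_comm_of_isOdd_right (f : Gr τ K) {g : Gr τ K} (hg : g.IsOdd) :
    f * g = g * parityAut f := by
  ext S
  rw [mul_apply, mul_apply]
  refine Finset.sum_bij' (fun T _ => S \ T) (fun T _ => S \ T) (by simp) (by simp) ?_ ?_ ?_
  · intro T hT
    simp [Finset.inter_eq_right.mpr (Finset.mem_powerset.mp hT)]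
  · intro T hT
    simp [Finset.inter_eq_right.mpr (Finset.mem_powerset.mp hT)]
  · intro T hT
    have h1 : S \ (S \ T) = T := by
      simp [Finset.inter_eq_right.mpr (Finset.mem_powerset.mp hT)]
    rw [h1, parityAut_apply, shuffleSign_swap Finset.disjoint_sdiff]
    by_cases h : g (S \ T) = 0
    · simp [h]
    · have h2 : ((-1 : ℤ)) ^ (T.card * (S \ T).card) = (-1) ^ T.card := by
        obtain ⟨k, hk⟩ := hg _ h
        rw [hk, mul_add, mul_one, pow_add, mul_comm T.card, mul_assoc, pow_mul]
        simp
      rw [h2]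
      push_cast
      ring

lemma commute_of_isEven {f : Gr τ K} (hf : f.IsEven) (g : Gr τ K) : f * g = g * f := by
  ext S
  rw [mul_apply, mul_apply]
  refine Finset.sum_bij' (fun T _ => S \ T) (fun T _ => S \ T) (by simp) (by simp) ?_ ?_ ?_
  · intro T hT
    simp [Finset.inter_eq_right.mpr (Finset.mem_powerset.mp hT)]
  · intro T hT
    simp [Finset.inter_eq_right.mpr (Finset.mem_powerset.mp hT)]
  · intro T hT
    have h1 : S \ (S \ T) = T := by
      simp [Finset.inter_eq_right.mpr (Finset.mem_powerset.mp hT)]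
    rw [h1, shuffleSign_swap Finset.disjoint_sdiff]
    by_cases h : f T = 0
    · simp [h]
    · rw [((hf _ h).mul_right _).neg_one_pow]
      ring_nf

lemma odd_mul_comm {f : Gr τ K} (hf : f.IsOdd) (g : Gr τ K) : f * g = parityAut g * f := by
  rw [mul_comm_of_isOdd_right _ hf, parityAut_parityAut]

end Parity

section Closure

set_option linter.unusedSectionVars false

variable {τ K : Type} [LinearOrder τ] [CommRing K] [Algebra ℂ K] {f g : Gr τ K}

lemma IsEven.mul (hf : f.IsEven) (hg : g.IsEven) : (f * g).IsEven := by
  rw [isEven_iff] at *; rw [map_mul, hf, hg]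

lemma IsEven.mul_isOdd (hf : f.IsEven) (hg : g.IsOdd) : (f * g).IsOdd := by
  rw [isEven_iff] at hf; rw [isOdd_iff] at *; rw [map_mul, hf, hg, mul_neg]

lemma IsOdd.mul (hf : f.IsOdd) (hg : g.IsOdd) : (f * g).IsEven := by
  rw [isOdd_iff] at *; rw [isEven_iff, map_mul, hf, hg, neg_mul_neg]

lemma IsEven.add (hf : f.IsEven) (hg : g.IsEven) : (f + g).IsEven := by
  rw [isEven_iff] at *; rw [map_add, hf, hg]

lemma IsOdd.add (hf : f.IsOdd) (hg : g.IsOdd) : (f + g).IsOdd := by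
  rw [isOdd_iff] at *; rw [map_add, hf, hg, neg_add]

lemma IsEven.neg (hf : f.IsEven) : (-f).IsEven := by
  rw [isEven_iff] at *; rw [map_neg, hf]

lemma IsOdd.neg (hf : f.IsOdd) : (-f).IsOdd := by
  rw [isOdd_iff] at *; rw [map_neg, hf]

lemma IsEven.smul (c : ℂ) (hf : f.IsEven) : (c • f).IsEven := by
  rw [isEven_iff] at *; rw [parityAut_smul, hf]

lemma IsOdd.smul (c : ℂ) (hf : f.IsOdd) : (c • f).IsOdd := by
  rw [isOdd_iff] at *; rw [parityAut_smul, hf, smul_neg]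

lemma isEven_one : (1 : Gr τ K).IsEven := by
  rw [isEven_iff, map_one]

lemma isEven_zero : (0 : Gr τ K).IsEven := fun _ h => absurd rfl h

lemma isOdd_zero : (0 : Gr τ K).IsOdd := fun _ h => absurd rfl h

lemma IsEven.pow (hf : f.IsEven) (n : ℕ) : (f ^ n).IsEven := by
  rw [isEven_iff] at *; rw [map_pow, hf]

lemma IsOdd.mul_self (hf : f.IsOdd) : f * f = 0 := by
  have h := odd_mul_comm hf f
  rw [isOdd_iff.mp hf, neg_mul] at h
  ext S
  exact eq_zero_of_neg_eq (congrFun h S).symm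

lemma isEven_of_mul_eq_one (hf : f.IsEven) (h : f * g = 1) : g.IsEven := by
  rw [isEven_iff] at *
  have h1 : f * parityAut g = 1 := by
    have := congrArg parityAut h
    rwa [map_mul, map_one, hf] at this
  have h2 : g * f = 1 := by rw [← commute_of_isEven (isEven_iff.mpr hf), h]
  calc parityAut g = (g * f) * parityAut g := by rw [h2, one_mul]
    _ = g := by rw [mul_assoc, h1, mul_one]

lemma isEven_mono_empty (k : K) : (mono (τ := τ) ∅ k).IsEven := by
  intro S hS
  unfold mono at hS
  split_ifs at hS with h
  · simp [h]
  · exact absurd rfl hS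

lemma isOdd_gen (p : τ) : (gen (K := K) p).IsOdd := by
  intro S hS
  unfold gen mono at hS
  split_ifs at hS with h
  · simp [h]
  · exact absurd rfl hS

end Closure

section Derivatives

variable {τ K : Type} [LinearOrder τ] [CommRing K]

lemma mono_empty_mul (k : K) (f : Gr τ K) (S : Finset τ) : (mono ∅ k * f : Gr τ K) S = k * f S := by
  rw [mul_apply, Finset.sum_eq_single ∅]
  · simp [mono, shuffleSign_empty_left]
  · intro T _ hT
    simp [mono, hT]
  · simp

lemma gen_mul_apply (p : τ) (f : Gr τ K) (S : Finset τ) :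
    (gen p * f : Gr τ K) S = if p ∈ S then (shuffleSign {p} (S.erase p) : K) * f (S.erase p) else 0 := by
  rw [mul_apply]
  split_ifs with h
  · rw [Finset.sum_eq_single {p}]
    · simp [gen, mono, Finset.sdiff_singleton_eq_erase]
    · intro T _ hT
      simp [gen, mono, hT]
    · simp [h]
  · refine Finset.sum_eq_zero fun T hT => ?_
    have : T ≠ {p} := by
      rintro rfl
      simp [h] at hT
    simp [gen, mono, this]

lemma leftDeriv_add (p : τ) (f g : Gr τ K) :
    leftDeriv p (f + g) = leftDeriv p f + leftDeriv p g := by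
  ext S
  simp only [leftDeriv, add_apply]
  split_ifs <;> simp [mul_add]

lemma leftDeriv_smul {R : Type} [CommRing R] [Algebra R K] (r : R) (p : τ) (f : Gr τ K) :
    leftDeriv p (r • f) = r • leftDeriv p f := by
  ext S
  simp only [leftDeriv, smul_apply]
  split_ifs <;> simp

lemma leftDeriv_apply_of_mem {p : τ} {S : Finset τ} (h : p ∈ S) (f : Gr τ K) :
    leftDeriv p f S = 0 := if_pos h

lemma leftDeriv_apply_of_notMem {p : τ} {S : Finset τ} (h : p ∉ S) (f : Gr τ K) :
    leftDeriv p f S = (shuffleSign {p} S : K) * f (insert p S) := if_neg h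

lemma shuffleSign_singleton_swap {p : τ} {S : Finset τ} (h : p ∉ S) :
    shuffleSign S {p} = (-1) ^ S.card * shuffleSign {p} S := by
  rw [shuffleSign_swap (by simpa using h)]
  simp

lemma leftDeriv_mul (p : τ) (f g : Gr τ K) :
    leftDeriv p (f * g) = leftDeriv p f * g + parityAut f * leftDeriv p g := by
  ext S
  rw [add_apply, mul_apply, mul_apply, ← Finset.sum_add_distrib]
  by_cases hp : p ∈ S
  · rw [leftDeriv_apply_of_mem hp]
    obtain ⟨S, hpS, rfl⟩ : ∃ S', p ∉ S' ∧ insert p S' = S :=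
      ⟨S.erase p, Finset.notMem_erase p S, Finset.insert_erase hp⟩
    rw [Finset.sum_powerset_insert hpS, ← Finset.sum_add_distrib, eq_comm]
    refine Finset.sum_eq_zero fun T hT => ?_
    have hpT : p ∉ T := fun h => hpS (Finset.mem_powerset.mp hT h)
    have h1 : insert p S \ T = insert p (S \ T) := Finset.insert_sdiff_of_notMem _ hpT
    have h2 : insert p S \ insert p T = S \ T := by
      rw [Finset.insert_sdiff_insert, Finset.sdiff_insert_of_notMem hpS]
    have h3 : p ∉ S \ T := fun h => hpS (Finset.mem_sdiff.mp h).1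
    rw [h1, h2, leftDeriv_apply_of_notMem hpT, leftDeriv_apply_of_mem (Finset.mem_insert_self _ _),
      leftDeriv_apply_of_mem (Finset.mem_insert_self _ _), leftDeriv_apply_of_notMem h3,
      shuffleSign_insert_right h3, shuffleSign_insert_left hpT, shuffleSign_singleton_swap hpT,
      parityAut_apply f T, parityAut_apply f (insert p T), Finset.card_insert_of_notMem hpT, pow_succ]
    have e1 := congrArg (Int.cast : ℤ → K) (shuffleSign_mul_self {p} T)
    have e2 := congrArg (Int.cast : ℤ → K) (shuffleSign_mul_self {p} (S \ T))
    push_cast at e1 e2 ⊢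
    linear_combination ((-1) ^ T.card * (shuffleSign T (S \ T) : K) * f (insert p T) *
      g (insert p (S \ T))) * (e1 - e2)
  · rw [leftDeriv_apply_of_notMem hp, mul_apply, Finset.sum_powerset_insert hp,
      ← Finset.sum_add_distrib, Finset.mul_sum]
    refine Finset.sum_congr rfl fun T hT => ?_
    have hpT : p ∉ T := fun h => hp (Finset.mem_powerset.mp hT h)
    have h1 : insert p S \ T = insert p (S \ T) := Finset.insert_sdiff_of_notMem _ hpT
    have h2 : insert p S \ insert p T = S \ T := by
      rw [Finset.insert_sdiff_insert, Finset.sdiff_insert_of_notMem hp]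
    have h3 : p ∉ S \ T := fun h => hp (Finset.mem_sdiff.mp h).1
    have h4 : shuffleSign {p} S = shuffleSign {p} T * shuffleSign {p} (S \ T) := by
      rw [← shuffleSign_union_right Finset.disjoint_sdiff,
        Finset.union_sdiff_of_subset (Finset.mem_powerset.mp hT)]
    rw [h1, h2, leftDeriv_apply_of_notMem hpT, leftDeriv_apply_of_notMem h3, h4,
      shuffleSign_insert_right h3, shuffleSign_insert_left hpT, shuffleSign_singleton_swap hpT,
      parityAut_apply]
    have e1 := congrArg (Int.cast : ℤ → K) (shuffleSign_mul_self {p} T)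
    have e2 := congrArg (Int.cast : ℤ → K) (shuffleSign_mul_self {p} (S \ T))
    push_cast at e1 e2 ⊢
    linear_combination ((-1) ^ T.card * (shuffleSign {p} (S \ T) : K) * (shuffleSign T (S \ T) : K)
      * f T * g (insert p (S \ T))) * e1 + ((shuffleSign {p} T : K) * (shuffleSign T (S \ T) : K)
      * f (insert p T) * g (S \ T)) * e2

lemma parityAut_leftDeriv (p : τ) (f : Gr τ K) :
    parityAut (leftDeriv p f) = -leftDeriv p (parityAut f) := by
  ext S
  change _ = -(leftDeriv p (parityAut f) S)
  rw [parityAut_apply]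
  by_cases hp : p ∈ S
  · simp [leftDeriv_apply_of_mem hp]
  · rw [leftDeriv_apply_of_notMem hp, leftDeriv_apply_of_notMem hp, parityAut_apply,
      Finset.card_insert_of_notMem hp, pow_succ]
    ring

lemma leftDeriv_comm (p q : τ) (f : Gr τ K) :
    leftDeriv p (leftDeriv q f) = -leftDeriv q (leftDeriv p f) := by
  ext S
  change _ = -(leftDeriv q (leftDeriv p f) S)
  by_cases hpq : p = q
  · subst hpq
    by_cases hp : p ∈ S
    · simp [leftDeriv_apply_of_mem hp]
    · rw [leftDeriv_apply_of_notMem hp, leftDeriv_apply_of_mem (Finset.mem_insert_self _ _)]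
      simp
  by_cases hp : p ∈ S
  · rw [leftDeriv_apply_of_mem hp]
    by_cases hq : q ∈ S
    · simp [leftDeriv_apply_of_mem hq]
    · rw [leftDeriv_apply_of_notMem hq, leftDeriv_apply_of_mem (Finset.mem_insert_of_mem hp)]
      simp
  · by_cases hq : q ∈ S
    · rw [leftDeriv_apply_of_notMem hp, leftDeriv_apply_of_mem hq,
        leftDeriv_apply_of_mem (Finset.mem_insert_of_mem hq)]
      simp
    · have h1 : q ∉ insert p S := by simp [hq, Ne.symm hpq]
      have h2 : p ∉ insert q S := by simp [hp, hpq]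
      rw [leftDeriv_apply_of_notMem hp, leftDeriv_apply_of_notMem hq,
        leftDeriv_apply_of_notMem h1, leftDeriv_apply_of_notMem h2, Finset.insert_comm,
        shuffleSign_insert_right hp, shuffleSign_insert_right hq, shuffleSign_singleton_comm hpq]
      push_cast
      ring

lemma leftDeriv_self (p : τ) (f : Gr τ K) : leftDeriv p (leftDeriv p f) = 0 := by
  ext S
  by_cases hp : p ∈ S
  · exact leftDeriv_apply_of_mem hp _
  · rw [leftDeriv_apply_of_notMem hp, leftDeriv_apply_of_mem (Finset.mem_insert_self _ _), mul_zero]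
    rfl

lemma leftDeriv_mono_empty (p : τ) (k : K) : leftDeriv p (mono ∅ k) = 0 := by
  ext S
  by_cases hp : p ∈ S
  · exact leftDeriv_apply_of_mem hp _
  · rw [leftDeriv_apply_of_notMem hp]
    simp [mono, zero_apply]

lemma leftDeriv_gen_self (p : τ) : leftDeriv p (gen p : Gr τ K) = 1 := by
  ext S
  by_cases hp : p ∈ S
  · rw [leftDeriv_apply_of_mem hp, one_apply, if_neg (Finset.ne_empty_of_mem hp)]
  · rw [leftDeriv_apply_of_notMem hp, one_apply, gen, mono]
    by_cases hS : S = ∅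
    · simp [hS, shuffleSign_empty_right]
    · rw [if_neg hS, if_neg, mul_zero]
      intro h
      apply hS
      rw [Finset.eq_empty_iff_forall_notMem]
      intro x hx
      have h2 : x ∈ insert p S := Finset.mem_insert_of_mem hx
      have : x = p := by rw [h] at h2; simpa using h2
      exact hp (this ▸ hx)

lemma leftDeriv_gen_of_ne {p q : τ} (h : p ≠ q) : leftDeriv p (gen q : Gr τ K) = 0 := by
  ext S
  by_cases hp : p ∈ S
  · exact leftDeriv_apply_of_mem hp _
  · rw [leftDeriv_apply_of_notMem hp, gen, mono, if_neg, mul_zero]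
    · rfl
    · intro h1
      have : p ∈ ({q} : Finset τ) := h1 ▸ Finset.mem_insert_self _ _
      exact h (by simpa using this)

lemma leftDeriv_eq_zero_iff (p : τ) (f : Gr τ K) :
    leftDeriv p f = 0 ↔ ∀ S, p ∈ S → f S = 0 := by
  constructor
  · intro h S hS
    have h1 := congrFun h (S.erase p)
    rw [leftDeriv_apply_of_notMem (Finset.notMem_erase p S), Finset.insert_erase hS] at h1
    have e1 := congrArg (Int.cast : ℤ → K) (shuffleSign_mul_self {p} (S.erase p))
    push_cast at e1
    calc f S = (shuffleSign {p} (S.erase p) : K) * ((shuffleSign {p} (S.erase p) : K) * f S) := by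
          rw [← mul_assoc, e1, one_mul]
      _ = 0 := by rw [h1]; exact mul_zero _
  · intro h
    ext S
    by_cases hp : p ∈ S
    · exact leftDeriv_apply_of_mem hp _
    · rw [leftDeriv_apply_of_notMem hp, h _ (Finset.mem_insert_self _ _), mul_zero]
      rfl

end Derivatives

end Gr

noncomputable section

/-! ## Coefficients, locally finite sums and continuous operators -/

instance EvenVar.instDecidableEq : DecidableEq EvenVar := Classical.decEq _

namespace Formal

/-- The index of a coefficient of a formal superseries. -/
abbrev Idx : Type := Finset OddVar × (EvenVar →₀ ℕ)

/-- The linear operators on formal superseries. -/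
abbrev Op : Type := Module.End ℂ Formal

/-- The coefficient of a monomial, a Laurent polynomial. -/
def cf (q : Idx) : Formal →ₗ[ℂ] Laurent where
  toFun f := MvPowerSeries.coeff q.2 (f q.1)
  map_add' _ _ := rfl
  map_smul' _ _ := rfl

lemma cf_ext {f g : Formal} (h : ∀ q, cf q f = cf q g) : f = g :=
  Gr.ext fun S => MvPowerSeries.ext fun d => h (S, d)

/-- The superseries with given coefficients. -/
def ofCf (F : Idx → Laurent) : Formal := fun S => (fun d => F (S, d) : (EvenVar →₀ ℕ) → Laurent)

lemma cf_ofCf (F : Idx → Laurent) (q : Idx) : cf q (ofCf F) = F q := rfl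

lemma cf_mul (q : Idx) (f g : Formal) :
    cf q (f * g) = ∑ T ∈ q.1.powerset, ∑ p ∈ Finset.HasAntidiagonal.antidiagonal q.2,
      shuffleSign T (q.1 \ T) • (cf (T, p.1) f * cf (q.1 \ T, p.2) g) := by
  classical
  change MvPowerSeries.coeff q.2 ((f * g) q.1) = _
  rw [Gr.mul_apply, map_sum]
  refine Finset.sum_congr rfl fun T _ => ?_
  rw [← zsmul_eq_mul, map_zsmul, MvPowerSeries.coeff_mul, Finset.smul_sum]
  rfl

/-- The monomials dividing a monomial. -/
def below (q : Idx) : Finset Idx := q.1.powerset ×ˢ (Finset.HasAntidiagonal.antidiagonal q.2).image Prod.fst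

lemma mem_below {q r : Idx} : r ∈ below q ↔ r.1 ⊆ q.1 ∧ r.2 ≤ q.2 := by
  unfold below
  simp only [Finset.mem_product, Finset.mem_powerset, Finset.mem_image, Finset.HasAntidiagonal.mem_antidiagonal,
    Prod.exists, exists_and_right, exists_eq_right]
  refine and_congr_right fun _ => ⟨?_, ?_⟩
  · rintro ⟨c, hc⟩
    exact hc ▸ le_self_add
  · intro h
    exact ⟨q.2 - r.2, add_tsub_cancel_of_le h⟩

lemma cf_mul_eq_zero_left {q : Idx} {f : Formal} (h : ∀ r ∈ below q, cf r f = 0) (g : Formal) :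
    cf q (f * g) = 0 := by
  rw [cf_mul]
  refine Finset.sum_eq_zero fun T hT => Finset.sum_eq_zero fun p hp => ?_
  rw [h (T, p.1), zero_mul, smul_zero]
  rw [mem_below]
  exact ⟨Finset.mem_powerset.mp hT, Finset.HasAntidiagonal.mem_antidiagonal.mp hp ▸ le_self_add⟩

lemma cf_mul_eq_zero_right {q : Idx} {g : Formal} (h : ∀ r ∈ below q, cf r g = 0) (f : Formal) :
    cf q (f * g) = 0 := by
  rw [cf_mul]
  refine Finset.sum_eq_zero fun T hT => Finset.sum_eq_zero fun p hp => ?_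
  rw [h (_, p.2), mul_zero, smul_zero]
  rw [mem_below]
  exact ⟨Finset.sdiff_subset, Finset.HasAntidiagonal.mem_antidiagonal.mp hp ▸ le_add_self⟩

lemma cf_csum {ι : Type} (F : ι → Formal) (q : Idx) : cf q (csum F) = ∑ᶠ i, cf q (F i) := rfl

lemma locallyFinite_iff {ι : Type} {F : ι → Formal} :
    LocallyFinite F ↔ ∀ q, {i | cf q (F i) ≠ 0}.Finite :=
  ⟨fun h q => h q.1 q.2, fun h S d => h (S, d)⟩

lemma LocallyFinite.exists_finset {ι : Type} {F : ι → Formal} (h : LocallyFinite F)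
    (Q : Finset Idx) : ∃ t : Finset ι, ∀ i ∉ t, ∀ q ∈ Q, cf q (F i) = 0 := by
  classical
  refine ⟨Q.biUnion fun q => (locallyFinite_iff.mp h q).toFinset, fun i hi q hq => ?_⟩
  by_contra hc
  exact hi (Finset.mem_biUnion.mpr ⟨q, hq, by simpa using hc⟩)

lemma cf_csum_of_finset {ι : Type} {F : ι → Formal} {t : Finset ι} {q : Idx}
    (h : ∀ i ∉ t, cf q (F i) = 0) : cf q (csum F) = ∑ i ∈ t, cf q (F i) := by
  rw [cf_csum]
  refine finsum_eq_sum_of_support_subset _ fun i hi => ?_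
  by_contra hc
  exact hi (h i hc)

/-- Continuity of an operator: each coefficient of the result is determined by finitely many
coefficients of the argument. -/
def IsCont (T : Op) : Prop :=
  ∀ q, ∃ Q : Finset Idx, ∀ f, (∀ r ∈ Q, cf r f = 0) → cf q (T f) = 0

lemma IsCont.locallyFinite {T : Op} (hT : IsCont T) {ι : Type}
    {F : ι → Formal} (hF : LocallyFinite F) : LocallyFinite fun i => T (F i) := by
  rw [locallyFinite_iff]
  intro q
  obtain ⟨Q, hQ⟩ := hT q
  obtain ⟨t, ht⟩ := hF.exists_finset Q
  refine t.finite_toSet.subset fun i hi => ?_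
  by_contra hc
  exact hi (hQ _ (ht i hc))

lemma IsCont.map_csum {T : Op} (hT : IsCont T) {ι : Type}
    {F : ι → Formal} (hF : LocallyFinite F) : T (csum F) = csum fun i => T (F i) := by
  refine cf_ext fun q => ?_
  obtain ⟨Q, hQ⟩ := hT q
  obtain ⟨t, ht⟩ := hF.exists_finset Q
  have h1 : cf q (T (csum F - ∑ i ∈ t, F i)) = 0 := by
    refine hQ _ fun r hr => ?_
    rw [map_sub, cf_csum_of_finset fun i hi => ht i hi r hr, map_sum, sub_self]
  rw [map_sub, map_sub, sub_eq_zero, map_sum, map_sum] at h1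
  rw [h1, cf_csum_of_finset fun i hi => hQ _ (ht i hi)]

lemma isCont_one : IsCont 1 := fun q => ⟨{q}, fun _ h => h q (Finset.mem_singleton_self q)⟩

lemma IsCont.mul {S T : Op} (hS : IsCont S) (hT : IsCont T) :
    IsCont (S * T) := by
  classical
  intro q
  obtain ⟨Q, hQ⟩ := hS q
  choose R hR using hT
  refine ⟨Q.biUnion R, fun f hf => hQ _ fun r hr => hR r f fun r' hr' => ?_⟩
  exact hf _ (Finset.mem_biUnion.mpr ⟨r, hr, hr'⟩)

lemma IsCont.add {S T : Op} (hS : IsCont S) (hT : IsCont T) :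
    IsCont (S + T) := by
  classical
  intro q
  obtain ⟨Q, hQ⟩ := hS q
  obtain ⟨R, hR⟩ := hT q
  refine ⟨Q ∪ R, fun f hf => ?_⟩
  rw [LinearMap.add_apply, map_add, hQ f fun r hr => hf r (Finset.mem_union_left _ hr),
    hR f fun r hr => hf r (Finset.mem_union_right _ hr), add_zero]

lemma IsCont.smul {T : Op} (c : ℂ) (hT : IsCont T) : IsCont (c • T) := by
  intro q
  obtain ⟨Q, hQ⟩ := hT q
  refine ⟨Q, fun f hf => ?_⟩
  rw [LinearMap.smul_apply, map_smul, hQ f hf, smul_zero]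

lemma IsCont.neg {T : Op} (hT : IsCont T) : IsCont (-T) := by
  simpa using hT.smul (-1)

lemma IsCont.sub {S T : Op} (hS : IsCont S) (hT : IsCont T) :
    IsCont (S - T) := by
  rw [sub_eq_add_neg]
  exact hS.add hT.neg

lemma IsCont.pow {T : Op} (hT : IsCont T) (n : ℕ) : IsCont (T ^ n) := by
  induction n with
  | zero => exact isCont_one
  | succ n ih => exact ih.mul hT

lemma isCont_mulLeft (f : Formal) : IsCont (LinearMap.mulLeft ℂ f) :=
  fun q => ⟨below q, fun _ h => cf_mul_eq_zero_right h f⟩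

lemma isCont_mulRight (f : Formal) : IsCont (LinearMap.mulRight ℂ f) :=
  fun q => ⟨below q, fun _ h => cf_mul_eq_zero_left h f⟩

section Sums

variable {ι : Type} {F G : ι → Formal}

lemma LocallyFinite.mul_left (hF : LocallyFinite F) (g : ι → Formal) :
    LocallyFinite fun i => F i * g i := by
  rw [locallyFinite_iff]
  intro q
  obtain ⟨t, ht⟩ := hF.exists_finset (below q)
  refine t.finite_toSet.subset fun i hi => ?_
  by_contra hc
  exact hi (cf_mul_eq_zero_left (ht i hc) _)

lemma LocallyFinite.mul_right (hF : LocallyFinite F) (g : ι → Formal) :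
    LocallyFinite fun i => g i * F i := by
  rw [locallyFinite_iff]
  intro q
  obtain ⟨t, ht⟩ := hF.exists_finset (below q)
  refine t.finite_toSet.subset fun i hi => ?_
  by_contra hc
  exact hi (cf_mul_eq_zero_right (ht i hc) _)

lemma LocallyFinite.add (hF : LocallyFinite F) (hG : LocallyFinite G) :
    LocallyFinite fun i => F i + G i := by
  rw [locallyFinite_iff] at *
  intro q
  refine ((hF q).union (hG q)).subset fun i hi => ?_
  by_contra hc
  simp only [Set.mem_union, Set.mem_ofPred_eq, not_or, not_not] at hc
  exact hi (by rw [map_add, hc.1, hc.2, add_zero])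

lemma LocallyFinite.smul (hF : LocallyFinite F) (c : ι → ℂ) :
    LocallyFinite fun i => c i • F i := by
  rw [locallyFinite_iff] at *
  intro q
  refine (hF q).subset fun i hi hc => hi ?_
  rw [map_smul, hc, smul_zero]

lemma LocallyFinite.neg (hF : LocallyFinite F) : LocallyFinite fun i => -F i := by
  simpa using hF.smul fun _ => -1

lemma LocallyFinite.comp_injective {κ : Type} (hF : LocallyFinite F) {e : κ → ι}
    (he : Function.Injective e) : LocallyFinite fun k => F (e k) := by
  rw [locallyFinite_iff] at *
  exact fun q => (hF q).preimage he.injOn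

lemma csum_eq_single (i₀ : ι) (h : ∀ i, i ≠ i₀ → F i = 0) : csum F = F i₀ := by
  refine cf_ext fun q => ?_
  rw [cf_csum, finsum_eq_single _ i₀]
  intro i hi
  rw [h i hi, map_zero]

lemma csum_congr (h : ∀ i, F i = G i) : csum F = csum G := by
  rw [funext h]

lemma csum_add (hF : LocallyFinite F) (hG : LocallyFinite G) :
    csum (fun i => F i + G i) = csum F + csum G := by
  refine cf_ext fun q => ?_
  rw [map_add, cf_csum, cf_csum, cf_csum, ← finsum_add_distrib]
  · simp only [map_add]
  · exact locallyFinite_iff.mp hF q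
  · exact locallyFinite_iff.mp hG q

lemma csum_mul_left (f : Formal) (hF : LocallyFinite F) :
    f * csum F = csum fun i => f * F i :=
  (isCont_mulLeft f).map_csum hF

lemma csum_mul_right (f : Formal) (hF : LocallyFinite F) :
    csum F * f = csum fun i => F i * f :=
  (isCont_mulRight f).map_csum hF

lemma csum_smul (c : ℂ) (hF : LocallyFinite F) : c • csum F = csum fun i => c • F i :=
  (isCont_one.smul c).map_csum hF

lemma csum_neg : csum (fun i => -F i) = -csum F := by
  refine cf_ext fun q => ?_
  rw [map_neg, cf_csum, cf_csum, ← finsum_neg_distrib]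
  simp only [map_neg]

lemma csum_reindex {κ : Type} {e : κ → ι} (he : Function.Injective e)
    (h : ∀ i, i ∉ Set.range e → F i = 0) : csum F = csum fun k => F (e k) := by
  refine cf_ext fun q => ?_
  rw [cf_csum, cf_csum, ← finsum_mem_range (f := fun i => cf q (F i)) he,
    ← finsum_mem_univ]
  refine finsum_mem_inter_support_eq' _ _ _ fun i hi => ⟨fun _ => ?_, fun _ => Set.mem_univ i⟩
  by_contra hc
  exact hi (show cf q (F i) = 0 by rw [h i hc, map_zero])

lemma csum_equiv {κ : Type} (e : κ ≃ ι) : csum F = csum fun k => F (e k) :=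
  csum_reindex e.injective fun i hi => absurd (e.surjective i) hi

end Sums

/-! ## The degree filtration -/

end Formal

/-- The degree of an odd generator in the formal variables. -/
def OddVar.weight : OddVar → ℕ
  | .formal _ _ _ => 1
  | _ => 0

namespace Formal

/-- The number of formal variables in a monomial. -/
def deg (q : Idx) : ℕ := ∑ p ∈ q.1, p.weight + Finsupp.degree q.2

/-- Superseries of degree at least `n` in the formal variables. -/
def I (n : ℕ) : Submodule ℂ Formal where
  carrier := {f | ∀ q, deg q < n → cf q f = 0}
  zero_mem' _ _ := map_zero _
  add_mem' hf hg q hq := by rw [map_add, hf q hq, hg q hq, add_zero]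
  smul_mem' c f hf q hq := by rw [map_smul, hf q hq, smul_zero]

lemma mem_I_zero (f : Formal) : f ∈ I 0 := fun _ h => absurd h (Nat.not_lt_zero _)

lemma I_anti {m n : ℕ} (h : m ≤ n) {f : Formal} (hf : f ∈ I n) : f ∈ I m :=
  fun q hq => hf q (lt_of_lt_of_le hq h)

lemma mul_mem_I {m n : ℕ} {f g : Formal} (hf : f ∈ I m) (hg : g ∈ I n) : f * g ∈ I (m + n) := by
  intro q hq
  rw [cf_mul]
  refine Finset.sum_eq_zero fun T hT => Finset.sum_eq_zero fun p hp => ?_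
  have h1 : deg q = deg (T, p.1) + deg (q.1 \ T, p.2) := by
    unfold deg
    simp only
    rw [← Finset.HasAntidiagonal.mem_antidiagonal.mp hp, map_add,
      ← Finset.sum_sdiff (Finset.mem_powerset.mp hT)]
    ring
  rcases lt_or_ge (deg (T, p.1)) m with h | h
  · rw [hf _ h, zero_mul, smul_zero]
  · rw [hg _ (by omega), mul_zero, smul_zero]

lemma mul_mem_I_left {n : ℕ} {g : Formal} (f : Formal) (hg : g ∈ I n) : f * g ∈ I n := by
  simpa using mul_mem_I (mem_I_zero f) hg

lemma mul_mem_I_right {n : ℕ} {f : Formal} (hf : f ∈ I n) (g : Formal) : f * g ∈ I n := by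
  simpa using mul_mem_I hf (mem_I_zero g)

lemma csum_mem_I {ι : Type} {F : ι → Formal} {n : ℕ} (h : ∀ i, F i ∈ I n) : csum F ∈ I n := by
  intro q hq
  rw [cf_csum, ← finsum_zero (α := ι)]
  exact finsum_congr fun i => h i q hq

lemma eq_zero_of_forall_mem_I {f : Formal} (h : ∀ n, f ∈ I n) : f = 0 :=
  cf_ext fun q => by rw [h (deg q + 1) q (Nat.lt_succ_self _), map_zero]

/-- Operators raising the degree by at least `n`. -/
def K (n : ℕ) : Submodule ℂ (Op) where
  carrier := {T | ∀ m, ∀ f ∈ I m, T f ∈ I (m + n)}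
  zero_mem' _ _ _ := Submodule.zero_mem _
  add_mem' hS hT m f hf := add_mem (hS m f hf) (hT m f hf)
  smul_mem' c T hT m f hf := Submodule.smul_mem _ c (hT m f hf)

lemma apply_mem_I' {n : ℕ} {T : Op} (hT : T ∈ K n) (f : Formal) : T f ∈ I n := by
  simpa using hT 0 f (mem_I_zero f)

lemma one_mem_K : (1 : Op) ∈ K 0 := fun _ _ hf => hf

lemma mul_mem_K {m n : ℕ} {S T : Op} (hS : S ∈ K m) (hT : T ∈ K n) :
    S * T ∈ K (m + n) := by
  intro k f hf
  have := hS _ _ (hT k f hf)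
  rwa [add_assoc, add_comm n m] at this

lemma K_anti {m n : ℕ} (h : m ≤ n) {T : Op} (hT : T ∈ K n) : T ∈ K m :=
  fun k f hf => I_anti (by omega) (hT k f hf)

lemma pow_mem_K {T : Op} (hT : T ∈ K 1) (n : ℕ) : T ^ n ∈ K n := by
  induction n with
  | zero => exact one_mem_K
  | succ n ih =>
    rw [pow_succ]
    exact mul_mem_K ih hT

lemma mulLeft_mem_K {n : ℕ} {f : Formal} (hf : f ∈ I n) : LinearMap.mulLeft ℂ f ∈ K n :=
  fun m g hg => by
    rw [LinearMap.mulLeft_apply, add_comm]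
    exact mul_mem_I hf hg

lemma mul_mem_K_left {n : ℕ} {S T : Op} (hS : S ∈ K 0) (hT : T ∈ K n) :
    S * T ∈ K n := by simpa using mul_mem_K hS hT

lemma mul_mem_K_right {n : ℕ} {S T : Op} (hS : S ∈ K n) (hT : T ∈ K 0) :
    S * T ∈ K n := by simpa using mul_mem_K hS hT

/-! ## Exponentials of operators -/

/-- The exponential of an operator that raises the degree. -/
def expE (T : Op) : Op where
  toFun f := ofCf fun q => ∑ n ∈ Finset.range (deg q + 1),
    ((n.factorial : ℂ)⁻¹) • cf q ((T ^ n) f)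
  map_add' f g := by
    refine cf_ext fun q => ?_
    rw [map_add, cf_ofCf, cf_ofCf, cf_ofCf]
    simp only [map_add, smul_add, Finset.sum_add_distrib]
  map_smul' c f := by
    refine cf_ext fun q => ?_
    rw [map_smul, cf_ofCf, cf_ofCf]
    simp only [map_smul, Finset.smul_sum, RingHom.id_apply, smul_comm c]

lemma cf_expE (T : Op) (f : Formal) (q : Idx) :
    cf q (expE T f) = ∑ n ∈ Finset.range (deg q + 1), ((n.factorial : ℂ)⁻¹) • cf q ((T ^ n) f) :=
  rfl

/-- The truncated exponential series. -/
def expTrunc (N : ℕ) (T : Op) : Op :=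
  ∑ n ∈ Finset.range N, ((n.factorial : ℂ)⁻¹) • T ^ n

lemma cf_expTrunc {T : Op} (hT : T ∈ K 1) {N : ℕ} {q : Idx} (h : deg q < N)
    (f : Formal) : cf q (expTrunc N T f) = cf q (expE T f) := by
  rw [cf_expE, expTrunc, LinearMap.sum_apply, map_sum]
  symm
  refine Finset.sum_subset_zero_on_sdiff (Finset.range_subset_range.mpr h) ?_ ?_
  · intro n hn
    simp only [Finset.mem_sdiff, Finset.mem_range, not_lt] at hn
    rw [LinearMap.smul_apply, map_smul, apply_mem_I' (pow_mem_K hT n) f q (by omega), smul_zero]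
  · intro n _
    rw [LinearMap.smul_apply, map_smul]

lemma expE_sub_expTrunc_mem {T : Op} (hT : T ∈ K 1) (N : ℕ) (f : Formal) :
    expE T f - expTrunc N T f ∈ I N := fun q hq => by
  rw [map_sub, cf_expTrunc hT hq, sub_self]

lemma expOp_eq {T : Op} (hT : T ∈ K 1) (f : Formal) :
    expOp (fun g => T g) f = expE T f := by
  refine cf_ext fun q => ?_
  rw [expOp, cf_csum_of_finset (t := Finset.range (deg q + 1)), cf_expE]
  · refine Finset.sum_congr rfl fun n _ => ?_
    rw [map_smul, Module.End.coe_pow]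
  · intro n hn
    rw [map_smul]
    have h1 := apply_mem_I' (pow_mem_K hT n) f q (by simpa using hn)
    rw [Module.End.coe_pow] at h1
    rw [h1, smul_zero]

lemma isCont_expE {T : Op} (hT : IsCont T) : IsCont (expE T) := by
  classical
  intro q
  choose Q hQ using fun n => hT.pow n q
  refine ⟨(Finset.range (deg q + 1)).biUnion Q, fun f hf => ?_⟩
  rw [cf_expE]
  refine Finset.sum_eq_zero fun n hn => ?_
  rw [hQ n f fun r hr => hf r (Finset.mem_biUnion.mpr ⟨n, hn, hr⟩), smul_zero]

lemma expE_apply_of_eq_zero (T : Op) {f : Formal} (h : T f = 0) :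
    expE T f = f := by
  refine cf_ext fun q => ?_
  rw [cf_expE, Finset.sum_eq_single 0]
  · simp
  · intro n _ hn
    obtain ⟨m, rfl⟩ := Nat.exists_eq_succ_of_ne_zero hn
    rw [pow_succ, Module.End.mul_apply, h, map_zero, map_zero, smul_zero]
  · simp

lemma semiconj_pow {σ T T' : Op} (h : σ * T = T' * σ) (n : ℕ) :
    σ * T ^ n = T' ^ n * σ := (SemiconjBy.pow_right (show SemiconjBy σ T T' from h) n).eq

/-- Operators preserving the degree filtration intertwine exponentials if they intertwine
the operators. -/
lemma semiconj_expE {σ T T' : Op} (hT : T ∈ K 1) (hT' : T' ∈ K 1)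
    (hσ : σ ∈ K 0) (h : σ * T = T' * σ) : σ * expE T = expE T' * σ := by
  refine LinearMap.ext fun f => ?_
  rw [← sub_eq_zero]
  refine eq_zero_of_forall_mem_I fun N => ?_
  have h1 : σ * expTrunc N T = expTrunc N T' * σ := by
    simp only [expTrunc, Finset.mul_sum, Finset.sum_mul, mul_smul_comm, smul_mul_assoc,
      semiconj_pow h]
  have h2 : (σ * expE T) f - (expE T' * σ) f = σ (expE T f - expTrunc N T f)
      - (expE T' (σ f) - expTrunc N T' (σ f)) := by
    have := LinearMap.congr_fun h1 f
    simp only [Module.End.mul_apply] at this ⊢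
    rw [map_sub, this]
    abel
  rw [h2]
  exact sub_mem (by simpa using hσ _ _ (expE_sub_expTrunc_mem hT N f))
    (expE_sub_expTrunc_mem hT' N _)

lemma expTrunc_mem_K {T : Op} (hT : T ∈ K 1) (N : ℕ) : expTrunc N T ∈ K 0 :=
  Submodule.sum_mem _ fun _ _ => Submodule.smul_mem _ _ (K_anti (Nat.zero_le _) (pow_mem_K hT _))

lemma mem_K_of_forall {n : ℕ} {T : Op} (U : ℕ → Op)
    (hU : ∀ N, U N ∈ K n) (h : ∀ N f, T f - U N f ∈ I N) : T ∈ K n := by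
  intro m f hf
  have := add_mem (h (m + n) f) (hU (m + n) m f hf)
  rwa [sub_add_cancel] at this

lemma expE_mem_K {T : Op} (hT : T ∈ K 1) : expE T ∈ K 0 :=
  mem_K_of_forall (fun N => expTrunc N T) (expTrunc_mem_K hT) (expE_sub_expTrunc_mem hT)

lemma expE_sub_sum_mem {T : Op} (hT : T ∈ K 1) (m : ℕ) :
    expE T - expTrunc m T ∈ K m := by
  refine mem_K_of_forall (fun N => expTrunc (m + N) T - expTrunc m T) (fun N => ?_) fun N f => ?_
  · rw [expTrunc, Finset.sum_range_add, ← expTrunc, add_sub_cancel_left]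
    exact Submodule.sum_mem _ fun k _ => Submodule.smul_mem _ _
      (K_anti (Nat.le_add_right m k) (pow_mem_K hT _))
  · have := expE_sub_expTrunc_mem hT (m + N) f
    have h2 : (expE T - expTrunc m T) f - (expTrunc (m + N) T - expTrunc m T) f
      = expE T f - expTrunc (m + N) T f := by
      simp only [LinearMap.sub_apply]
      abel
    rw [h2]
    exact I_anti (Nat.le_add_left N m) this

lemma expE_sub_one_mem {T : Op} (hT : T ∈ K 1) : expE T - 1 ∈ K 1 := by
  simpa [expTrunc] using expE_sub_sum_mem hT 1

lemma expE_sub_quadratic_mem {T : Op} (hT : T ∈ K 1) :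
    expE T - (1 + T + (2 : ℂ)⁻¹ • (T * T)) ∈ K 3 := by
  simpa [expTrunc, Finset.sum_range_succ, pow_two] using expE_sub_sum_mem hT 3

lemma add_pow_sub_mem {T t : Op} (hT : T ∈ K 1) {n : ℕ} (hn : 1 ≤ n)
    (ht : t ∈ K n) (k : ℕ) : (T + t) ^ (k + 1) - T ^ (k + 1) ∈ K (n + k) := by
  induction k with
  | zero => simpa using ht
  | succ k ih =>
    have h1 : (T + t) ^ (k + 1 + 1) - T ^ (k + 1 + 1)
        = (T + t) * ((T + t) ^ (k + 1) - T ^ (k + 1)) + t * T ^ (k + 1) := by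
      rw [pow_succ' (T + t) (k + 1), pow_succ' T (k + 1)]
      noncomm_ring
    rw [h1]
    refine add_mem ?_ (mul_mem_K ht (pow_mem_K hT _))
    have := mul_mem_K (add_mem hT (K_anti hn ht)) ih
    rwa [show 1 + (n + k) = n + (k + 1) by ring] at this

/-- The first order variation of the exponential. -/
lemma expE_add_sub_mem {T t : Op} (hT : T ∈ K 1) {n : ℕ} (hn : 1 ≤ n)
    (ht : t ∈ K n) : expE (T + t) - expE T - t ∈ K (n + 1) := by
  have hTt : T + t ∈ K 1 := add_mem hT (K_anti hn ht)
  refine mem_K_of_forall (fun N => expTrunc (N + 2) (T + t) - expTrunc (N + 2) T - t)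
    (fun N => ?_) fun N f => ?_
  · rw [expTrunc, expTrunc, ← Finset.sum_sub_distrib, Finset.sum_range_succ', Finset.sum_range_succ']
    simp only [zero_add, Nat.factorial_one, Nat.cast_one, inv_one, one_smul, pow_one,
      Nat.factorial_zero, pow_zero, sub_self, add_zero, add_sub_cancel_left, add_sub_cancel_right]
    refine Submodule.sum_mem _ fun k _ => ?_
    rw [← smul_sub]
    exact Submodule.smul_mem _ _ (K_anti (by omega) (add_pow_sub_mem hT hn ht (k + 1)))
  · have h1 := expE_sub_expTrunc_mem hT (N + 2) f
    have h2 := expE_sub_expTrunc_mem hTt (N + 2) f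
    have h3 := I_anti (Nat.le_add_right N 2) (sub_mem h2 h1)
    convert h3 using 1
    simp only [LinearMap.sub_apply]
    abel

open scoped TensorProduct in
lemma leibniz_pow {A B C : Op}
    (h : ∀ f g, A (g * f) = B g * f + g * C f) (n : ℕ) (f g : Formal) :
    (A ^ n) (g * f) = ∑ p ∈ Finset.HasAntidiagonal.antidiagonal n,
      (n.choose p.1) • ((B ^ p.1) g * (C ^ p.2) f) := by
  have hμ : A ∘ₗ LinearMap.mul' ℂ Formal
      = LinearMap.mul' ℂ Formal ∘ₗ (TensorProduct.map B 1 + TensorProduct.map 1 C) :=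
    TensorProduct.ext' fun g f => by simp [h]
  have hμn : ∀ z, (A ^ n) (LinearMap.mul' ℂ Formal z)
      = LinearMap.mul' ℂ Formal (((TensorProduct.map B 1 + TensorProduct.map 1 C :
        Module.End ℂ (Formal ⊗[ℂ] Formal)) ^ n) z) := by
    induction n with
    | zero => simp
    | succ n ih =>
      intro z
      rw [pow_succ, pow_succ, Module.End.mul_apply, Module.End.mul_apply, ← ih]
      exact congrArg _ (LinearMap.congr_fun hμ z)
  have hc : Commute (TensorProduct.map B (1 : Op))
      (TensorProduct.map (1 : Op) C) := by
    refine TensorProduct.ext' fun g f => ?_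
    simp
  have h1 := hμn (g ⊗ₜ[ℂ] f)
  rw [LinearMap.mul'_apply] at h1
  rw [h1, hc.add_pow', LinearMap.sum_apply, map_sum]
  refine Finset.sum_congr rfl fun p _ => ?_
  rw [LinearMap.smul_apply, map_nsmul, TensorProduct.map_pow, TensorProduct.map_pow, one_pow,
    one_pow, Module.End.mul_apply]
  simp

lemma expTrunc_leibniz_mem {A B C : Op} (hB : B ∈ K 1) (hC : C ∈ K 1)
    (h : ∀ f g, A (g * f) = B g * f + g * C f) (N : ℕ) (f g : Formal) :
    expTrunc N B g * expTrunc N C f - expTrunc N A (g * f) ∈ I N := by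
  set b : ℕ → Formal := fun i => ((i.factorial : ℂ)⁻¹) • (B ^ i) g with hb
  set c : ℕ → Formal := fun i => ((i.factorial : ℂ)⁻¹) • (C ^ i) f with hc
  have h1 : expTrunc N A (g * f) = ∑ n ∈ Finset.range N, ∑ p ∈ Finset.HasAntidiagonal.antidiagonal n,
      b p.1 * c p.2 := by
    rw [expTrunc, LinearMap.sum_apply]
    refine Finset.sum_congr rfl fun n _ => ?_
    rw [LinearMap.smul_apply, leibniz_pow h, Finset.smul_sum]
    refine Finset.sum_congr rfl fun p hp => ?_
    have hp' := Finset.HasAntidiagonal.mem_antidiagonal.mp hp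
    rw [hb, hc]
    simp only [smul_mul_assoc, mul_smul_comm, smul_smul]
    rw [← Nat.cast_smul_eq_nsmul ℂ, smul_smul, ← hp', Nat.cast_add_choose]
    congr 1
    have e1 : ((p.1 + p.2).factorial : ℂ) ≠ 0 := by exact_mod_cast Nat.factorial_ne_zero _
    have e2 : (p.1.factorial : ℂ) ≠ 0 := by exact_mod_cast Nat.factorial_ne_zero _
    have e3 : (p.2.factorial : ℂ) ≠ 0 := by exact_mod_cast Nat.factorial_ne_zero _
    field_simp
  have h2 : expTrunc N B g * expTrunc N C f
      = ∑ p ∈ Finset.range N ×ˢ Finset.range N, b p.1 * c p.2 := by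
    rw [expTrunc, expTrunc, LinearMap.sum_apply, LinearMap.sum_apply, Finset.sum_mul_sum,
      Finset.sum_product]
    rfl
  have h3 : ∑ n ∈ Finset.range N, ∑ p ∈ Finset.HasAntidiagonal.antidiagonal n, b p.1 * c p.2
      = ∑ p ∈ (Finset.range N ×ˢ Finset.range N).filter (fun p => p.1 + p.2 < N),
        b p.1 * c p.2 := by
    rw [← Finset.sum_fiberwise_of_maps_to (s := (Finset.range N ×ˢ Finset.range N).filter
      (fun p => p.1 + p.2 < N)) (t := Finset.range N) (g := fun p => p.1 + p.2)]
    · refine Finset.sum_congr rfl fun n hn => Finset.sum_congr ?_ fun _ _ => rfl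
      ext p
      simp only [Finset.mem_range] at hn
      simp only [Finset.HasAntidiagonal.mem_antidiagonal, Finset.mem_filter, Finset.mem_product, Finset.mem_range]
      omega
    · intro p hp
      simpa using (Finset.mem_filter.mp hp).2
  rw [h1, h2, h3, ← Finset.sum_filter_add_sum_filter_not _ (fun p : ℕ × ℕ => p.1 + p.2 < N),
    add_sub_cancel_left]
  refine Submodule.sum_mem _ fun p hp => ?_
  have hp' := (Finset.mem_filter.mp hp).2
  refine I_anti (not_lt.mp hp') (mul_mem_I ?_ ?_)
  · exact Submodule.smul_mem _ _ (apply_mem_I' (pow_mem_K hB _) g)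
  · exact Submodule.smul_mem _ _ (apply_mem_I' (pow_mem_K hC _) f)

/-- The exponential of an operator satisfying a Leibniz rule is multiplicative. -/
lemma expE_leibniz {A B C : Op} (hA : A ∈ K 1) (hB : B ∈ K 1) (hC : C ∈ K 1)
    (h : ∀ f g, A (g * f) = B g * f + g * C f) (f g : Formal) :
    expE A (g * f) = expE B g * expE C f := by
  rw [← sub_eq_zero]
  refine eq_zero_of_forall_mem_I fun N => ?_
  have h1 := expTrunc_leibniz_mem hB hC h N f g
  have h2 := expE_sub_expTrunc_mem hA N (g * f)
  have h3 := mul_mem_I_right (expE_sub_expTrunc_mem hB N g) (expE C f)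
  have h4 := mul_mem_I_left (expTrunc N B g) (expE_sub_expTrunc_mem hC N f)
  have h5 : expE A (g * f) - expE B g * expE C f
      = (expE A (g * f) - expTrunc N A (g * f))
        - ((expE B g - expTrunc N B g) * expE C f)
        - (expTrunc N B g * (expE C f - expTrunc N C f))
        - (expTrunc N B g * expTrunc N C f - expTrunc N A (g * f)) := by
    noncomm_ring
  rw [h5]
  exact sub_mem (sub_mem (sub_mem h2 h3) h4) h1

end Formal

/-! ## Operators on Laurent polynomial coefficients -/

namespace Laurent

lemma induction {P : Laurent → Prop} (f : Laurent) (h0 : P 0)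
    (hs : ∀ w c, P (AddMonoidAlgebra.single w c)) (ha : ∀ f g, P f → P g → P (f + g)) : P f := by
  obtain ⟨f⟩ := f
  induction f using Finsupp.induction_linear with
  | zero => exact h0
  | add f g hf hg => exact ha _ _ hf hg
  | single w c => exact hs w c

lemma deriv_single (u : ℤ × ℤ × ℤ) (n : ℤ × ℤ × ℤ → ℤ) (w : ℤ × ℤ × ℤ) (c : ℂ) :
    deriv u n (AddMonoidAlgebra.single w c) = AddMonoidAlgebra.single (w - u) ((n w : ℂ) * c) := by
  rw [deriv, AddMonoidAlgebra.coeff_single, Finsupp.sum_single_index]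
  simp

/-- `Laurent.deriv` as a linear map. -/
def derivL (u : ℤ × ℤ × ℤ) (n : ℤ × ℤ × ℤ → ℤ) : Laurent →ₗ[ℂ] Laurent where
  toFun := deriv u n
  map_add' f g := by
    rw [deriv, AddMonoidAlgebra.coeff_add, Finsupp.sum_add_index']
    · rfl
    · simp
    · intro w b c
      rw [mul_add, AddMonoidAlgebra.single_add]
  map_smul' c f := by
    rw [deriv, AddMonoidAlgebra.coeff_smul, Finsupp.sum_smul_index (by simp), RingHom.id_apply,
      deriv, Finsupp.smul_sum]
    refine Finset.sum_congr rfl fun w _ => ?_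
    simp only [AddMonoidAlgebra.smul_single, smul_eq_mul]
    congr 1
    ring

lemma derivL_single (u : ℤ × ℤ × ℤ) (n : ℤ × ℤ × ℤ → ℤ) (w : ℤ × ℤ × ℤ) (c : ℂ) :
    derivL u n (AddMonoidAlgebra.single w c)
      = AddMonoidAlgebra.single (w - u) ((n w : ℂ) * c) := deriv_single u n w c

lemma derivL_mul (u : ℤ × ℤ × ℤ) (n : ℤ × ℤ × ℤ →+ ℤ) (f g : Laurent) :
    derivL u n (f * g) = derivL u n f * g + f * derivL u n g := by
  induction f using induction with
  | h0 => simp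
  | ha f₁ f₂ h₁ h₂ =>
    rw [add_mul, map_add, h₁, h₂, map_add]
    ring
  | hs w c =>
    induction g using induction with
    | h0 => simp
    | ha f₁ f₂ h₁ h₂ =>
      rw [mul_add, map_add, h₁, h₂, map_add]
      ring
    | hs v d =>
      rw [AddMonoidAlgebra.single_mul_single, derivL_single, derivL_single, derivL_single,
        AddMonoidAlgebra.single_mul_single, AddMonoidAlgebra.single_mul_single, map_add,
        show w - u + v = w + v - u by abel, show w + (v - u) = w + v - u by abel,
        ← AddMonoidAlgebra.single_add]
      congr 1
      push_cast
      ring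

lemma coeffX_single (k : ℤ) (w : ℤ × ℤ × ℤ) (c : ℂ) :
    coeffX k (AddMonoidAlgebra.single w c)
      = if w.2.2 = k then AddMonoidAlgebra.single (w.1, w.2.1, 0) c else 0 := by
  rw [coeffX, AddMonoidAlgebra.coeff_single, Finsupp.sum_single_index]
  split_ifs <;> simp

/-- `Laurent.coeffX` as a linear map. -/
def coeffXL (k : ℤ) : Laurent →ₗ[ℂ] Laurent where
  toFun := coeffX k
  map_add' f g := by
    rw [coeffX, AddMonoidAlgebra.coeff_add, Finsupp.sum_add_index']
    · rfl
    · intro w; split_ifs <;> simp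
    · intro w b c
      split_ifs
      · rw [AddMonoidAlgebra.single_add]
      · simp
  map_smul' c f := by
    rw [coeffX, AddMonoidAlgebra.coeff_smul, Finsupp.sum_smul_index (by intro w; split_ifs <;> simp),
      RingHom.id_apply, coeffX, Finsupp.smul_sum]
    refine Finset.sum_congr rfl fun w _ => ?_
    simp only [smul_ite, AddMonoidAlgebra.smul_single, smul_eq_mul, smul_zero]

lemma coeffXL_single (k : ℤ) (w : ℤ × ℤ × ℤ) (c : ℂ) :
    coeffXL k (AddMonoidAlgebra.single w c)
      = if w.2.2 = k then AddMonoidAlgebra.single (w.1, w.2.1, 0) c else 0 := coeffX_single k w c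

/-- The exponents of `x` occurring in a Laurent polynomial. -/
def xExps (f : Laurent) : Finset ℤ := f.coeff.support.image fun w => w.2.2

lemma eq_sum_single (f : Laurent) :
    f = ∑ w ∈ f.coeff.support, AddMonoidAlgebra.single w (f.coeff w) := by
  apply AddMonoidAlgebra.coeff_injective
  rw [AddMonoidAlgebra.coeff_sum]
  simp only [AddMonoidAlgebra.coeff_single]
  exact (Finsupp.sum_single f.coeff).symm

lemma coeffXL_eq_zero {f : Laurent} {k : ℤ} (h : k ∉ xExps f) : coeffXL k f = 0 := by
  rw [eq_sum_single f, map_sum]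
  refine Finset.sum_eq_zero fun w hw => ?_
  rw [coeffXL_single, if_neg]
  rintro rfl
  exact h (Finset.mem_image_of_mem (fun w : ℤ × ℤ × ℤ => w.2.2) hw)

lemma sum_coeffXL {f : Laurent} {s : Finset ℤ} (h : xExps f ⊆ s) :
    ∑ k ∈ s, AddMonoidAlgebra.single (0, 0, k) 1 * coeffXL k f = f := by
  have h1 : ∀ k, coeffXL k f = ∑ w ∈ f.coeff.support,
      coeffXL k (AddMonoidAlgebra.single w (f.coeff w)) := fun k => by
    conv_lhs => rw [eq_sum_single f, map_sum]
  simp only [h1, Finset.mul_sum]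
  rw [Finset.sum_comm]
  conv_rhs => rw [eq_sum_single f]
  refine Finset.sum_congr rfl fun w hw => ?_
  rw [Finset.sum_eq_single w.2.2]
  · rw [coeffXL_single, if_pos rfl, AddMonoidAlgebra.single_mul_single]
    simp
  · intro k _ hk
    rw [coeffXL_single, if_neg (Ne.symm hk), mul_zero]
  · intro h2
    exact absurd (h (Finset.mem_image_of_mem (fun w : ℤ × ℤ × ℤ => w.2.2) hw)) h2

end Laurent

namespace Formal

/-- A linear map applied to all Laurent polynomial coefficients. -/
def lift (g : Laurent →ₗ[ℂ] Laurent) : Op where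
  toFun f := ofCf fun q => g (cf q f)
  map_add' f h := cf_ext fun q => by rw [cf_ofCf, map_add, map_add, map_add]; rfl
  map_smul' c f := cf_ext fun q => by rw [cf_ofCf, map_smul, map_smul, map_smul]; rfl

lemma cf_lift (g : Laurent →ₗ[ℂ] Laurent) (f : Formal) (q : Idx) :
    cf q (lift g f) = g (cf q f) := rfl

lemma isCont_lift (g : Laurent →ₗ[ℂ] Laurent) : IsCont (lift g) :=
  fun q => ⟨{q}, fun f h => by rw [cf_lift, h q (Finset.mem_singleton_self q), map_zero]⟩

lemma lift_mem_K (g : Laurent →ₗ[ℂ] Laurent) : lift g ∈ K 0 :=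
  fun m f hf q hq => by rw [cf_lift, hf q hq, map_zero]

lemma lift_mul {g : Laurent →ₗ[ℂ] Laurent} (hg : ∀ a b, g (a * b) = g a * b + a * g b)
    (f h : Formal) : lift g (f * h) = lift g f * h + f * lift g h := by
  refine cf_ext fun q => ?_
  rw [cf_lift, map_add, cf_mul, cf_mul, cf_mul, map_sum, ← Finset.sum_add_distrib]
  refine Finset.sum_congr rfl fun T _ => ?_
  rw [map_sum, ← Finset.sum_add_distrib]
  refine Finset.sum_congr rfl fun p _ => ?_
  rw [map_zsmul, hg, cf_lift, cf_lift, smul_add]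

/-- The left derivative with respect to an odd generator. -/
def dOdd (p : OddVar) : Op where
  toFun := Gr.leftDeriv p
  map_add' := Gr.leftDeriv_add p
  map_smul' c f := Gr.leftDeriv_smul c p f

lemma cf_dOdd (p : OddVar) (f : Formal) (q : Idx) :
    cf q (dOdd p f) = if p ∈ q.1 then 0 else shuffleSign {p} q.1 • cf (insert p q.1, q.2) f := by
  change MvPowerSeries.coeff q.2 (Gr.leftDeriv p f q.1) = _
  unfold Gr.leftDeriv
  split_ifs
  · exact map_zero _
  · rw [← zsmul_eq_mul, map_zsmul]
    rfl

lemma isCont_dOdd (p : OddVar) : IsCont (dOdd p) :=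
  fun q => ⟨{(insert p q.1, q.2)}, fun f h => by
    rw [cf_dOdd, h _ (Finset.mem_singleton_self _)]; simp⟩

lemma dOdd_mul (p : OddVar) (f g : Formal) :
    dOdd p (f * g) = dOdd p f * g + Gr.parityAut f * dOdd p g := Gr.leftDeriv_mul p f g

lemma dOdd_comm (p q : OddVar) (f : Formal) : dOdd p (dOdd q f) = -dOdd q (dOdd p f) :=
  Gr.leftDeriv_comm p q f

lemma dOdd_lift (p : OddVar) (g : Laurent →ₗ[ℂ] Laurent) (f : Formal) :
    dOdd p (lift g f) = lift g (dOdd p f) := by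
  refine cf_ext fun q => ?_
  rw [cf_dOdd, cf_lift, cf_lift, cf_dOdd]
  split_ifs
  · simp
  · rw [map_zsmul]

/-- The parity involution as a linear operator. -/
def par : Op where
  toFun := Gr.parityAut
  map_add' f g := map_add _ f g
  map_smul' c f := Gr.parityAut_smul c f

lemma par_apply (f : Formal) : par f = Gr.parityAut f := rfl

lemma par_par (f : Formal) : par (par f) = f := Gr.parityAut_parityAut f

lemma par_mul (f g : Formal) : par (f * g) = par f * par g := map_mul Gr.parityAut f g

lemma cf_par (f : Formal) (q : Idx) : cf q (par f) = (-1 : ℤ) ^ q.1.card • cf q f := by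
  change MvPowerSeries.coeff q.2 (Gr.parityAut f q.1) = _
  rw [Gr.parityAut_apply]
  rcases neg_one_pow_eq_or ℤ q.1.card with h | h
  · have : ((-1 : FormalCoeff)) ^ q.1.card = 1 := by exact_mod_cast congrArg (Int.cast : ℤ → FormalCoeff) h
    rw [h, this, one_mul, one_smul]; rfl
  · have : ((-1 : FormalCoeff)) ^ q.1.card = -1 := by exact_mod_cast congrArg (Int.cast : ℤ → FormalCoeff) h
    rw [h, this, neg_one_mul, neg_one_smul, map_neg]; rfl

lemma isCont_par : IsCont par :=
  fun q => ⟨{q}, fun f h => by rw [cf_par, h q (Finset.mem_singleton_self q), smul_zero]⟩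

lemma par_mem_K : par ∈ K 0 := fun m f hf q hq => by rw [cf_par, hf q hq, smul_zero]

lemma par_lift (g : Laurent →ₗ[ℂ] Laurent) (f : Formal) : par (lift g f) = lift g (par f) := by
  refine cf_ext fun q => ?_
  rw [cf_par, cf_lift, cf_lift, cf_par, map_zsmul]

lemma par_dOdd (p : OddVar) (f : Formal) : par (dOdd p f) = -dOdd p (par f) :=
  Gr.parityAut_leftDeriv p f

lemma par_of_isEven {f : Formal} (h : f.IsEven) : par f = f := Gr.parityAut_of_isEven h

lemma par_of_isOdd {f : Formal} (h : f.IsOdd) : par f = -f := Gr.parityAut_of_isOdd h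

lemma isEven_iff {f : Formal} : f.IsEven ↔ par f = f := Gr.isEven_iff

lemma isOdd_iff {f : Formal} : f.IsOdd ↔ par f = -f := Gr.isOdd_iff

/-! ### Laurent monomials and the coordinates -/

lemma cf_laurentMono_mul (w : ℤ × ℤ × ℤ) (f : Formal) (q : Idx) :
    cf q (laurentMono w * f) = AddMonoidAlgebra.single w 1 * cf q f := by
  change MvPowerSeries.coeff q.2 ((laurentMono w * f : Formal) q.1) = _
  rw [laurentMono, Gr.mono_empty_mul, MvPowerSeries.coeff_C_mul]
  rfl

lemma laurentMono_mul (v w : ℤ × ℤ × ℤ) :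
    laurentMono v * laurentMono w = laurentMono (v + w) := by
  ext S : 1
  rw [laurentMono, Gr.mono_empty_mul]
  simp only [laurentMono, Gr.mono]
  split_ifs
  · rw [← map_mul, AddMonoidAlgebra.single_mul_single, one_mul]
  · rw [mul_zero]

lemma laurentMono_zero : laurentMono 0 = 1 := by
  ext S : 1
  rw [Gr.one_apply, laurentMono, Gr.mono]
  rfl

lemma isEven_laurentMono (w : ℤ × ℤ × ℤ) : (laurentMono w).IsEven := Gr.isEven_mono_empty _

lemma laurentMono_comm (w : ℤ × ℤ × ℤ) (f : Formal) : laurentMono w * f = f * laurentMono w :=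
  Gr.commute_of_isEven (isEven_laurentMono w) f

lemma cf_laurentMono (w : ℤ × ℤ × ℤ) (q : Idx) :
    cf q (laurentMono w) = if q = (∅, 0) then AddMonoidAlgebra.single w 1 else 0 := by
  obtain ⟨S, d⟩ := q
  change MvPowerSeries.coeff d (laurentMono w S) = _
  unfold laurentMono Gr.mono
  by_cases hS : S = ∅
  · simp [hS, MvPowerSeries.coeff_C]
  · simp [hS]

lemma cf_one (q : Idx) : cf q 1 = if q = (∅, 0) then 1 else 0 := by
  rw [← laurentMono_zero, cf_laurentMono]
  rfl

lemma dOdd_laurentMono (p : OddVar) (w : ℤ × ℤ × ℤ) : dOdd p (laurentMono w) = 0 :=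
  Gr.leftDeriv_mono_empty p _

lemma dOdd_one (p : OddVar) : dOdd p 1 = 0 := by
  rw [← laurentMono_zero, dOdd_laurentMono]

lemma par_laurentMono (w : ℤ × ℤ × ℤ) : par (laurentMono w) = laurentMono w :=
  par_of_isEven (isEven_laurentMono w)

lemma dOdd_laurentMono_mul (p : OddVar) (w : ℤ × ℤ × ℤ) (f : Formal) :
    dOdd p (laurentMono w * f) = laurentMono w * dOdd p f := by
  rw [dOdd_mul, dOdd_laurentMono, zero_mul, zero_add, ← par_apply, par_laurentMono]

/-- The derivation of Laurent polynomials in the direction of an exponent, as an operator. -/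
def dLaurent (u : ℤ × ℤ × ℤ) (n : ℤ × ℤ × ℤ → ℤ) : Op := lift (Laurent.derivL u n)

lemma dLaurent_mul (u : ℤ × ℤ × ℤ) (n : ℤ × ℤ × ℤ →+ ℤ) (f g : Formal) :
    dLaurent u n (f * g) = dLaurent u n f * g + f * dLaurent u n g :=
  lift_mul (Laurent.derivL_mul u n) f g

lemma dLaurent_laurentMono (u : ℤ × ℤ × ℤ) (n : ℤ × ℤ × ℤ → ℤ) (w : ℤ × ℤ × ℤ) :
    dLaurent u n (laurentMono w) = (n w : ℂ) • laurentMono (w - u) := by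
  refine cf_ext fun q => ?_
  rw [dLaurent, cf_lift, cf_laurentMono, map_smul, cf_laurentMono]
  split_ifs
  · rw [Laurent.derivL_single, AddMonoidAlgebra.smul_single, smul_eq_mul]
  · simp

/-- The exponent of `x`. -/
def expX : ℤ × ℤ × ℤ →+ ℤ := (AddMonoidHom.snd ℤ ℤ).comp (AddMonoidHom.snd ℤ (ℤ × ℤ))

/-- The exponent of `α₀^{1/2}`. -/
def expAlpha : ℤ × ℤ × ℤ →+ ℤ := AddMonoidHom.fst ℤ (ℤ × ℤ)

/-- The exponent of `β₀^{1/2}`. -/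
def expBeta : ℤ × ℤ × ℤ →+ ℤ := (AddMonoidHom.fst ℤ ℤ).comp (AddMonoidHom.snd ℤ (ℤ × ℤ))

/-- The operator `∂/∂x`. -/
def dX : Op := dLaurent (0, 0, 1) expX

/-- The operator `∂/∂φ`. -/
def dPhi : Op := dOdd OddVar.phi

/-- The odd coordinate `φ` on formal superseries. -/
abbrev phi : Formal := sphi FormalCoeff

lemma sdphi_eq (f : Formal) : sdphi f = dPhi f := rfl

lemma sx_eq (n : ℤ) : sx X n = laurentMono (0, 0, n) := rfl

lemma dX_mul (f g : Formal) : dX (f * g) = dX f * g + f * dX g := dLaurent_mul _ expX f g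

lemma dPhi_mul (f g : Formal) : dPhi (f * g) = dPhi f * g + par f * dPhi g := dOdd_mul _ f g

lemma dPhi_dPhi (f : Formal) : dPhi (dPhi f) = 0 := Gr.leftDeriv_self _ f

lemma dPhi_dX (f : Formal) : dPhi (dX f) = dX (dPhi f) := dOdd_lift _ _ f

lemma par_dX (f : Formal) : par (dX f) = dX (par f) := par_lift _ f

lemma par_dPhi (f : Formal) : par (dPhi f) = -dPhi (par f) := par_dOdd _ f

lemma isOdd_phi : phi.IsOdd := Gr.isOdd_gen _

lemma phi_mul_phi : phi * phi = 0 := Gr.IsOdd.mul_self isOdd_phi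

lemma phi_mul_phi_mul (f : Formal) : phi * (phi * f) = 0 := by
  rw [← mul_assoc, phi_mul_phi, zero_mul]

lemma phi_comm (f : Formal) : phi * f = par f * phi := Gr.odd_mul_comm isOdd_phi f

lemma par_phi : par phi = -phi := par_of_isOdd isOdd_phi

lemma dPhi_phi : dPhi phi = 1 := Gr.leftDeriv_gen_self _

lemma dPhi_phi_mul (f : Formal) : dPhi (phi * f) = f - phi * dPhi f := by
  rw [dPhi_mul, dPhi_phi, par_phi, one_mul, neg_mul, sub_eq_add_neg]

lemma lift_phi (g : Laurent →ₗ[ℂ] Laurent) (h : g 1 = 0) : lift g phi = 0 := by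
  refine cf_ext fun q => ?_
  rw [cf_lift, map_zero]
  change g (MvPowerSeries.coeff q.2 (Gr.mono _ _ q.1)) = 0
  unfold Gr.mono
  split_ifs
  · rw [MvPowerSeries.coeff_one]
    split_ifs
    · exact h
    · exact map_zero g
  · simp

lemma derivL_one (u : ℤ × ℤ × ℤ) (n : ℤ × ℤ × ℤ →+ ℤ) : Laurent.derivL u n 1 = 0 := by
  rw [AddMonoidAlgebra.one_def, Laurent.derivL_single, map_zero]
  simp

lemma dX_phi : dX phi = 0 := lift_phi _ (derivL_one _ expX)

lemma dX_phi_mul (f : Formal) : dX (phi * f) = phi * dX f := by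
  rw [dX_mul, dX_phi, zero_mul, zero_add]

lemma dX_sx (n : ℤ) : dX (sx X n) = (n : ℂ) • sx X (n - 1) := by
  rw [sx_eq, dX, dLaurent_laurentMono]
  simp [expX, sx_eq]

lemma dX_one : dX 1 = 0 := by
  have := dX_sx 0
  simpa [sx_eq, show ((0, 0, 0) : ℤ × ℤ × ℤ) = 0 from rfl, laurentMono_zero] using this

lemma dX_sx_mul (n : ℤ) (f : Formal) :
    dX (sx X n * f) = (n : ℂ) • (sx X (n - 1) * f) + sx X n * dX f := by
  rw [dX_mul, dX_sx, smul_mul_assoc]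

lemma dPhi_sx (n : ℤ) : dPhi (sx X n) = 0 := dOdd_laurentMono _ _

lemma dPhi_sx_mul (n : ℤ) (f : Formal) : dPhi (sx X n * f) = sx X n * dPhi f :=
  dOdd_laurentMono_mul _ _ f

lemma par_sx (n : ℤ) : par (sx X n) = sx X n := par_laurentMono _

lemma sx_comm (n : ℤ) (f : Formal) : sx X n * f = f * sx X n := laurentMono_comm _ f

lemma sx_mul (m n : ℤ) : (sx X m * sx X n : Formal) = sx X (m + n) := by
  rw [sx_eq, sx_eq, laurentMono_mul, sx_eq]
  rfl

lemma sx_mul_sx_mul (m n : ℤ) (f : Formal) : sx X m * (sx X n * f) = sx X (m + n) * f := by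
  rw [← mul_assoc, sx_mul]

lemma phi_mul_sx_mul (n : ℤ) (f : Formal) : phi * (sx X n * f) = sx X n * (phi * f) := by
  rw [← mul_assoc, ← sx_comm, mul_assoc]

lemma sx_zero : (sx X 0 : Formal) = 1 := laurentMono_zero

lemma isEven_sx (n : ℤ) : (sx X n : Formal).IsEven := isEven_laurentMono _

/-! ### The operators `L_n` and `G_{n-1/2}` -/

/-- `L_n` as a linear operator. -/
def L (n : ℤ) : Op :=
  -(LinearMap.mulLeft ℂ (sx X (n + 1)) * dX + (((n : ℂ) + 1) / 2) •
    (LinearMap.mulLeft ℂ phi * (LinearMap.mulLeft ℂ (sx X n) * dPhi)))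

/-- `G_{n-1/2}` as a linear operator. -/
def G (n : ℤ) : Op :=
  -(LinearMap.mulLeft ℂ (sx X n) * (dPhi - LinearMap.mulLeft ℂ phi * dX))

lemma L_apply (n : ℤ) (f : Formal) :
    L n f = -(sx X (n + 1) * dX f + (((n : ℂ) + 1) / 2) • (sx X n * (phi * dPhi f))) := by
  rw [← phi_mul_sx_mul]
  rfl

lemma G_apply (n : ℤ) (f : Formal) : G n f = -(sx X n * dPhi f - sx X n * (phi * dX f)) := by
  rw [← mul_sub]
  rfl

lemma isCont_L (n : ℤ) : IsCont (L n) :=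
  (((isCont_mulLeft _).mul (isCont_lift _)).add (((isCont_mulLeft _).mul
    ((isCont_mulLeft _).mul (isCont_dOdd _))).smul _)).neg

lemma isCont_G (n : ℤ) : IsCont (G n) :=
  ((isCont_mulLeft _).mul ((isCont_dOdd _).sub ((isCont_mulLeft _).mul (isCont_lift _)))).neg

lemma dOdd_mem_K {p : OddVar} (h : p.weight = 0) : dOdd p ∈ K 0 := by
  intro m f hf q hq
  rw [cf_dOdd]
  split_ifs with hp
  · rfl
  · rw [hf, smul_zero]
    rw [add_zero] at hq
    unfold deg at hq ⊢
    simpa [Finset.sum_insert hp, h] using hq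

lemma dPhi_mem_K : dPhi ∈ K 0 := dOdd_mem_K rfl

lemma dX_mem_K : dX ∈ K 0 := lift_mem_K _

lemma mulLeft_mem_K_zero (f : Formal) : LinearMap.mulLeft ℂ f ∈ K 0 := mulLeft_mem_K (mem_I_zero f)

lemma L_mem_K (n : ℤ) : L n ∈ K 0 := by
  refine neg_mem (add_mem ?_ (Submodule.smul_mem _ _ ?_))
  · exact mul_mem_K_left (mulLeft_mem_K_zero _) dX_mem_K
  · exact mul_mem_K_left (mulLeft_mem_K_zero _)
      (mul_mem_K_left (mulLeft_mem_K_zero _) dPhi_mem_K)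

lemma G_mem_K (n : ℤ) : G n ∈ K 0 :=
  neg_mem (mul_mem_K_left (mulLeft_mem_K_zero _) (sub_mem dPhi_mem_K
    (mul_mem_K_left (mulLeft_mem_K_zero _) dX_mem_K)))

lemma sx_mul_left_comm (n : ℤ) (f g : Formal) : f * (sx X n * g) = sx X n * (f * g) := by
  rw [← mul_assoc, ← sx_comm, mul_assoc]

lemma phi_left_comm (f g : Formal) : f * (phi * g) = phi * (par f * g) := by
  rw [← mul_assoc phi, phi_comm (par f), par_par, mul_assoc]

lemma L_mul (n : ℤ) (f g : Formal) : L n (f * g) = L n f * g + f * L n g := by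
  simp only [L_apply, dX_mul, dPhi_mul, mul_add, smul_add, neg_mul, mul_neg, add_mul, mul_assoc,
    smul_mul_assoc, mul_smul_comm]
  rw [sx_mul_left_comm (n + 1) f, sx_mul_left_comm n f, phi_left_comm f]
  abel

lemma G_mul (n : ℤ) (f g : Formal) : G n (f * g) = G n f * g + par f * G n g := by
  simp only [G_apply, dX_mul, dPhi_mul, mul_add, mul_sub, neg_mul, mul_neg, sub_mul, mul_assoc]
  rw [sx_mul_left_comm n (par f), sx_mul_left_comm n (par f), phi_left_comm (par f), par_par]
  abel

lemma par_L (n : ℤ) (f : Formal) : par (L n f) = L n (par f) := by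
  simp only [L_apply, map_neg, map_add, map_smul, par_mul, par_sx, par_dX, par_dPhi, par_phi]
  simp

lemma par_G (n : ℤ) (f : Formal) : par (G n f) = -G n (par f) := by
  simp only [G_apply, map_neg, map_sub, par_mul, par_sx, par_dX, par_dPhi, par_phi]
  noncomm_ring

lemma L_sx (n : ℤ) : L n (sx X 1) = -sx X (n + 1) := by
  simp [L_apply, dX_sx, dPhi_sx, sx_zero]

lemma L_phi (n : ℤ) : L n phi = -((((n : ℂ) + 1) / 2) • (sx X n * phi)) := by
  simp [L_apply, dX_phi, dPhi_phi]

lemma G_sx (n : ℤ) : G n (sx X 1) = sx X n * phi := by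
  simp [G_apply, dX_sx, dPhi_sx, sx_zero]

lemma G_phi (n : ℤ) : G n phi = -sx X n := by
  simp [G_apply, dX_phi, dPhi_phi]

end Formal

namespace Formal

/-! ### Brackets -/

lemma L_L (m n : ℤ) (f : Formal) :
    L m (L n f) - L n (L m f) = ((m : ℂ) - n) • L (m + n) f := by
  simp only [L_apply, map_neg, map_add, map_smul, dX_sx_mul, dPhi_sx_mul, dX_phi_mul, dPhi_phi_mul,
    dPhi_dPhi, dPhi_dX, mul_neg, mul_add, mul_sub, mul_smul_comm, phi_mul_sx_mul, sx_mul_sx_mul,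
    phi_mul_phi_mul, mul_zero, smul_zero, smul_add, smul_neg, smul_sub, smul_smul]
  push_cast
  ring_nf
  module

lemma L_G (m n : ℤ) (f : Formal) :
    L m (G n f) - G n (L m f) = (((m : ℂ) + 1) / 2 - n) • G (m + n) f := by
  simp only [L_apply, G_apply, map_neg, map_add, map_sub, map_smul, dX_sx_mul, dPhi_sx_mul,
    dX_phi_mul, dPhi_phi_mul,
    dPhi_dPhi, dPhi_dX, mul_neg, mul_add, mul_sub, mul_smul_comm, phi_mul_sx_mul, sx_mul_sx_mul,
    phi_mul_phi_mul, mul_zero, smul_zero, smul_add, smul_neg, smul_sub, smul_smul]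
  push_cast
  ring_nf
  module

lemma G_G (m n : ℤ) (f : Formal) :
    G m (G n f) + G n (G m f) = (2 : ℂ) • L (m + n - 1) f := by
  simp only [L_apply, G_apply, map_neg, map_add, map_sub, map_smul, dX_sx_mul, dPhi_sx_mul,
    dX_phi_mul, dPhi_phi_mul,
    dPhi_dPhi, dPhi_dX, mul_neg, mul_add, mul_sub, mul_smul_comm, phi_mul_sx_mul, sx_mul_sx_mul,
    phi_mul_phi_mul, mul_zero, smul_zero, smul_add, smul_neg, smul_sub, smul_smul]
  push_cast
  ring_nf
  module

/-- The superconformal derivation `D = ∂/∂φ + φ ∂/∂x`. -/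
def D : Op := dPhi + LinearMap.mulLeft ℂ phi * dX

lemma D_apply (f : Formal) : D f = dPhi f + phi * dX f := rfl

lemma D_L (n : ℤ) (f : Formal) :
    D (L n f) = L n (D f) - (((n : ℂ) + 1) / 2) • (sx X n * D f) := by
  simp only [D_apply, L_apply, map_neg, map_add, map_sub, map_smul, dX_sx_mul, dPhi_sx_mul,
    dX_phi_mul, dPhi_phi_mul,
    dPhi_dPhi, dPhi_dX, mul_neg, mul_add, mul_sub, mul_smul_comm, phi_mul_sx_mul, sx_mul_sx_mul,
    phi_mul_phi_mul, mul_zero, smul_zero, smul_add, smul_neg, smul_sub, smul_smul]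
  push_cast
  ring_nf
  module

lemma D_G (n : ℤ) (f : Formal) :
    D (G n f) = -G n (D f) - (n : ℂ) • (sx X (n - 1) * (phi * D f)) := by
  simp only [D_apply, G_apply, map_neg, map_add, map_sub, map_smul, dX_sx_mul, dPhi_sx_mul,
    dX_phi_mul, dPhi_phi_mul,
    dPhi_dPhi, dPhi_dX, mul_neg, mul_add, mul_sub, mul_smul_comm, phi_mul_sx_mul, sx_mul_sx_mul,
    phi_mul_phi_mul, mul_zero, smul_zero, smul_add, smul_neg, smul_sub, smul_smul]
  push_cast
  ring_nf
  module

end Formal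

namespace Laurent

lemma derivL_coeff (u : ℤ × ℤ × ℤ) (n : ℤ × ℤ × ℤ → ℤ) (f : Laurent) (v : ℤ × ℤ × ℤ) :
    (derivL u n f).coeff v = n (v + u) * f.coeff (v + u) := by
  induction f using induction with
  | h0 => simp
  | ha f₁ f₂ h₁ h₂ =>
    rw [map_add, AddMonoidAlgebra.coeff_add, Finsupp.add_apply, h₁, h₂, AddMonoidAlgebra.coeff_add,
      Finsupp.add_apply, mul_add]
  | hs w c =>
    rw [derivL_single, AddMonoidAlgebra.coeff_single, AddMonoidAlgebra.coeff_single]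
    by_cases h : w = v + u
    · subst h
      simp
    · rw [Finsupp.single_eq_of_ne, Finsupp.single_eq_of_ne, mul_zero]
      · exact Ne.symm h
      · intro h2
        exact h (by rw [h2]; abel)

end Laurent

namespace Formal

/-! ### Constants and superseries in the formal variables -/

/-- Superseries not involving the coordinates `x` and `φ`. -/
def IsConst (f : Formal) : Prop := dX f = 0 ∧ dPhi f = 0

lemma dX_eq_zero_iff (f : Formal) :
    dX f = 0 ↔ ∀ S d w, (MvPowerSeries.coeff d (f S)).coeff w ≠ 0 → w.2.2 = 0 := by
  constructor
  · intro h S d w hw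
    have h1 : cf (S, d) (dX f) = 0 := by rw [h, map_zero]
    have h2 := Laurent.derivL_coeff (0, 0, 1) expX (cf (S, d) f) (w - (0, 0, 1))
    rw [sub_add_cancel] at h2
    rw [show Laurent.derivL (0, 0, 1) expX (cf (S, d) f) = 0 from h1, AddMonoidAlgebra.coeff_zero,
      Finsupp.zero_apply] at h2
    rcases mul_eq_zero.mp h2.symm with h3 | h3
    · exact_mod_cast h3
    · exact absurd h3 hw
  · intro h
    refine cf_ext fun q => ?_
    rw [map_zero]
    apply AddMonoidAlgebra.coeff_injective
    ext v
    rw [show cf q (dX f) = Laurent.derivL (0, 0, 1) expX (cf q f) from rfl, Laurent.derivL_coeff]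
    by_cases h1 : (cf q f).coeff (v + (0, 0, 1)) = 0
    · rw [h1, mul_zero]; rfl
    · have h2 : expX (v + (0, 0, 1)) = 0 := h q.1 q.2 _ h1
      rw [h2]
      simp

lemma isFormal_iff (f : Formal) :
    IsFormal f ↔ IsConst f ∧ ∀ i, dOdd (OddVar.zeta i) f = 0 := by
  have h0 : ∀ p, dOdd p f = 0 ↔ ∀ S, p ∈ S → f S = 0 := fun p => Gr.leftDeriv_eq_zero_iff p f
  constructor
  · rintro ⟨h1, h2⟩
    refine ⟨⟨(dX_eq_zero_iff f).mpr h2, (h0 _).mpr fun S hS => ?_⟩, fun i => (h0 _).mpr fun S hS => ?_⟩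
    · by_contra hc
      obtain ⟨s, k, j, h⟩ := h1 S hc _ hS
      cases h
    · by_contra hc
      obtain ⟨s, k, j, h⟩ := h1 S hc _ hS
      cases h
  · rintro ⟨⟨h1, h2⟩, h3⟩
    refine ⟨fun S hS p hp => ?_, (dX_eq_zero_iff f).mp h1⟩
    cases p with
    | zeta i => exact absurd ((h0 _).mp (h3 i) S hp) hS
    | phi => exact absurd ((h0 _).mp h2 S hp) hS
    | formal s k j => exact ⟨s, k, j, rfl⟩

lemma IsFormal.isConst {f : Formal} (h : IsFormal f) : IsConst f := ((isFormal_iff f).mp h).1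

lemma IsConst.add {f g : Formal} (hf : IsConst f) (hg : IsConst g) : IsConst (f + g) :=
  ⟨by rw [map_add, hf.1, hg.1, add_zero], by rw [map_add, hf.2, hg.2, add_zero]⟩

lemma IsConst.mul {f g : Formal} (hf : IsConst f) (hg : IsConst g) : IsConst (f * g) :=
  ⟨by rw [dX_mul, hf.1, hg.1, zero_mul, mul_zero, add_zero],
    by rw [dPhi_mul, hf.2, hg.2, zero_mul, mul_zero, add_zero]⟩

lemma IsConst.smul {f : Formal} (c : ℂ) (hf : IsConst f) : IsConst (c • f) :=
  ⟨by rw [map_smul, hf.1, smul_zero], by rw [map_smul, hf.2, smul_zero]⟩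

lemma IsConst.neg {f : Formal} (hf : IsConst f) : IsConst (-f) := by
  simpa using hf.smul (-1)

lemma isConst_one : IsConst 1 := ⟨dX_one, dOdd_one _⟩

lemma isConst_zero : IsConst 0 := ⟨map_zero _, map_zero _⟩

lemma IsFormal.add {f g : Formal} (hf : IsFormal f) (hg : IsFormal g) : IsFormal (f + g) := by
  rw [isFormal_iff] at *
  exact ⟨hf.1.add hg.1, fun i => by rw [map_add, hf.2, hg.2, add_zero]⟩

lemma IsFormal.mul {f g : Formal} (hf : IsFormal f) (hg : IsFormal g) : IsFormal (f * g) := by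
  rw [isFormal_iff] at *
  exact ⟨hf.1.mul hg.1, fun i => by rw [dOdd_mul, hf.2, hg.2, zero_mul, mul_zero, add_zero]⟩

lemma IsFormal.smul {f : Formal} (c : ℂ) (hf : IsFormal f) : IsFormal (c • f) := by
  rw [isFormal_iff] at *
  exact ⟨hf.1.smul c, fun i => by rw [map_smul, hf.2, smul_zero]⟩

lemma IsFormal.neg {f : Formal} (hf : IsFormal f) : IsFormal (-f) := by
  simpa using hf.smul (-1)

lemma isFormal_zero : IsFormal 0 :=
  (isFormal_iff 0).mpr ⟨isConst_zero, fun _ => map_zero _⟩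

lemma isFormal_one : IsFormal 1 := (isFormal_iff 1).mpr ⟨isConst_one, fun _ => dOdd_one _⟩

lemma IsFormal.pow {f : Formal} (hf : IsFormal f) (n : ℕ) : IsFormal (f ^ n) := by
  induction n with
  | zero => rw [pow_zero]; exact isFormal_one
  | succ n ih => rw [pow_succ]; exact ih.mul hf

lemma lift_eq_zero {g : Laurent →ₗ[ℂ] Laurent} (hg : g 1 = 0) {f : Formal}
    (h : ∀ q, cf q f = 0 ∨ cf q f = 1) : lift g f = 0 := by
  refine cf_ext fun q => ?_
  rw [cf_lift, map_zero]
  rcases h q with h | h <;> rw [h]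
  · exact map_zero g
  · exact hg

lemma cf_evenVar (s : Side) (k : Puncture) (j : ℕ+) (q : Idx) :
    cf q (evenVar s k j) = if q = (∅, Finsupp.single (s, k, j) 1) then 1 else 0 := by
  obtain ⟨S, d⟩ := q
  change MvPowerSeries.coeff d (Gr.mono ∅ (MvPowerSeries.X (s, k, j)) S) = _
  unfold Gr.mono
  by_cases hS : S = ∅
  · simp [hS, MvPowerSeries.coeff_X]
  · simp [hS]

lemma cf_oddVar (s : Side) (k : Puncture) (j : ℕ+) (q : Idx) :
    cf q (oddVar s k j) = if q = ({OddVar.formal s k j}, 0) then 1 else 0 := by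
  obtain ⟨S, d⟩ := q
  change MvPowerSeries.coeff d (Gr.mono _ 1 S) = _
  unfold Gr.mono
  by_cases hS : S = {OddVar.formal s k j}
  · simp [hS, MvPowerSeries.coeff_one]
  · simp [hS]

lemma lift_evenVar {g : Laurent →ₗ[ℂ] Laurent} (hg : g 1 = 0) (s : Side) (k : Puncture) (j : ℕ+) :
    lift g (evenVar s k j) = 0 :=
  lift_eq_zero hg fun q => by rw [cf_evenVar]; split_ifs <;> simp

lemma lift_oddVar {g : Laurent →ₗ[ℂ] Laurent} (hg : g 1 = 0) (s : Side) (k : Puncture) (j : ℕ+) :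
    lift g (oddVar s k j) = 0 :=
  lift_eq_zero hg fun q => by rw [cf_oddVar]; split_ifs <;> simp

lemma isFormal_evenVar (s : Side) (k : Puncture) (j : ℕ+) : IsFormal (evenVar s k j) := by
  rw [isFormal_iff]
  exact ⟨⟨lift_evenVar (derivL_one _ expX) s k j, Gr.leftDeriv_mono_empty _ _⟩,
    fun i => Gr.leftDeriv_mono_empty _ _⟩

lemma isFormal_oddVar (s : Side) (k : Puncture) (j : ℕ+) : IsFormal (oddVar s k j) := by
  rw [isFormal_iff]
  exact ⟨⟨lift_oddVar (derivL_one _ expX) s k j, Gr.leftDeriv_gen_of_ne nofun⟩,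
    fun i => Gr.leftDeriv_gen_of_ne nofun⟩

lemma isEven_evenVar (s : Side) (k : Puncture) (j : ℕ+) : (evenVar s k j).IsEven :=
  Gr.isEven_mono_empty _

lemma isOdd_oddVar (s : Side) (k : Puncture) (j : ℕ+) : (oddVar s k j).IsOdd := Gr.isOdd_gen _

lemma isFormal_laurentMono {w : ℤ × ℤ × ℤ} (h : w.2.2 = 0) : IsFormal (laurentMono w) := by
  rw [isFormal_iff]
  refine ⟨⟨?_, dOdd_laurentMono _ _⟩, fun i => dOdd_laurentMono _ _⟩
  rw [dX, dLaurent_laurentMono, show expX w = 0 from h]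
  simp

lemma mem_I_one_of_isFormal {f : Formal} (hf : IsFormal f) (h0 : NoConstantTerm f) : f ∈ I 1 := by
  rintro ⟨S, d⟩ hq
  have hq' : deg (S, d) = 0 := by omega
  unfold deg at hq'
  simp only [Nat.add_eq_zero_iff, Finset.sum_eq_zero_iff] at hq'
  have hd : d = 0 := (Finsupp.degree_eq_zero_iff d).mp hq'.2
  subst hd
  by_cases hS : S = ∅
  · subst hS
    exact h0
  · obtain ⟨p, hp⟩ := Finset.nonempty_iff_ne_empty.mpr hS
    have : f S = 0 := by
      by_contra hc
      obtain ⟨s, k, j, rfl⟩ := hf.1 S hc p hp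
      exact one_ne_zero (hq'.1 _ hp)
    change MvPowerSeries.coeff 0 (f S) = 0
    rw [this, map_zero]

lemma noConstantTerm_of_mem_I {f : Formal} (hf : f ∈ I 1) : NoConstantTerm f :=
  hf (∅, 0) (by simp [deg])

/-! ### Vector fields with coefficients in the formal variables -/

/-- Sums `∑ c_n X_n` of operators with locally finite coefficients. -/
def csumOp {ι : Type} (c : ι → Formal) (hc : LocallyFinite c) (T : ι → Op) :
    Op where
  toFun f := csum fun n => c n * T n f
  map_add' f g := by
    rw [← csum_add (hc.mul_left _) (hc.mul_left _)]
    simp only [map_add, mul_add]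
  map_smul' r f := by
    rw [RingHom.id_apply, csum_smul r (hc.mul_left _)]
    simp only [map_smul, mul_smul_comm]

section csumOp

variable {ι : Type} {c : ι → Formal} {hc : LocallyFinite c} {T : ι → Op}

lemma csumOp_apply (f : Formal) : csumOp c hc T f = csum fun n => c n * T n f := rfl

lemma isCont_csumOp (hT : ∀ n, IsCont (T n)) : IsCont (csumOp c hc T) := by
  classical
  intro q
  obtain ⟨t, ht⟩ := hc.exists_finset (below q)
  choose Q hQ using fun n => ((isCont_mulLeft (c n)).mul (hT n)) q
  refine ⟨t.biUnion Q, fun f hf => ?_⟩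
  rw [csumOp_apply, cf_csum_of_finset (t := t) fun n hn => cf_mul_eq_zero_left (ht n hn) _]
  exact Finset.sum_eq_zero fun n hn => hQ n f fun r hr => hf r (Finset.mem_biUnion.mpr ⟨n, hn, hr⟩)

lemma csumOp_mem_K {k : ℕ} (hck : ∀ n, c n ∈ I k) (hT : ∀ n, T n ∈ K 0) :
    csumOp c hc T ∈ K k := fun m f hf => csum_mem_I fun n => by
  rw [add_comm]
  exact mul_mem_I (hck n) (hT n m f hf)

lemma apply_csumOp {S : Op} (hS : IsCont S) (f : Formal) :
    S (csumOp c hc T f) = csum fun n => S (c n * T n f) := hS.map_csum (hc.mul_left _)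

lemma csumOp_add_fam {c' : ι → Formal} (hc' : LocallyFinite c') (f : Formal) :
    csum (fun n => (c n + c' n) * T n f) = csumOp c hc T f + csumOp c' hc' T f := by
  rw [csumOp_apply, csumOp_apply, ← csum_add (hc.mul_left _) (hc'.mul_left _)]
  simp only [add_mul]

end csumOp

/-- The coefficients of a vector field `∑_n (c_n L_n + e_n G_{n-1/2})`. -/
structure SFam where
  c : ℤ → Formal
  e : ℤ → Formal
  hc : IsFamily Gr.IsEven c
  he : IsFamily Gr.IsOdd e

namespace IsFamily

variable {ι : Type} {f g : ι → Formal}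

lemma mem_I {P : Formal → Prop} (h : IsFamily P f) (i : ι) : f i ∈ I 1 :=
  mem_I_one_of_isFormal (h.formal i) (h.noConstantTerm i)

lemma add {P : Formal → Prop} (hP : ∀ a b, P a → P b → P (a + b)) (hf : IsFamily P f)
    (hg : IsFamily P g) : IsFamily P fun i => f i + g i where
  formal i := (hf.formal i).add (hg.formal i)
  parity i := hP _ _ (hf.parity i) (hg.parity i)
  noConstantTerm i := noConstantTerm_of_mem_I (add_mem (hf.mem_I i) (hg.mem_I i))
  locallyFinite := hf.locallyFinite.add hg.locallyFinite

lemma neg {P : Formal → Prop} (hP : ∀ a, P a → P (-a)) (hf : IsFamily P f) :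
    IsFamily P fun i => -f i where
  formal i := (hf.formal i).neg
  parity i := hP _ (hf.parity i)
  noConstantTerm i := noConstantTerm_of_mem_I (neg_mem (hf.mem_I i))
  locallyFinite := hf.locallyFinite.neg

lemma smul {P : Formal → Prop} (r : ι → ℂ) (hP : ∀ a (s : ℂ), P a → P (s • a))
    (hf : IsFamily P f) : IsFamily P fun i => r i • f i where
  formal i := (hf.formal i).smul _
  parity i := hP _ _ (hf.parity i)
  noConstantTerm i := noConstantTerm_of_mem_I (Submodule.smul_mem _ _ (hf.mem_I i))
  locallyFinite := hf.locallyFinite.smul r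

lemma mul_left {P : Formal → Prop} {u : ι → Formal} (hP : ∀ a b : Formal, a.IsEven → P b → P (a * b))
    (hu : ∀ i, IsFormal (u i)) (hu' : ∀ i, (u i).IsEven)
    (hf : IsFamily P f) : IsFamily P fun i => u i * f i where
  formal i := (hu i).mul (hf.formal i)
  parity i := hP _ _ (hu' i) (hf.parity i)
  noConstantTerm i := noConstantTerm_of_mem_I (mul_mem_I_left _ (hf.mem_I i))
  locallyFinite := hf.locallyFinite.mul_right u

lemma of_zero {P : Formal → Prop} (hP : P 0) : IsFamily P fun _ : ι => 0 where
  formal _ := isFormal_zero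
  parity _ := hP
  noConstantTerm _ := noConstantTerm_of_mem_I (Submodule.zero_mem _)
  locallyFinite S d := by simp [Gr.zero_apply]

/-- Extension by zero along an injection. -/
lemma extend {κ : Type} {P : Formal → Prop} (hP : P 0) (hf : IsFamily P f) {g : κ → Formal}
    {e : κ → ι} (hg : ∀ k, g k = f (e k) ∨ g k = 0)
    (he : ∀ i, {k | e k = i ∧ g k ≠ 0}.Finite) : IsFamily P g where
  formal k := by rcases hg k with h | h <;> rw [h]; exacts [hf.formal _, isFormal_zero]
  parity k := by rcases hg k with h | h <;> rw [h]; exacts [hf.parity _, hP]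
  noConstantTerm k := by
    rcases hg k with h | h <;> rw [h]
    exacts [hf.noConstantTerm _, noConstantTerm_of_mem_I (Submodule.zero_mem _)]
  locallyFinite := by
    rw [locallyFinite_iff]
    intro q
    refine ((locallyFinite_iff.mp hf.locallyFinite q).biUnion fun i _ => he i).subset fun k hk => ?_
    have h0 : g k ≠ 0 := fun h => hk (by rw [h, map_zero])
    have h1 := (hg k).resolve_right h0
    simp only [Set.mem_iUnion]
    exact ⟨e k, by simpa [← h1] using hk, rfl, h0⟩

end IsFamily

namespace SFam

lemma ext {F H : SFam} (hc : ∀ n, F.c n = H.c n) (he : ∀ n, F.e n = H.e n) : F = H := by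
  cases F; cases H
  simp only [mk.injEq]
  exact ⟨funext hc, funext he⟩

instance : Zero SFam := ⟨⟨fun _ => 0, fun _ => 0, .of_zero Gr.isEven_zero, .of_zero Gr.isOdd_zero⟩⟩

instance : Add SFam := ⟨fun F H => ⟨fun n => F.c n + H.c n, fun n => F.e n + H.e n,
  F.hc.add (fun _ _ => Gr.IsEven.add) H.hc, F.he.add (fun _ _ => Gr.IsOdd.add) H.he⟩⟩

instance : Neg SFam := ⟨fun F => ⟨fun n => -F.c n, fun n => -F.e n,
  F.hc.neg (fun _ => Gr.IsEven.neg), F.he.neg (fun _ => Gr.IsOdd.neg)⟩⟩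

lemma zero_c (n : ℤ) : (0 : SFam).c n = 0 := rfl
lemma zero_e (n : ℤ) : (0 : SFam).e n = 0 := rfl
lemma add_c (F H : SFam) (n : ℤ) : (F + H).c n = F.c n + H.c n := rfl
lemma add_e (F H : SFam) (n : ℤ) : (F + H).e n = F.e n + H.e n := rfl
lemma neg_c (F : SFam) (n : ℤ) : (-F).c n = -F.c n := rfl
lemma neg_e (F : SFam) (n : ℤ) : (-F).e n = -F.e n := rfl

/-- The part of a vector field with indices in given sets. -/
def restrict (F : SFam) (P Q : ℤ → Prop) [DecidablePred P] [DecidablePred Q] : SFam where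
  c n := if P n then F.c n else 0
  e n := if Q n then F.e n else 0
  hc := F.hc.extend (e := id) Gr.isEven_zero (fun n => by split_ifs <;> simp)
    fun n => (Set.finite_singleton n).subset fun _ h => h.1
  he := F.he.extend (e := id) Gr.isOdd_zero (fun n => by split_ifs <;> simp)
    fun n => (Set.finite_singleton n).subset fun _ h => h.1

/-- The part `∑_{n ≥ 1} (c_n L_n + e_n G_{n-1/2})`. -/
def pos (F : SFam) : SFam := F.restrict (0 < ·) (0 < ·)

/-- The part `∑_{n ≥ 1} (c_{-n} L_{-n} + e_{1-n} G_{-n+1/2})`. -/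
def neg' (F : SFam) : SFam := F.restrict (· < 0) (· ≤ 0)

/-- The part `c_0 L_0`. -/
def zero' (F : SFam) : SFam := F.restrict (· = 0) (fun _ => False)

lemma eq_add (F : SFam) : F = F.neg' + F.zero' + F.pos := by
  refine ext (fun n => ?_) fun n => ?_
  · simp only [add_c, neg', zero', pos, restrict]
    rcases lt_trichotomy n 0 with h | h | h
    · simp [h, h.ne, h.le.not_gt]
    · simp [h]
    · simp [h, h.ne', h.le.not_gt]
  · simp only [add_e, neg', zero', pos, restrict]
    rcases le_or_gt n 0 with h | h
    · simp [h, h.not_gt]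
    · simp [h, h.not_ge]

/-- The vector field `∑_n (c_n L_n + e_n G_{n-1/2})` as an operator. -/
def op (F : SFam) : Op :=
  csumOp F.c F.hc.locallyFinite L + csumOp F.e F.he.locallyFinite G

lemma op_apply (F : SFam) (f : Formal) :
    F.op f = csum (fun n => F.c n * L n f) + csum (fun n => F.e n * G n f) := rfl

lemma op_add (F H : SFam) : (F + H).op = F.op + H.op := by
  refine LinearMap.ext fun f => ?_
  rw [op_apply]
  change csum (fun n => (F.c n + H.c n) * L n f) + csum (fun n => (F.e n + H.e n) * G n f) = _
  rw [csumOp_add_fam (hc := F.hc.locallyFinite) H.hc.locallyFinite,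
    csumOp_add_fam (hc := F.he.locallyFinite) H.he.locallyFinite]
  simp only [op, LinearMap.add_apply]
  abel

lemma op_neg (F : SFam) : (-F).op = -F.op := by
  refine LinearMap.ext fun f => ?_
  rw [op_apply]
  change csum (fun n => -F.c n * L n f) + csum (fun n => -F.e n * G n f) = _
  simp only [neg_mul, csum_neg]
  rw [LinearMap.neg_apply, op_apply, neg_add]

lemma isCont_op (F : SFam) : IsCont F.op := (isCont_csumOp isCont_L).add (isCont_csumOp isCont_G)

lemma op_mem_K_of {F : SFam} {n : ℕ} (hc : ∀ k, F.c k ∈ I n) (he : ∀ k, F.e k ∈ I n) :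
    F.op ∈ K n :=
  add_mem (csumOp_mem_K hc L_mem_K) (csumOp_mem_K he G_mem_K)

lemma op_mem_K (F : SFam) : F.op ∈ K 1 := op_mem_K_of F.hc.mem_I F.he.mem_I

lemma op_mul (F : SFam) (f g : Formal) : F.op (f * g) = F.op f * g + f * F.op g := by
  simp only [op_apply, add_mul, mul_add, csum_mul_right _ (F.hc.locallyFinite.mul_left _),
    csum_mul_right _ (F.he.locallyFinite.mul_left _),
    csum_mul_left _ (F.hc.locallyFinite.mul_left _), csum_mul_left _ (F.he.locallyFinite.mul_left _)]
  have h1 : csum (fun n => F.c n * L n (f * g))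
      = csum (fun n => F.c n * L n f * g) + csum (fun n => f * (F.c n * L n g)) := by
    rw [← csum_add ((F.hc.locallyFinite.mul_left _).mul_left _)
      ((F.hc.locallyFinite.mul_left _).mul_right _)]
    refine csum_congr fun n => ?_
    rw [L_mul, mul_add, mul_assoc, ← mul_assoc f, ← Gr.commute_of_isEven (F.hc.parity n), mul_assoc]
  have h2 : csum (fun n => F.e n * G n (f * g))
      = csum (fun n => F.e n * G n f * g) + csum (fun n => f * (F.e n * G n g)) := by
    rw [← csum_add ((F.he.locallyFinite.mul_left _).mul_left _)
      ((F.he.locallyFinite.mul_left _).mul_right _)]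
    refine csum_congr fun n => ?_
    rw [G_mul, mul_add, mul_assoc, ← mul_assoc f, Gr.mul_comm_of_isOdd_right f (F.he.parity n),
      mul_assoc]
    rfl
  rw [h1, h2]
  abel

lemma L_of_isConst (n : ℤ) {f : Formal} (hf : IsConst f) : L n f = 0 := by
  simp [L_apply, hf.1, hf.2]

lemma G_of_isConst (n : ℤ) {f : Formal} (hf : IsConst f) : G n f = 0 := by
  simp [G_apply, hf.1, hf.2]

lemma op_of_isConst (F : SFam) {f : Formal} (hf : IsConst f) : F.op f = 0 := by
  simp only [op_apply, L_of_isConst _ hf, G_of_isConst _ hf, mul_zero, csum_zero, add_zero]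

lemma par_op (F : SFam) : par * F.op = F.op * par := by
  refine LinearMap.ext fun f => ?_
  rw [Module.End.mul_apply, Module.End.mul_apply, op, LinearMap.add_apply, map_add,
    apply_csumOp isCont_par, apply_csumOp isCont_par, ← op, op_apply]
  congr 1
  · refine csum_congr fun n => ?_
    rw [par_mul, par_of_isEven (F.hc.parity n), par_L]
  · refine csum_congr fun n => ?_
    rw [par_mul, par_of_isOdd (F.he.parity n), par_G, neg_mul_neg]

lemma dOdd_L {p : OddVar} (hp : p ≠ .phi) (n : ℤ) (f : Formal) : dOdd p (L n f) = L n (dOdd p f) := by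
  have h1 : ∀ g, dOdd p (phi * g) = -(phi * dOdd p g) := fun g => by
    rw [dOdd_mul, show dOdd p phi = 0 from Gr.leftDeriv_gen_of_ne hp, ← par_apply, par_phi, zero_mul,
      zero_add, neg_mul]
  have h2 : dOdd p (dPhi f) = -dPhi (dOdd p f) := dOdd_comm _ _ _
  have h3 : dOdd p (dX f) = dX (dOdd p f) := dOdd_lift _ _ _
  simp only [L_apply, map_neg, map_add, map_smul, sx_eq, dOdd_laurentMono_mul, h1, h2, h3]
  simp

lemma dOdd_G {p : OddVar} (hp : p ≠ .phi) (n : ℤ) (f : Formal) :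
    dOdd p (G n f) = -G n (dOdd p f) := by
  have h1 : ∀ g, dOdd p (phi * g) = -(phi * dOdd p g) := fun g => by
    rw [dOdd_mul, show dOdd p phi = 0 from Gr.leftDeriv_gen_of_ne hp, ← par_apply, par_phi, zero_mul,
      zero_add, neg_mul]
  have h2 : dOdd p (dPhi f) = -dPhi (dOdd p f) := dOdd_comm _ _ _
  have h3 : dOdd p (dX f) = dX (dOdd p f) := dOdd_lift _ _ _
  simp only [G_apply, map_neg, map_sub, sx_eq, dOdd_laurentMono_mul, h1, h2, h3]
  noncomm_ring

/-- The left derivative of a vector field with respect to an odd variable. -/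
lemma dOdd_op (F : SFam) {p : OddVar} (hp : p ≠ .phi) (f : Formal) :
    dOdd p (F.op f) = csum (fun n => dOdd p (F.c n) * L n f) + csum (fun n => dOdd p (F.e n) * G n f)
      + F.op (dOdd p f) := by
  have hc := (isCont_dOdd p).locallyFinite F.hc.locallyFinite
  have he := (isCont_dOdd p).locallyFinite F.he.locallyFinite
  rw [op, LinearMap.add_apply, map_add, apply_csumOp (isCont_dOdd p), apply_csumOp (isCont_dOdd p),
    ← op, op_apply]
  have h1 : csum (fun n => dOdd p (F.c n * L n f)) = csum (fun n => dOdd p (F.c n) * L n f)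
      + csum (fun n => F.c n * L n (dOdd p f)) := by
    rw [← csum_add (hc.mul_left _) (F.hc.locallyFinite.mul_left _)]
    refine csum_congr fun n => ?_
    rw [dOdd_mul, dOdd_L hp, Gr.parityAut_of_isEven (F.hc.parity n)]
  have h2 : csum (fun n => dOdd p (F.e n * G n f)) = csum (fun n => dOdd p (F.e n) * G n f)
      + csum (fun n => F.e n * G n (dOdd p f)) := by
    rw [← csum_add (he.mul_left _) (F.he.locallyFinite.mul_left _)]
    refine csum_congr fun n => ?_
    rw [dOdd_mul, dOdd_G hp, Gr.parityAut_of_isOdd (F.he.parity n), neg_mul_neg]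
  rw [h1, h2]
  abel

lemma dOdd_zeta_op (F : SFam) (i : ℕ) : dOdd (.zeta i) * F.op = F.op * dOdd (.zeta i) := by
  refine LinearMap.ext fun f => ?_
  rw [Module.End.mul_apply, Module.End.mul_apply, dOdd_op F (by rintro ⟨⟩)]
  simp only [((isFormal_iff _).mp (F.hc.formal _)).2, ((isFormal_iff _).mp (F.he.formal _)).2,
    zero_mul, csum_zero, zero_add]

/-- The even superseries `h` with `D T = (T + h) D` for a vector field `T`. -/
def conf (F : SFam) : Formal :=
  csum (fun n => F.c n * (-(((n : ℂ) + 1) / 2) • sx X n)) +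
    csum (fun n => F.e n * ((n : ℂ) • (sx X (n - 1) * phi)))

lemma conf_mem_I (F : SFam) : F.conf ∈ I 1 :=
  add_mem (csum_mem_I fun n => mul_mem_I_right (F.hc.mem_I n) _)
    (csum_mem_I fun n => mul_mem_I_right (F.he.mem_I n) _)

lemma isCont_D : IsCont D := (isCont_dOdd _).add ((isCont_mulLeft _).mul (isCont_lift _))

lemma D_mul (f g : Formal) : D (f * g) = D f * g + par f * D g := by
  simp only [D_apply, dPhi_mul, dX_mul, mul_add, add_mul]
  rw [← mul_assoc phi f, phi_comm f]
  simp only [mul_assoc]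
  abel

lemma D_of_isConst {f : Formal} (hf : IsConst f) : D f = 0 := by
  rw [D_apply, hf.1, hf.2, mul_zero, add_zero]

lemma D_op (F : SFam) : D * F.op = (F.op + LinearMap.mulLeft ℂ F.conf) * D := by
  refine LinearMap.ext fun f => ?_
  rw [Module.End.mul_apply, Module.End.mul_apply, op, LinearMap.add_apply, map_add,
    apply_csumOp isCont_D, apply_csumOp isCont_D, ← op, LinearMap.add_apply, op_apply,
    LinearMap.mulLeft_apply, conf, add_mul, csum_mul_right _ (F.hc.locallyFinite.mul_left _),
    csum_mul_right _ (F.he.locallyFinite.mul_left _)]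
  have h1 : csum (fun n => D (F.c n * L n f)) = csum (fun n => F.c n * L n (D f))
      + csum (fun n => F.c n * (-(((n : ℂ) + 1) / 2) • sx X n) * D f) := by
    rw [← csum_add (F.hc.locallyFinite.mul_left _) ((F.hc.locallyFinite.mul_left _).mul_left _)]
    refine csum_congr fun n => ?_
    rw [D_mul, D_of_isConst (F.hc.formal n).isConst, par_of_isEven (F.hc.parity n), D_L, zero_mul,
      zero_add, mul_sub, sub_eq_add_neg, neg_smul, mul_neg, neg_mul, mul_assoc, smul_mul_assoc]
  have h2 : csum (fun n => D (F.e n * G n f)) = csum (fun n => F.e n * G n (D f))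
      + csum (fun n => F.e n * ((n : ℂ) • (sx X (n - 1) * phi)) * D f) := by
    rw [← csum_add (F.he.locallyFinite.mul_left _) ((F.he.locallyFinite.mul_left _).mul_left _)]
    refine csum_congr fun n => ?_
    rw [D_mul, D_of_isConst (F.he.formal n).isConst, par_of_isOdd (F.he.parity n), D_G, zero_mul,
      zero_add, mul_assoc, smul_mul_assoc, mul_assoc]
    simp only [neg_mul, mul_sub, mul_neg]
    abel
  rw [h1, h2]
  abel

end SFam

end Formal

namespace Formal

/-! ### Automorphisms given by substitutions of coordinates -/

/-- Continuous endomorphisms fixing the superseries free of the coordinates. -/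
structure IsSubst (σ : Op) : Prop where
  cont : IsCont σ
  mem_K : σ ∈ K 0
  map_mul : ∀ f g, σ (f * g) = σ f * σ g
  map_const : ∀ f, IsConst f → σ f = f
  par_comm : ∀ f, par (σ f) = σ (par f)
  zeta_comm : ∀ i f, dOdd (.zeta i) (σ f) = σ (dOdd (.zeta i) f)

namespace IsSubst

variable {σ τ : Op}

lemma map_one (h : IsSubst σ) : σ 1 = 1 := h.map_const 1 isConst_one

lemma mul (hσ : IsSubst σ) (hτ : IsSubst τ) : IsSubst (σ * τ) where
  cont := hσ.cont.mul hτ.cont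
  mem_K := mul_mem_K_left hσ.mem_K hτ.mem_K
  map_mul f g := by simp only [Module.End.mul_apply, hτ.map_mul, hσ.map_mul]
  map_const f hf := by simp only [Module.End.mul_apply, hτ.map_const f hf, hσ.map_const f hf]
  par_comm f := by simp only [Module.End.mul_apply, hσ.par_comm, hτ.par_comm]
  zeta_comm i f := by simp only [Module.End.mul_apply, hσ.zeta_comm, hτ.zeta_comm]

lemma map_const_mul (hσ : IsSubst σ) {c : Formal} (hc : IsConst c) (f : Formal) :
    σ (c * f) = c * σ f := by
  rw [hσ.map_mul, hσ.map_const c hc]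

lemma map_pow (hσ : IsSubst σ) (f : Formal) (n : ℕ) : σ (f ^ n) = σ f ^ n := by
  induction n with
  | zero => rw [pow_zero, pow_zero, hσ.map_one]
  | succ n ih => rw [pow_succ, pow_succ, hσ.map_mul, ih]

end IsSubst

/-- Operators compatible with the superconformal structure. -/
def IsSuperconformal (σ : Op) : Prop := ∃ ρ, ∀ f, D (σ f) = ρ * σ (D f)

lemma IsSuperconformal.mul {σ τ : Op} (hσ : IsSuperconformal σ)
    (hσ' : IsSubst σ) (hτ : IsSuperconformal τ) : IsSuperconformal (σ * τ) := by
  obtain ⟨ρ, hρ⟩ := hσ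
  obtain ⟨ρ', hρ'⟩ := hτ
  refine ⟨ρ * σ ρ', fun f => ?_⟩
  rw [Module.End.mul_apply, Module.End.mul_apply, hρ, hρ', hσ'.map_mul, mul_assoc]

lemma D_sx : D (sx X 1) = phi := by
  rw [D_apply, dPhi_sx, dX_sx]
  simp [sx_zero]

lemma D_phi : D phi = 1 := by
  rw [D_apply, dPhi_phi, dX_phi, mul_zero, add_zero]

lemma par_D (f : Formal) : par (D f) = -D (par f) := by
  simp only [D_apply, map_add, par_mul, par_dPhi, par_dX, par_phi]
  noncomm_ring

lemma IsSuperconformal.eq {σ : Op} (hσ : IsSuperconformal σ)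
    (hσ' : IsSubst σ) : D (σ (sx X 1)) = σ phi * D (σ phi) := by
  obtain ⟨ρ, hρ⟩ := hσ
  have h1 : D (σ phi) = ρ := by rw [hρ, D_phi, hσ'.map_one, mul_one]
  have h2 : (D (σ phi)).IsEven := by
    rw [isEven_iff, par_D, hσ'.par_comm, par_phi, map_neg, map_neg, neg_neg]
  rw [← Gr.commute_of_isEven h2, h1, hρ, D_sx]

lemma isSubst_expE (F : SFam) : IsSubst (expE F.op) where
  cont := isCont_expE F.isCont_op
  mem_K := expE_mem_K F.op_mem_K
  map_mul f g := expE_leibniz F.op_mem_K F.op_mem_K F.op_mem_K (fun f g => F.op_mul g f) g f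
  map_const f hf := expE_apply_of_eq_zero _ (F.op_of_isConst hf)
  par_comm f := LinearMap.congr_fun (semiconj_expE F.op_mem_K F.op_mem_K par_mem_K F.par_op) f
  zeta_comm i f := LinearMap.congr_fun (semiconj_expE F.op_mem_K F.op_mem_K
    (dOdd_mem_K rfl) (F.dOdd_zeta_op i)) f

lemma D_mem_K : D ∈ K 0 :=
  add_mem dPhi_mem_K (mul_mem_K_left (mulLeft_mem_K_zero _) dX_mem_K)

lemma isSuperconformal_expE (F : SFam) : IsSuperconformal (expE F.op) := by
  have h0 : LinearMap.mulLeft ℂ F.conf ∈ K 1 := mulLeft_mem_K F.conf_mem_I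
  have h1 : F.op + LinearMap.mulLeft ℂ F.conf ∈ K 1 := add_mem F.op_mem_K h0
  refine ⟨expE (F.op + LinearMap.mulLeft ℂ F.conf) 1, fun f => ?_⟩
  have h2 := LinearMap.congr_fun (semiconj_expE F.op_mem_K h1 D_mem_K F.D_op) f
  rw [Module.End.mul_apply, Module.End.mul_apply] at h2
  rw [h2, ← expE_leibniz h1 h1 F.op_mem_K, one_mul]
  intro f g
  simp only [LinearMap.add_apply, LinearMap.mulLeft_apply, F.op_mul, add_mul, mul_assoc]
  abel

/-! ### Coefficients of powers of `x` -/

/-- The coefficient of `x^k`, as a linear operator. -/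
def cX (k : ℤ) : Op := lift (Laurent.coeffXL k)

/-- The `φ`-free part, as a linear operator. -/
def nP : Op := dPhi * LinearMap.mulLeft ℂ phi

lemma coeffX_eq (k : ℤ) (f : Formal) : coeffX k f = cX k f := rfl

lemma nP_apply (f : Formal) : nP f = f - phi * dPhi f := dPhi_phi_mul f

lemma dPhi_nP (f : Formal) : dPhi (nP f) = 0 := dPhi_dPhi _

lemma noPhi_eq (f : Formal) : noPhi f = nP f := by
  have hz := (Gr.leftDeriv_eq_zero_iff OddVar.phi (nP f)).mp (dPhi_nP f)
  ext S : 1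
  by_cases h : OddVar.phi ∈ S
  · rw [noPhi, if_pos h, hz S h]
  · rw [noPhi, if_neg h]
    have h1 : (phi * dPhi f : Formal) S = 0 := by
      change (Gr.gen OddVar.phi * dPhi f : Formal) S = 0
      rw [Gr.gen_mul_apply, if_neg h]
    have h2 : f S = (nP f + phi * dPhi f : Formal) S := by rw [nP_apply, sub_add_cancel]
    rw [h2, Gr.add_apply, h1, add_zero]

lemma isCont_cX (k : ℤ) : IsCont (cX k) := isCont_lift _

lemma isCont_nP : IsCont nP := (isCont_dOdd _).mul (isCont_mulLeft _)

lemma cX_mem_K (k : ℤ) : cX k ∈ K 0 := lift_mem_K _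

lemma nP_mem_K : nP ∈ K 0 := mul_mem_K_left dPhi_mem_K (mulLeft_mem_K_zero _)

lemma dOdd_cX (p : OddVar) (k : ℤ) (f : Formal) : dOdd p (cX k f) = cX k (dOdd p f) :=
  dOdd_lift _ _ _

lemma par_cX (k : ℤ) (f : Formal) : par (cX k f) = cX k (par f) := par_lift _ _

lemma par_nP (f : Formal) : par (nP f) = nP (par f) := by
  simp only [nP_apply, map_sub, par_mul, par_phi, par_dPhi, neg_mul_neg]

lemma dOdd_nP {p : OddVar} (hp : p ≠ .phi) (f : Formal) : dOdd p (nP f) = nP (dOdd p f) := by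
  have h1 : ∀ g, dOdd p (phi * g) = -(phi * dOdd p g) := fun g => by
    rw [dOdd_mul, show dOdd p phi = 0 from Gr.leftDeriv_gen_of_ne hp, ← par_apply, par_phi, zero_mul,
      zero_add, neg_mul]
  have h2 : dOdd p (dPhi f) = -dPhi (dOdd p f) := dOdd_comm _ _ _
  rw [nP_apply, nP_apply, map_sub, h1, h2, mul_neg, neg_neg]

lemma dX_cX (k : ℤ) (f : Formal) : dX (cX k f) = 0 := by
  refine cf_ext fun q => ?_
  rw [map_zero]
  change Laurent.derivL (0, 0, 1) expX (Laurent.coeffXL k (cf q f)) = 0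
  induction cf q f using Laurent.induction with
  | h0 => simp
  | ha f g hf hg => rw [map_add, map_add, hf, hg, add_zero]
  | hs w c =>
    rw [Laurent.coeffXL_single]
    split_ifs
    · rw [Laurent.derivL_single]; simp [expX]
    · simp

lemma isConst_cX_nP (k : ℤ) (f : Formal) : IsConst (cX k (nP f)) :=
  ⟨dX_cX k _, by rw [dPhi, dOdd_cX, ← dPhi, dPhi_nP, map_zero]⟩

lemma isConst_cX_dPhi (k : ℤ) (f : Formal) : IsConst (cX k (dPhi f)) :=
  ⟨dX_cX k _, by rw [dPhi, dOdd_cX, ← dPhi, dPhi_dPhi, map_zero]⟩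

lemma cX_laurentMono_mul (k : ℤ) (w : ℤ × ℤ × ℤ) (f : Formal) :
    cX k (laurentMono w * f) = laurentMono (w.1, w.2.1, 0) * cX (k - w.2.2) f := by
  refine cf_ext fun q => ?_
  rw [cf_laurentMono_mul]
  change Laurent.coeffXL k (cf q (laurentMono w * f)) = _ * Laurent.coeffXL _ (cf q f)
  rw [cf_laurentMono_mul]
  induction cf q f using Laurent.induction with
  | h0 => simp
  | ha f g hf hg => rw [mul_add, map_add, map_add, mul_add, hf, hg]
  | hs v c =>
    rw [AddMonoidAlgebra.single_mul_single, Laurent.coeffXL_single, Laurent.coeffXL_single]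
    by_cases h : v.2.2 = k - w.2.2
    · rw [if_pos h, if_pos (show (w + v).2.2 = k by change w.2.2 + v.2.2 = k; omega),
        AddMonoidAlgebra.single_mul_single]
      congr 1
    · rw [if_neg h, if_neg (show ¬ (w + v).2.2 = k by change ¬ w.2.2 + v.2.2 = k; omega), mul_zero]

lemma cX_sx_mul (k n : ℤ) (f : Formal) : cX k (sx X n * f) = cX (k - n) f := by
  rw [sx_eq, cX_laurentMono_mul, show (((0, 0, n) : ℤ × ℤ × ℤ).1, ((0, 0, n) : ℤ × ℤ × ℤ).2.1, (0 : ℤ))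
    = (0 : ℤ × ℤ × ℤ) from rfl, laurentMono_zero, one_mul]

lemma locallyFinite_cX (f : Formal) : LocallyFinite fun k => cX k f := by
  rw [locallyFinite_iff]
  intro q
  refine (Laurent.xExps (cf q f)).finite_toSet.subset fun k hk => ?_
  by_contra hc
  exact hk (Laurent.coeffXL_eq_zero hc)

lemma csum_cX (f : Formal) : csum (fun k => sx X k * cX k f) = f := by
  refine cf_ext fun q => ?_
  rw [cf_csum_of_finset (t := Laurent.xExps (cf q f))]
  · refine Eq.trans (Finset.sum_congr rfl fun k _ => ?_)
      (Laurent.sum_coeffXL (Finset.Subset.refl (Laurent.xExps (cf q f))))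
    rw [sx_eq, cf_laurentMono_mul]
    rfl
  · intro k hk
    rw [sx_eq, cf_laurentMono_mul, cX, cf_lift, Laurent.coeffXL_eq_zero hk, mul_zero]

lemma cX_of_dX_eq_zero {f : Formal} (hf : dX f = 0) (k : ℤ) :
    cX k f = if k = 0 then f else 0 := by
  have h0 : ∀ k, k ≠ 0 → cX k f = 0 := by
    intro k hk
    refine cf_ext fun q => ?_
    change Laurent.coeffXL k (cf q f) = _
    rw [Laurent.coeffXL_eq_zero, map_zero]
    intro h
    obtain ⟨w, hw, rfl⟩ := Finset.mem_image.mp h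
    exact hk ((dX_eq_zero_iff f).mp hf q.1 q.2 w (Finsupp.mem_support_iff.mp hw))
  split_ifs with hk
  · subst hk
    have := csum_cX f
    rw [csum_eq_single 0 (fun i hi => by rw [h0 i hi, mul_zero]), sx_zero, one_mul] at this
    exact this
  · exact h0 k hk

lemma cX_const_mul {c : Formal} (hc : IsConst c) (k : ℤ) (f : Formal) :
    cX k (c * f) = c * cX k f := by
  have h1 : c * f = csum fun j => sx X j * (c * cX j f) := by
    conv_lhs => rw [← csum_cX f]
    rw [csum_mul_left c ((locallyFinite_cX f).mul_right _)]
    exact csum_congr fun j => sx_mul_left_comm j c _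
  rw [h1, (isCont_cX k).map_csum (((locallyFinite_cX f).mul_right _).mul_right _),
    csum_eq_single k]
  · rw [cX_sx_mul, sub_self, cX_of_dX_eq_zero, if_pos rfl]
    rw [dX_mul, hc.1, dX_cX, zero_mul, mul_zero, add_zero]
  · intro j hj
    rw [cX_sx_mul, cX_of_dX_eq_zero, if_neg (by omega)]
    rw [dX_mul, hc.1, dX_cX, zero_mul, mul_zero, add_zero]

/-- Expansion of a superseries in powers of the coordinates. -/
lemma csum_coeffs (f : Formal) :
    csum (fun k => cX k (nP f) * sx X k + phi * (cX k (dPhi f) * sx X k)) = f := by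
  have h1 := csum_cX (nP f)
  have h2 := csum_cX (dPhi f)
  have h3 : f = nP f + phi * dPhi f := by rw [nP_apply, sub_add_cancel]
  conv_rhs => rw [h3, ← h1, ← h2]
  rw [csum_mul_left _ ((locallyFinite_cX _).mul_right _),
    ← csum_add ((locallyFinite_cX _).mul_right _) (((locallyFinite_cX _).mul_right _).mul_right _)]
  refine csum_congr fun k => ?_
  rw [sx_comm, sx_comm]

/-! ### Composition of superfunctions -/

lemma zpow_one (f : Formal) : zpow f 1 = f := by simp [zpow]

lemma zpow_zero (f : Formal) : zpow f 0 = 1 := by simp [zpow]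

/-- The substitution of `x'` and `φ'` for `x` and `φ` as a linear operator. -/
def compE (x' φ' : Formal) : Op where
  toFun f := comp f x' φ'
  map_add' f g := by
    simp only [comp, sdphi_eq, noPhi_eq, coeffX_eq]
    rw [← csum_add]
    · refine csum_congr fun k => ?_
      simp only [map_add, add_mul, mul_add]
      abel
    · exact ((locallyFinite_cX _).mul_left _).add (((locallyFinite_cX _).mul_left _).mul_right _)
    · exact ((locallyFinite_cX _).mul_left _).add (((locallyFinite_cX _).mul_left _).mul_right _)
  map_smul' c f := by
    simp only [comp, sdphi_eq, noPhi_eq, coeffX_eq, RingHom.id_apply]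
    rw [csum_smul]
    · refine csum_congr fun k => ?_
      simp only [map_smul, smul_mul_assoc, mul_smul_comm, smul_add]
    · exact ((locallyFinite_cX _).mul_left _).add (((locallyFinite_cX _).mul_left _).mul_right _)

lemma compE_apply (x' φ' f : Formal) : compE x' φ' f
    = csum fun k : ℤ => cX k (nP f) * zpow x' k + φ' * (cX k (dPhi f) * zpow x' k) := by
  change comp f x' φ' = _
  simp only [comp, sdphi_eq, noPhi_eq, coeffX_eq]

lemma comp_eq (x' φ' f : Formal) : comp f x' φ' = compE x' φ' f := rfl

lemma locallyFinite_comp (x' φ' f : Formal) : LocallyFinite fun k : ℤ =>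
    cX k (nP f) * zpow x' k + φ' * (cX k (dPhi f) * zpow x' k) :=
  ((locallyFinite_cX _).mul_left _).add (((locallyFinite_cX _).mul_left _).mul_right _)

lemma isCont_compE (x' φ' : Formal) : IsCont (compE x' φ') := by
  classical
  intro q
  choose Q hQ using fun r => (isCont_nP r)
  choose R hR using fun r => (isCont_dOdd OddVar.phi r)
  refine ⟨((below q).biUnion Q) ∪ (((below q).biUnion below).biUnion R), fun f hf => ?_⟩
  rw [compE_apply, cf_csum_of_finset (t := ∅), Finset.sum_empty]
  intro k _
  rw [map_add, cf_mul_eq_zero_left, cf_mul_eq_zero_right, add_zero]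
  · intro r hr
    refine cf_mul_eq_zero_left (fun r' hr' => ?_) _
    rw [cX, cf_lift, dPhi, hR r' f fun s hs => hf s ?_, map_zero]
    exact Finset.mem_union_right _ (Finset.mem_biUnion.mpr
      ⟨r', Finset.mem_biUnion.mpr ⟨r, hr, hr'⟩, hs⟩)
  · intro r hr
    rw [cX, cf_lift, hQ r f fun s hs => hf s ?_, map_zero]
    exact Finset.mem_union_left _ (Finset.mem_biUnion.mpr ⟨r, hr, hs⟩)

lemma nP_sx (n : ℤ) : nP (sx X n) = sx X n := by
  rw [nP_apply, dPhi_sx, mul_zero, sub_zero]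

lemma nP_phi : nP phi = 0 := by
  rw [nP_apply, dPhi_phi, mul_one, sub_self]

lemma cX_sx (k n : ℤ) : cX k (sx X n) = if k = n then 1 else 0 := by
  have h := cX_sx_mul k n 1
  rw [mul_one] at h
  rw [h, cX_of_dX_eq_zero dX_one]
  simp [sub_eq_zero]

lemma cX_one (k : ℤ) : cX k 1 = if k = 0 then 1 else 0 := cX_of_dX_eq_zero dX_one k

lemma comp_sx (x' φ' : Formal) : compE x' φ' (sx X 1) = x' := by
  rw [compE_apply, csum_eq_single 1]
  · rw [nP_sx, cX_sx, if_pos rfl, dPhi_sx, map_zero, zero_mul, mul_zero, add_zero, one_mul, zpow_one]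
  · intro k hk
    rw [nP_sx, cX_sx, if_neg hk, zero_mul, dPhi_sx, map_zero, zero_mul, mul_zero, add_zero]

lemma comp_phi (x' φ' : Formal) : compE x' φ' phi = φ' := by
  rw [compE_apply, csum_eq_single 0]
  · rw [nP_phi, map_zero, zero_mul, zero_add, dPhi_phi, cX_one, if_pos rfl, one_mul, zpow_zero,
      mul_one]
  · intro k hk
    rw [nP_phi, map_zero, zero_mul, zero_add, dPhi_phi, cX_one, if_neg hk, zero_mul, mul_zero]

lemma inverse_eq {a b : Formal} (h1 : a * b = 1) (h2 : b * a = 1) : Ring.inverse a = b :=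
  Ring.inverse_unit (⟨a, b, h1, h2⟩ : Formalˣ)

lemma zpow_eq {x' y : Formal} (h1 : x' * y = 1) (h2 : y * x' = 1) (k : ℤ) :
    zpow x' k = (((⟨x', y, h1, h2⟩ : Formalˣ) ^ k : Formalˣ) : Formal) := by
  unfold zpow
  split_ifs with hk
  · lift k to ℕ using hk
    simp
  · obtain ⟨n, rfl⟩ : ∃ n : ℕ, k = -n := ⟨(-k).toNat, by omega⟩
    rw [inverse_eq h1 h2]
    simp

lemma IsSubst.map_sx {σ : Op} (hσ : IsSubst σ) (k : ℤ) :
    σ (sx X k) = zpow (σ (sx X 1)) k := by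
  have h1 : σ (sx X 1) * σ (sx X (-1)) = 1 := by
    rw [← hσ.map_mul, sx_mul, add_neg_cancel, sx_zero, hσ.map_one]
  have h2 : σ (sx X (-1)) * σ (sx X 1) = 1 := by
    rw [← hσ.map_mul, sx_mul, neg_add_cancel, sx_zero, hσ.map_one]
  have hpos : ∀ (m : ℤ) (n : ℕ), (sx X m : Formal) ^ n = sx X (n * m) := by
    intro m n
    induction n with
    | zero => simp [sx_zero]
    | succ n ih => rw [pow_succ, ih, sx_mul]; push_cast; congr 1; ring
  unfold zpow
  split_ifs with hk
  · rw [← hσ.map_pow, hpos, mul_one, Int.toNat_of_nonneg hk]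
  · rw [inverse_eq h1 h2, ← hσ.map_pow, hpos, Int.toNat_of_nonneg (by omega)]
    simp

/-- Substitution of the images of the coordinates under `σ` is `σ`. -/
lemma IsSubst.compE_eq {σ : Op} (hσ : IsSubst σ) :
    compE (σ (sx X 1)) (σ phi) = σ := by
  refine LinearMap.ext fun f => ?_
  conv_rhs => rw [← csum_coeffs f]
  rw [compE_apply, hσ.cont.map_csum
    (((locallyFinite_cX _).mul_left _).add (((locallyFinite_cX _).mul_left _).mul_right _))]
  refine csum_congr fun k => ?_
  rw [map_add, hσ.map_mul, hσ.map_mul, hσ.map_mul, hσ.map_const _ (isConst_cX_nP k f),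
    hσ.map_const _ (isConst_cX_dPhi k f), hσ.map_sx k]

section CompHom

variable {x' y φ' : Formal} (hx : x'.IsEven) (h1 : x' * y = 1) (h2 : y * x' = 1) (hφ : φ'.IsOdd)

include hx in
lemma isEven_zpow (h1 : x' * y = 1) (h2 : y * x' = 1) (k : ℤ) : (zpow x' k).IsEven := by
  unfold zpow
  split_ifs
  · exact hx.pow _
  · rw [inverse_eq h1 h2]
    exact (Gr.isEven_of_mul_eq_one hx h1).pow _

lemma nP_const_mul {c : Formal} (hc : IsConst c) (f : Formal) : nP (c * f) = c * nP f := by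
  rw [nP_apply, nP_apply, dPhi_mul, hc.2, zero_mul, zero_add, mul_sub, phi_left_comm c]

include hφ in
lemma comp_const_mul {c : Formal} (hc : IsConst c) (f : Formal) :
    compE x' φ' (c * f) = c * compE x' φ' f := by
  have hc' : IsConst (par c) := ⟨by rw [← par_dX, hc.1, map_zero], by
    rw [← neg_eq_zero, ← par_dPhi, hc.2, map_zero]⟩
  rw [compE_apply, compE_apply, csum_mul_left _ (locallyFinite_comp x' φ' f)]
  refine csum_congr fun k => ?_
  rw [nP_const_mul hc, cX_const_mul hc, dPhi_mul, hc.2, zero_mul, zero_add, cX_const_mul hc', mul_add,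
    ← mul_assoc c φ', Gr.mul_comm_of_isOdd_right c hφ]
  simp only [mul_assoc]
  rfl

include h1 h2 in
lemma comp_sx_mul (n : ℤ) (f : Formal) (hx : x'.IsEven) :
    compE x' φ' (sx X n * f) = zpow x' n * compE x' φ' f := by
  have hz : ∀ k, zpow x' (k + n) = zpow x' k * zpow x' n := fun k => by
    rw [zpow_eq h1 h2, zpow_eq h1 h2, zpow_eq h1 h2, _root_.zpow_add, Units.val_mul]
  rw [compE_apply, compE_apply, csum_mul_left _ (locallyFinite_comp x' φ' f),
    csum_equiv (Equiv.addRight n)]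
  refine csum_congr fun k => ?_
  have hn : nP (sx X n * f) = sx X n * nP f := by
    rw [nP_apply, nP_apply, dPhi_sx_mul, mul_sub, phi_mul_sx_mul]
  rw [hn, dPhi_sx_mul, Equiv.coe_addRight, cX_sx_mul, cX_sx_mul, add_sub_cancel_right, hz,
    Gr.commute_of_isEven (isEven_zpow hx h1 h2 n)]
  simp only [add_mul, mul_assoc]

include hφ in
lemma comp_phi_mul (f : Formal) : compE x' φ' (phi * f) = φ' * compE x' φ' f := by
  rw [compE_apply, compE_apply, csum_mul_left _ (locallyFinite_comp x' φ' f)]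
  refine csum_congr fun k => ?_
  have h3 : nP (phi * f) = 0 := by
    rw [nP_apply, dPhi_phi_mul, mul_sub, phi_mul_phi_mul, sub_zero, sub_self]
  rw [h3, map_zero, zero_mul, zero_add, mul_add, ← mul_assoc φ' φ', hφ.mul_self, zero_mul, add_zero,
    dPhi_phi_mul, ← nP_apply]

include hx h1 h2 hφ in
lemma comp_mul (f g : Formal) : compE x' φ' (f * g) = compE x' φ' f * compE x' φ' g := by
  have hl : LocallyFinite fun k =>
      cX k (nP f) * (sx X k : Formal) + phi * (cX k (dPhi f) * sx X k) :=
    ((locallyFinite_cX _).mul_left _).add (((locallyFinite_cX _).mul_left _).mul_right _)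
  conv_lhs => rw [← csum_coeffs f]
  rw [csum_mul_right _ hl, (isCont_compE x' φ').map_csum (hl.mul_left _), compE_apply x' φ' f,
    csum_mul_right _ (locallyFinite_comp x' φ' f)]
  refine csum_congr fun k => ?_
  rw [add_mul, map_add, mul_assoc, comp_const_mul hφ (isConst_cX_nP k f), comp_sx_mul h1 h2 _ _ hx,
    mul_assoc, comp_phi_mul hφ, mul_assoc, comp_const_mul hφ (isConst_cX_dPhi k f),
    comp_sx_mul h1 h2 _ _ hx, add_mul]
  simp only [mul_assoc]

lemma comp_of_isConst {f : Formal} (hf : IsConst f) : compE x' φ' f = f := by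
  have h3 : nP f = f := by rw [nP_apply, hf.2, mul_zero, sub_zero]
  rw [compE_apply, csum_eq_single 0]
  · rw [h3, hf.2, map_zero, zero_mul, mul_zero, add_zero, zpow_zero, mul_one,
      cX_of_dX_eq_zero hf.1, if_pos rfl]
  · intro k hk
    rw [h3, hf.2, map_zero, zero_mul, mul_zero, add_zero, cX_of_dX_eq_zero hf.1, if_neg hk, zero_mul]

end CompHom

end Formal

namespace Formal

/-! ### Rescalings of the coordinates -/

/-- Continuous operators agreeing on monomials in the coordinates agree. -/
lemma IsCont.ext_monomial {S T : Op} (hS : IsCont S) (hT : IsCont T)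
    (h1 : ∀ c k, IsConst c → S (c * sx X k) = T (c * sx X k))
    (h2 : ∀ c k, IsConst c → S (phi * (c * sx X k)) = T (phi * (c * sx X k))) : S = T := by
  refine LinearMap.ext fun f => ?_
  have hl : LocallyFinite fun k =>
      cX k (nP f) * (sx X k : Formal) + phi * (cX k (dPhi f) * sx X k) :=
    ((locallyFinite_cX _).mul_left _).add (((locallyFinite_cX _).mul_left _).mul_right _)
  rw [← csum_coeffs f, hS.map_csum hl, hT.map_csum hl]
  refine csum_congr fun k => ?_
  rw [map_add, map_add, h1 _ _ (isConst_cX_nP k f), h2 _ _ (isConst_cX_dPhi k f)]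

/-- Invertible even superseries in the formal variables. -/
structure Scalar where
  u : Formalˣ
  formal : IsFormal u
  even : (u : Formal).IsEven

lemma isFormal_of_mul_eq_one {a b : Formal} (ha : IsFormal a) (ha' : a.IsEven)
    (h1 : a * b = 1) (h2 : b * a = 1) : IsFormal b := by
  have key : ∀ g : Formal, a * g = 0 → g = 0 := fun g hg => by
    rw [← one_mul g, ← h2, mul_assoc, hg, mul_zero]
  rw [isFormal_iff] at ha ⊢
  have hd : ∀ p, dOdd p a = 0 → dOdd p b = 0 := fun p hp => key _ (by
    have := dOdd_mul p a b
    rwa [h1, dOdd_one, hp, zero_mul, zero_add, Gr.parityAut_of_isEven ha', eq_comm] at this)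
  refine ⟨⟨key _ ?_, hd _ ha.1.2⟩, fun i => hd _ (ha.2 i)⟩
  have := dX_mul a b
  rwa [h1, dX_one, ha.1.1, zero_mul, zero_add, eq_comm] at this

namespace Scalar

lemma isEven_inv (s : Scalar) : ((s.u⁻¹ : Formalˣ) : Formal).IsEven :=
  Gr.isEven_of_mul_eq_one s.even s.u.mul_inv

/-- Integral powers of an invertible even superseries. -/
def pw (s : Scalar) (n : ℤ) : Formal := ((s.u ^ n : Formalˣ) : Formal)

lemma pw_add (s : Scalar) (m n : ℤ) : s.pw (m + n) = s.pw m * s.pw n := by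
  rw [pw, _root_.zpow_add, Units.val_mul]; rfl

lemma pw_zero (s : Scalar) : s.pw 0 = 1 := by rw [pw, _root_.zpow_zero, Units.val_one]

lemma pw_one (s : Scalar) : s.pw 1 = s.u := by rw [pw, _root_.zpow_one]

lemma pw_of_val_eq_one {s : Scalar} (h : (s.u : Formal) = 1) (n : ℤ) : s.pw n = 1 := by
  rw [pw, Units.val_eq_one.mp h, one_zpow, Units.val_one]

lemma pw_mem (s : Scalar) {P : Formal → Prop} (h1 : P 1) (hmul : ∀ a b, P a → P b → P (a * b))
    (hu : P s.u) (hi : P (s.u⁻¹ : Formalˣ)) (n : ℤ) : P (s.pw n) := by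
  induction n using Int.induction_on with
  | zero => rwa [pw_zero]
  | succ n ih => rw [pw_add, pw_one]; exact hmul _ _ ih hu
  | pred n ih =>
    rw [sub_eq_add_neg, pw_add]
    refine hmul _ _ ih ?_
    rwa [pw, _root_.zpow_neg, _root_.zpow_one]

lemma isEven_pw (s : Scalar) (n : ℤ) : (s.pw n).IsEven :=
  s.pw_mem (P := Gr.IsEven) Gr.isEven_one (fun _ _ => Gr.IsEven.mul) s.even s.isEven_inv n

lemma isFormal_pw (s : Scalar) (n : ℤ) : IsFormal (s.pw n) :=
  s.pw_mem isFormal_one (fun _ _ => IsFormal.mul) s.formal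
    (isFormal_of_mul_eq_one s.formal s.even s.u.mul_inv s.u.inv_mul) n

lemma isConst_pw (s : Scalar) (n : ℤ) : IsConst (s.pw n) := (s.isFormal_pw n).isConst

lemma pw_comm (s : Scalar) (n : ℤ) (f : Formal) : s.pw n * f = f * s.pw n :=
  Gr.commute_of_isEven (s.isEven_pw n) f

lemma pw_left_comm (s : Scalar) (n : ℤ) (f g : Formal) :
    f * (s.pw n * g) = s.pw n * (f * g) := by
  rw [← mul_assoc, ← s.pw_comm, mul_assoc]

lemma pw_mul_pw_mul (s : Scalar) (m n : ℤ) (f : Formal) :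
    s.pw m * (s.pw n * f) = s.pw (m + n) * f := by
  rw [← mul_assoc, pw_add]

instance : Mul Scalar := ⟨fun s t =>
  { u := s.u * t.u
    formal := by rw [Units.val_mul]; exact s.formal.mul t.formal
    even := by rw [Units.val_mul]; exact s.even.mul t.even }⟩

lemma mul_u (s t : Scalar) : (s * t).u = s.u * t.u := rfl

instance : Inv Scalar := ⟨fun s =>
  { u := s.u⁻¹
    formal := isFormal_of_mul_eq_one s.formal s.even s.u.mul_inv s.u.inv_mul
    even := s.isEven_inv }⟩

lemma inv_u (s : Scalar) : (s⁻¹).u = s.u⁻¹ := rfl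

/-- The operator `s^{-2L_0}`. -/
def scaleE (s : Scalar) : Op := compE ((s.u : Formal) ^ 2 * sx X 1) (s.u * phi)

section

variable (s : Scalar)

lemma scale_aux1 : (s.u : Formal) ^ 2 * sx X 1 * (s.pw (-2) * sx X (-1)) = 1 := by
  rw [← s.pw_one, pow_two, ← pw_add, mul_assoc, s.pw_left_comm, s.pw_mul_pw_mul, sx_mul,
    add_neg_cancel, sx_zero, mul_one]
  exact s.pw_zero

lemma scale_aux2 : s.pw (-2) * sx X (-1) * ((s.u : Formal) ^ 2 * sx X 1) = 1 := by
  have := s.scale_aux1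
  rwa [Gr.commute_of_isEven ((s.even.pow 2).mul (isEven_sx 1))] at this

lemma scaleE_mul (f g : Formal) : s.scaleE (f * g) = s.scaleE f * s.scaleE g :=
  comp_mul ((s.even.pow 2).mul (isEven_sx 1)) s.scale_aux1 s.scale_aux2 (s.even.mul_isOdd isOdd_phi)
    f g

lemma scaleE_of_isConst {f : Formal} (hf : IsConst f) : s.scaleE f = f := comp_of_isConst hf

lemma scaleE_phi : s.scaleE phi = s.pw 1 * phi := by rw [s.pw_one]; exact comp_phi _ _

lemma isCont_scaleE : IsCont s.scaleE := isCont_compE _ _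

lemma scaleE_sx (n : ℤ) : s.scaleE (sx X n) = s.pw (2 * n) * sx X n := by
  have h1 : s.scaleE (sx X 1) = s.pw 2 * sx X 1 := by
    rw [show (2 : ℤ) = 1 + 1 from rfl, pw_add, pw_one, ← pow_two]; exact comp_sx _ _
  have h2 : ∀ m, s.scaleE (sx X (m + 1)) = s.scaleE (sx X m) * s.scaleE (sx X 1) := fun m => by
    rw [← sx_mul, scaleE_mul]
  have h3 : ∀ m, s.pw (2 * (m + 1)) * sx X (m + 1) = s.pw (2 * m) * sx X m * (s.pw 2 * sx X 1) :=
    fun m => by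
      rw [mul_add, mul_one, pw_add, ← sx_mul, mul_assoc, mul_assoc, s.pw_left_comm 2 (sx X m)]
  have hu : IsUnit (s.pw 2 * sx X 1 : Formal) := by
    rw [← h1, isUnit_iff_exists]
    exact ⟨s.scaleE (sx X (-1)),
      by rw [← scaleE_mul, sx_mul, add_neg_cancel, sx_zero, s.scaleE_of_isConst isConst_one],
      by rw [← scaleE_mul, sx_mul, neg_add_cancel, sx_zero, s.scaleE_of_isConst isConst_one]⟩
  induction n using Int.induction_on with
  | zero => rw [sx_zero, s.scaleE_of_isConst isConst_one, mul_zero, pw_zero, one_mul]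
  | succ n ih => rw [h2, h3, ih, h1]
  | pred n ih =>
    have h4 := h2 (-n - 1)
    have h5 := h3 (-n - 1)
    rw [sub_add_cancel] at h4 h5
    rw [ih, h5, h1] at h4
    exact (hu.mul_left_injective h4).symm

lemma isSubst_scaleE : IsSubst s.scaleE where
  cont := s.isCont_scaleE
  mem_K := by
    intro m f hf
    rw [add_zero, ← csum_coeffs f, s.isCont_scaleE.map_csum
      (((locallyFinite_cX _).mul_left _).add (((locallyFinite_cX _).mul_left _).mul_right _))]
    refine csum_mem_I fun k => ?_
    have h0 : cX k (nP f) ∈ I m := by simpa using cX_mem_K k _ _ (nP_mem_K _ _ hf)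
    have h1 : cX k (dPhi f) ∈ I m := by simpa using cX_mem_K k _ _ (dPhi_mem_K _ _ hf)
    rw [map_add, scaleE_mul, scaleE_mul, scaleE_mul, s.scaleE_of_isConst (isConst_cX_nP k f),
      s.scaleE_of_isConst (isConst_cX_dPhi k f)]
    exact add_mem (mul_mem_I_right h0 _) (mul_mem_I_left _ (mul_mem_I_right h1 _))
  map_mul := s.scaleE_mul
  map_const f hf := s.scaleE_of_isConst hf
  par_comm f := by
    refine LinearMap.congr_fun (IsCont.ext_monomial (S := par * s.scaleE) (T := s.scaleE * par)
      (isCont_par.mul s.isCont_scaleE) (s.isCont_scaleE.mul isCont_par) ?_ ?_) f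
    · intro c k hc
      have hc' : IsConst (par c) := ⟨by rw [← par_dX, hc.1, map_zero], by
        rw [← neg_eq_zero, ← par_dPhi, hc.2, map_zero]⟩
      simp only [Module.End.mul_apply, par_mul, scaleE_mul, scaleE_sx, par_sx,
        s.scaleE_of_isConst hc, s.scaleE_of_isConst hc', par_of_isEven (s.isEven_pw _)]
    · intro c k hc
      have hc' : IsConst (par c) := ⟨by rw [← par_dX, hc.1, map_zero], by
        rw [← neg_eq_zero, ← par_dPhi, hc.2, map_zero]⟩
      simp only [Module.End.mul_apply, par_mul, scaleE_mul, scaleE_sx, par_sx, scaleE_phi, par_phi,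
        s.scaleE_of_isConst hc, s.scaleE_of_isConst hc', par_of_isEven (s.isEven_pw _), map_neg,
        mul_neg, neg_mul]
  zeta_comm i f := by
    refine LinearMap.congr_fun (IsCont.ext_monomial (S := dOdd (.zeta i) * s.scaleE)
      (T := s.scaleE * dOdd (.zeta i)) ((isCont_dOdd _).mul s.isCont_scaleE)
      (s.isCont_scaleE.mul (isCont_dOdd _)) ?_ ?_) f
    · intro c k hc
      have hc' : IsConst (dOdd (.zeta i) c) := ⟨by
        rw [show dX (dOdd (.zeta i) c) = dOdd (.zeta i) (dX c) from (dOdd_lift _ _ _).symm, hc.1,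
          map_zero], by rw [dPhi, dOdd_comm, ← dPhi, hc.2, map_zero, neg_zero]⟩
      have hs : dOdd (.zeta i) (s.pw (2 * k)) = 0 := ((isFormal_iff _).mp (s.isFormal_pw _)).2 i
      have hx : dOdd (.zeta i) (sx X k) = 0 := dOdd_laurentMono _ _
      simp only [Module.End.mul_apply, dOdd_mul, scaleE_mul, scaleE_sx, hs, hx, zero_mul, mul_zero,
        add_zero, s.scaleE_of_isConst hc, s.scaleE_of_isConst hc']
    · intro c k hc
      have hc' : IsConst (dOdd (.zeta i) c) := ⟨by
        rw [show dX (dOdd (.zeta i) c) = dOdd (.zeta i) (dX c) from (dOdd_lift _ _ _).symm, hc.1,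
          map_zero], by rw [dPhi, dOdd_comm, ← dPhi, hc.2, map_zero, neg_zero]⟩
      have hs : ∀ m, dOdd (.zeta i) (s.pw m) = 0 := fun m =>
        ((isFormal_iff _).mp (s.isFormal_pw m)).2 i
      have hx : dOdd (.zeta i) (sx X k) = 0 := dOdd_laurentMono _ _
      have hp : dOdd (.zeta i) phi = 0 := Gr.leftDeriv_gen_of_ne nofun
      simp only [Module.End.mul_apply, dOdd_mul, scaleE_mul, scaleE_sx, scaleE_phi, hs, hx, hp,
        zero_mul, mul_zero, zero_add, add_zero, s.scaleE_of_isConst hc, s.scaleE_of_isConst hc',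
        ← par_apply, par_phi, par_mul, par_of_isEven (s.isEven_pw _), map_neg, neg_mul, mul_neg]

lemma dX_pw_mul (n : ℤ) (f : Formal) : dX (s.pw n * f) = s.pw n * dX f := by
  rw [dX_mul, (s.isConst_pw n).1, zero_mul, zero_add]

lemma dPhi_pw_mul (n : ℤ) (f : Formal) : dPhi (s.pw n * f) = s.pw n * dPhi f := by
  rw [dPhi_mul, (s.isConst_pw n).2, zero_mul, zero_add, par_of_isEven (s.isEven_pw n)]

lemma dX_const_mul {c : Formal} (hc : IsConst c) (f : Formal) : dX (c * f) = c * dX f := by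
  rw [dX_mul, hc.1, zero_mul, zero_add]

lemma dPhi_const_mul {c : Formal} (hc : IsConst c) (f : Formal) :
    dPhi (c * f) = par c * dPhi f := by
  rw [dPhi_mul, hc.2, zero_mul, zero_add]

lemma dX_scaleE (f : Formal) : dX (s.scaleE f) = s.pw 2 * s.scaleE (dX f) := by
  refine LinearMap.congr_fun (IsCont.ext_monomial (S := dX * s.scaleE)
    (T := LinearMap.mulLeft ℂ (s.pw 2) * (s.scaleE * dX)) ((isCont_lift _).mul s.isCont_scaleE)
    ((isCont_mulLeft _).mul (s.isCont_scaleE.mul (isCont_lift _))) ?_ ?_) f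
  · intro c k hc
    simp only [Module.End.mul_apply, LinearMap.mulLeft_apply, scaleE_mul, s.scaleE_of_isConst hc,
      dX_const_mul hc, scaleE_sx, dX_pw_mul, dX_sx, map_smul, mul_smul_comm]
    rw [← s.pw_left_comm 2 c, s.pw_mul_pw_mul, show 2 + 2 * (k - 1) = 2 * k by ring]
  · intro c k hc
    simp only [Module.End.mul_apply, LinearMap.mulLeft_apply, scaleE_mul, s.scaleE_of_isConst hc,
      dX_const_mul hc, scaleE_sx, dX_pw_mul, dX_sx, map_smul, mul_smul_comm, dX_phi_mul, scaleE_phi,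
      mul_assoc]
    rw [← s.pw_left_comm 2 (s.pw 1), ← s.pw_left_comm 2 phi, ← s.pw_left_comm 2 c, s.pw_mul_pw_mul,
      show 2 + 2 * (k - 1) = 2 * k by ring]

lemma dPhi_scaleE (f : Formal) : dPhi (s.scaleE f) = s.pw 1 * s.scaleE (dPhi f) := by
  refine LinearMap.congr_fun (IsCont.ext_monomial (S := dPhi * s.scaleE)
    (T := LinearMap.mulLeft ℂ (s.pw 1) * (s.scaleE * dPhi)) ((isCont_dOdd _).mul s.isCont_scaleE)
    ((isCont_mulLeft _).mul (s.isCont_scaleE.mul (isCont_dOdd _))) ?_ ?_) f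
  · intro c k hc
    simp only [Module.End.mul_apply, LinearMap.mulLeft_apply, scaleE_mul, s.scaleE_of_isConst hc,
      dPhi_const_mul hc, scaleE_sx, dPhi_pw_mul, dPhi_sx, map_zero, mul_zero]
  · intro c k hc
    simp only [Module.End.mul_apply, LinearMap.mulLeft_apply, scaleE_mul, s.scaleE_of_isConst hc,
      scaleE_sx, dPhi_pw_mul, scaleE_phi, mul_assoc, dPhi_phi_mul, dPhi_const_mul hc, dPhi_sx,
      mul_zero, sub_zero]

lemma scaleE_L (n : ℤ) (f : Formal) : s.scaleE (L n f) = s.pw (2 * n) * L n (s.scaleE f) := by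
  simp only [L_apply, map_neg, map_add, map_smul, scaleE_mul, scaleE_sx, scaleE_phi, dX_scaleE,
    dPhi_scaleE, mul_neg, mul_add, mul_smul_comm, mul_assoc]
  simp only [s.pw_left_comm _ (sx X _), s.pw_left_comm _ phi, s.pw_mul_pw_mul]
  ring_nf

lemma scaleE_G (n : ℤ) (f : Formal) : s.scaleE (G n f) = s.pw (2 * n - 1) * G n (s.scaleE f) := by
  simp only [G_apply, map_neg, map_sub, scaleE_mul, scaleE_sx, scaleE_phi, dX_scaleE,
    dPhi_scaleE, mul_neg, mul_sub, mul_assoc]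
  simp only [s.pw_left_comm _ (sx X _), s.pw_left_comm _ phi, s.pw_mul_pw_mul]
  ring_nf

end

lemma scaleE_mul_scaleE (s t : Scalar) : s.scaleE * t.scaleE = (s * t).scaleE := by
  rw [← (s.isSubst_scaleE.mul t.isSubst_scaleE).compE_eq, ← (s * t).isSubst_scaleE.compE_eq]
  simp only [Module.End.mul_apply, scaleE_sx, scaleE_phi, scaleE_mul,
    s.scaleE_of_isConst (t.isConst_pw _)]
  have h : ∀ n, (s * t).pw n = t.pw n * s.pw n := fun n => by
    have h1 : Commute s.u t.u := Units.ext (Gr.commute_of_isEven s.even t.u)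
    rw [pw, mul_u, h1.mul_zpow, Units.val_mul, t.pw_comm]; rfl
  rw [h, h, mul_assoc, mul_assoc]

lemma pw_of_u_eq_one {s : Scalar} (h : s.u = 1) (n : ℤ) : s.pw n = 1 :=
  pw_of_val_eq_one (by rw [h, Units.val_one]) n

lemma scaleE_of_u_eq_one {s : Scalar} (h : s.u = 1) : s.scaleE = 1 := by
  refine IsCont.ext_monomial s.isCont_scaleE isCont_one (fun c k hc => ?_) fun c k hc => ?_ <;>
  simp only [scaleE_mul, s.scaleE_of_isConst hc, scaleE_sx, scaleE_phi, pw_of_u_eq_one h, one_mul,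
    Module.End.one_apply]

lemma scaleE_mul_inv (s : Scalar) : s.scaleE * (s⁻¹).scaleE = 1 := by
  rw [scaleE_mul_scaleE, scaleE_of_u_eq_one]
  rw [mul_u, inv_u, mul_inv_cancel]

end Scalar

namespace SFam

/-- The vector field with coefficients `s^{2n} c_n` and `s^{2n-1} e_n`. -/
def twist (F : SFam) (s : Scalar) : SFam where
  c n := s.pw (2 * n) * F.c n
  e n := s.pw (2 * n - 1) * F.e n
  hc := F.hc.mul_left (fun _ _ => Gr.IsEven.mul) (fun _ => s.isFormal_pw _) fun _ => s.isEven_pw _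
  he := F.he.mul_left (fun _ _ => Gr.IsEven.mul_isOdd) (fun _ => s.isFormal_pw _)
    fun _ => s.isEven_pw _

lemma scaleE_op (F : SFam) (s : Scalar) : s.scaleE * F.op = (F.twist s).op * s.scaleE := by
  refine LinearMap.ext fun f => ?_
  rw [Module.End.mul_apply, Module.End.mul_apply, op, LinearMap.add_apply, map_add,
    apply_csumOp s.isCont_scaleE, apply_csumOp s.isCont_scaleE, op_apply]
  congr 1
  · refine csum_congr fun n => ?_
    rw [s.scaleE_mul, s.scaleE_of_isConst (F.hc.formal n).isConst, s.scaleE_L, s.pw_left_comm,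
      ← mul_assoc]
    rfl
  · refine csum_congr fun n => ?_
    rw [s.scaleE_mul, s.scaleE_of_isConst (F.he.formal n).isConst, s.scaleE_G, s.pw_left_comm,
      ← mul_assoc]
    rfl

lemma scaleE_expE (F : SFam) (s : Scalar) :
    s.scaleE * expE F.op = expE (F.twist s).op * s.scaleE :=
  semiconj_expE F.op_mem_K (F.twist s).op_mem_K s.isSubst_scaleE.mem_K (F.scaleE_op s)

lemma twist_neg (F : SFam) (s : Scalar) : (-F).twist s = -F.twist s :=
  ext (fun _ => mul_neg _ _) fun _ => mul_neg _ _

end SFam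

/-! ### The exponential of a superseries -/

lemma exp_eq {f : Formal} (hf : f ∈ I 1) : Formal.exp f = expE (LinearMap.mulLeft ℂ f) 1 :=
  expOp_eq (T := LinearMap.mulLeft ℂ f) (mulLeft_mem_K hf) 1

lemma exp_add {f g : Formal} (hf : f ∈ I 1) (hg : g ∈ I 1) (hg' : f.IsEven) :
    Formal.exp (g + f) = Formal.exp g * Formal.exp f := by
  rw [exp_eq hf, exp_eq hg, exp_eq (add_mem hg hf),
    ← expE_leibniz (A := LinearMap.mulLeft ℂ (g + f)) (mulLeft_mem_K (add_mem hg hf))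
      (mulLeft_mem_K hg) (mulLeft_mem_K hf), one_mul]
  intro a b
  simp only [LinearMap.mulLeft_apply, add_mul, mul_assoc]
  rw [← mul_assoc b f, ← Gr.commute_of_isEven hg' b, mul_assoc]

lemma exp_zero : Formal.exp 0 = 1 := by
  rw [exp_eq (Submodule.zero_mem _), expE_apply_of_eq_zero]
  rw [LinearMap.mulLeft_apply, zero_mul]

end Formal

namespace Formal

/-! ### The formal sewing problem in terms of operators -/

/-- The images of the coordinates under an operator. -/
def act (σ : Op) : SPair EvenVar Laurent := (σ (sx X 1), σ phi)

lemma act_inj {σ τ : Op} (hσ : IsSubst σ) (hτ : IsSubst τ) :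
    act σ = act τ ↔ σ = τ := by
  refine ⟨fun h => ?_, fun h => by rw [h]⟩
  rw [act, act, Prod.mk.injEq] at h
  rw [← hσ.compE_eq, ← hτ.compE_eq, h.1, h.2]

lemma compPair_act {σ : Op} (hσ : IsSubst σ) (τ : Op) :
    compPair (act τ) (act σ) = act (σ * τ) := by
  rw [compPair, act, act, comp_eq, comp_eq, hσ.compE_eq]
  rfl

lemma isFamily_evenVar (s : Side) (k : Puncture) : IsFamily Gr.IsEven (evenVar s k) where
  formal j := isFormal_evenVar s k j
  parity j := isEven_evenVar s k j
  noConstantTerm j := by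
    change cf (∅, 0) (evenVar s k j) = 0
    rw [cf_evenVar, if_neg]
    intro h
    have := congrArg (fun q : Idx => q.2 (s, k, j)) h
    simp at this
  locallyFinite := by
    rw [locallyFinite_iff]
    intro q
    refine Set.Subsingleton.finite fun i hi j hj => ?_
    rw [Set.mem_setOf_eq, cf_evenVar] at hi hj
    have h1 := (Classical.not_not.mp fun h => hi (if_neg h))
    have h2 := (Classical.not_not.mp fun h => hj (if_neg h))
    have h3 := (Prod.mk.inj (h1.symm.trans h2)).2
    have h4 := ((Finsupp.single_left_inj one_ne_zero).mp h3)
    simpa using h4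

lemma isFamily_oddVar (s : Side) (k : Puncture) : IsFamily Gr.IsOdd (oddVar s k) where
  formal j := isFormal_oddVar s k j
  parity j := isOdd_oddVar s k j
  noConstantTerm j := by
    change cf (∅, 0) (oddVar s k j) = 0
    rw [cf_oddVar, if_neg]
    intro h
    have := (Prod.mk.inj h).1
    simp [eq_comm] at this
  locallyFinite := by
    rw [locallyFinite_iff]
    intro q
    refine Set.Subsingleton.finite fun i hi j hj => ?_
    rw [Set.mem_setOf_eq, cf_oddVar] at hi hj
    have h1 := (Classical.not_not.mp fun h => hi (if_neg h))
    have h2 := (Classical.not_not.mp fun h => hj (if_neg h))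
    have h3 := (Prod.mk.inj (h1.symm.trans h2)).1
    simpa using h3

namespace SFam

/-- The vector field `∑_{j ≥ 1} (A_j L_j + M_j G_{j-1/2})`. -/
def ofPos {A M : ℕ+ → Formal} (hA : IsFamily Gr.IsEven A) (hM : IsFamily Gr.IsOdd M) : SFam where
  c n := if 0 < n then A n.toNat.toPNat' else 0
  e n := if 0 < n then M n.toNat.toPNat' else 0
  hc := hA.extend (e := fun n : ℤ => n.toNat.toPNat') Gr.isEven_zero
    (fun n => by split_ifs <;> simp) fun i => (Set.finite_singleton (i : ℤ)).subset fun n hn => by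
      have h : 0 < n := by
        by_contra h
        exact hn.2 (if_neg h)
      have h1 := congrArg PNat.val hn.1
      rw [Nat.toPNat'_coe] at h1
      simp only [Set.mem_singleton_iff]
      split_ifs at h1 <;> omega
  he := hM.extend (e := fun n : ℤ => n.toNat.toPNat') Gr.isOdd_zero
    (fun n => by split_ifs <;> simp) fun i => (Set.finite_singleton (i : ℤ)).subset fun n hn => by
      have h : 0 < n := by
        by_contra h
        exact hn.2 (if_neg h)
      have h1 := congrArg PNat.val hn.1
      rw [Nat.toPNat'_coe] at h1
      simp only [Set.mem_singleton_iff]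
      split_ifs at h1 <;> omega

/-- The vector field `∑_{j ≥ 1} (A_j L_{-j} + M_j G_{-j+1/2})`. -/
def ofNeg {A M : ℕ+ → Formal} (hA : IsFamily Gr.IsEven A) (hM : IsFamily Gr.IsOdd M) : SFam where
  c n := if n < 0 then A (-n).toNat.toPNat' else 0
  e n := if n ≤ 0 then M (1 - n).toNat.toPNat' else 0
  hc := hA.extend (e := fun n : ℤ => (-n).toNat.toPNat') Gr.isEven_zero
    (fun n => by split_ifs <;> simp) fun i => (Set.finite_singleton (-(i : ℤ))).subset fun n hn => by
      have h : n < 0 := by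
        by_contra h
        exact hn.2 (if_neg h)
      have h1 := congrArg PNat.val hn.1
      rw [Nat.toPNat'_coe] at h1
      simp only [Set.mem_singleton_iff]
      split_ifs at h1 <;> omega
  he := hM.extend (e := fun n : ℤ => (1 - n).toNat.toPNat') Gr.isOdd_zero
    (fun n => by split_ifs <;> simp) fun i => (Set.finite_singleton (1 - (i : ℤ))).subset
      fun n hn => by
        have h : n ≤ 0 := by
          by_contra h
          exact hn.2 (if_neg h)
        have h1 := congrArg PNat.val hn.1
        rw [Nat.toPNat'_coe] at h1
        simp only [Set.mem_singleton_iff]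
        split_ifs at h1 <;> omega

section

variable {A M : ℕ+ → Formal} (hA : IsFamily Gr.IsEven A) (hM : IsFamily Gr.IsOdd M)

lemma ofPos_c (j : ℕ+) : (ofPos hA hM).c j = A j := by
  simp [ofPos]

lemma ofPos_e (j : ℕ+) : (ofPos hA hM).e j = M j := by
  simp [ofPos]

lemma ofNeg_c (j : ℕ+) : (ofNeg hA hM).c (-j) = A j := by
  simp [ofNeg]

lemma ofNeg_e (j : ℕ+) : (ofNeg hA hM).e (1 - j) = M j := by
  have : (1 : ℤ) - j ≤ 0 := by have := j.pos; omega
  simp [ofNeg]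

lemma pos_ofPos : (ofPos hA hM).pos = ofPos hA hM :=
  ext (fun n => by simp only [pos, restrict, ofPos]; split_ifs <;> rfl)
    fun n => by simp only [pos, restrict, ofPos]; split_ifs <;> rfl

lemma neg_ofNeg : (ofNeg hA hM).neg' = ofNeg hA hM :=
  ext (fun n => by simp only [neg', restrict, ofNeg]; split_ifs <;> rfl)
    fun n => by simp only [neg', restrict, ofNeg]; split_ifs <;> rfl

end

variable (F : SFam)

lemma pos_op (f : Formal) : posOp X (fun j => F.c j) (fun j => F.e j) f = F.pos.op f := by
  have hinj : Function.Injective fun j : ℕ+ => (j : ℤ) := fun i j h => PNat.eq (by simpa using h)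
  have hout : ∀ n : ℤ, n ∉ Set.range (fun j : ℕ+ => (j : ℤ)) → ¬ 0 < n := fun n hn h =>
    hn ⟨⟨n.toNat, by omega⟩, by simp; omega⟩
  rw [op_apply, csum_reindex hinj (F := fun n => F.pos.c n * L n f), csum_reindex hinj
    (F := fun n => F.pos.e n * G n f), posOp, ← csum_add]
  · refine csum_congr fun j => ?_
    have h : (0 : ℤ) < j := by have := j.pos; omega
    simp only [pos, restrict, if_pos h]
    rfl
  · exact (F.pos.hc.locallyFinite.comp_injective hinj).mul_left _
  · exact (F.pos.he.locallyFinite.comp_injective hinj).mul_left _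
  · intro n hn
    simp only [pos, restrict, if_neg (hout n hn), zero_mul]
  · intro n hn
    simp only [pos, restrict, if_neg (hout n hn), zero_mul]

lemma neg_op (f : Formal) :
    negOp X (fun j => F.c (-(j : ℤ))) (fun j => F.e (1 - (j : ℤ))) f = F.neg'.op f := by
  have hinj : Function.Injective fun j : ℕ+ => -(j : ℤ) := fun i j h => PNat.eq (by simpa using h)
  have hinj' : Function.Injective fun j : ℕ+ => 1 - (j : ℤ) := fun i j h => PNat.eq (by simpa using h)
  have hout : ∀ n : ℤ, n ∉ Set.range (fun j : ℕ+ => -(j : ℤ)) → ¬ n < 0 := fun n hn h =>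
    hn ⟨⟨(-n).toNat, by omega⟩, by simp; omega⟩
  have hout' : ∀ n : ℤ, n ∉ Set.range (fun j : ℕ+ => 1 - (j : ℤ)) → ¬ n ≤ 0 := fun n hn h =>
    hn ⟨⟨(1 - n).toNat, by omega⟩, by simp; omega⟩
  rw [op_apply, csum_reindex hinj (F := fun n => F.neg'.c n * L n f), csum_reindex hinj'
    (F := fun n => F.neg'.e n * G n f), negOp, ← csum_add]
  · refine csum_congr fun j => ?_
    have h : -(j : ℤ) < 0 := by have := j.pos; omega
    have h' : 1 - (j : ℤ) ≤ 0 := by have := j.pos; omega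
    simp only [neg', restrict, if_pos h, if_pos h']
    rfl
  · exact (F.neg'.hc.locallyFinite.comp_injective hinj).mul_left _
  · exact (F.neg'.he.locallyFinite.comp_injective hinj').mul_left _
  · intro n hn
    simp only [neg', restrict, if_neg (hout' n hn), zero_mul]
  · intro n hn
    simp only [neg', restrict, if_neg (hout n hn), zero_mul]

lemma zero_op (f : Formal) : F.zero'.op f = F.c 0 * L 0 f := by
  rw [op_apply, csum_eq_single 0, csum_eq_single 0]
  · simp [zero', restrict]
  · intro n hn
    simp [zero', restrict]
  · intro n hn
    simp [zero', restrict, hn]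

lemma expOp_pos (f : Formal) :
    expOp (fun g => -posOp X (fun j => F.c j) (fun j => F.e j) g) f = expE (-F.pos).op f := by
  rw [← expOp_eq (-F.pos).op_mem_K]
  congr 1
  funext g
  rw [pos_op, op_neg, LinearMap.neg_apply]

lemma etilde_eq : Etilde X (fun j => F.c j) (fun j => F.e j) = act (expE (-F.pos).op) := by
  rw [Etilde, expOp_pos, expOp_pos]
  rfl

lemma ehat_eq (lam : Formal) : Ehat lam (fun j => F.c j) (fun j => F.e j)
    = act (expE (-F.pos).op * compE (lam ^ 2 * sx X 1) (lam * phi)) := by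
  simp only [Ehat, expOp_pos]
  rfl

end SFam

lemma etilde_eq {A M : ℕ+ → Formal} (hA : IsFamily Gr.IsEven A) (hM : IsFamily Gr.IsOdd M) :
    Etilde X A M = act (expE (-SFam.ofPos hA hM).op) := by
  have := (SFam.ofPos hA hM).etilde_eq
  simpa only [SFam.ofPos_c, SFam.ofPos_e, SFam.pos_ofPos] using this

lemma ehat_eq {A M : ℕ+ → Formal} (hA : IsFamily Gr.IsEven A) (hM : IsFamily Gr.IsOdd M)
    (lam : Formal) : Ehat lam A M =
      act (expE (-SFam.ofPos hA hM).op * compE (lam ^ 2 * sx X 1) (lam * phi)) := by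
  have := (SFam.ofPos hA hM).ehat_eq lam
  simpa only [SFam.ofPos_c, SFam.ofPos_e, SFam.pos_ofPos] using this

/-- A Laurent monomial free of `x`. -/
def Scalar.mono (w : ℤ × ℤ × ℤ) (h : w.2.2 = 0) : Scalar where
  u := ⟨laurentMono w, laurentMono (-w), by rw [laurentMono_mul, add_neg_cancel, laurentMono_zero],
    by rw [laurentMono_mul, neg_add_cancel, laurentMono_zero]⟩
  formal := isFormal_laurentMono h
  even := isEven_laurentMono w

lemma Scalar.pw_mono (w : ℤ × ℤ × ℤ) (h : w.2.2 = 0) (n : ℤ) :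
    (Scalar.mono w h).pw n = laurentMono (n • w) := by
  induction n using Int.induction_on with
  | zero => rw [pw_zero, zero_smul, laurentMono_zero]
  | succ n ih =>
    rw [pw_add, ih, pw_one, add_smul, ← laurentMono_mul, one_smul]; rfl
  | pred n ih =>
    rw [sub_eq_add_neg, pw_add, ih, add_smul, ← laurentMono_mul, neg_one_smul, pw,
      _root_.zpow_neg, _root_.zpow_one]; rfl

/-- The scalar `α₀^{1/2}`. -/
def sAlpha : Scalar := .mono (1, 0, 0) rfl

/-- The scalar `β₀^{1/2}`. -/
def sBeta : Scalar := .mono (0, 1, 0) rfl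

lemma isFormal_of_forall {f : Formal} (h : ∀ n, ∃ g, IsFormal g ∧ f - g ∈ I n) : IsFormal f := by
  have key : ∀ T : Op, T ∈ K 0 → (∀ g, IsFormal g → T g = 0) → T f = 0 := by
    intro T hT h0
    refine eq_zero_of_forall_mem_I fun n => ?_
    obtain ⟨g, hg, hn⟩ := h n
    have := hT n _ hn
    rwa [map_sub, h0 g hg, sub_zero] at this
  rw [isFormal_iff]
  exact ⟨⟨key _ dX_mem_K fun g hg => hg.isConst.1, key _ dPhi_mem_K fun g hg => hg.isConst.2⟩,
    fun i => key _ (dOdd_mem_K rfl) fun g hg => ((isFormal_iff g).mp hg).2 i⟩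

lemma isEven_of_forall {f : Formal} (h : ∀ n, ∃ g : Formal, g.IsEven ∧ f - g ∈ I n) :
    f.IsEven := by
  rw [isEven_iff, ← sub_eq_zero]
  refine eq_zero_of_forall_mem_I fun n => ?_
  obtain ⟨g, hg, hn⟩ := h n
  have h1 := par_mem_K n _ hn
  rw [map_sub, par_of_isEven hg, add_zero] at h1
  have h2 := sub_mem h1 hn
  rwa [sub_sub_sub_cancel_right] at h2

lemma isOdd_of_forall {f : Formal} (h : ∀ n, ∃ g : Formal, g.IsOdd ∧ f - g ∈ I n) :
    f.IsOdd := by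
  rw [isOdd_iff, ← add_eq_zero_iff_eq_neg]
  refine eq_zero_of_forall_mem_I fun n => ?_
  obtain ⟨g, hg, hn⟩ := h n
  have h1 := par_mem_K n _ hn
  rw [map_sub, par_of_isOdd hg, add_zero] at h1
  have h2 := add_mem h1 hn
  rwa [sub_add_sub_comm, neg_add_cancel, sub_zero] at h2

lemma expTrunc_apply (N : ℕ) (T : Op) (f : Formal) :
    expTrunc N T f = ∑ n ∈ Finset.range N, ((n.factorial : ℂ)⁻¹) • (T ^ n) f := by
  simp [expTrunc]

section ExpFormal

variable {f : Formal} (hf : IsFormal f) (hf' : f.IsEven) (hI : f ∈ I 1)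

lemma mulLeft_pow_one (f : Formal) (n : ℕ) : (LinearMap.mulLeft ℂ f ^ n) 1 = f ^ n := by
  induction n with
  | zero => simp
  | succ n ih => rw [pow_succ', Module.End.mul_apply, ih, LinearMap.mulLeft_apply, ← pow_succ']

include hf hI in
lemma isFormal_exp : IsFormal (Formal.exp f) := by
  refine isFormal_of_forall fun N => ⟨expTrunc N (LinearMap.mulLeft ℂ f) 1, ?_, ?_⟩
  · rw [expTrunc_apply]
    refine Finset.sum_induction _ IsFormal (fun _ _ => IsFormal.add) isFormal_zero fun n _ => ?_
    rw [mulLeft_pow_one]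
    exact (hf.pow n).smul _
  · rw [exp_eq hI]
    exact expE_sub_expTrunc_mem (mulLeft_mem_K hI) N 1

include hf' hI in
lemma isEven_exp : (Formal.exp f).IsEven := by
  refine isEven_of_forall fun N => ⟨expTrunc N (LinearMap.mulLeft ℂ f) 1, ?_, ?_⟩
  · rw [expTrunc_apply]
    refine Finset.sum_induction _ Gr.IsEven (fun _ _ => Gr.IsEven.add) Gr.isEven_zero fun n _ => ?_
    rw [mulLeft_pow_one]
    exact (hf'.pow n).smul _
  · rw [exp_eq hI]
    exact expE_sub_expTrunc_mem (mulLeft_mem_K hI) N 1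

/-- The exponential of an even superseries in the formal variables without constant term. -/
def Scalar.exp : Scalar where
  u := ⟨Formal.exp f, Formal.exp (-f),
    by rw [← exp_add (neg_mem hI) hI hf'.neg, add_neg_cancel, exp_zero],
    by rw [← exp_add hI (neg_mem hI) hf', neg_add_cancel, exp_zero]⟩
  formal := isFormal_exp hf hI
  even := isEven_exp hf' hI

end ExpFormal

end Formal

namespace Formal

/-! ### The effect of vector fields with positive indices -/

lemma isCont_dX : IsCont dX := isCont_lift _

lemma cX_dX (k : ℤ) (f : Formal) : cX k (dX f) = ((k : ℂ) + 1) • cX (k + 1) f := by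
  have h1 : dX f = csum fun j => sx X (j - 1) * ((j : ℂ) • cX j f) := by
    conv_lhs => rw [← csum_cX f]
    rw [isCont_dX.map_csum ((locallyFinite_cX f).mul_right _)]
    refine csum_congr fun j => ?_
    rw [dX_sx_mul, dX_cX, mul_zero, add_zero, mul_smul_comm]
  rw [h1, (isCont_cX k).map_csum (((locallyFinite_cX f).smul _).mul_right _),
    csum_eq_single (k + 1)]
  · rw [cX_sx_mul, map_smul, cX_of_dX_eq_zero (dX_cX _ _), if_pos (by omega)]
    push_cast
    rfl
  · intro j hj
    rw [cX_sx_mul, map_smul, cX_of_dX_eq_zero (dX_cX _ _), if_neg (by omega), smul_zero]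

lemma nP_L (n : ℤ) (f : Formal) : nP (L n f) = -(sx X (n + 1) * dX (nP f)) := by
  simp only [nP_apply, L_apply, map_neg, map_add, map_sub, map_smul, dPhi_sx_mul, dPhi_phi_mul,
    dPhi_dX, dX_phi_mul, dPhi_dPhi, mul_zero, sub_zero, mul_neg, mul_add, mul_sub, mul_smul_comm,
    phi_mul_sx_mul, phi_mul_phi_mul]
  rw [sub_self, smul_zero, add_zero]

lemma dPhi_L (n : ℤ) (f : Formal) : dPhi (L n f)
    = -(sx X (n + 1) * dX (dPhi f) + (((n : ℂ) + 1) / 2) • (sx X n * dPhi f)) := by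
  simp only [L_apply, map_neg, map_add, map_smul, dPhi_sx_mul, dPhi_phi_mul,
    dPhi_dX, dPhi_dPhi, mul_zero, sub_zero]

lemma nP_G (n : ℤ) (f : Formal) : nP (G n f) = -(sx X n * dPhi f) := by
  simp only [nP_apply, G_apply, map_neg, map_sub, dPhi_sx_mul, dPhi_phi_mul,
    dPhi_dX, dPhi_dPhi, mul_zero, sub_zero, mul_neg, mul_sub, phi_mul_sx_mul, phi_mul_phi_mul]
  abel

lemma dPhi_G (n : ℤ) (f : Formal) : dPhi (G n f) = sx X n * dX (nP f) := by
  simp only [nP_apply, G_apply, map_neg, map_sub, dPhi_sx_mul, dPhi_phi_mul,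
    dPhi_dX, dPhi_dPhi, mul_zero, dX_phi_mul, mul_sub]
  abel

/-- Superseries whose `φ`-free part only involves `x^k` with `k ≥ a`, and whose remaining part only
involves `φ x^k` with `k ≥ b`. -/
def xFilt (a b : ℤ) : Submodule ℂ Formal where
  carrier := {f | (∀ k < a, cX k (nP f) = 0) ∧ ∀ k < b, cX k (dPhi f) = 0}
  zero_mem' := by simp
  add_mem' hf hg := ⟨fun k hk => by rw [map_add, map_add, hf.1 k hk, hg.1 k hk, add_zero],
    fun k hk => by rw [map_add, map_add, hf.2 k hk, hg.2 k hk, add_zero]⟩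
  smul_mem' c f hf := ⟨fun k hk => by rw [map_smul, map_smul, hf.1 k hk, smul_zero],
    fun k hk => by rw [map_smul, map_smul, hf.2 k hk, smul_zero]⟩

lemma xFilt_anti {a b a' b' : ℤ} (ha : a' ≤ a) (hb : b' ≤ b) {f : Formal} (hf : f ∈ xFilt a b) :
    f ∈ xFilt a' b' :=
  ⟨fun k hk => hf.1 k (hk.trans_le ha), fun k hk => hf.2 k (hk.trans_le hb)⟩

lemma const_mul_mem_xFilt {a b : ℤ} {c f : Formal} (hc : IsConst c) (hf : f ∈ xFilt a b) :
    c * f ∈ xFilt a b := by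
  have hc' : IsConst (par c) := ⟨by rw [← par_dX, hc.1, map_zero], by
    rw [← neg_eq_zero, ← par_dPhi, hc.2, map_zero]⟩
  refine ⟨fun k hk => ?_, fun k hk => ?_⟩
  · rw [nP_const_mul hc, cX_const_mul hc, hf.1 k hk, mul_zero]
  · rw [Scalar.dPhi_const_mul hc, cX_const_mul hc', hf.2 k hk, mul_zero]

lemma csum_mem_xFilt {ι : Type} {F : ι → Formal} {a b : ℤ} (hF : LocallyFinite F)
    (h : ∀ i, F i ∈ xFilt a b) : csum F ∈ xFilt a b := by
  have key : ∀ T : Op, IsCont T → (∀ i, T (F i) = 0) → T (csum F) = 0 := by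
    intro T hT h0
    rw [hT.map_csum hF]
    simp only [h0, csum_zero]
  exact ⟨fun k hk => key (cX k * nP) ((isCont_cX k).mul isCont_nP) fun i => (h i).1 k hk,
    fun k hk => key (cX k * dPhi) ((isCont_cX k).mul (isCont_dOdd _)) fun i => (h i).2 k hk⟩

lemma mem_xFilt_of_forall {f : Formal} {a b : ℤ} (h : ∀ N, ∃ g ∈ xFilt a b, f - g ∈ I N) :
    f ∈ xFilt a b := by
  have key : ∀ T : Op, T ∈ K 0 → (∀ g ∈ xFilt a b, T g = 0) → T f = 0 := by
    intro T hT h0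
    refine eq_zero_of_forall_mem_I fun n => ?_
    obtain ⟨g, hg, hn⟩ := h n
    have := hT n _ hn
    rwa [map_sub, h0 g hg, sub_zero] at this
  exact ⟨fun k hk => key (cX k * nP) (mul_mem_K_left (cX_mem_K k) nP_mem_K) fun g hg => hg.1 k hk,
    fun k hk => key (cX k * dPhi) (mul_mem_K_left (cX_mem_K k) dPhi_mem_K) fun g hg => hg.2 k hk⟩

lemma L_mem_xFilt {a b n : ℤ} {f : Formal} (hf : f ∈ xFilt a b) : L n f ∈ xFilt (a + n) (b + n) := by
  refine ⟨fun k hk => ?_, fun k hk => ?_⟩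
  · rw [nP_L, map_neg, cX_sx_mul, cX_dX, hf.1 _ (by omega), smul_zero, neg_zero]
  · rw [dPhi_L, map_neg, map_add, map_smul, cX_sx_mul, cX_sx_mul, cX_dX, hf.2 _ (by omega),
      hf.2 _ (by omega), smul_zero, smul_zero, add_zero, neg_zero]

lemma G_mem_xFilt {a b n : ℤ} {f : Formal} (hf : f ∈ xFilt a b) :
    G n f ∈ xFilt (b + n) (a + n - 1) := by
  refine ⟨fun k hk => ?_, fun k hk => ?_⟩
  · rw [nP_G, map_neg, cX_sx_mul, hf.2 _ (by omega), neg_zero]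
  · rw [dPhi_G, cX_sx_mul, cX_dX, hf.1 _ (by omega), smul_zero]

namespace SFam

/-- The vector field only involves `L_n` and `G_{n-1/2}` with `n` in the given sets. -/
def Supp (F : SFam) (P Q : Set ℤ) : Prop := (∀ n ∉ P, F.c n = 0) ∧ ∀ n ∉ Q, F.e n = 0

lemma Supp.neg {F : SFam} {P Q : Set ℤ} (h : F.Supp P Q) : (-F).Supp P Q :=
  ⟨fun n hn => by rw [neg_c, h.1 n hn, neg_zero], fun n hn => by rw [neg_e, h.2 n hn, neg_zero]⟩

lemma Supp.add {F H : SFam} {P Q : Set ℤ} (h : F.Supp P Q) (h' : H.Supp P Q) : (F + H).Supp P Q :=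
  ⟨fun n hn => by rw [add_c, h.1 n hn, h'.1 n hn, add_zero],
    fun n hn => by rw [add_e, h.2 n hn, h'.2 n hn, add_zero]⟩

/-- The vector field only involves positive indices. -/
abbrev IsPos (F : SFam) : Prop := F.Supp (Set.Ioi 0) (Set.Ioi 0)

lemma isPos_ofPos {A M : ℕ+ → Formal} (hA : IsFamily Gr.IsEven A) (hM : IsFamily Gr.IsOdd M) :
    (ofPos hA hM).IsPos := ⟨fun _ hn => if_neg hn, fun _ hn => if_neg hn⟩

lemma isPos_pos (F : SFam) : F.pos.IsPos := ⟨fun _ hn => if_neg hn, fun _ hn => if_neg hn⟩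

lemma IsPos.twist {F : SFam} (hF : F.IsPos) (s : Scalar) : (F.twist s).IsPos :=
  ⟨fun n hn => by change _ * F.c n = 0; rw [hF.1 n hn, mul_zero],
    fun n hn => by change _ * F.e n = 0; rw [hF.2 n hn, mul_zero]⟩

variable {F : SFam}

lemma op_mem_xFilt {a b : ℤ} (hF : F.IsPos) {f : Formal} (hf : f ∈ xFilt a b) :
    F.op f ∈ xFilt (min (a + 1) (b + 1)) (min (b + 1) a) := by
  rw [op_apply]
  refine add_mem (csum_mem_xFilt (F.hc.locallyFinite.mul_left _) fun n => ?_)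
    (csum_mem_xFilt (F.he.locallyFinite.mul_left _) fun n => ?_)
  · by_cases hn : 0 < n
    · exact const_mul_mem_xFilt (F.hc.formal n).isConst
        (xFilt_anti (by omega) (by omega) (L_mem_xFilt (n := n) hf))
    · rw [hF.1 n hn, zero_mul]
      exact Submodule.zero_mem _
  · by_cases hn : 0 < n
    · exact const_mul_mem_xFilt (F.he.formal n).isConst
        (xFilt_anti (by omega) (by omega) (G_mem_xFilt (n := n) hf))
    · rw [hF.2 n hn, zero_mul]
      exact Submodule.zero_mem _

lemma expE_sub_mem_xFilt {a b : ℤ} {f : Formal} (h0 : F.op f ∈ xFilt a b)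
    (h : ∀ g ∈ xFilt a b, F.op g ∈ xFilt a b) : expE F.op f - f ∈ xFilt a b := by
  refine mem_xFilt_of_forall fun N => ⟨expTrunc (N + 1) F.op f - f, ?_, ?_⟩
  · rw [expTrunc_apply, Finset.sum_range_succ']
    simp only [Nat.factorial_zero, Nat.cast_one, inv_one, pow_zero, Module.End.one_apply, one_smul,
      add_sub_cancel_right]
    refine Submodule.sum_mem _ fun n hn => Submodule.smul_mem _ _ ?_
    clear hn
    induction n with
    | zero => simpa using h0
    | succ n ih =>
      rw [pow_succ', Module.End.mul_apply]
      exact h _ ih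
  · rw [sub_sub_sub_cancel_right]
    exact I_anti (by omega) (expE_sub_expTrunc_mem F.op_mem_K (N + 1) f)

lemma sx_mem_xFilt : (sx X 1 : Formal) ∈ xFilt 1 1 :=
  ⟨fun k hk => by rw [nP_sx, cX_sx, if_neg hk.ne], fun k _ => by rw [dPhi_sx, map_zero]⟩

lemma phi_mem_xFilt : phi ∈ xFilt 1 0 :=
  ⟨fun k _ => by rw [nP_phi, map_zero], fun k hk => by rw [dPhi_phi, cX_one, if_neg hk.ne]⟩

/-- Operators changing `x` and `φ` only by terms of higher order at `x = φ = 0`. -/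
def Tangent (σ : Op) : Prop :=
  σ (sx X 1) - sx X 1 ∈ xFilt 2 1 ∧ σ phi - phi ∈ xFilt 1 1 ∧
    (∀ f ∈ xFilt 2 1, σ f ∈ xFilt 2 1) ∧ ∀ f ∈ xFilt 1 1, σ f ∈ xFilt 1 1

lemma IsPos.tangent (hF : F.IsPos) : Tangent (expE F.op) := by
  have h21 : ∀ g ∈ xFilt 2 1, F.op g ∈ xFilt 2 1 := fun g hg =>
    xFilt_anti (by norm_num) (by norm_num) (op_mem_xFilt hF hg)
  have h11 : ∀ g ∈ xFilt 1 1, F.op g ∈ xFilt 1 1 := fun g hg =>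
    xFilt_anti (by norm_num) (by norm_num) (op_mem_xFilt hF hg)
  refine ⟨expE_sub_mem_xFilt (op_mem_xFilt hF sx_mem_xFilt) h21,
    expE_sub_mem_xFilt (op_mem_xFilt hF phi_mem_xFilt) h11, fun f hf => ?_, fun f hf => ?_⟩
  · rw [← sub_add_cancel (expE F.op f) f]
    exact add_mem (expE_sub_mem_xFilt (h21 f hf) h21) hf
  · rw [← sub_add_cancel (expE F.op f) f]
    exact add_mem (expE_sub_mem_xFilt (h11 f hf) h11) hf

lemma Tangent.mul {σ τ : Op} (hσ : Tangent σ) (hτ : Tangent τ) :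
    Tangent (σ * τ) := by
  refine ⟨?_, ?_, fun f hf => hσ.2.2.1 _ (hτ.2.2.1 f hf), fun f hf => hσ.2.2.2 _ (hτ.2.2.2 f hf)⟩
  · rw [Module.End.mul_apply, ← sub_add_sub_cancel _ (σ (sx X 1)), ← map_sub]
    exact add_mem (hσ.2.2.1 _ hτ.1) hσ.1
  · rw [Module.End.mul_apply, ← sub_add_sub_cancel _ (σ phi), ← map_sub]
    exact add_mem (hσ.2.2.2 _ hτ.2.1) hσ.2.1

end SFam

/-! ### Reading off the coefficients of a vector field -/

/-- The coefficient of `L_n` in an operator. -/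
def coefL (n : ℤ) : Op →ₗ[ℂ] Formal where
  toFun T := -cX (n + 1) (nP (T (sx X 1)))
  map_add' S T := by rw [LinearMap.add_apply, map_add, map_add, neg_add]
  map_smul' c T := by rw [LinearMap.smul_apply, map_smul, map_smul, smul_neg, RingHom.id_apply]

/-- The coefficient of `G_{n-1/2}` in an operator. -/
def coefG (n : ℤ) : Op →ₗ[ℂ] Formal where
  toFun T := -cX n (nP (T phi))
  map_add' S T := by rw [LinearMap.add_apply, map_add, map_add, neg_add]
  map_smul' c T := by rw [LinearMap.smul_apply, map_smul, map_smul, smul_neg, RingHom.id_apply]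

lemma coefL_apply (n : ℤ) (T : Op) : coefL n T = -cX (n + 1) (nP (T (sx X 1))) :=
  rfl

lemma coefG_apply (n : ℤ) (T : Op) : coefG n T = -cX n (nP (T phi)) := rfl

lemma coefL_mem_I {n : ℤ} {m : ℕ} {T : Op} (hT : T ∈ K m) : coefL n T ∈ I m :=
  neg_mem (by
    simpa using cX_mem_K _ _ _ (nP_mem_K _ _ (apply_mem_I' hT (sx X 1))))

lemma coefG_mem_I {n : ℤ} {m : ℕ} {T : Op} (hT : T ∈ K m) : coefG n T ∈ I m :=
  neg_mem (by
    simpa using cX_mem_K _ _ _ (nP_mem_K _ _ (apply_mem_I' hT phi)))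

lemma cX_const_mul_sx {c : Formal} (hc : IsConst c) (k n : ℤ) :
    cX k (c * sx X n) = if k = n then c else 0 := by
  rw [cX_const_mul hc, cX_sx]
  split_ifs <;> simp

namespace SFam

variable (F : SFam)

lemma op_sx : F.op (sx X 1) = -csum (fun n => F.c n * sx X (n + 1))
    + csum (fun n => F.e n * (sx X n * phi)) := by
  rw [op_apply]
  simp only [L_sx, G_sx, mul_neg, csum_neg]

lemma op_phi : F.op phi = -csum (fun n => F.c n * ((((n : ℂ) + 1) / 2) • (sx X n * phi)))
    - csum (fun n => F.e n * sx X n) := by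
  rw [op_apply]
  simp only [L_phi, G_phi, mul_neg, csum_neg, sub_eq_add_neg]

lemma nP_sx_mul_phi (n : ℤ) : nP (sx X n * phi) = 0 := by
  rw [nP_apply, dPhi_sx_mul, dPhi_phi, mul_one, ← sx_comm, sub_self]

lemma nP_op_sx : nP (F.op (sx X 1)) = -csum (fun n => F.c n * sx X (n + 1)) := by
  rw [op_sx, map_add, map_neg, isCont_nP.map_csum (F.hc.locallyFinite.mul_left _),
    isCont_nP.map_csum (F.he.locallyFinite.mul_left _)]
  simp only [nP_const_mul (F.hc.formal _).isConst, nP_const_mul (F.he.formal _).isConst,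
    nP_sx_mul_phi, nP_sx, mul_zero, csum_zero, add_zero]

lemma nP_op_phi : nP (F.op phi) = -csum (fun n => F.e n * sx X n) := by
  rw [op_phi, map_sub, map_neg, isCont_nP.map_csum (F.hc.locallyFinite.mul_left _),
    isCont_nP.map_csum (F.he.locallyFinite.mul_left _)]
  simp only [nP_const_mul (F.hc.formal _).isConst, nP_const_mul (F.he.formal _).isConst,
    nP_sx_mul_phi, nP_sx, mul_zero, csum_zero, map_smul, smul_zero, neg_zero, zero_sub]

lemma coefL_op (n : ℤ) : coefL n F.op = F.c n := by
  rw [coefL_apply, nP_op_sx, map_neg, neg_neg,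
    (isCont_cX _).map_csum (F.hc.locallyFinite.mul_left _), csum_eq_single n]
  · rw [cX_const_mul_sx (F.hc.formal n).isConst, if_pos rfl]
  · intro m hm
    rw [cX_const_mul_sx (F.hc.formal m).isConst, if_neg (by omega)]

lemma coefG_op (n : ℤ) : coefG n F.op = F.e n := by
  rw [coefG_apply, nP_op_phi, map_neg, neg_neg,
    (isCont_cX _).map_csum (F.he.locallyFinite.mul_left _), csum_eq_single n]
  · rw [cX_const_mul_sx (F.he.formal n).isConst, if_pos rfl]
  · intro m hm
    rw [cX_const_mul_sx (F.he.formal m).isConst, if_neg (by omega)]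

end SFam

section Extract

variable {σ τ : Op} (hσ : IsSubst σ) (hτ : IsSubst τ)

include hσ hτ in
lemma isFormal_coefL_sub (n : ℤ) : IsFormal (coefL n (σ - τ)) := by
  refine IsFormal.neg ((isFormal_iff _).mpr ⟨isConst_cX_nP _ _, fun i => ?_⟩)
  have hx : dOdd (.zeta i) (sx X 1) = 0 := dOdd_laurentMono _ _
  rw [dOdd_cX, dOdd_nP (by rintro ⟨⟩), LinearMap.sub_apply, map_sub, hσ.zeta_comm, hτ.zeta_comm, hx]
  simp

include hσ hτ in
lemma isFormal_coefG_sub (n : ℤ) : IsFormal (coefG n (σ - τ)) := by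
  refine IsFormal.neg ((isFormal_iff _).mpr ⟨isConst_cX_nP _ _, fun i => ?_⟩)
  have hx : dOdd (.zeta i) phi = 0 := Gr.leftDeriv_gen_of_ne nofun
  rw [dOdd_cX, dOdd_nP (by rintro ⟨⟩), LinearMap.sub_apply, map_sub, hσ.zeta_comm, hτ.zeta_comm, hx]
  simp

variable (hI : σ - τ ∈ K 1)

/-- The vector field approximating the difference of two substitutions. -/
def extract : SFam where
  c n := coefL n (σ - τ)
  e n := coefG n (σ - τ)
  hc :=
    { formal := isFormal_coefL_sub hσ hτ
      parity := fun n => by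
        refine Gr.IsEven.neg ?_
        rw [isEven_iff, par_cX, par_nP, LinearMap.sub_apply, map_sub, hσ.par_comm, hτ.par_comm,
          par_sx]
      noConstantTerm := fun n => noConstantTerm_of_mem_I (coefL_mem_I hI)
      locallyFinite := ((locallyFinite_cX _).comp_injective (add_left_injective 1)).neg }
  he :=
    { formal := isFormal_coefG_sub hσ hτ
      parity := fun n => by
        refine Gr.IsOdd.neg ?_
        rw [isOdd_iff, par_cX, par_nP, LinearMap.sub_apply, map_sub, hσ.par_comm, hτ.par_comm,
          par_phi]
        simp only [map_neg, ← neg_sub', sub_neg_eq_add]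
        simp only [map_sub, map_add, map_neg]
        abel
      noConstantTerm := fun n => noConstantTerm_of_mem_I (coefG_mem_I hI)
      locallyFinite := (locallyFinite_cX _).neg }

lemma csum_cX_mul_sx (f : Formal) : csum (fun n => cX n f * sx X n) = f := by
  simp only [← sx_comm, csum_cX]

lemma extract_op_sx : (extract hσ hτ hI).op (sx X 1)
    = nP ((σ - τ) (sx X 1)) + phi * nP ((σ - τ) phi) := by
  rw [SFam.op_sx]
  congr 1
  · rw [← csum_neg]
    refine Eq.trans ?_ (csum_cX_mul_sx (nP ((σ - τ) (sx X 1))))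
    rw [csum_equiv (F := fun n => cX n (nP ((σ - τ) (sx X 1))) * sx X n) (Equiv.addRight 1)]
    refine csum_congr fun n => ?_
    change -(-_ * _) = _
    rw [neg_mul, neg_neg]
    rfl
  · have h : (nP ((σ - τ) phi)).IsOdd := by
      rw [isOdd_iff, par_nP, LinearMap.sub_apply, map_sub, hσ.par_comm, hτ.par_comm, par_phi]
      simp only [map_sub, map_neg]
      abel
    have h2 := csum_cX_mul_sx (nP ((σ - τ) phi))
    conv_rhs => rw [phi_comm, par_of_isOdd h, ← h2, neg_mul,
      csum_mul_right _ ((locallyFinite_cX _).mul_left _), ← csum_neg]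
    refine csum_congr fun n => ?_
    change -_ * _ = _
    rw [neg_mul, mul_assoc]

lemma extract_op_phi : (extract hσ hτ hI).op phi
    = (2 : ℂ)⁻¹ • (phi * dX (nP ((σ - τ) (sx X 1)))) + nP ((σ - τ) phi) := by
  rw [SFam.op_phi, sub_eq_add_neg]
  congr 1
  · have h2 := csum_cX_mul_sx (nP ((σ - τ) (sx X 1)))
    have h : (nP ((σ - τ) (sx X 1))).IsEven := by
      rw [isEven_iff, par_nP, LinearMap.sub_apply, map_sub, hσ.par_comm, hτ.par_comm, par_sx]
    have hl := isCont_dX.locallyFinite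
      ((locallyFinite_cX (nP ((σ - τ) (sx X 1)))).mul_left fun n => sx X n)
    conv_rhs => rw [← h2, isCont_dX.map_csum ((locallyFinite_cX _).mul_left _),
      csum_mul_left _ hl, csum_smul _ (hl.mul_right _), csum_equiv (Equiv.addRight (1 : ℤ))]
    rw [← csum_neg]
    refine csum_congr fun n => ?_
    change -(-_ * _) = (2 : ℂ)⁻¹ • (phi * dX (cX (n + 1) _ * sx X (n + 1)))
    rw [dX_mul, dX_cX, zero_mul, zero_add, dX_sx, neg_mul, neg_neg, add_sub_cancel_right,
      phi_comm, par_mul, par_cX, par_of_isEven h, map_smul, par_sx, mul_assoc, smul_mul_assoc,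
      mul_smul_comm, mul_smul_comm, smul_smul]
    congr 1
    push_cast
    ring
  · rw [← csum_neg]
    refine Eq.trans ?_ (csum_cX_mul_sx (nP ((σ - τ) phi)))
    refine csum_congr fun n => ?_
    change -(-_ * _) = _
    rw [neg_mul, neg_neg]

end Extract

end Formal

namespace Formal

/-! ### Successive approximation -/

section Approx

variable {σ τ : Op} (hσ : IsSubst σ) (hτ : IsSubst τ) (hI : σ - τ ∈ K 1)

lemma nP_phi_mul (f : Formal) : nP (phi * f) = 0 := by
  rw [nP_apply, dPhi_phi_mul, mul_sub, phi_mul_phi_mul, sub_zero, sub_self]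

lemma nP_dPhi (f : Formal) : nP (dPhi f) = dPhi f := by
  rw [nP_apply, dPhi_dPhi, mul_zero, sub_zero]

include hσ hτ in
/-- The relation between the components of the difference of two superconformal substitutions. -/
lemma defect_mem (hσ1 : σ - 1 ∈ K 1) (hτ1 : τ - 1 ∈ K 1) (hσ' : IsSuperconformal σ)
    (hτ' : IsSuperconformal τ) {n : ℕ} (hv : (σ - τ) phi ∈ I n) :
    dPhi ((σ - τ) (sx X 1)) - nP ((σ - τ) phi) ∈ I (n + 1) ∧
      dX (nP ((σ - τ) (sx X 1))) - (2 : ℂ) • dPhi ((σ - τ) phi) ∈ I (n + 1) := by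
  set u := (σ - τ) (sx X 1) with hu
  set v := (σ - τ) phi with hv'
  have hE : D u - v - phi * D v ∈ I (n + 1) := by
    have h1 : D u - v - phi * D v = v * D ((σ - 1) phi) + (τ - 1) phi * D v := by
      simp only [hu, hv', LinearMap.sub_apply, map_sub, hσ'.eq hσ, hτ'.eq hτ, Module.End.one_apply,
        D_phi]
      noncomm_ring
    rw [h1]
    refine add_mem (mul_mem_I hv ?_) ?_
    · simpa using D_mem_K _ _ (apply_mem_I' hσ1 phi)
    · rw [add_comm n 1]
      exact mul_mem_I (apply_mem_I' hτ1 phi) (by simpa using D_mem_K _ _ hv)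
  have h2 : nP (D u - v - phi * D v) = dPhi u - nP v := by
    rw [map_sub, map_sub, nP_phi_mul, D_apply, map_add, nP_phi_mul, nP_dPhi, add_zero, sub_zero]
  have h3 : dPhi (D u - v - phi * D v) = dX (nP u) - (2 : ℂ) • dPhi v := by
    have h4 : nP (D v) = dPhi v := by rw [D_apply, map_add, nP_phi_mul, nP_dPhi, add_zero]
    have h5 : nP (dX u) = dX (nP u) := by
      rw [nP_apply, nP_apply, map_sub, dX_phi_mul, dPhi_dX]
    rw [map_sub, map_sub, dPhi_phi_mul, ← nP_apply, h4, D_apply, map_add, dPhi_dPhi, dPhi_phi_mul,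
      ← nP_apply, h5, two_smul]
    abel
  rw [← h2, ← h3]
  exact ⟨nP_mem_K _ _ hE, dPhi_mem_K _ _ hE⟩

lemma extract_approx (hσ1 : σ - 1 ∈ K 1) (hτ1 : τ - 1 ∈ K 1) (hσ' : IsSuperconformal σ)
    (hτ' : IsSuperconformal τ) {n : ℕ} (hv : (σ - τ) phi ∈ I n) :
    (σ - τ) (sx X 1) - (extract hσ hτ hI).op (sx X 1) ∈ I (n + 1) ∧
      (σ - τ) phi - (extract hσ hτ hI).op phi ∈ I (n + 1) := by
  obtain ⟨h1, h2⟩ := defect_mem hσ hτ hσ1 hτ1 hσ' hτ' hv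
  rw [extract_op_sx, extract_op_phi]
  constructor
  · have : (σ - τ) (sx X 1) - (nP ((σ - τ) (sx X 1)) + phi * nP ((σ - τ) phi))
        = phi * (dPhi ((σ - τ) (sx X 1)) - nP ((σ - τ) phi)) := by
      rw [nP_apply ((σ - τ) (sx X 1)), mul_sub]
      abel
    rw [this]
    exact mul_mem_I_left _ h1
  · have : (σ - τ) phi - ((2 : ℂ)⁻¹ • (phi * dX (nP ((σ - τ) (sx X 1)))) + nP ((σ - τ) phi))
        = (-(2 : ℂ)⁻¹) • (phi * (dX (nP ((σ - τ) (sx X 1))) - (2 : ℂ) • dPhi ((σ - τ) phi))) := by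
      rw [nP_apply ((σ - τ) phi), mul_sub, mul_smul_comm]
      module
    rw [this]
    exact Submodule.smul_mem _ _ (mul_mem_I_left _ h2)

end Approx

/-- The limit of a sequence whose terms of a given degree eventually stabilize. -/
def lim (a : ℕ → Formal) : Formal := ofCf fun q => cf q (a (deg q))

lemma lim_sub_mem {a : ℕ → Formal} (h : ∀ m, a (m + 1) - a m ∈ I (m + 1)) (m : ℕ) :
    lim a - a m ∈ I (m + 1) := by
  have key : ∀ q j, cf q (a (deg q + j)) = cf q (a (deg q)) := by
    intro q j
    induction j with
    | zero => rfl
    | succ j ih =>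
      have := h (deg q + j) q (by omega)
      rw [map_sub, sub_eq_zero] at this
      rw [← add_assoc, this, ih]
  intro q hq
  obtain ⟨j, rfl⟩ := Nat.exists_eq_add_of_le (Nat.lt_succ_iff.mp hq)
  rw [map_sub, lim, cf_ofCf, key, sub_self]

namespace SFam

/-- All coefficients have degree at least `n`. -/
def Deg (F : SFam) (n : ℕ) : Prop := (∀ k, F.c k ∈ I n) ∧ ∀ k, F.e k ∈ I n

lemma Deg.neg {F : SFam} {n : ℕ} (h : F.Deg n) : (-F).Deg n :=
  ⟨fun k => neg_mem (h.1 k), fun k => neg_mem (h.2 k)⟩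

lemma Deg.op {F : SFam} {n : ℕ} (h : F.Deg n) : F.op ∈ K n := op_mem_K_of h.1 h.2

lemma Deg.restrict {F : SFam} {n : ℕ} (h : F.Deg n) (P Q : ℤ → Prop) [DecidablePred P]
    [DecidablePred Q] : (F.restrict P Q).Deg n :=
  ⟨fun k => by simp only [SFam.restrict]; split_ifs; exacts [h.1 k, Submodule.zero_mem _],
    fun k => by simp only [SFam.restrict]; split_ifs; exacts [h.2 k, Submodule.zero_mem _]⟩

lemma Deg.c_sub {F H : SFam} {n : ℕ} (h : (F + -H).Deg n) (k : ℤ) : F.c k - H.c k ∈ I n := by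
  rw [sub_eq_add_neg]
  exact h.1 k

lemma Deg.e_sub {F H : SFam} {n : ℕ} (h : (F + -H).Deg n) (k : ℤ) : F.e k - H.e k ∈ I n := by
  rw [sub_eq_add_neg]
  exact h.2 k

lemma restrict_add (F H : SFam) (P Q : ℤ → Prop) [DecidablePred P]
    [DecidablePred Q] : (F + H).restrict P Q = F.restrict P Q + H.restrict P Q :=
  ext (fun n => by simp only [SFam.restrict, add_c]; split_ifs <;> simp)
    fun n => by simp only [SFam.restrict, add_e]; split_ifs <;> simp

lemma neg_add' (F H : SFam) : -(F + H) = -F + -H :=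
  ext (fun n => neg_add _ _) fun n => neg_add _ _

lemma expE_add_op {F t : SFam} {n : ℕ} (hn : 1 ≤ n) (ht : t.Deg n) :
    expE (F + t).op - expE F.op - t.op ∈ K (n + 1) := by
  rw [op_add]
  exact expE_add_sub_mem F.op_mem_K hn ht.op

/-- The limit of a sequence of vector fields. -/
def limit (F : ℕ → SFam) (h : ∀ m, (F (m + 1) + -F m).Deg (m + 1)) : SFam where
  c k := lim fun m => (F m).c k
  e k := lim fun m => (F m).e k
  hc :=
    { formal := fun k => isFormal_of_forall fun n => ⟨_, (F n).hc.formal k,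
        I_anti (Nat.le_succ n) (lim_sub_mem (fun m => (h m).c_sub k) n)⟩
      parity := fun k => isEven_of_forall fun n => ⟨_, (F n).hc.parity k,
        I_anti (Nat.le_succ n) (lim_sub_mem (fun m => (h m).c_sub k) n)⟩
      noConstantTerm := fun k => (F (deg (∅, 0))).hc.noConstantTerm k
      locallyFinite := fun S d => (F (deg (S, d))).hc.locallyFinite S d }
  he :=
    { formal := fun k => isFormal_of_forall fun n => ⟨_, (F n).he.formal k,
        I_anti (Nat.le_succ n) (lim_sub_mem (fun m => (h m).e_sub k) n)⟩
      parity := fun k => isOdd_of_forall fun n => ⟨_, (F n).he.parity k,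
        I_anti (Nat.le_succ n) (lim_sub_mem (fun m => (h m).e_sub k) n)⟩
      noConstantTerm := fun k => (F (deg (∅, 0))).he.noConstantTerm k
      locallyFinite := fun S d => (F (deg (S, d))).he.locallyFinite S d }

lemma limit_sub_deg (F : ℕ → SFam) (h : ∀ m, (F (m + 1) + -F m).Deg (m + 1)) (m : ℕ) :
    (limit F h + -F m).Deg (m + 1) :=
  ⟨fun k => by
    have := lim_sub_mem (a := fun m => (F m).c k)
      (fun m => (h m).c_sub k) m
    rwa [sub_eq_add_neg] at this, fun k => by
    have := lim_sub_mem (a := fun m => (F m).e k)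
      (fun m => (h m).e_sub k) m
    rwa [sub_eq_add_neg] at this⟩

end SFam

/-- An equation between substitutions depending on a vector field is solvable if the difference of
its sides varies to leading order by the vector field itself. -/
lemma exists_solution {l r : SFam → Op} (hl : ∀ F, IsSubst (l F))
    (hr : ∀ F, IsSubst (r F)) (hl' : ∀ F, IsSuperconformal (l F))
    (hr' : ∀ F, IsSuperconformal (r F)) (hl1 : ∀ F, l F - 1 ∈ K 1) (hr1 : ∀ F, r F - 1 ∈ K 1)
    (hv : ∀ F t : SFam, ∀ n : ℕ, 1 ≤ n → t.Deg n →
      l (F + t) - r (F + t) - (l F - r F) - t.op ∈ K (n + 1))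
    {P Q : Set ℤ} (hs : ∀ F, F.Supp P Q →
      (∀ n ∉ P, coefL n (l F - r F) = 0) ∧ ∀ n ∉ Q, coefG n (l F - r F) = 0) :
    ∃ F, F.Supp P Q ∧ l F = r F := by
  have hlr : ∀ F, l F - r F ∈ K 1 := fun F => by
    have := sub_mem (hl1 F) (hr1 F)
    rwa [sub_sub_sub_cancel_right] at this
  let step : SFam → SFam := fun F => F + -extract (hl F) (hr F) (hlr F)
  let seq : ℕ → SFam := fun m => step^[m] 0
  have hseq : ∀ m, seq (m + 1) = seq m + -extract (hl (seq m)) (hr (seq m)) (hlr (seq m)) :=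
    fun m => Function.iterate_succ_apply' step m 0
  have hX : ∀ (F : SFam) n, (l F - r F) (sx X 1) ∈ I n → (l F - r F) phi ∈ I n →
      (extract (hl F) (hr F) (hlr F)).Deg n := fun F n hx hp =>
    ⟨fun k => neg_mem (by simpa using cX_mem_K _ _ _ (nP_mem_K _ _ hx)),
      fun k => neg_mem (by simpa using cX_mem_K _ _ _ (nP_mem_K _ _ hp))⟩
  have hdef : ∀ m, (l (seq m) - r (seq m)) (sx X 1) ∈ I (m + 1) ∧
      (l (seq m) - r (seq m)) phi ∈ I (m + 1) := by
    intro m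
    induction m with
    | zero => exact ⟨apply_mem_I' (hlr _) _, apply_mem_I' (hlr _) _⟩
    | succ m ih =>
      rw [hseq]
      set F := seq m
      have h1 := hv F _ (m + 1) (by omega) (hX F _ ih.1 ih.2).neg
      obtain ⟨h2, h3⟩ := extract_approx (hl F) (hr F) (hlr F) (hl1 F) (hr1 F) (hl' F) (hr' F) ih.2
      have h4 := add_mem (apply_mem_I' h1 (sx X 1)) h2
      have h5 := add_mem (apply_mem_I' h1 phi) h3
      simp only [LinearMap.sub_apply, SFam.op_neg, LinearMap.neg_apply] at h4 h5 ⊢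
      constructor
      · convert h4 using 1
        abel
      · convert h5 using 1
        abel
  have hdeg : ∀ m, (seq (m + 1) + -seq m).Deg (m + 1) := by
    intro m
    have h1 := (hX _ _ (hdef m).1 (hdef m).2).neg
    rw [hseq]
    refine ⟨fun k => ?_, fun k => ?_⟩
    · simpa only [SFam.add_c, SFam.neg_c, neg_add_cancel_comm, add_neg_cancel_comm] using h1.1 k
    · simpa only [SFam.add_e, SFam.neg_e, neg_add_cancel_comm, add_neg_cancel_comm] using h1.2 k
  have hsupp : ∀ m, (seq m).Supp P Q := by
    intro m
    induction m with
    | zero => exact ⟨fun _ _ => rfl, fun _ _ => rfl⟩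
    | succ m ih =>
      rw [hseq]
      exact ih.add (SFam.Supp.neg (hs _ ih))
  refine ⟨SFam.limit seq hdeg, ⟨fun n hn => ?_, fun n hn => ?_⟩, ?_⟩
  · refine cf_ext fun q => ?_
    change cf q ((seq (deg q)).c n) = _
    rw [(hsupp _).1 n hn]
  · refine cf_ext fun q => ?_
    change cf q ((seq (deg q)).e n) = _
    rw [(hsupp _).2 n hn]
  · have hfin : ∀ m f, (l (seq m) - r (seq m)) f ∈ I (m + 1) →
        (l (SFam.limit seq hdeg) - r (SFam.limit seq hdeg)) f ∈ I (m + 1) := by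
      intro m f hf
      have h1 := SFam.limit_sub_deg seq hdeg m
      have h2 : SFam.limit seq hdeg = seq m + (SFam.limit seq hdeg + -seq m) :=
        SFam.ext (fun k => (add_add_neg_cancel'_right _ _).symm)
          fun k => (add_add_neg_cancel'_right _ _).symm
      have h3 := I_anti (Nat.le_succ _) (apply_mem_I' (hv (seq m) _ (m + 1) (by omega) h1) f)
      rw [← h2] at h3
      have h4 := add_mem (add_mem h3 hf) (apply_mem_I' h1.op f)
      convert h4 using 1
      simp only [LinearMap.sub_apply]
      abel
    rw [← act_inj (hl _) (hr _), act, act, Prod.mk.injEq, ← sub_eq_zero, ← sub_eq_zero (b := r _ phi),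
      ← LinearMap.sub_apply, ← LinearMap.sub_apply]
    exact ⟨eq_zero_of_forall_mem_I fun n => I_anti (Nat.le_succ n) (hfin n _ (hdef n).1),
      eq_zero_of_forall_mem_I fun n => I_anti (Nat.le_succ n) (hfin n _ (hdef n).2)⟩

lemma mem_K_zero {T : Op} (hT : T - 1 ∈ K 1) : T ∈ K 0 := by
  have := add_mem (K_anti (Nat.zero_le 1) hT) one_mem_K
  rwa [sub_add_cancel] at this

lemma mul_sub_one_mem {S T : Op} (hS : S - 1 ∈ K 1) (hT : T - 1 ∈ K 1) :
    S * T - 1 ∈ K 1 := by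
  rw [show S * T - 1 = (S - 1) * T + (T - 1) by noncomm_ring]
  exact add_mem (mul_mem_K_right hS (mem_K_zero hT)) hT

lemma mul_variation {S T S' T' s t : Op} {n : ℕ} (hS : S - 1 ∈ K 1)
    (hT : T' - 1 ∈ K 1) (hs : s ∈ K n) (ht : t ∈ K n) (h1 : S' - S - s ∈ K (n + 1))
    (h2 : T' - T - t ∈ K (n + 1)) : S' * T' - S * T - (s + t) ∈ K (n + 1) := by
  rw [show S' * T' - S * T - (s + t)
    = (S' - S - s) * T' + S * (T' - T - t) + s * (T' - 1) + (S - 1) * t by noncomm_ring]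
  refine add_mem (add_mem (add_mem (mul_mem_K_right h1 (mem_K_zero hT))
    (mul_mem_K_left (mem_K_zero hS) h2)) (mul_mem_K hs hT)) ?_
  rw [add_comm n 1]
  exact mul_mem_K hS ht

namespace SFam

lemma expE_sub_one (F : SFam) : expE F.op - 1 ∈ K 1 := expE_sub_one_mem F.op_mem_K

/-- Substitutions tangent to the identity are exponentials of vector fields with positive indices. -/
lemma exists_log {σ : Op} (hσ : IsSubst σ) (hσ' : IsSuperconformal σ)
    (hσ1 : σ - 1 ∈ K 1) (ht : Tangent σ) : ∃ F : SFam, F.IsPos ∧ expE (-F).op = σ := by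
  refine (exists_solution (l := fun _ => σ) (r := fun F => expE (-F).op)
    (fun _ => hσ) (fun F => isSubst_expE _) (fun _ => hσ') (fun F => isSuperconformal_expE _)
    (fun _ => hσ1) (fun F => expE_sub_one _) (P := Set.Ioi 0) (Q := Set.Ioi 0) ?_ ?_).imp
    fun F hF => ⟨hF.1, hF.2.symm⟩
  · intro F t n hn ht
    have h1 := neg_mem (expE_add_op (F := -F) hn ht.neg)
    rw [← neg_add', op_neg t] at h1
    convert h1 using 1
    abel
  · intro F hF
    have h1 := IsPos.tangent hF.neg
    have h2 := sub_mem ht.1 h1.1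
    have h3 := sub_mem ht.2.1 h1.2.1
    rw [sub_sub_sub_cancel_right] at h2 h3
    refine ⟨fun n hn => ?_, fun n hn => ?_⟩
    · rw [coefL_apply, LinearMap.sub_apply, h2.1 _ (by simp at hn; omega), neg_zero]
    · rw [coefG_apply, LinearMap.sub_apply, h3.1 _ (by simp at hn; omega), neg_zero]

/-- The formal sewing equation in terms of operators is solvable. -/
lemma exists_sewing (A B : SFam) : ∃ F : SFam, expE F.neg'.op =
    expE A.op * (expE B.op * (expE (-F.zero').op * expE (-F.pos).op)) := by
  refine (exists_solution (l := fun F => expE F.neg'.op)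
    (r := fun F => expE A.op * (expE B.op * (expE (-F.zero').op * expE (-F.pos).op)))
    (fun F => isSubst_expE _) (fun F => (isSubst_expE _).mul ((isSubst_expE _).mul
      ((isSubst_expE _).mul (isSubst_expE _)))) (fun F => isSuperconformal_expE _)
    (fun F => (isSuperconformal_expE _).mul (isSubst_expE _) ((isSuperconformal_expE _).mul
      (isSubst_expE _) ((isSuperconformal_expE _).mul (isSubst_expE _) (isSuperconformal_expE _))))
    (fun F => expE_sub_one _) (fun F => mul_sub_one_mem (expE_sub_one _) (mul_sub_one_mem
      (expE_sub_one _) (mul_sub_one_mem (expE_sub_one _) (expE_sub_one _))))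
    (P := Set.univ) (Q := Set.univ) ?_
    (by simp)).imp fun F hF => hF.2
  · intro F t n hn ht
    have d1 : t.neg'.Deg n := ht.restrict _ _
    have d2 : (-t.zero').Deg n := (ht.restrict _ _).neg
    have d3 : (-t.pos).Deg n := (ht.restrict _ _).neg
    have h0 : ∀ S : Op, S - S - 0 ∈ K (n + 1) := fun S => by simp
    have hz : (0 : Op) ∈ K n := Submodule.zero_mem _
    have h1 := expE_add_op (F := F.neg') hn d1
    have h2 := expE_add_op (F := -F.zero') hn d2
    have h3 := expE_add_op (F := -F.pos) hn d3
    have h4 := mul_variation (expE_sub_one _) (expE_sub_one _) d2.op d3.op h2 h3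
    have hm := mul_sub_one_mem (expE_sub_one (-F.zero' + -t.zero')) (expE_sub_one (-F.pos + -t.pos))
    have hd := add_mem d2.op d3.op
    have h5 := mul_variation (expE_sub_one B) hm hz hd (h0 _) h4
    have h6 := mul_variation (expE_sub_one A) (mul_sub_one_mem (expE_sub_one B) hm) hz
      (add_mem hz hd) (h0 _) h5
    have h7 := sub_mem h1 h6
    have e : t.op = t.neg'.op + t.zero'.op + t.pos.op := by
      rw [← op_add, ← op_add, ← eq_add]
    rw [← neg_add', ← neg_add', op_neg t.zero', op_neg t.pos] at h7
    rw [show (F + t).neg' = F.neg' + t.neg' from restrict_add _ _ _ _,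
      show (F + t).zero' = F.zero' + t.zero' from restrict_add _ _ _ _,
      show (F + t).pos = F.pos + t.pos from restrict_add _ _ _ _, e]
    generalize expE (F.neg' + t.neg').op = x1 at h7 ⊢
    generalize expE A.op * (expE B.op * (expE (-(F.zero' + t.zero')).op *
      expE (-(F.pos + t.pos)).op)) = x2 at h7 ⊢
    generalize expE A.op * (expE B.op * (expE (-F.zero').op * expE (-F.pos).op)) = x3 at h7 ⊢
    generalize expE F.neg'.op = x4 at h7 ⊢
    convert h7 using 1
    abel

end SFam

end Formal

namespace Formal

namespace IsFamily

variable {ι : Type} {f : ι → Formal}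

lemma comp_injective {κ : Type} {P : Formal → Prop} (hf : IsFamily P f) {e : κ → ι}
    (he : Function.Injective e) : IsFamily P fun k => f (e k) where
  formal k := hf.formal _
  parity k := hf.parity _
  noConstantTerm k := hf.noConstantTerm _
  locallyFinite := hf.locallyFinite.comp_injective he

lemma neg_even (hf : IsFamily Gr.IsEven f) : IsFamily Gr.IsEven fun i => -f i :=
  hf.neg fun _ => Gr.IsEven.neg

lemma neg_odd (hf : IsFamily Gr.IsOdd f) : IsFamily Gr.IsOdd fun i => -f i :=
  hf.neg fun _ => Gr.IsOdd.neg

lemma smul_odd (hf : IsFamily Gr.IsOdd f) (c : ℂ) : IsFamily Gr.IsOdd fun i => c • f i :=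
  hf.smul (fun _ => c) fun _ s ha => ha.smul s

end IsFamily

lemma injective_coe : Function.Injective fun j : ℕ+ => (j : ℤ) :=
  fun i j h => PNat.eq (by simpa using h)

lemma injective_neg_coe : Function.Injective fun j : ℕ+ => -(j : ℤ) :=
  fun i j h => PNat.eq (by simpa using h)

lemma injective_one_sub_coe : Function.Injective fun j : ℕ+ => 1 - (j : ℤ) :=
  fun i j h => PNat.eq (by simpa using h)

end Formal

namespace SewingData

open Formal

/-- The conditions on the superseries in a solution of the formal sewing problem, other than the
equations. -/
structure Regular (S : SewingData) : Prop where
  psiEven : IsFamily Gr.IsEven S.psiEven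
  psiOdd : IsFamily Gr.IsOdd S.psiOdd
  phiEven : ∀ k, IsFamily Gr.IsEven (S.phiEven k)
  phiOdd : ∀ k, IsFamily Gr.IsOdd (S.phiOdd k)
  lam_formal : IsFormal S.lam
  lam_even : S.lam.IsEven

lemma IsSewing.regular {S : SewingData} (h : S.IsSewing) : S.Regular :=
  ⟨h.psiEven, h.psiOdd, h.phiEven, h.phiOdd, h.lam_formal, h.lam_even⟩

/-- `∑_{j ≥ 1} (𝒜^{(1)}_j L_j + ℳ^{(1)}_{j-1/2} G_{j-1/2})` for the variables of a side. -/
def zeroField (s : Side) : SFam := .ofPos (isFamily_evenVar s .zero) (isFamily_oddVar s .zero)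

/-- `∑_{j ≥ 1} (ℬ^{(0)}_j L_{-j} + 𝒩^{(0)}_{j-1/2} G_{-j+1/2})`. -/
def inftyField : SFam := .ofNeg (isFamily_evenVar .right .infty) (isFamily_oddVar .right .infty)

/-- `∑_{j ≥ 1} (𝒜^{(0)}_j L_j - i ℳ^{(0)}_{j-1/2} G_{j-1/2})`. -/
def inftyField' : SFam :=
  .ofPos (isFamily_evenVar .left .infty) ((isFamily_oddVar .left .infty).smul_odd Complex.I).neg_odd

namespace Regular

variable {S : SewingData} (h : S.Regular)

/-- The vector field `2 Ψ_0 L_0 + ∑_{n ≠ 0} Ψ_n L_n + ∑_n Ψ_{n-1/2} G_{n-1/2}`. -/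
def psi : SFam where
  c n := (if n = 0 then (2 : ℂ) else 1) • S.psiEven n
  e := S.psiOdd
  hc := h.psiEven.smul (fun n => if n = 0 then (2 : ℂ) else 1) fun _ s ha => ha.smul s
  he := h.psiOdd

lemma psi_c_zero : h.psi.c 0 = (2 : ℂ) • S.psiEven 0 := by
  change (if (0 : ℤ) = 0 then (2 : ℂ) else 1) • _ = _
  rw [if_pos rfl]

lemma psi_c {n : ℤ} (hn : n ≠ 0) : h.psi.c n = S.psiEven n := by
  change (if n = 0 then (2 : ℂ) else 1) • _ = _
  rw [if_neg hn, one_smul]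

lemma psi_e (n : ℤ) : h.psi.e n = S.psiOdd n := rfl

/-- The scalar `α e^{-Ψ_0}`. -/
def scalar : Scalar := sAlpha * .exp (h.psiEven.formal 0).neg (h.psiEven.parity 0).neg
  (neg_mem (h.psiEven.mem_I 0))

/-- The vector field with coefficients `Φ^{(1)}`. -/
def phiZero : SFam := .ofPos (h.phiEven .zero) (h.phiOdd .zero)

/-- The vector field with coefficients `Φ^{(0)}_j`, `-i Φ^{(0)}_{j-1/2}`. -/
def phiInfty : SFam := .ofPos (h.phiEven .infty) ((h.phiOdd .infty).smul_odd Complex.I).neg_odd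

/-- The vector field with coefficients `-Ψ_{-j}`, `i Ψ_{-j+1/2}`. -/
def psiInfty : SFam := .ofPos (h.psiEven.comp_injective injective_neg_coe).neg_even
  ((h.psiOdd.comp_injective injective_one_sub_coe).smul_odd Complex.I)

lemma F1_eq : S.F1 = act (expE h.psi.neg'.op) := by
  have h1 : ∀ f, expOp (negOp X (fun j => S.psiEven (-(j : ℤ))) fun j => S.psiOdd (1 - (j : ℤ))) f
      = expE h.psi.neg'.op f := by
    intro f
    rw [← expOp_eq h.psi.neg'.op_mem_K]
    congr 1
    funext g
    rw [← SFam.neg_op]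
    congr 1
    funext j
    rw [h.psi_c (by have := j.pos; omega)]
  rw [F1, applyPair, h1, h1]
  rfl

lemma expOp_psi_pos (f : Formal) :
    expOp (fun g => -posOp X (fun j => S.psiEven (j : ℤ)) (fun j => S.psiOdd (j : ℤ)) g) f
      = expE (-h.psi.pos).op f := by
  have h1 : (fun j : ℕ+ => S.psiEven (j : ℤ)) = fun j : ℕ+ => h.psi.c j :=
    funext fun j => (h.psi_c (by have := j.pos; omega)).symm
  have h2 : (fun j : ℕ+ => S.psiOdd (j : ℤ)) = fun j : ℕ+ => h.psi.e j := rfl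
  rw [h1, h2, SFam.expOp_pos]

lemma F2_eq : S.F2
    = act (expE (-h.psi.zero').op * (sAlpha⁻¹.scaleE * expE (-h.psi.pos).op)) := by
  have h1 : ∀ f, expOp (fun g => -((2 : ℂ) • (S.psiEven 0 * opL X 0 g))) f
      = expE (-h.psi.zero').op f := by
    intro f
    rw [← expOp_eq (-h.psi.zero').op_mem_K]
    congr 1
    funext g
    rw [SFam.op_neg, LinearMap.neg_apply, SFam.zero_op, psi_c_zero, smul_mul_assoc]
    rfl
  simp only [F2, applyPair, h.expOp_psi_pos, h1]
  rfl

lemma W_eq : W = act (expE (-inftyField).op) := by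
  have h1 : ∀ f, expOp (fun f => -negOp X (evenVar .right .infty) (oddVar .right .infty) f) f
      = expE (-inftyField).op f := by
    intro f
    rw [← expOp_eq (-inftyField).op_mem_K]
    congr 1
    funext g
    rw [SFam.op_neg, LinearMap.neg_apply, ← show inftyField.neg' = inftyField from SFam.neg_ofNeg _ _,
      ← SFam.neg_op]
    simp only [inftyField, SFam.ofNeg_c, SFam.ofNeg_e]
  simp only [W, applyPair, h1]
  rfl

lemma H1_eq : H1 = act (expE (-zeroField .left).op * sAlpha.scaleE) := by
  rw [H1, ehat_eq (isFamily_evenVar _ _) (isFamily_oddVar _ _)]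
  rfl

lemma twist_zero (F : SFam) (s : Scalar) : (-F.zero').twist s = -F.zero' := by
  refine SFam.ext (fun n => ?_) fun n => ?_
  · change s.pw (2 * n) * -(if n = 0 then F.c n else 0) = -(if n = 0 then F.c n else 0)
    split_ifs with hn
    · rw [hn, mul_zero, Scalar.pw_zero, one_mul]
    · rw [neg_zero, mul_zero]
  · change s.pw (2 * n - 1) * -(if False then F.e n else 0) = -(if False then F.e n else 0)
    rw [if_neg not_false, neg_zero, mul_zero]

lemma sewing_iff : S.F1 = compPair S.F2 (compPair W H1) ↔
    expE h.psi.neg'.op = expE (-zeroField .left).op * (expE (-inftyField.twist sAlpha).op *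
      (expE (-h.psi.zero').op * expE (-h.psi.pos).op)) := by
  have hH : IsSubst (expE (-zeroField .left).op * sAlpha.scaleE) :=
    (isSubst_expE _).mul sAlpha.isSubst_scaleE
  have hW := hH.mul (isSubst_expE (-inftyField))
  rw [h.F1_eq, h.F2_eq, W_eq, H1_eq, compPair_act hH, compPair_act hW, act_inj (isSubst_expE _)
    (hW.mul ((isSubst_expE _).mul (Scalar.isSubst_scaleE _ |>.mul (isSubst_expE _))))]
  have key : expE (-zeroField .left).op * sAlpha.scaleE * expE (-inftyField).op *
      (expE (-h.psi.zero').op * (sAlpha⁻¹.scaleE * expE (-h.psi.pos).op))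
      = expE (-zeroField .left).op * (expE (-inftyField.twist sAlpha).op *
      (expE (-h.psi.zero').op * expE (-h.psi.pos).op)) := by
    rw [mul_assoc (expE (-zeroField .left).op), SFam.scaleE_expE, SFam.twist_neg]
    simp only [mul_assoc]
    rw [← mul_assoc sAlpha.scaleE, SFam.scaleE_expE, twist_zero]
    simp only [mul_assoc]
    rw [← mul_assoc sAlpha.scaleE, Scalar.scaleE_mul_inv, one_mul]
  rw [key]

lemma infty_iff : (Etilde X (S.phiEven .infty) (fun j => -(Complex.I • S.phiOdd .infty j)) =
    compPair
      (Etilde X (evenVar .left .infty) fun j => -(Complex.I • oddVar .left .infty j))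
      (Etilde X (fun j => -S.psiEven (-(j : ℤ))) fun j => Complex.I • S.psiOdd (1 - (j : ℤ)))) ↔
    expE (-h.phiInfty).op = expE (-h.psiInfty).op * expE (-inftyField').op := by
  rw [etilde_eq (h.phiEven .infty) ((h.phiOdd .infty).smul_odd Complex.I).neg_odd,
    etilde_eq (isFamily_evenVar .left .infty)
      ((isFamily_oddVar .left .infty).smul_odd Complex.I).neg_odd,
    etilde_eq (h.psiEven.comp_injective injective_neg_coe).neg_even
      ((h.psiOdd.comp_injective injective_one_sub_coe).smul_odd Complex.I),
    compPair_act (isSubst_expE _), act_inj (isSubst_expE _) ((isSubst_expE _).mul (isSubst_expE _))]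
  rfl

lemma neg_pos_psi : (-SFam.ofPos (h.psiEven.comp_injective injective_coe).neg_even
    (h.psiOdd.comp_injective injective_coe).neg_odd) = h.psi.pos := by
  refine SFam.ext (fun n => ?_) fun n => ?_
  · change -(if 0 < n then -S.psiEven (n.toNat.toPNat' : ℕ+) else 0) = if 0 < n then h.psi.c n else 0
    split_ifs with hn
    · rw [neg_neg, h.psi_c hn.ne']
      congr 1
      simp; omega
    · rw [neg_zero]
  · change -(if 0 < n then -S.psiOdd (n.toNat.toPNat' : ℕ+) else 0) = if 0 < n then h.psi.e n else 0
    split_ifs with hn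
    · rw [neg_neg, h.psi_e]
      congr 1
      simp; omega
    · rw [neg_zero]

lemma lam_coeff {c : Formal} (hc : IsConst c) (hc' : c.IsEven) {σ : Formal.Op}
    (hσ : IsSubst σ) (ht : SFam.Tangent σ) : cX 0 (dPhi (σ (c * phi))) = c := by
  have h1 := ht.2.1.2 0 one_pos
  rw [map_sub, map_sub, dPhi_phi, cX_one, if_pos rfl, sub_eq_zero] at h1
  rw [hσ.map_const_mul hc, Scalar.dPhi_const_mul hc, par_of_isEven hc', cX_const_mul hc, h1, mul_one]

lemma zero_iff : (Ehat S.lam (S.phiEven .zero) (S.phiOdd .zero) =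
    compPair
      (Ehat (beta 1) (evenVar .right .zero) (oddVar .right .zero))
      (Ehat (alpha 1 * Formal.exp (-S.psiEven 0)) (fun j => -S.psiEven (j : ℤ))
        fun j => -S.psiOdd (j : ℤ))) ↔
    S.lam = (h.scalar * sBeta).u ∧ expE (-h.phiZero).op
      = expE h.psi.pos.op * expE (-(zeroField .right).twist h.scalar).op := by
  have hB : Ehat (beta 1) (evenVar .right .zero) (oddVar .right .zero)
      = act (expE (-zeroField .right).op * sBeta.scaleE) := by
    rw [ehat_eq (isFamily_evenVar _ _) (isFamily_oddVar _ _)]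
    rfl
  have hP : Ehat (alpha 1 * Formal.exp (-S.psiEven 0)) (fun j => -S.psiEven (j : ℤ))
      (fun j => -S.psiOdd (j : ℤ)) = act (expE h.psi.pos.op * h.scalar.scaleE) := by
    rw [ehat_eq (h.psiEven.comp_injective injective_coe).neg_even
      (h.psiOdd.comp_injective injective_coe).neg_odd, h.neg_pos_psi]
    rfl
  have hs : IsSubst (expE h.psi.pos.op * h.scalar.scaleE) :=
    (isSubst_expE _).mul (Scalar.isSubst_scaleE _)
  have ht : SFam.Tangent (expE h.psi.pos.op * expE (-(zeroField .right).twist h.scalar).op) :=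
    (SFam.IsPos.tangent h.psi.isPos_pos).mul
      (SFam.IsPos.tangent (SFam.IsPos.twist (SFam.isPos_ofPos _ _) _).neg)
  have hr : compPair (act (expE (-zeroField .right).op * sBeta.scaleE))
      (act (expE h.psi.pos.op * h.scalar.scaleE))
      = act (expE h.psi.pos.op * expE (-(zeroField .right).twist h.scalar).op *
        (h.scalar * sBeta).scaleE) := by
    rw [compPair_act hs, ← Scalar.scaleE_mul_scaleE]
    congr 1
    simp only [mul_assoc]
    rw [← mul_assoc (h.scalar.scaleE), SFam.scaleE_expE, SFam.twist_neg]
    simp only [mul_assoc]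
  rw [hB, hP, hr, ehat_eq (h.phiEven .zero) (h.phiOdd .zero)]
  constructor
  · intro he
    have h1 := congrArg Prod.snd he
    simp only [act, Module.End.mul_apply, comp_phi, Scalar.scaleE_phi, Scalar.pw_one] at h1
    have h2 := congrArg (fun f => cX 0 (dPhi f)) h1
    have h3 := lam_coeff (h.scalar * sBeta).formal.isConst (h.scalar * sBeta).even
      ((isSubst_expE h.psi.pos).mul (isSubst_expE (-(zeroField .right).twist h.scalar))) ht
    rw [Module.End.mul_apply] at h3
    beta_reduce at h2
    rw [h3, lam_coeff h.lam_formal.isConst h.lam_even (isSubst_expE _)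
      (SFam.IsPos.tangent (SFam.isPos_ofPos _ _).neg)] at h2
    refine ⟨h2, ?_⟩
    rw [h2] at he
    have h4 : expE (-h.phiZero).op * (h.scalar * sBeta).scaleE = expE h.psi.pos.op *
        expE (-(zeroField .right).twist h.scalar).op * (h.scalar * sBeta).scaleE :=
      (act_inj ((isSubst_expE _).mul (Scalar.isSubst_scaleE _))
        (((isSubst_expE _).mul (isSubst_expE _)).mul (Scalar.isSubst_scaleE _))).mp he
    have h5 := congrArg (· * ((h.scalar * sBeta)⁻¹).scaleE) h4
    simpa only [mul_assoc, Scalar.scaleE_mul_inv, mul_one] using h5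
  · rintro ⟨h1, h2⟩
    rw [← h2, h1]
    rfl

end Regular

/-- The formal sewing problem is solvable. -/
lemma exists_isSewing : ∃ S : SewingData, S.IsSewing := by
  obtain ⟨F, hF⟩ := SFam.exists_sewing (-zeroField .left) (-inftyField.twist sAlpha)
  have hE : IsFamily Gr.IsEven fun n : ℤ => (if n = 0 then (2 : ℂ)⁻¹ else 1) • F.c n :=
    F.hc.smul (fun n => if n = 0 then (2 : ℂ)⁻¹ else 1) fun _ s ha => ha.smul s
  let S0 : SewingData := ⟨fun n => (if n = 0 then (2 : ℂ)⁻¹ else 1) • F.c n, F.e, 1, 0, 0⟩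
  have h0 : S0.Regular := ⟨hE, F.he, fun _ => .of_zero Gr.isEven_zero, fun _ => .of_zero Gr.isOdd_zero,
    isFormal_one, Gr.isEven_one⟩
  have hpos : ∀ A B : SFam, A.IsPos → B.IsPos → ∃ H : SFam, H.IsPos ∧
      expE (-H).op = expE A.op * expE B.op := fun A B hA hB =>
    SFam.exists_log ((isSubst_expE _).mul (isSubst_expE _)) ((isSuperconformal_expE _).mul
      (isSubst_expE _) (isSuperconformal_expE _)) (mul_sub_one_mem (SFam.expE_sub_one _)
      (SFam.expE_sub_one _)) (hA.tangent.mul hB.tangent)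
  obtain ⟨Z, hZ, hZ'⟩ := hpos h0.psi.pos (-(zeroField .right).twist h0.scalar) (SFam.isPos_pos _)
    (SFam.IsPos.twist (SFam.isPos_ofPos _ _) _).neg
  obtain ⟨Y, hY, hY'⟩ := hpos (-h0.psiInfty) (-inftyField') (SFam.isPos_ofPos _ _).neg
    (SFam.isPos_ofPos _ _).neg
  let S : SewingData := ⟨S0.psiEven, S0.psiOdd, (h0.scalar * sBeta).u,
    fun k j => match k with | .infty => Y.c j | .zero => Z.c j,
    fun k j => match k with | .infty => Complex.I • Y.e j | .zero => Z.e j⟩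
  have h : S.Regular :=
    { psiEven := hE
      psiOdd := F.he
      phiEven := fun k => match k with
        | .infty => Y.hc.comp_injective injective_coe
        | .zero => Z.hc.comp_injective injective_coe
      phiOdd := fun k => match k with
        | .infty => (Y.he.comp_injective injective_coe).smul_odd Complex.I
        | .zero => Z.he.comp_injective injective_coe
      lam_formal := (h0.scalar * sBeta).formal
      lam_even := (h0.scalar * sBeta).even }
  have hcoe : ∀ {n : ℤ}, 0 < n → ((n.toNat.toPNat' : ℕ+) : ℤ) = n := fun {n} hn => by simp; omega
  have hpsi : h.psi = F := by
    refine SFam.ext (fun n => ?_) fun n => rfl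
    change (if n = 0 then (2 : ℂ) else 1) • (if n = 0 then (2 : ℂ)⁻¹ else 1) • F.c n = F.c n
    split_ifs <;> simp [smul_smul]
  have hZp : h.phiZero = Z := by
    refine SFam.ext (fun n => ?_) fun n => ?_
    · change (if 0 < n then Z.c (n.toNat.toPNat' : ℕ+) else 0) = _
      split_ifs with hn
      · rw [hcoe hn]
      · exact (hZ.1 n hn).symm
    · change (if 0 < n then Z.e (n.toNat.toPNat' : ℕ+) else 0) = _
      split_ifs with hn
      · rw [hcoe hn]
      · exact (hZ.2 n hn).symm
  have hYp : h.phiInfty = Y := by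
    refine SFam.ext (fun n => ?_) fun n => ?_
    · change (if 0 < n then Y.c (n.toNat.toPNat' : ℕ+) else 0) = _
      split_ifs with hn
      · rw [hcoe hn]
      · exact (hY.1 n hn).symm
    · change (if 0 < n then -(Complex.I • (Complex.I • Y.e (n.toNat.toPNat' : ℕ+))) else 0) = _
      split_ifs with hn
      · rw [hcoe hn, smul_smul, Complex.I_mul_I, neg_smul, one_smul, neg_neg]
      · exact (hY.2 n hn).symm
  refine ⟨S, ⟨h.1, h.2, h.3, h.4, h.5, h.6, ?_, ?_, ?_⟩⟩
  · rw [h.sewing_iff, hpsi]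
    exact hF
  · rw [h.infty_iff, hYp]
    exact hY'
  · rw [h.zero_iff, hZp]
    exact ⟨rfl, hZ'⟩

end SewingData

namespace Formal

/-! ### Second order expansions -/

/-- `S = 1 + s + s'` up to terms raising the degree by at least three. -/
structure Quad (S s s' : Op) : Prop where
  h1 : s ∈ K 1
  h2 : s' ∈ K 2
  h3 : S - (1 + s + s') ∈ K 3

namespace Quad

variable {S T s s' t t' : Op}

lemma mul (hS : Quad S s s') (hT : Quad T t t') : Quad (S * T) (s + t) (s' + t' + s * t) := by
  refine ⟨add_mem hS.h1 hT.h1,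
    add_mem (add_mem hS.h2 hT.h2) (mul_mem_K hS.h1 hT.h1), ?_⟩
  have h0 : ∀ {S s s' : Op}, Quad S s s' → S ∈ K 0 := fun {S s s'} h => by
    have h4 := add_mem (add_mem (add_mem
      (K_anti (Nat.zero_le 3) h.h3) one_mem_K) (K_anti (Nat.zero_le 1) h.h1))
      (K_anti (Nat.zero_le 2) h.h2)
    convert h4 using 1
    abel
  have e : S * T - (1 + (s + t) + (s' + t' + s * t))
      = (S - (1 + s + s')) * T + (T - (1 + t + t')) + s * (T - (1 + t + t'))
        + s' * (T - (1 + t + t')) + s * t' + s' * t + s' * t' := by noncomm_ring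
  rw [e]
  refine add_mem (add_mem (add_mem (add_mem
    (add_mem (add_mem ?_ ?_) ?_) ?_) ?_) ?_) ?_
  · exact mul_mem_K_right hS.h3 (h0 hT)
  · exact hT.h3
  · exact mul_mem_K_left (K_anti (Nat.zero_le 1) hS.h1) hT.h3
  · exact mul_mem_K_left (K_anti (Nat.zero_le 2) hS.h2) hT.h3
  · exact mul_mem_K hS.h1 hT.h2
  · exact mul_mem_K hS.h2 hT.h1
  · exact K_anti (by norm_num) (mul_mem_K hS.h2 hT.h2)

lemma exp (hT : T ∈ K 1) : Quad (expE T) T ((2 : ℂ)⁻¹ • (T * T)) :=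
  ⟨hT, Submodule.smul_mem _ _ (mul_mem_K hT hT), expE_sub_quadratic_mem hT⟩

lemma sub_mem (hS : Quad S s s') (hT : Quad S t t') : s + s' - (t + t') ∈ K 3 := by
  have := _root_.sub_mem hT.h3 hS.h3
  convert this using 1
  abel

lemma linear_sub_mem (hS : Quad S s s') (hT : Quad S t t') : s - t ∈ K 2 := by
  have := _root_.sub_mem (_root_.sub_mem (K_anti (show 2 ≤ 3 by norm_num)
    (hS.sub_mem hT)) hS.h2) (neg_mem hT.h2)
  convert this using 1
  abel

end Quad

/-- The Baker–Campbell–Hausdorff formula to second order. -/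
lemma bch_mem {c q b : Op} (hc : c ∈ K 1) (hq : q ∈ K 1) (hb : b ∈ K 1)
    (h : expE (-c) = expE q * expE (-b)) :
    c - (b - q + (2 : ℂ)⁻¹ • (q * b - b * q)) ∈ K 3 := by
  have h1 := Quad.exp (neg_mem hc)
  have h2 := (Quad.exp hq).mul (Quad.exp (neg_mem hb))
  rw [← h] at h2
  have h3 := h1.linear_sub_mem h2
  have h4 := h1.sub_mem h2
  obtain ⟨e, he⟩ : ∃ e, e = -c - (q + -b) := ⟨_, rfl⟩
  rw [← he] at h3
  have hc' : c = b - q - e := by rw [he]; abel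
  have h5 : c - (b - q + (2 : ℂ)⁻¹ • (q * b - b * q))
      = -(-c + (2 : ℂ)⁻¹ • (-c * -c) - (q + -b + ((2 : ℂ)⁻¹ • (q * q) + (2 : ℂ)⁻¹ • (-b * -b)
        + q * -b))) + (2 : ℂ)⁻¹ • (e * e - e * (b - q) - (b - q) * e) := by
    rw [hc']
    simp only [mul_sub, sub_mul, neg_mul, mul_neg, neg_neg, smul_sub, smul_add, neg_sub]
    module
  rw [h5]
  refine add_mem (neg_mem h4) (Submodule.smul_mem _ _ ?_)
  have hbq := _root_.sub_mem hb hq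
  exact _root_.sub_mem (_root_.sub_mem (K_anti (by norm_num) (mul_mem_K h3 h3))
    (mul_mem_K h3 hbq)) (mul_mem_K hbq h3)

lemma sewing_identity {R : Type*} [Ring R] [Algebra ℂ R] (z e d p b : R) :
    (d - b) + z + (e - p) - (-(p + b) + (p * b - b * p))
      = ((d - b) + (2 : ℂ)⁻¹ • ((d - b) * (d - b)) - (-p + (-b + (-z + -(e - p))) +
          ((2 : ℂ)⁻¹ • (-p * -p) + ((2 : ℂ)⁻¹ • (-b * -b) + ((2 : ℂ)⁻¹ • (-z * -z) +
            (2 : ℂ)⁻¹ • (-(e - p) * -(e - p)) + -z * -(e - p)) +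
            -b * (-z + -(e - p))) + -p * (-b + (-z + -(e - p))))))
        + (-(2 : ℂ)⁻¹) • (d * d - d * b - b * d) + (2 : ℂ)⁻¹ • (e * e - e * p + p * e)
        + b * e + ((2 : ℂ)⁻¹ • (z * z) + z * (e - p) + b * z + p * z) := by
  simp only [mul_sub, sub_mul, neg_mul, mul_neg, neg_neg, mul_add, add_mul, neg_sub]
  module

lemma sewing_remainder_mem {z e d p b : Op} (hz : z ∈ K 2) (he : e ∈ K 2)
    (hd : d ∈ K 2) (hp : p ∈ K 1) (hb : b ∈ K 1) :
    (-(2 : ℂ)⁻¹) • (d * d - d * b - b * d) + (2 : ℂ)⁻¹ • (e * e - e * p + p * e)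
        + b * e + ((2 : ℂ)⁻¹ • (z * z) + z * (e - p) + b * z + p * z) ∈ K 3 := by
  have hz1 : z ∈ K 1 := K_anti (by norm_num) hz
  have he1 : e ∈ K 1 := K_anti (by norm_num) he
  have hd1 : d ∈ K 1 := K_anti (by norm_num) hd
  have h12 : ∀ {s t : Op}, s ∈ K 1 → t ∈ K 2 → s * t ∈ K 3 := fun hs ht =>
    mul_mem_K hs ht
  have h21 : ∀ {s t : Op}, s ∈ K 2 → t ∈ K 1 → s * t ∈ K 3 := fun hs ht =>
    mul_mem_K hs ht
  refine add_mem (add_mem (add_mem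
    (Submodule.smul_mem _ _ ?_) (Submodule.smul_mem _ _ ?_)) (h12 hb he)) ?_
  · exact _root_.sub_mem (_root_.sub_mem (h12 hd1 hd) (h21 hd hb)) (h12 hb hd)
  · exact add_mem (_root_.sub_mem (h12 he1 he) (h21 he hp)) (h12 hp he)
  · exact add_mem (add_mem (add_mem (Submodule.smul_mem _ _
      (h12 hz1 hz)) (h21 hz (_root_.sub_mem he1 hp))) (h12 hb hz)) (h12 hp hz)

lemma sewing_mem_of_remainder {R : Type*} [Ring R] [Algebra ℂ R] {V : Submodule ℂ R}
    {n z q p b : R} (h : n + (2 : ℂ)⁻¹ • (n * n) - (-p + (-b + (-z + -q)) +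
          ((2 : ℂ)⁻¹ • (-p * -p) + ((2 : ℂ)⁻¹ • (-b * -b) + ((2 : ℂ)⁻¹ • (-z * -z) +
            (2 : ℂ)⁻¹ • (-q * -q) + -z * -q) + -b * (-z + -q)) + -p * (-b + (-z + -q)))) ∈ V)
    (h2 : (-(2 : ℂ)⁻¹) • ((n + b) * (n + b) - (n + b) * b - b * (n + b))
        + (2 : ℂ)⁻¹ • ((q + p) * (q + p) - (q + p) * p + p * (q + p))
        + b * (q + p) + ((2 : ℂ)⁻¹ • (z * z) + z * q + b * z + p * z) ∈ V) :
    n + z + q - (-(p + b) + (p * b - b * p)) ∈ V := by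
  have h6 := sewing_identity z (q + p) (n + b) p b
  rw [add_sub_cancel_right, add_sub_cancel_right] at h6
  rw [h6]
  simpa only [add_assoc] using V.add_mem h h2

/-- The solution of the formal sewing equation to second order. -/
lemma sewing_mem {n z q p b : Op} (hn : n ∈ K 1) (hz : z ∈ K 2) (hq : q + p ∈ K 2)
    (hp : p ∈ K 1) (hb : b ∈ K 1) (hn' : n + b ∈ K 2)
    (h : expE n = expE (-p) * (expE (-b) * (expE (-z) * expE (-q)))) :
    n + z + q - (-(p + b) + (p * b - b * p)) ∈ K 3 := by
  have hz1 : z ∈ K 1 := K_anti one_le_two hz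
  have hq1 : q ∈ K 1 := by
    have := _root_.sub_mem (K_anti one_le_two hq) hp
    rwa [add_sub_cancel_right] at this
  have h1 := Quad.exp hn
  have h2 := (Quad.exp (neg_mem hp)).mul ((Quad.exp (neg_mem hb)).mul
    ((Quad.exp (neg_mem hz1)).mul (Quad.exp (neg_mem hq1))))
  rw [← h] at h2
  have h5 := sewing_remainder_mem hz hq hn' hp hb
  rw [add_sub_cancel_right] at h5
  exact sewing_mem_of_remainder (h1.sub_mem h2) h5

lemma sewing_linear_mem {n z q p b : Op} (hn : n ∈ K 1) (hz : z ∈ K 1)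
    (hq : q ∈ K 1) (hp : p ∈ K 1) (hb : b ∈ K 1)
    (h : expE n = expE (-p) * (expE (-b) * (expE (-z) * expE (-q)))) :
    n + z + q + p + b ∈ K 2 := by
  have h1 := Quad.exp hn
  have h2 := (Quad.exp (neg_mem hp)).mul ((Quad.exp (neg_mem hb)).mul
    ((Quad.exp (neg_mem hz)).mul (Quad.exp (neg_mem hq))))
  rw [← h] at h2
  have h3 := h1.linear_sub_mem h2
  convert h3 using 1
  abel

lemma SFam.deg_of_op {F : SFam} {n : ℕ} (h : F.op ∈ K n) : F.Deg n :=
  ⟨fun k => by rw [← F.coefL_op]; exact coefL_mem_I h,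
    fun k => by rw [← F.coefG_op]; exact coefG_mem_I h⟩

lemma mul_sub_mul_mem {s s' t t' : Op} {n : ℕ} (hs : s - s' ∈ K n)
    (ht : t - t' ∈ K n) (h1 : s ∈ K 1) (h2 : t' ∈ K 1) : s * t - s' * t' ∈ K (n + 1) := by
  have e : s * t - s' * t' = s * (t - t') + (s - s') * t' := by noncomm_ring
  rw [e]
  refine add_mem ?_ (mul_mem_K hs h2)
  rw [add_comm]
  exact mul_mem_K h1 ht

lemma comm_sub_comm_mem {s s' t t' : Op} {n : ℕ} (hs : s - s' ∈ K n)
    (ht : t - t' ∈ K n) (h1 : s ∈ K 1) (h2 : t ∈ K 1) (h3 : s' ∈ K 1) (h4 : t' ∈ K 1) :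
    (s * t - t * s) - (s' * t' - t' * s') ∈ K (n + 1) := by
  have := _root_.sub_mem (mul_sub_mul_mem hs ht h1 h4) (mul_sub_mul_mem ht hs h2 h3)
  convert this using 1
  abel

end Formal

namespace SewingData

open Formal

/-- `∑_{j ≥ 1} (ℬ^{(0)}_j L_j - i 𝒩^{(0)}_{j-1/2} G_{j-1/2})`. -/
def inftyFieldRight : SFam :=
  .ofPos (isFamily_evenVar .right .infty) ((isFamily_oddVar .right .infty).smul_odd Complex.I).neg_odd

lemma zeroField_isPos (s : Side) : (zeroField s).IsPos := SFam.isPos_ofPos _ _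

namespace Regular

variable {S : SewingData} (h : S.Regular) (hS : S.IsSewing)

/-- The commutator of the vector fields of the local coordinates to be sewn. -/
def sewComm : Formal.Op :=
  (zeroField .left).op * (inftyField.twist sAlpha).op
    - (inftyField.twist sAlpha).op * (zeroField .left).op

lemma sewComm_mem : sewComm ∈ K 2 :=
  _root_.sub_mem (mul_mem_K (SFam.op_mem_K _) (SFam.op_mem_K _))
    (mul_mem_K (SFam.op_mem_K _) (SFam.op_mem_K _))

include h hS in
lemma sewing_op : expE h.psi.neg'.op = expE (-(zeroField .left).op) *
    (expE (-(inftyField.twist sAlpha).op) * (expE (-h.psi.zero'.op) * expE (-h.psi.pos.op))) := by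
  have := h.sewing_iff.mp hS.sewing
  simpa only [SFam.op_neg] using this

lemma psi_op : h.psi.op = h.psi.neg'.op + h.psi.zero'.op + h.psi.pos.op := by
  rw [← SFam.op_add, ← SFam.op_add, ← SFam.eq_add]

include h hS in
lemma psi_linear : (h.psi + (zeroField .left + inftyField.twist sAlpha)).Deg 2 := by
  refine SFam.deg_of_op ?_
  rw [SFam.op_add, SFam.op_add, psi_op]
  have := sewing_linear_mem (SFam.op_mem_K _) (SFam.op_mem_K _) (SFam.op_mem_K _) (SFam.op_mem_K _)
    (SFam.op_mem_K _) (h.sewing_op hS)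
  convert this using 1
  abel

include h hS in
lemma pos_add_mem : h.psi.pos.op + (zeroField .left).op ∈ K 2 := by
  have hd := h.psi_linear hS
  rw [← SFam.op_add]
  refine SFam.op_mem_K_of (fun n => ?_) fun n => ?_
  · have h1 := hd.1 n
    change h.psi.c n + ((zeroField .left).c n + sAlpha.pw _ *
      (if n < 0 then evenVar .right .infty _ else 0)) ∈ I 2 at h1
    change (if 0 < n then h.psi.c n else 0) + (zeroField .left).c n ∈ I 2
    split_ifs with hn
    · rwa [if_neg (by omega), mul_zero, add_zero] at h1
    · simp [(zeroField_isPos _).1 n hn]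
  · have h1 := hd.2 n
    change h.psi.e n + ((zeroField .left).e n + sAlpha.pw _ *
      (if n ≤ 0 then oddVar .right .infty _ else 0)) ∈ I 2 at h1
    change (if 0 < n then h.psi.e n else 0) + (zeroField .left).e n ∈ I 2
    split_ifs with hn
    · rwa [if_neg (by omega), mul_zero, add_zero] at h1
    · simp [(zeroField_isPos _).2 n hn]

include h hS in
lemma psi_quadratic : h.psi.op - (-((zeroField .left).op + (inftyField.twist sAlpha).op)
    + sewComm) ∈ K 3 := by
  have hd := h.psi_linear hS
  rw [psi_op]
  refine sewing_mem (SFam.op_mem_K _) ?_ (h.pos_add_mem hS) (SFam.op_mem_K _) (SFam.op_mem_K _) ?_ (h.sewing_op hS)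
  · refine SFam.op_mem_K_of (fun n => ?_) fun n => ?_
    · change (if n = 0 then h.psi.c n else 0) ∈ I 2
      split_ifs with hn
      · have h1 := hd.1 n
        subst hn
        change h.psi.c 0 + (0 + sAlpha.pw _ * 0) ∈ I 2 at h1
        rwa [mul_zero, add_zero, add_zero] at h1
      · exact Submodule.zero_mem _
    · exact Submodule.zero_mem _
  · rw [← SFam.op_add]
    refine SFam.op_mem_K_of (fun n => ?_) fun n => ?_
    · have h1 := hd.1 n
      change h.psi.c n + ((zeroField .left).c n + sAlpha.pw _ *
        (if n < 0 then evenVar .right .infty _ else 0)) ∈ I 2 at h1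
      change (if n < 0 then h.psi.c n else 0) + sAlpha.pw _ *
        (if n < 0 then evenVar .right .infty _ else 0) ∈ I 2
      split_ifs with hn
      · rwa [if_pos hn, (zeroField_isPos _).1 n (by simp; omega), zero_add] at h1
      · simp
    · have h1 := hd.2 n
      change h.psi.e n + ((zeroField .left).e n + sAlpha.pw _ *
        (if n ≤ 0 then oddVar .right .infty _ else 0)) ∈ I 2 at h1
      change (if n ≤ 0 then h.psi.e n else 0) + sAlpha.pw _ *
        (if n ≤ 0 then oddVar .right .infty _ else 0) ∈ I 2
      split_ifs with hn
      · rwa [if_pos hn, (zeroField_isPos _).2 n (by simp; omega), zero_add] at h1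
      · simp

include h hS in
lemma psi_c_mem (n : ℤ) : h.psi.c n - (-((zeroField .left).c n + (inftyField.twist sAlpha).c n)
    + coefL n sewComm) ∈ I 3 := by
  have := coefL_mem_I (n := n) (h.psi_quadratic hS)
  simpa only [map_sub, map_add, map_neg, SFam.coefL_op] using this

include h hS in
lemma psi_e_mem (n : ℤ) : h.psi.e n - (-((zeroField .left).e n + (inftyField.twist sAlpha).e n)
    + coefG n sewComm) ∈ I 3 := by
  have := coefG_mem_I (n := n) (h.psi_quadratic hS)
  simpa only [map_sub, map_add, map_neg, SFam.coefG_op] using this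

include h hS in
lemma psi_zero_mem : S.psiEven 0 - (2 : ℂ)⁻¹ • coefL 0 sewComm ∈ I 3 := by
  have h1 := h.psi_c_mem hS 0
  have h2 : (zeroField .left).c 0 = 0 := rfl
  have h3 : (inftyField.twist sAlpha).c 0 = 0 := mul_zero _
  rw [h2, h3, psi_c_zero, add_zero, neg_zero, zero_add] at h1
  have h4 := Submodule.smul_mem _ ((2 : ℂ)⁻¹) h1
  rwa [smul_sub, smul_smul, inv_mul_cancel₀ two_ne_zero, one_smul] at h4

include h hS in
lemma psi_zero_mem_two : S.psiEven 0 ∈ I 2 := by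
  have h1 := add_mem (I_anti (show 2 ≤ 3 by norm_num) (h.psi_zero_mem hS))
    (Submodule.smul_mem _ (2 : ℂ)⁻¹ (coefL_mem_I (n := 0) sewComm_mem))
  rwa [sub_add_cancel] at h1

lemma exp_sub_mem {f : Formal} (hf : f ∈ I 2) : Formal.exp f - (1 + f) ∈ I 3 := by
  have hf1 : f ∈ I 1 := I_anti (by norm_num) hf
  rw [exp_eq hf1]
  have h1 := apply_mem_I' (expE_sub_quadratic_mem (mulLeft_mem_K hf1)) 1
  have h2 : f * f ∈ I 3 := I_anti (by norm_num) (mul_mem_I hf hf)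
  have h3 := add_mem h1 (Submodule.smul_mem _ (2 : ℂ)⁻¹ h2)
  convert h3 using 1
  simp only [LinearMap.sub_apply, LinearMap.add_apply, LinearMap.smul_apply, Module.End.mul_apply,
    Module.End.one_apply, LinearMap.mulLeft_apply, mul_one]
  abel

include h hS in
lemma lam_mem : S.lam - (laurentMono (1, 1, 0)
    - (2 : ℂ)⁻¹ • (laurentMono (1, 1, 0) * coefL 0 sewComm)) ∈ I 3 := by
  have h1 := (h.zero_iff.mp hS.at_zero).1
  have h2 : ((h.scalar * sBeta).u : Formal)
      = laurentMono (1, 1, 0) * Formal.exp (-S.psiEven 0) := by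
    change laurentMono (1, 0, 0) * Formal.exp (-S.psiEven 0) * laurentMono (0, 1, 0) = _
    rw [mul_assoc, ← laurentMono_comm, ← mul_assoc, laurentMono_mul]
    rfl
  have h3 := exp_sub_mem (neg_mem (h.psi_zero_mem_two hS))
  have h4 := mul_mem_I_left (laurentMono (1, 1, 0)) (_root_.sub_mem h3 (h.psi_zero_mem hS))
  rw [h1, h2]
  convert h4 using 1
  simp only [mul_sub, mul_add, mul_smul_comm, mul_neg, mul_one]
  abel

include h in
lemma pw_scalar (n : ℤ) : h.scalar.pw n = sAlpha.pw n * (Scalar.exp (h.psiEven.formal 0).neg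
    (h.psiEven.parity 0).neg (neg_mem (h.psiEven.mem_I 0))).pw n := by
  have h1 : Commute sAlpha.u (Scalar.exp (h.psiEven.formal 0).neg
    (h.psiEven.parity 0).neg (neg_mem (h.psiEven.mem_I 0))).u :=
    Units.ext (Gr.commute_of_isEven sAlpha.even _)
  rw [Scalar.pw, scalar, Scalar.mul_u, h1.mul_zpow, Units.val_mul]
  rfl

lemma pw_sub_one_mem' {s : Scalar} {m : ℕ} (hs : (s.u : Formal) - 1 ∈ I m) (n : ℤ) :
    s.pw n - 1 ∈ I m := by
  refine s.pw_mem (P := fun f => f - 1 ∈ I m) (by simp) ?_ hs ?_ n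
  · intro a b ha hb
    rw [show a * b - 1 = (a - 1) * b + (b - 1) by noncomm_ring]
    exact add_mem (mul_mem_I_right ha b) hb
  · have h1 : ((s.u⁻¹ : Formalˣ) : Formal) - 1 = -(((s.u⁻¹ : Formalˣ) : Formal) * (s.u - 1)) := by
      rw [mul_sub, Units.inv_mul, mul_one, neg_sub]
    rw [h1]
    exact neg_mem (mul_mem_I_left _ hs)

include h hS in
lemma pw_scalar_sub_mem (n : ℤ) : h.scalar.pw n - sAlpha.pw n ∈ I 2 := by
  rw [pw_scalar]
  have h0 := h.psi_zero_mem_two hS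
  have h1 : Formal.exp (-S.psiEven 0) - 1 ∈ I 2 := by
    have := add_mem (I_anti (show 2 ≤ 3 by norm_num)
      (exp_sub_mem (neg_mem h0))) (neg_mem h0)
    convert this using 1
    abel
  have h2 := pw_sub_one_mem' (s := Scalar.exp (h.psiEven.formal 0).neg
    (h.psiEven.parity 0).neg (neg_mem (h.psiEven.mem_I 0))) h1 n
  have h3 := mul_mem_I_left (sAlpha.pw n) h2
  rwa [mul_sub, mul_one] at h3

include h hS in
lemma twist_scalar_mem (F : SFam) : (F.twist h.scalar).op - (F.twist sAlpha).op ∈ K 3 := by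
  rw [sub_eq_add_neg, ← SFam.op_neg, ← SFam.op_add]
  refine SFam.op_mem_K_of (fun n => ?_) fun n => ?_
  · have := mul_mem_I (h.pw_scalar_sub_mem hS (2 * n)) (F.hc.mem_I n)
    rwa [sub_mul, sub_eq_add_neg] at this
  · have := mul_mem_I (h.pw_scalar_sub_mem hS (2 * n - 1)) (F.he.mem_I n)
    rwa [sub_mul, sub_eq_add_neg] at this

/-- The commutator of the vector fields of the local coordinates at `0`. -/
def zeroComm : Formal.Op :=
  (zeroField .left).op * ((zeroField .right).twist sAlpha).op
    - ((zeroField .right).twist sAlpha).op * (zeroField .left).op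

/-- The commutator of the vector fields of the local coordinates at `∞`. -/
def inftyComm : Formal.Op :=
  (inftyFieldRight.twist sAlpha⁻¹).op * inftyField'.op
    - inftyField'.op * (inftyFieldRight.twist sAlpha⁻¹).op

include h hS in
lemma phiZero_op_mem : h.phiZero.op - (((zeroField .right).twist sAlpha).op - h.psi.pos.op
    - (2 : ℂ)⁻¹ • zeroComm) ∈ K 3 := by
  have h1 := (h.zero_iff.mp hS.at_zero).2
  rw [SFam.op_neg, SFam.op_neg] at h1
  have h2 := bch_mem (SFam.op_mem_K _) (SFam.op_mem_K _) (SFam.op_mem_K _) h1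
  have h3 := h.twist_scalar_mem hS (zeroField .right)
  have h4 : h.psi.pos.op - -(zeroField .left).op ∈ K 2 := by
    rw [sub_neg_eq_add]
    exact h.pos_add_mem hS
  have h5 := comm_sub_comm_mem h4 (K_anti (show 2 ≤ 3 by norm_num) h3) (SFam.op_mem_K _)
    (SFam.op_mem_K _) (neg_mem (SFam.op_mem_K _)) (SFam.op_mem_K _)
  have h6 := add_mem (add_mem h2 h3) (Submodule.smul_mem _ (2 : ℂ)⁻¹ h5)
  convert h6 using 1
  simp only [zeroComm, neg_mul, mul_neg]
  module

lemma mem_of_sub_mem {M : Type*} [AddCommGroup M] [Module ℂ M] {V : Submodule ℂ M}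
    {u v w x y z : M} (h : u - (v - w - z) ∈ V) (h' : w - (-x + y) ∈ V) :
    u - (x + v - y - z) ∈ V := by
  have := V.sub_mem h h'
  rwa [show u - (v - w - z) - (w - (-x + y)) = u - (x + v - y - z) by abel] at this

lemma zeroField_c (s : Side) (j : ℕ+) : (zeroField s).c j = evenVar s .zero j :=
  SFam.ofPos_c _ _ j

lemma zeroField_e (s : Side) (j : ℕ+) : (zeroField s).e j = oddVar s .zero j :=
  SFam.ofPos_e _ _ j

lemma zeroField_twist_c (j : ℕ+) :
    ((zeroField .right).twist sAlpha).c j = sAlpha.pw (2 * j) * evenVar .right .zero j :=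
  congrArg (sAlpha.pw (2 * j) * ·) (zeroField_c _ j)

lemma zeroField_twist_e (j : ℕ+) :
    ((zeroField .right).twist sAlpha).e j = sAlpha.pw (2 * j - 1) * oddVar .right .zero j :=
  congrArg (sAlpha.pw (2 * j - 1) * ·) (zeroField_e _ j)

lemma inftyField_twist_c_coe (j : ℕ+) : (inftyField.twist sAlpha).c j = 0 := by
  exact (congrArg (_ * ·) (if_neg (by omega))).trans (mul_zero _)

lemma inftyField_twist_e_coe (j : ℕ+) : (inftyField.twist sAlpha).e j = 0 := by
  have := j.pos
  exact (congrArg (_ * ·) (if_neg (by omega))).trans (mul_zero _)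

include h hS in
lemma phiZero_even_mem (j : ℕ+) : S.phiEven .zero j - (evenVar .left .zero j
    + sAlpha.pw (2 * j) * evenVar .right .zero j - coefL j sewComm
    - (2 : ℂ)⁻¹ • coefL j zeroComm) ∈ I 3 := by
  have h1 := coefL_mem_I (n := j) (h.phiZero_op_mem hS)
  have h2 := h.psi_c_mem hS j
  have hj : (0 : ℤ) < j := by have := j.pos; omega
  have e1 : h.phiZero.c j = S.phiEven .zero j := SFam.ofPos_c _ _ j
  have e3 : h.psi.pos.c j = h.psi.c j := if_pos hj
  rw [map_sub, map_sub, map_sub, map_smul, SFam.coefL_op, SFam.coefL_op, SFam.coefL_op, e1,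
    zeroField_twist_c, e3] at h1
  rw [zeroField_c, inftyField_twist_c_coe, add_zero] at h2
  exact mem_of_sub_mem h1 h2

include h hS in
lemma phiZero_odd_mem (j : ℕ+) : S.phiOdd .zero j - (oddVar .left .zero j
    + sAlpha.pw (2 * j - 1) * oddVar .right .zero j - coefG j sewComm
    - (2 : ℂ)⁻¹ • coefG j zeroComm) ∈ I 3 := by
  have h1 := coefG_mem_I (n := j) (h.phiZero_op_mem hS)
  have h2 := h.psi_e_mem hS j
  have hj : (0 : ℤ) < j := by have := j.pos; omega
  have e1 : h.phiZero.e j = S.phiOdd .zero j := SFam.ofPos_e _ _ j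
  have e3 : h.psi.pos.e j = h.psi.e j := if_pos hj
  rw [map_sub, map_sub, map_sub, map_smul, SFam.coefG_op, SFam.coefG_op, SFam.coefG_op, e1,
    zeroField_twist_e, e3] at h1
  rw [zeroField_e, inftyField_twist_e_coe, add_zero] at h2
  exact mem_of_sub_mem h1 h2

lemma inftyField_c (j : ℕ+) : inftyField.c (-j) = evenVar .right .infty j :=
  SFam.ofNeg_c _ _ j

lemma inftyField_e (j : ℕ+) : inftyField.e (1 - j) = oddVar .right .infty j :=
  SFam.ofNeg_e _ _ j

lemma inftyField_twist_c (j : ℕ+) :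
    (inftyField.twist sAlpha).c (-j) = sAlpha.pw (2 * -j) * evenVar .right .infty j :=
  congrArg (sAlpha.pw (2 * -j) * ·) (inftyField_c j)

lemma inftyField_twist_e (j : ℕ+) :
    (inftyField.twist sAlpha).e (1 - j) = sAlpha.pw (2 * (1 - j) - 1) * oddVar .right .infty j :=
  congrArg (sAlpha.pw (2 * (1 - j) - 1) * ·) (inftyField_e j)

lemma pw_inv (s : Scalar) (n : ℤ) : (s⁻¹).pw n = s.pw (-n) := by
  rw [Scalar.pw, Scalar.inv_u, Scalar.pw, inv_zpow, zpow_neg]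

lemma inftyFieldRight_c (j : ℕ+) :
    (inftyFieldRight.twist sAlpha⁻¹).c j = sAlpha.pw (2 * -j) * evenVar .right .infty j := by
  have h1 : inftyFieldRight.c j = evenVar .right .infty j := SFam.ofPos_c _ _ j
  have h2 : (inftyFieldRight.twist sAlpha⁻¹).c j = (sAlpha⁻¹).pw (2 * j) * inftyFieldRight.c j := rfl
  rw [h2, h1, pw_inv, mul_neg]

lemma inftyFieldRight_e (j : ℕ+) : (inftyFieldRight.twist sAlpha⁻¹).e j
    = -(Complex.I • (sAlpha.pw (2 * (1 - j) - 1) * oddVar .right .infty j)) := by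
  have h1 : inftyFieldRight.e j = -(Complex.I • oddVar .right .infty j) := SFam.ofPos_e _ _ j
  have h2 : (inftyFieldRight.twist sAlpha⁻¹).e j
    = (sAlpha⁻¹).pw (2 * j - 1) * inftyFieldRight.e j := rfl
  rw [h2, h1, pw_inv, mul_neg, mul_smul_comm]
  congr 4
  ring

lemma inftyFieldRight_isPos : (inftyFieldRight.twist sAlpha⁻¹).IsPos :=
  SFam.IsPos.twist (SFam.isPos_ofPos _ _) _

include h in
lemma psiInfty_isPos : h.psiInfty.IsPos := SFam.isPos_ofPos _ _

lemma zeroField_c_neg (s : Side) (j : ℕ+) : (zeroField s).c (-j) = 0 :=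
  (zeroField_isPos s).1 (-j) (by have := j.pos; simp)

lemma zeroField_e_neg (s : Side) (j : ℕ+) : (zeroField s).e (1 - j) = 0 :=
  (zeroField_isPos s).2 (1 - j) (by have := j.pos; simp)

include h hS in
lemma psiEven_neg_mem (j : ℕ+) : S.psiEven (-j) - (-(sAlpha.pw (2 * -j) * evenVar .right .infty j)
    + coefL (-j) sewComm) ∈ I 3 := by
  have h1 := h.psi_c_mem hS (-j)
  rwa [h.psi_c (by have := j.pos; omega), zeroField_c_neg, zero_add, inftyField_twist_c] at h1

include h hS in
lemma psiOdd_neg_mem (j : ℕ+) : S.psiOdd (1 - j)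
    - (-(sAlpha.pw (2 * (1 - j) - 1) * oddVar .right .infty j) + coefG (1 - j) sewComm) ∈ I 3 := by
  have h1 := h.psi_e_mem hS (1 - j)
  rwa [h.psi_e, zeroField_e_neg, zero_add, inftyField_twist_e] at h1

include h in
lemma psiInfty_c (j : ℕ+) : h.psiInfty.c j = -S.psiEven (-j) := SFam.ofPos_c _ _ j

include h in
lemma psiInfty_e (j : ℕ+) : h.psiInfty.e j = Complex.I • S.psiOdd (1 - j) := SFam.ofPos_e _ _ j

lemma exists_coe_of_pos {n : ℤ} (hn : 0 < n) : ∃ j : ℕ+, n = j :=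
  ⟨⟨n.toNat, by omega⟩, by simp; omega⟩

include h hS in
lemma psiInfty_sub_mem :
    h.psiInfty.op - (inftyFieldRight.twist sAlpha⁻¹).op ∈ K 2 := by
  have h0 : ∀ n, coefL n sewComm ∈ I 2 := fun n => coefL_mem_I sewComm_mem
  have h0' : ∀ n, coefG n sewComm ∈ I 2 := fun n => coefG_mem_I sewComm_mem
  rw [sub_eq_add_neg, ← SFam.op_neg, ← SFam.op_add]
  refine SFam.op_mem_K_of (fun n => ?_) fun n => ?_
  · change h.psiInfty.c n + -(inftyFieldRight.twist sAlpha⁻¹).c n ∈ I 2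
    by_cases hn : 0 < n
    · obtain ⟨j, rfl⟩ := exists_coe_of_pos hn
      rw [psiInfty_c, inftyFieldRight_c]
      have h1 := I_anti (show 2 ≤ 3 by norm_num) (h.psiEven_neg_mem hS j)
      have h2 := neg_mem (add_mem h1 (h0 (-j)))
      convert h2 using 1
      abel
    · rw [h.psiInfty_isPos.1 n hn, inftyFieldRight_isPos.1 n hn, neg_zero, add_zero]
      exact Submodule.zero_mem _
  · change h.psiInfty.e n + -(inftyFieldRight.twist sAlpha⁻¹).e n ∈ I 2
    by_cases hn : 0 < n
    · obtain ⟨j, rfl⟩ := exists_coe_of_pos hn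
      rw [psiInfty_e, inftyFieldRight_e]
      have h1 := I_anti (show 2 ≤ 3 by norm_num) (h.psiOdd_neg_mem hS j)
      have h2 := Submodule.smul_mem _ Complex.I (add_mem h1 (h0' (1 - j)))
      convert h2 using 1
      module
    · rw [h.psiInfty_isPos.2 n hn, inftyFieldRight_isPos.2 n hn, neg_zero, add_zero]
      exact Submodule.zero_mem _

include h hS in
lemma phiInfty_op_mem : h.phiInfty.op - (inftyField'.op + h.psiInfty.op
    - (2 : ℂ)⁻¹ • inftyComm) ∈ K 3 := by
  have h1 := h.infty_iff.mp hS.at_infty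
  rw [SFam.op_neg, SFam.op_neg, SFam.op_neg] at h1
  have h2 := bch_mem (SFam.op_mem_K _) (neg_mem (SFam.op_mem_K _)) (SFam.op_mem_K _) h1
  have h4 := h.psiInfty_sub_mem hS
  have h6 := _root_.sub_mem h2 (Submodule.smul_mem _ (2 : ℂ)⁻¹ (comm_sub_comm_mem h4
    (show inftyField'.op - inftyField'.op ∈ K 2 by rw [sub_self]; exact Submodule.zero_mem _)
    (SFam.op_mem_K _) (SFam.op_mem_K _) (SFam.op_mem_K _) (SFam.op_mem_K _)))
  convert h6 using 1
  simp only [inftyComm, neg_mul, mul_neg]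
  module

lemma mem_of_sub_mem_infty {M : Type*} [AddCommGroup M] [Module ℂ M] {V : Submodule ℂ M}
    {u v w x y z : M} (h : u - (v + -w - z) ∈ V) (h' : w - (-x + y) ∈ V) :
    u - (v + x - y - z) ∈ V := by
  have := V.sub_mem h h'
  rwa [show u - (v + -w - z) - (w - (-x + y)) = u - (v + x - y - z) by abel] at this

lemma mem_of_sub_mem_infty_odd {M : Type*} [AddCommGroup M] [Module ℂ M] {V : Submodule ℂ M}
    {u v w x y z : M} (h : -(Complex.I • u) - (-(Complex.I • v) + Complex.I • w - (2 : ℂ)⁻¹ • z) ∈ V)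
    (h' : w - (-x + y) ∈ V) : u - (v + x - y - (Complex.I / 2) • z) ∈ V := by
  have := V.sub_mem (V.smul_mem Complex.I h) h'
  convert this using 1
  simp only [smul_sub, smul_add, smul_neg, smul_smul, Complex.I_mul_I]
  module

include h hS in
lemma phiInfty_even_mem (j : ℕ+) : S.phiEven .infty j - (evenVar .left .infty j
    + sAlpha.pw (2 * -j) * evenVar .right .infty j - coefL (-j) sewComm
    - (2 : ℂ)⁻¹ • coefL j inftyComm) ∈ I 3 := by
  have h1 := coefL_mem_I (n := j) (h.phiInfty_op_mem hS)
  have e1 : h.phiInfty.c j = S.phiEven .infty j := SFam.ofPos_c _ _ j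
  have e2 : inftyField'.c j = evenVar .left .infty j := SFam.ofPos_c _ _ j
  rw [map_sub, map_sub, map_add, map_smul, SFam.coefL_op, SFam.coefL_op, SFam.coefL_op, e1, e2,
    psiInfty_c] at h1
  exact mem_of_sub_mem_infty h1 (h.psiEven_neg_mem hS j)

include h hS in
lemma phiInfty_odd_mem (j : ℕ+) : S.phiOdd .infty j - (oddVar .left .infty j
    + sAlpha.pw (2 * (1 - j) - 1) * oddVar .right .infty j - coefG (1 - j) sewComm
    - (Complex.I / 2) • coefG j inftyComm) ∈ I 3 := by
  have h1 := coefG_mem_I (n := j) (h.phiInfty_op_mem hS)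
  have e1 : h.phiInfty.e j = -(Complex.I • S.phiOdd .infty j) := SFam.ofPos_e _ _ j
  have e2 : inftyField'.e j = -(Complex.I • oddVar .left .infty j) := SFam.ofPos_e _ _ j
  rw [map_sub, map_sub, map_add, map_smul, SFam.coefG_op, SFam.coefG_op, SFam.coefG_op, e1, e2,
    psiInfty_e] at h1
  exact mem_of_sub_mem_infty_odd h1 (h.psiOdd_neg_mem hS j)

end Regular

end SewingData

/-! ### Partial derivatives with respect to the formal variables -/

namespace Formal

lemma lift_comm {g h : Laurent →ₗ[ℂ] Laurent}
    (H : ∀ w c, g (h (AddMonoidAlgebra.single w c)) = h (g (AddMonoidAlgebra.single w c)))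
    (f : Formal) : lift g (lift h f) = lift h (lift g f) := by
  refine cf_ext fun q => ?_
  rw [cf_lift, cf_lift, cf_lift, cf_lift]
  induction cf q f using Laurent.induction with
  | h0 => simp
  | hs w c => exact H w c
  | ha a b ha hb => rw [map_add, map_add, map_add, map_add, ha, hb]

/-- The partial derivative with respect to an even formal variable. -/
def dEven (v : EvenVar) : Op where
  toFun f := ofCf fun q => (q.2 v + 1) • cf (q.1, q.2 + Finsupp.single v 1) f
  map_add' f g := cf_ext fun q => by simp only [cf_ofCf, map_add, smul_add]
  map_smul' c f := cf_ext fun q => by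
    simp only [cf_ofCf, map_smul, RingHom.id_apply]
    exact smul_comm _ _ _

lemma cf_dEven (v : EvenVar) (f : Formal) (q : Idx) :
    cf q (dEven v f) = (q.2 v + 1) • cf (q.1, q.2 + Finsupp.single v 1) f := rfl

lemma dEven_apply (v : EvenVar) (f : Formal) (S : Finset OddVar) :
    dEven v f S = MvPowerSeries.pderiv Laurent v (f S) := by
  refine MvPowerSeries.ext fun d => ?_
  rw [MvPowerSeries.coeff_pderiv, mul_comm, ← Nat.cast_add_one, ← nsmul_eq_mul]
  exact cf_dEven v f (S, d)

lemma derivation_intCast_mul {R A : Type*} [CommRing R] [CommRing A] [Algebra R A]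
    (D : Derivation R A A) (z : ℤ) (a b : A) :
    D (z * (a * b)) = z * (D a * b) + z * (a * D b) := by
  rw [← zsmul_eq_mul, map_zsmul, Derivation.leibniz, smul_eq_mul, smul_eq_mul, zsmul_eq_mul]
  ring

lemma dEven_mul (v : EvenVar) (f g : Formal) :
    dEven v (f * g) = dEven v f * g + f * dEven v g := by
  ext S : 1
  rw [dEven_apply, Gr.add_apply, Gr.mul_apply, Gr.mul_apply, Gr.mul_apply, map_sum,
    ← Finset.sum_add_distrib]
  refine Finset.sum_congr rfl fun T _ => ?_
  rw [dEven_apply, dEven_apply]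
  exact derivation_intCast_mul _ _ _ _

lemma isCont_dEven (v : EvenVar) : IsCont (dEven v) :=
  fun q => ⟨{(q.1, q.2 + Finsupp.single v 1)}, fun f h => by
    rw [cf_dEven, h _ (Finset.mem_singleton_self _), smul_zero]⟩

lemma dEven_lift (v : EvenVar) (g : Laurent →ₗ[ℂ] Laurent) (f : Formal) :
    dEven v (lift g f) = lift g (dEven v f) :=
  cf_ext fun q => by rw [cf_dEven, cf_lift, cf_lift, cf_dEven, map_nsmul]

lemma dEven_dOdd (v : EvenVar) (p : OddVar) (f : Formal) :
    dEven v (dOdd p f) = dOdd p (dEven v f) := by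
  refine cf_ext fun q => ?_
  rw [cf_dEven, cf_dOdd, cf_dOdd, cf_dEven]
  split_ifs
  · exact smul_zero _
  · exact smul_comm _ _ _

lemma dEven_laurentMono (v : EvenVar) (w : ℤ × ℤ × ℤ) : dEven v (laurentMono w) = 0 := by
  refine cf_ext fun q => ?_
  rw [cf_dEven, cf_laurentMono, if_neg, smul_zero, map_zero]
  intro h
  simpa using DFunLike.congr_fun (congrArg Prod.snd h) v

lemma dEven_gen (v : EvenVar) (p : OddVar) : dEven v (Gr.gen p) = 0 := by
  ext S : 1
  rw [dEven_apply, Gr.zero_apply, Gr.gen, Gr.mono]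
  split_ifs
  · exact Derivation.map_one_eq_zero _
  · exact map_zero _

/-- A derivative with respect to a variable other than `x` and `φ`, of sign `s`. -/
structure IsVarDeriv (d : Op) (s : ℂ) : Prop where
  cont : IsCont d
  mul_even : ∀ f g : Formal, f.IsEven → d (f * g) = d f * g + f * d g
  mul_odd : ∀ f g : Formal, f.IsOdd → d (f * g) = d f * g + s • (f * d g)
  comm_L : ∀ n f, d (L n f) = L n (d f)
  comm_G : ∀ n f, d (G n f) = s • G n (d f)
  comm_cX : ∀ k f, d (cX k f) = cX k (d f)
  comm_nP : ∀ f, d (nP f) = nP (d f)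
  map_sx : d (sx X 1) = 0
  map_phi : d phi = 0
  sq : s * s = 1

lemma IsVarDeriv.of_even {d : Op} (cont : IsCont d)
    (mul : ∀ f g, d (f * g) = d f * g + f * d g) (hX : ∀ f, d (dX f) = dX (d f))
    (hP : ∀ f, d (dPhi f) = dPhi (d f)) (hc : ∀ k f, d (cX k f) = cX k (d f))
    (hs : ∀ n, d (sx X n) = 0) (hp : d phi = 0) : IsVarDeriv d 1 where
  cont := cont
  mul_even f g _ := mul f g
  mul_odd f g _ := by rw [mul, one_smul]
  comm_L n f := by simp only [L_apply, map_neg, map_add, map_smul, mul, hs, hp, hX, hP, zero_mul, zero_add]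
  comm_G n f := by
    simp only [G_apply, map_neg, map_sub, mul, hs, hp, hX, hP, zero_mul, zero_add, one_smul]
  comm_cX := hc
  comm_nP f := by simp only [nP_apply, map_sub, mul, hp, hP, zero_mul, zero_add]
  map_sx := hs 1
  map_phi := hp
  sq := one_mul 1

lemma isVarDeriv_dEven (v : EvenVar) : IsVarDeriv (dEven v) 1 :=
  .of_even (isCont_dEven v) (dEven_mul v) (dEven_lift v _) (dEven_dOdd v _)
    (fun k => dEven_lift v _) (fun _ => dEven_laurentMono v _) (dEven_gen v _)

lemma isVarDeriv_dOdd {p : OddVar} (hp : p ≠ .phi) : IsVarDeriv (dOdd p) (-1) where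
  cont := isCont_dOdd p
  mul_even f g hf := by rw [dOdd_mul, ← par_apply, par_of_isEven hf]
  mul_odd f g hf := by rw [dOdd_mul, ← par_apply, par_of_isOdd hf, neg_smul, one_smul, neg_mul]
  comm_L := SFam.dOdd_L hp
  comm_G n f := by rw [SFam.dOdd_G hp, neg_smul, one_smul]
  comm_cX k := dOdd_cX p k
  comm_nP := dOdd_nP hp
  map_sx := dOdd_laurentMono _ _
  map_phi := Gr.leftDeriv_gen_of_ne hp
  sq := by norm_num

lemma isVarDeriv_dLaurent {u : ℤ × ℤ × ℤ} (hu : u.2.2 = 0) (n : ℤ × ℤ × ℤ →+ ℤ)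
    (hn : ∀ k, n (0, 0, k) = 0) : IsVarDeriv (dLaurent u n) 1 := by
  have hsub : ∀ w k, n (w - (0, 0, k)) = n w := fun w k => by rw [map_sub, hn, sub_zero]
  refine .of_even (isCont_lift _) (dLaurent_mul u n) (lift_comm fun w c => ?_)
    (fun f => (dOdd_lift _ _ f).symm) (fun k => lift_comm fun w c => ?_)
    (fun k => ?_) (lift_phi _ (derivL_one u n))
  · simp only [Laurent.derivL_single]
    rw [hsub, show expX (w - u) = expX w by rw [map_sub]; exact sub_eq_self.mpr hu, sub_right_comm]
    congr 1
    ring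
  · rw [Laurent.derivL_single, Laurent.coeffXL_single, Laurent.coeffXL_single,
      show (w - u).2.2 = w.2.2 from sub_eq_self.mpr hu]
    split_ifs with h
    · rw [Laurent.derivL_single]
      have h1 : ((w.1, w.2.1, 0) : ℤ × ℤ × ℤ) = w - (0, 0, w.2.2) := by ext <;> simp
      congr 1
      · ext <;> simp [hu]
      · rw [h1, hsub]
    · rw [map_zero]
  · rw [sx_eq, dLaurent_laurentMono, hn, Int.cast_zero, zero_smul]

/-- The partial derivatives as linear operators. -/
def dVar : Side → Coord → Op
  | .left, .a => dLaurent (1, 0, 0) expAlpha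
  | .right, .a => dLaurent (0, 1, 0) expBeta
  | s, .A k j => dEven (s, k, j)
  | s, .M k j => dOdd (.formal s k j)

lemma partialDeriv_eq (s : Side) (p : Coord) (f : Formal) : partialDeriv s p f = dVar s p f := by
  cases s <;> cases p <;> rfl

end Formal

/-- The sign of a coordinate. -/
def Coord.sgn : Coord → ℂ
  | .M _ _ => -1
  | _ => 1

namespace Formal

lemma isVarDeriv_dVar (s : Side) (p : Coord) : IsVarDeriv (dVar s p) p.sgn := by
  cases p with
  | a =>
    cases s
    · exact isVarDeriv_dLaurent rfl expAlpha fun _ => rfl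
    · exact isVarDeriv_dLaurent rfl expBeta fun _ => rfl
  | A k j =>
    cases s <;> exact isVarDeriv_dEven _
  | M k j =>
    cases s <;> exact isVarDeriv_dOdd nofun

lemma deg_insert {p : OddVar} {q : Idx} (h : p ∉ q.1) :
    deg (insert p q.1, q.2) = p.weight + deg q := by
  unfold deg
  rw [Finset.sum_insert h, add_assoc]

lemma dVar_mem_I {s : Side} {p : Coord} {n : ℕ} {f : Formal} (hf : f ∈ I (n + 1)) :
    dVar s p f ∈ I n := by
  have hA : ∀ v, dEven v f ∈ I n := fun v q hq => by
    rw [cf_dEven, hf, smul_zero]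
    unfold deg at hq ⊢
    simp only [map_add, Finsupp.degree_single]
    omega
  have hM : ∀ p, dOdd p f ∈ I n := fun p q hq => by
    rw [cf_dOdd]
    split_ifs with h
    · rfl
    · rw [hf, smul_zero]
      rw [deg_insert h]
      have : p.weight ≤ 1 := by cases p <;> simp [OddVar.weight]
      omega
  cases p with
  | a => cases s <;> exact lift_mem_K _ n f (I_anti (Nat.le_succ n) hf)
  | A k j => cases s <;> exact hA _
  | M k j => cases s <;> exact hM _

/-! ### The value at `e` -/

lemma evalOne_add (f g : Laurent) : Laurent.evalOne (f + g) = Laurent.evalOne f + Laurent.evalOne g :=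
  Finsupp.sum_add_index' (fun _ => rfl) fun _ _ _ => rfl

lemma evalOne_single (w : ℤ × ℤ × ℤ) (c : ℂ) :
    Laurent.evalOne (AddMonoidAlgebra.single w c) = c := Finsupp.sum_single_index rfl

lemma evalOne_zero : Laurent.evalOne 0 = 0 := Finsupp.sum_zero_index

/-- The value of a Laurent polynomial at `1`, as an algebra homomorphism. -/
def evalOneHom : Laurent →ₐ[ℂ] ℂ :=
  AlgHom.ofLinearMap
    { toFun := Laurent.evalOne
      map_add' := evalOne_add
      map_smul' := fun c f => by
        induction f using Laurent.induction with
        | h0 => rw [smul_zero, evalOne_zero, smul_zero]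
        | hs w b => rw [AddMonoidAlgebra.smul_single, evalOne_single, evalOne_single]; rfl
        | ha f g hf hg => rw [smul_add, evalOne_add, evalOne_add, hf, hg, smul_add] }
    (evalOne_single _ _) fun f g => by
      change Laurent.evalOne _ = Laurent.evalOne _ * Laurent.evalOne _
      induction f using Laurent.induction with
      | h0 => rw [zero_mul, evalOne_zero, zero_mul]
      | ha f f' hf hf' => rw [add_mul, evalOne_add, evalOne_add, hf, hf', add_mul]
      | hs w b =>
        induction g using Laurent.induction with
        | h0 => rw [mul_zero, evalOne_zero, mul_zero]
        | ha f f' hf hf' => rw [mul_add, evalOne_add, evalOne_add, hf, hf', mul_add]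
        | hs w' b' =>
          rw [AddMonoidAlgebra.single_mul_single, evalOne_single, evalOne_single, evalOne_single]

lemma inversions_map {τ ρ : Type} [LinearOrder τ] [LinearOrder ρ] (e : τ ↪ ρ)
    (he : ∀ i j, e i < e j ↔ i < j) (S T : Finset τ) :
    inversions (S.map e) (T.map e) = inversions S T := by
  unfold inversions
  rw [← Finset.prodMap_map_product, Finset.filter_map, Finset.card_map]
  congr 1
  exact Finset.filter_congr fun p _ => he _ _

lemma mul_apply_map {τ ρ R : Type} [LinearOrder τ] [LinearOrder ρ] [CommRing R] (e : τ ↪ ρ)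
    (he : ∀ i j, e i < e j ↔ i < j) (f g : Gr ρ R) (S : Finset τ) :
    (f * g) (S.map e) = ∑ T ∈ S.powerset,
      (shuffleSign T (S \ T) : R) * (f (T.map e) * g ((S \ T).map e)) := by
  rw [Gr.mul_apply, Finset.map_eq_image, Finset.powerset_image, Finset.sum_image]
  · refine Finset.sum_congr rfl fun T _ => ?_
    rw [← Finset.map_eq_image, ← Finset.map_eq_image, ← Finset.map_sdiff, shuffleSign,
      inversions_map e he]
    rfl
  · exact (Finset.image_injective e.injective).injOn

lemma zeta_lt_zeta (i j : ℕ) : OddVar.zetaEmb i < OddVar.zetaEmb j ↔ i < j := by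
  change OddVar.code (.zeta i) < OddVar.code (.zeta j) ↔ _
  simp [OddVar.code, Prod.Lex.toLex_lt_toLex]

/-- The value of a coefficient at `e`. -/
def coeffAtE : FormalCoeff →+* ℂ := (evalOneHom : Laurent →+* ℂ).comp MvPowerSeries.constantCoeff

lemma atE_apply (f : Formal) (S : Finset ℕ) : atE f S = coeffAtE (f (S.map OddVar.zetaEmb)) := rfl

lemma atE_mul (f g : Formal) : atE (f * g) = atE f * atE g := by
  ext S
  rw [atE_apply, mul_apply_map _ zeta_lt_zeta, map_sum, Gr.mul_apply]
  refine Finset.sum_congr rfl fun T _ => ?_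
  rw [map_mul, map_mul, map_intCast, atE_apply, atE_apply]

lemma atE_one : atE 1 = 1 := by
  ext S
  rw [atE_apply, Gr.one_apply, Gr.one_apply]
  by_cases hS : S = ∅
  · subst hS
    rw [if_pos rfl, if_pos (Finset.map_empty _), map_one]
  · rw [if_neg hS, if_neg fun h => hS (Finset.map_eq_empty.mp h), map_zero]

/-- The value at `e`, as an algebra homomorphism. -/
def atEHom : Formal →ₐ[ℂ] Lam :=
  AlgHom.ofLinearMap
    { toFun := atE
      map_add' := fun f g => Gr.ext fun S => map_add evalOneHom _ _
      map_smul' := fun c f => Gr.ext fun S => map_smul evalOneHom c _ }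
    atE_one atE_mul

lemma atE_eq (f : Formal) : atE f = atEHom f := rfl

lemma atE_of_mem_I {f : Formal} (hf : f ∈ I 1) : atE f = 0 := by
  ext S
  change evalOneHom (cf (S.map OddVar.zetaEmb, 0) f) = 0
  rw [hf, map_zero]
  simp [deg, OddVar.zetaEmb, OddVar.weight]

lemma atE_laurentMono (w : ℤ × ℤ × ℤ) : atE (laurentMono w) = 1 := by
  ext S
  rw [atE_apply, laurentMono, Gr.mono, Gr.one_apply]
  by_cases hS : S = ∅
  · subst hS
    rw [if_pos rfl, if_pos (Finset.map_empty _)]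
    change evalOneHom (MvPowerSeries.constantCoeff (MvPowerSeries.C _)) = 1
    rw [MvPowerSeries.constantCoeff_C]
    exact evalOne_single _ _
  · rw [if_neg hS, if_neg fun h => hS (Finset.map_eq_empty.mp h), map_zero]

/-- `deriv2` as a linear map. -/
def deriv2L (s : Side) (p : Coord) (t : Side) (q : Coord) : Formal →ₗ[ℂ] Lam :=
  atEHom.toLinearMap ∘ₗ (dVar s p * dVar t q)

lemma deriv2_eq (f : Formal) (s : Side) (p : Coord) (t : Side) (q : Coord) :
    deriv2 f s p t q = deriv2L s p t q f := by
  rw [deriv2, partialDeriv_eq, partialDeriv_eq]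
  rfl

lemma deriv2L_apply (f : Formal) (s : Side) (p : Coord) (t : Side) (q : Coord) :
    deriv2L s p t q f = atE (dVar s p (dVar t q f)) := rfl

lemma deriv2L_of_mem_I {f : Formal} (hf : f ∈ I 3) (s : Side) (p : Coord) (t : Side) (q : Coord) :
    deriv2L s p t q f = 0 := atE_of_mem_I (dVar_mem_I (dVar_mem_I hf))

lemma dVar_a_mem_I {s : Side} {n : ℕ} {f : Formal} (hf : f ∈ I n) : dVar s .a f ∈ I n := by
  cases s <;> exact lift_mem_K _ n f hf

lemma deriv2L_a_left {f : Formal} (hf : f ∈ I 2) (s : Side) (t : Side) (q : Coord) :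
    deriv2L s .a t q f = 0 := atE_of_mem_I (dVar_a_mem_I (dVar_mem_I hf))

lemma deriv2L_a_right {f : Formal} (hf : f ∈ I 2) (s : Side) (t : Side) (q : Coord) :
    deriv2L s q t .a f = 0 := atE_of_mem_I (dVar_mem_I (dVar_a_mem_I hf))

end Formal

/-- The sign of a basis element. -/
def NSIndex.sgn : NSIndex → ℂ
  | .L _ => 1
  | .G _ => -1

/-- The sign with which an operation of sign `s` passes a basis element. -/
def NSIndex.act : NSIndex → ℂ → ℂ
  | .L _, _ => 1
  | .G _, s => s

namespace NS0

lemma L_L_apply (m n : ℤ) : L m (.L n) = if m = n then 1 else 0 := by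
  classical
  rw [L, Finsupp.single_apply]
  exact if_congr ⟨fun h => NSIndex.L.inj h, congrArg _⟩ rfl rfl

lemma L_G_apply (m n : ℤ) : L m (.G n) = 0 := Finsupp.single_eq_of_ne nofun

lemma G_L_apply (m n : ℤ) : G m (.L n) = 0 := Finsupp.single_eq_of_ne nofun

lemma G_G_apply (m n : ℤ) : G m (.G n) = if m = n then 1 else 0 := by
  classical
  rw [G, Finsupp.single_apply]
  exact if_congr ⟨fun h => NSIndex.G.inj h, congrArg _⟩ rfl rfl

end NS0

namespace Formal

/-! ### The representation of the Neveu–Schwarz algebra -/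

/-- The operators representing the basis elements. -/
def nsOp : NSIndex → Op
  | .L n => L n
  | .G n => G (n + 1)

/-- The coefficient functionals of the operators `nsOp`. -/
def coefNS : NSIndex → Op →ₗ[ℂ] Formal
  | .L n => coefL n
  | .G n => coefG (n + 1)

lemma coefL_L (m n : ℤ) : coefL m (L n) = if n = m then 1 else 0 := by
  rw [coefL_apply, L_sx, map_neg, map_neg, neg_neg, nP_sx, cX_sx]
  exact if_congr (by omega) rfl rfl

lemma coefL_G (m n : ℤ) : coefL m (G n) = 0 := by
  rw [coefL_apply, G_sx, SFam.nP_sx_mul_phi, map_zero, neg_zero]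

lemma coefG_L (m n : ℤ) : coefG m (L n) = 0 := by
  rw [coefG_apply, L_phi, map_neg, map_smul, SFam.nP_sx_mul_phi, smul_zero, neg_zero, map_zero, neg_zero]

lemma coefG_G (m n : ℤ) : coefG m (G n) = if n = m then 1 else 0 := by
  rw [coefG_apply, G_phi, map_neg, map_neg, neg_neg, nP_sx, cX_sx]
  exact if_congr (by omega) rfl rfl

lemma coefNS_bracket (i j r : NSIndex) :
    coefNS r (nsOp i * nsOp j - j.act i.sgn • (nsOp j * nsOp i)) = NS0.basisBracket i j r • 1 := by
  have hLL : ∀ m n : ℤ, L m * L n - L n * L m = ((m : ℂ) - n) • L (m + n) := fun m n =>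
    LinearMap.ext fun f => L_L m n f
  have hLG : ∀ m n : ℤ, L m * G n - G n * L m = (((m : ℂ) + 1) / 2 - n) • G (m + n) := fun m n =>
    LinearMap.ext fun f => L_G m n f
  have hGG : ∀ m n : ℤ, G m * G n + G n * G m = (2 : ℂ) • L (m + n - 1) := fun m n =>
    LinearMap.ext fun f => G_G m n f
  rcases i with m | m <;> rcases j with n | n
  · simp only [NSIndex.act, one_smul, nsOp, hLL, NS0.basisBracket]
    rcases r with l | l
    · simp only [coefNS, map_smul, coefL_L, Finsupp.smul_apply, NS0.L_L_apply, NS0.L_G_apply, NS0.G_L_apply, NS0.G_G_apply]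
      split_ifs <;> simp
    · simp [coefNS, coefG_L, NS0.L_G_apply]
  · simp only [NSIndex.act, NSIndex.sgn, one_smul, nsOp, hLG, NS0.basisBracket]
    rcases r with l | l
    · simp [coefNS, coefL_G, NS0.G_L_apply]
    · simp only [coefNS, map_smul, coefG_G, Finsupp.smul_apply, NS0.L_L_apply, NS0.L_G_apply, NS0.G_L_apply, NS0.G_G_apply, Finsupp.neg_apply]
      by_cases h : n + m = l
      · rw [if_pos h, if_pos (by omega)]
        push_cast
        simp only [smul_eq_mul, mul_one, ← neg_smul]
        congr 1
        ring
      · rw [if_neg h, if_neg (by omega)]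
        simp
  · have h1 : G (m + 1) * L n - L n * G (m + 1) = -(L n * G (m + 1) - G (m + 1) * L n) := by abel
    simp only [NSIndex.act, NSIndex.sgn, one_smul, nsOp, h1, hLG, NS0.basisBracket]
    rcases r with l | l
    · simp [coefNS, coefL_G, NS0.G_L_apply]
    · simp only [coefNS, map_smul, map_neg, coefG_G, Finsupp.smul_apply, NS0.L_L_apply, NS0.L_G_apply, NS0.G_L_apply, NS0.G_G_apply, Finsupp.neg_apply]
      by_cases h : m + n = l
      · rw [if_pos h, if_pos (by omega)]
        push_cast
        simp only [smul_eq_mul, mul_one, ← neg_smul]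
        congr 1
        ring
      · rw [if_neg h, if_neg (by omega)]
        simp
  · simp only [NSIndex.act, NSIndex.sgn, neg_smul, one_smul, sub_neg_eq_add, nsOp, hGG,
      NS0.basisBracket]
    rcases r with l | l
    · simp only [coefNS, map_smul, coefL_L, Finsupp.smul_apply, NS0.L_L_apply, NS0.L_G_apply, NS0.G_L_apply, NS0.G_G_apply]
      by_cases h : m + (n + 1) = l
      · rw [if_pos h, if_pos (by omega)]
        simp
      · rw [if_neg h, if_neg (by omega)]
        simp
    · simp [coefNS, coefG_L, NS0.L_G_apply]

lemma coefNS_mulLeft {c : Formal} (hc : IsConst c) (r : NSIndex) (A : Op) :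
    coefNS r (LinearMap.mulLeft ℂ c * A) = c * coefNS r A := by
  cases r <;>
    simp only [coefNS, coefL_apply, coefG_apply, Module.End.mul_apply, LinearMap.mulLeft_apply,
      nP_const_mul hc, cX_const_mul hc, mul_neg]

namespace IsVarDeriv

variable {d : Op} {s : ℂ} (hd : IsVarDeriv d s)

include hd in
lemma comm_nsOp (i : NSIndex) (f : Formal) : d (nsOp i f) = i.act s • nsOp i (d f) := by
  cases i with
  | L n => rw [NSIndex.act, one_smul]; exact hd.comm_L n f
  | G n => exact hd.comm_G _ f

end IsVarDeriv

lemma dVar_dVar_coefNS (r : NSIndex) {s t : Side} {p q : Coord} {A B : Op}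
    (hB : ∀ f, (∀ s' p', dVar s' p' f = 0) → dVar s p (dVar t q (A f)) = B f) :
    dVar s p (dVar t q (coefNS r A)) = coefNS r B := by
  have h1 := hB (sx X 1) fun s' p' => (isVarDeriv_dVar s' p').map_sx
  have h2 := hB phi fun s' p' => (isVarDeriv_dVar s' p').map_phi
  cases r <;>
    simp only [coefNS, coefL_apply, coefG_apply, map_neg, (isVarDeriv_dVar _ _).comm_cX,
      (isVarDeriv_dVar _ _).comm_nP, h1, h2]

/-- The second derivative of a product of two vector fields in terms of their derivatives. -/
lemma second_deriv {T U Tp Tq Up Uq d d' : Op} {s s' : ℂ}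
    (hTp : ∀ f, d (T f) = Tp f + T (d f)) (hTq : ∀ f, d' (T f) = Tq f + T (d' f))
    (hUp : ∀ f, d (U f) = Up f + U (d f)) (hUq : ∀ f, d' (U f) = Uq f + U (d' f))
    (hT : ∀ f, d (Tq f) = s • Tq (d f)) (hU : ∀ f, d (Uq f) = s' • Uq (d f))
    {f : Formal} (h : d f = 0) (h' : d' f = 0) : d (d' (T (U f))) = Tp (Uq f) + s • Tq (Up f) := by
  rw [hTq, hUq, h', map_zero, add_zero, map_add, hT, hUp, h, map_zero, add_zero, hTp, hU, h,
    map_zero, smul_zero, map_zero, add_zero, add_comm]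

/-! ### Scalars -/

/-- Laurent monomials in `α₀^{1/2}`, `β₀^{1/2}`, up to a factor. -/
def IsMono (g : Formal) : Prop := ∃ (c : ℂ) (w : ℤ × ℤ × ℤ), w.2.2 = 0 ∧ g = c • laurentMono w

namespace IsMono

variable {g h : Formal}

lemma laurentMono {w : ℤ × ℤ × ℤ} (hw : w.2.2 = 0) : IsMono (laurentMono w) :=
  ⟨1, w, hw, (one_smul _ _).symm⟩

lemma smul (c : ℂ) (hg : IsMono g) : IsMono (c • g) := by
  obtain ⟨b, w, hw, rfl⟩ := hg
  exact ⟨c * b, w, hw, smul_smul _ _ _⟩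

lemma neg (hg : IsMono g) : IsMono (-g) := by
  rw [← neg_one_smul ℂ]
  exact hg.smul _

lemma isConst (hg : IsMono g) : IsConst g := by
  obtain ⟨c, w, hw, rfl⟩ := hg
  exact (isFormal_laurentMono hw).isConst.smul c

lemma isEven (hg : IsMono g) : g.IsEven := by
  obtain ⟨c, w, hw, rfl⟩ := hg
  exact (isEven_laurentMono w).smul c

lemma comm (hg : IsMono g) (f : Formal) : g * f = f * g := Gr.commute_of_isEven hg.isEven f

lemma dVar_eq_zero (hg : IsMono g) (s : Side) {p : Coord} (hp : p ≠ .a) : dVar s p g = 0 := by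
  obtain ⟨c, w, hw, rfl⟩ := hg
  rw [map_smul]
  cases p with
  | a => exact absurd rfl hp
  | A k j => cases s <;> exact (congrArg _ (dEven_laurentMono _ _)).trans (smul_zero c)
  | M k j => cases s <;> exact (congrArg _ (dOdd_laurentMono _ _)).trans (smul_zero c)

lemma dVar_mul (hg : IsMono g) (s : Side) {p : Coord} (hp : p ≠ .a) (f : Formal) :
    dVar s p (g * f) = g * dVar s p f := by
  rw [(isVarDeriv_dVar s p).mul_even _ _ hg.isEven, hg.dVar_eq_zero s hp, zero_mul, zero_add]

lemma nsOp_mul (hg : IsMono g) (i : NSIndex) (f : Formal) : nsOp i (g * f) = g * nsOp i f := by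
  cases i with
  | L n => rw [nsOp, L_mul, SFam.L_of_isConst _ hg.isConst, zero_mul, zero_add]
  | G n => rw [nsOp, G_mul, SFam.G_of_isConst _ hg.isConst, zero_mul, zero_add, par_of_isEven hg.isEven]

end IsMono

/-! ### Derivatives of the coordinates -/

open scoped Classical in
lemma dVar_evenVar (s t : Side) (p : Coord) (k : Puncture) (j : ℕ+) :
    dVar s p (evenVar t k j) = if s = t ∧ p = .A k j then 1 else 0 := by
  cases p with
  | a =>
    rw [if_neg (by simp)]
    cases s
    · exact lift_evenVar (derivL_one _ expAlpha) _ _ _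
    · exact lift_evenVar (derivL_one _ expBeta) _ _ _
  | A k' j' =>
    have h0 : dVar s (.A k' j') = dEven (s, k', j') := by cases s <;> rfl
    rw [h0]
    refine cf_ext fun q => ?_
    rw [cf_dEven, cf_evenVar]
    by_cases h : s = t ∧ Coord.A k' j' = .A k j
    · rw [if_pos h]
      obtain ⟨rfl, h2⟩ := h
      cases h2
      rw [cf_one]
      by_cases hq : q = (∅, 0)
      · subst hq
        simp
      · rw [if_neg hq, if_neg, smul_zero]
        rintro h
        apply hq
        have h3 := congrArg Prod.snd h
        have h4 := congrArg Prod.fst h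
        ext1
        · exact h4
        · simpa using h3
    · rw [if_neg h, if_neg, smul_zero, map_zero]
      intro h3
      have h4 := DFunLike.congr_fun (congrArg Prod.snd h3) (s, k', j')
      simp only [Finsupp.add_apply, Finsupp.single_eq_same] at h4
      rw [Finsupp.single_apply] at h4
      split_ifs at h4 with h5
      · simp only [Prod.mk.injEq] at h5
        obtain ⟨rfl, rfl, rfl⟩ := h5
        exact h ⟨rfl, rfl⟩
  | M k' j' =>
    rw [if_neg (by simp)]
    cases s <;> exact Gr.leftDeriv_mono_empty _ _

open scoped Classical in
lemma dVar_oddVar (s t : Side) (p : Coord) (k : Puncture) (j : ℕ+) :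
    dVar s p (oddVar t k j) = if s = t ∧ p = .M k j then 1 else 0 := by
  cases p with
  | a =>
    rw [if_neg (by simp)]
    cases s
    · exact lift_oddVar (derivL_one _ expAlpha) _ _ _
    · exact lift_oddVar (derivL_one _ expBeta) _ _ _
  | A k' j' =>
    rw [if_neg (by simp)]
    cases s <;> exact dEven_gen _ _
  | M k' j' =>
    have h0 : dVar s (.M k' j') = dOdd (.formal s k' j') := by cases s <;> rfl
    rw [h0]
    by_cases h : s = t ∧ Coord.M k' j' = .M k j
    · rw [if_pos h]
      obtain ⟨rfl, h2⟩ := h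
      cases h2
      exact Gr.leftDeriv_gen_self _
    · rw [if_neg h]
      refine Gr.leftDeriv_gen_of_ne fun h1 => h ?_
      cases h1
      exact ⟨rfl, rfl⟩

end Formal

/-- A coordinate other than `a` at a given puncture. -/
def Coord.At (k : Puncture) : Coord → Prop
  | .a => False
  | .A k' _ => k' = k
  | .M k' _ => k' = k

lemma Coord.At.ne_a {k : Puncture} {p : Coord} (h : p.At k) : p ≠ .a := by
  rintro rfl
  exact h

namespace Formal

/-! ### Vector fields whose coefficients are coordinates -/

/-- The operator belonging to a coordinate, for given indices of `L` and `G`. -/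
def coordIdx (μ ν : ℕ+ → ℤ) : Coord → NSIndex
  | .a => .L 0
  | .A _ j => .L (μ j)
  | .M _ j => .G (ν j)

def coordCoef (u v : ℕ+ → Formal) : Coord → Formal
  | .a => 0
  | .A _ j => u j
  | .M _ j => v j

/-- `F` is the sum of the `u_j p_j L_{μ_j} + v_j p_{j-1/2} G_{ν_j+1/2}`, where `p` stands for the
formal variables of the side `s` at the puncture `k`. -/
structure CoordField (F : SFam) (s : Side) (k : Puncture) (u v : ℕ+ → Formal) (μ ν : ℕ+ → ℤ) :
    Prop where
  isMono_u : ∀ j, IsMono (u j)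
  isMono_v : ∀ j, IsMono (v j)
  injective_μ : Function.Injective μ
  injective_ν : Function.Injective ν
  c_eq : ∀ j, F.c (μ j) = u j * evenVar s k j
  c_zero : ∀ n, (∀ j, μ j ≠ n) → F.c n = 0
  e_eq : ∀ j, F.e (ν j + 1) = v j * oddVar s k j
  e_zero : ∀ n, (∀ j, ν j + 1 ≠ n) → F.e n = 0

lemma dVar_op_aux (F : SFam) (s : Side) (p : Coord) (f : Formal) :
    dVar s p (F.op f) = csum (fun n => dVar s p (F.c n) * L n f)
      + csum (fun n => dVar s p (F.e n) * G n f) + F.op (dVar s p f) := by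
  have hd := isVarDeriv_dVar s p
  have hc : ∀ n, dVar s p (F.c n * L n f) = dVar s p (F.c n) * L n f + F.c n * L n (dVar s p f) :=
    fun n => by rw [hd.mul_even _ _ (F.hc.parity n), hd.comm_L]
  have he : ∀ n, dVar s p (F.e n * G n f) = dVar s p (F.e n) * G n f + F.e n * G n (dVar s p f) :=
    fun n => by rw [hd.mul_odd _ _ (F.he.parity n), hd.comm_G, mul_smul_comm, smul_smul, hd.sq, one_smul]
  rw [SFam.op_apply, map_add, hd.cont.map_csum (F.hc.locallyFinite.mul_left _),
    hd.cont.map_csum (F.he.locallyFinite.mul_left _)]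
  simp only [hc, he]
  rw [csum_add ((hd.cont.locallyFinite F.hc.locallyFinite).mul_left _)
      (F.hc.locallyFinite.mul_left _),
    csum_add ((hd.cont.locallyFinite F.he.locallyFinite).mul_left _)
      (F.he.locallyFinite.mul_left _), SFam.op_apply]
  abel

namespace CoordField

variable {F : SFam} {s : Side} {k : Puncture} {u v : ℕ+ → Formal} {μ ν : ℕ+ → ℤ}
  (h : CoordField F s k u v μ ν)

include h in
lemma isMono {p : Coord} (hp : p.At k) : IsMono (coordCoef u v p) := by
  cases p with
  | a => exact absurd hp id
  | A k j => exact h.isMono_u j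
  | M k j => exact h.isMono_v j

include h in
lemma dVar_c {t : Side} {p : Coord} (hp : p ≠ .a) (j : ℕ+) :
    dVar t p (F.c (μ j)) = u j * dVar t p (evenVar s k j) := by
  rw [h.c_eq, (h.isMono_u j).dVar_mul t hp]

include h in
lemma dVar_e {t : Side} {p : Coord} (hp : p ≠ .a) (j : ℕ+) :
    dVar t p (F.e (ν j + 1)) = v j * dVar t p (oddVar s k j) := by
  rw [h.e_eq, (h.isMono_v j).dVar_mul t hp]

include h in
lemma dVar_c_eq_zero {t : Side} {p : Coord} (hp : p ≠ .a)
    (h0 : ∀ j, ¬(t = s ∧ p = .A k j)) (n : ℤ) : dVar t p (F.c n) = 0 := by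
  by_cases hn : ∃ j, μ j = n
  · obtain ⟨j, rfl⟩ := hn
    rw [h.dVar_c hp, dVar_evenVar, if_neg (h0 j), mul_zero]
  · rw [h.c_zero n fun j hj => hn ⟨j, hj⟩, map_zero]

include h in
lemma dVar_e_eq_zero {t : Side} {p : Coord} (hp : p ≠ .a)
    (h0 : ∀ j, ¬(t = s ∧ p = .M k j)) (n : ℤ) : dVar t p (F.e n) = 0 := by
  by_cases hn : ∃ j, ν j + 1 = n
  · obtain ⟨j, rfl⟩ := hn
    rw [h.dVar_e hp, dVar_oddVar, if_neg (h0 j), mul_zero]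
  · rw [h.e_zero n fun j hj => hn ⟨j, hj⟩, map_zero]

include h in
/-- The derivative of a vector field with respect to a coordinate not occurring in it. -/
lemma dVar_op_of_not {t : Side} {p : Coord} (hp : p ≠ .a) (h0 : ¬(t = s ∧ p.At k)) (f : Formal) :
    dVar t p (F.op f) = (0 : Op) f + F.op (dVar t p f) := by
  have h1 := h.dVar_c_eq_zero (t := t) hp fun j hj => h0 ⟨hj.1, by rw [hj.2]; exact rfl⟩
  have h2 := h.dVar_e_eq_zero (t := t) hp fun j hj => h0 ⟨hj.1, by rw [hj.2]; exact rfl⟩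
  rw [dVar_op_aux]
  simp only [h1, h2, zero_mul, csum_zero, add_zero, LinearMap.zero_apply]

include h in
/-- The derivative of a vector field with respect to a coordinate occurring in it. -/
lemma dVar_op {p : Coord} (hp : p.At k) (f : Formal) : dVar s p (F.op f) =
    (LinearMap.mulLeft ℂ (coordCoef u v p) * nsOp (coordIdx μ ν p)) f + F.op (dVar s p f) := by
  rw [dVar_op_aux]
  congr 1
  cases p with
  | a => exact absurd hp id
  | A k' j =>
    cases (show k' = k from hp)
    have h2 := h.dVar_e_eq_zero (t := s) hp.ne_a fun j hj => by simp at hj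
    simp only [h2, zero_mul, csum_zero, add_zero]
    rw [csum_eq_single (μ j)]
    · rw [h.dVar_c hp.ne_a, dVar_evenVar, if_pos ⟨rfl, rfl⟩, mul_one]
      rfl
    · intro n hn
      by_cases hn' : ∃ i, μ i = n
      · obtain ⟨i, rfl⟩ := hn'
        rw [h.dVar_c hp.ne_a, dVar_evenVar, if_neg, mul_zero, zero_mul]
        rintro ⟨-, h3⟩
        cases h3
        exact hn rfl
      · rw [h.c_zero n fun j hj => hn' ⟨j, hj⟩, map_zero, zero_mul]
  | M k' j =>
    cases (show k' = k from hp)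
    have h2 := h.dVar_c_eq_zero (t := s) hp.ne_a fun j hj => by simp at hj
    simp only [h2, zero_mul, csum_zero, zero_add]
    rw [csum_eq_single (ν j + 1)]
    · rw [h.dVar_e hp.ne_a, dVar_oddVar, if_pos ⟨rfl, rfl⟩, mul_one]
      rfl
    · intro n hn
      by_cases hn' : ∃ i, ν i + 1 = n
      · obtain ⟨i, rfl⟩ := hn'
        rw [h.dVar_e hp.ne_a, dVar_oddVar, if_neg, mul_zero, zero_mul]
        rintro ⟨-, h3⟩
        cases h3
        exact hn rfl
      · rw [h.e_zero n fun j hj => hn' ⟨j, hj⟩, map_zero, zero_mul]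

end CoordField

lemma IsMono.dVar_nsOp {g : Formal} (hg : IsMono g) (i : NSIndex) (s : Side) {p : Coord}
    (hp : p ≠ .a) (f : Formal) : dVar s p ((LinearMap.mulLeft ℂ g * nsOp i) f)
      = i.act p.sgn • (LinearMap.mulLeft ℂ g * nsOp i) (dVar s p f) := by
  rw [Module.End.mul_apply, Module.End.mul_apply, LinearMap.mulLeft_apply, LinearMap.mulLeft_apply,
    hg.dVar_mul s hp, (isVarDeriv_dVar s p).comm_nsOp, mul_smul_comm]

lemma sgn_coordIdx (μ ν : ℕ+ → ℤ) (p : Coord) : (coordIdx μ ν p).sgn = p.sgn := by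
  cases p <;> rfl

section Comm

variable {T U : SFam} {s t : Side} {k l : Puncture} {u v u' v' : ℕ+ → Formal} {μ ν μ' ν' : ℕ+ → ℤ}
  (hT : CoordField T s k u v μ ν) (hU : CoordField U t l u' v' μ' ν')

include hT hU in
/-- The second derivative of the commutator of two vector fields with respect to a coordinate of
each of them. -/
lemma deriv2L_comm (hst : s ≠ t) {p q : Coord} (hp : p.At k) (hq : q.At l) (r : NSIndex) :
    deriv2L s p t q (coefNS r (T.op * U.op - U.op * T.op))
      = NS0.basisBracket (coordIdx μ ν p) (coordIdx μ' ν' q) r •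
        atE (coordCoef u v p * coordCoef u' v' q) := by
  have hg := hT.isMono hp
  have hh := hU.isMono hq
  have hTp := hT.dVar_op hp
  have hTq := hT.dVar_op_of_not hq.ne_a fun h => hst h.1.symm
  have hUp := hU.dVar_op_of_not hp.ne_a fun h => hst h.1
  have hUq := hU.dVar_op hq
  have h0 : ∀ (a : Side) (b : Coord) (f : Formal), dVar a b ((0 : Op) f)
      = (0 : ℂ) • (0 : Op) (dVar a b f) := by simp
  have hTq' := h0 s p
  have hUq' := hh.dVar_nsOp (coordIdx μ' ν' q) s hp.ne_a
  rw [deriv2L_apply, dVar_dVar_coefNS (B := LinearMap.mulLeft ℂ (coordCoef u v p * coordCoef u' v' q) *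
    (nsOp (coordIdx μ ν p) * nsOp (coordIdx μ' ν' q) -
      (coordIdx μ' ν' q).act (coordIdx μ ν p).sgn •
        (nsOp (coordIdx μ' ν' q) * nsOp (coordIdx μ ν p)))),
    coefNS_mulLeft (hg.isConst.mul hh.isConst), coefNS_bracket, mul_smul_comm, mul_one, atE_eq,
    map_smul, atE_eq]
  intro f hf
  rw [LinearMap.sub_apply, Module.End.mul_apply, Module.End.mul_apply, map_sub, map_sub,
    second_deriv hTp hTq hUp hUq hTq' hUq' (hf _ _) (hf _ _),
    second_deriv hUp hUq hTp hTq hUq' hTq' (hf _ _) (hf _ _)]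
  simp only [LinearMap.zero_apply, map_zero, smul_zero, add_zero, zero_add, Module.End.mul_apply,
    LinearMap.mulLeft_apply, LinearMap.sub_apply, LinearMap.smul_apply, hg.nsOp_mul, hh.nsOp_mul,
    mul_sub, mul_smul_comm, sgn_coordIdx, ← mul_assoc, hh.comm (coordCoef u v p)]

include hT hU in
lemma deriv2L_comm_eq_zero {a b : Side} {p q : Coord} (hp : p ≠ .a) (hq : q ≠ .a)
    (h1 : ¬(a = s ∧ p.At k) ∨ ¬(b = t ∧ q.At l)) (h2 : ¬(b = s ∧ q.At k) ∨ ¬(a = t ∧ p.At l))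
    (r : NSIndex) : deriv2L a p b q (coefNS r (T.op * U.op - U.op * T.op)) = 0 := by
  have key : ∀ {F : SFam} {s : Side} {k : Puncture} {u v : ℕ+ → Formal} {μ ν : ℕ+ → ℤ}
      (_ : CoordField F s k u v μ ν) (c : Side) {m : Coord}, m ≠ .a →
      ∃ Fm : Op, (∀ f, dVar c m (F.op f) = Fm f + F.op (dVar c m f)) ∧
        (∃ s : ℂ, ∀ f, dVar a p (Fm f) = s • Fm (dVar a p f)) ∧ (¬(c = s ∧ m.At k) → Fm = 0) := by
    intro F s k u v μ ν hF c m hm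
    by_cases h : c = s ∧ m.At k
    · obtain ⟨rfl, hk⟩ := h
      exact ⟨_, hF.dVar_op hk, ⟨_, (hF.isMono hk).dVar_nsOp _ a hp⟩, fun h => absurd ⟨rfl, hk⟩ h⟩
    · exact ⟨0, hF.dVar_op_of_not hm h, ⟨0, by simp⟩, fun _ => rfl⟩
  obtain ⟨Tp, hTp, -, hTp0⟩ := key hT a hp
  obtain ⟨Tq, hTq, ⟨s1, hTq'⟩, hTq0⟩ := key hT b hq
  obtain ⟨Up, hUp, -, hUp0⟩ := key hU a hp
  obtain ⟨Uq, hUq, ⟨s2, hUq'⟩, hUq0⟩ := key hU b hq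
  have e1 : ∀ f, Tp (Uq f) = 0 ∧ Uq (Tp f) = 0 := fun f => by
    rcases h1 with h | h
    · rw [hTp0 h]; simp
    · rw [hUq0 h]; simp
  have e2 : ∀ f, Tq (Up f) = 0 ∧ Up (Tq f) = 0 := fun f => by
    rcases h2 with h | h
    · rw [hTq0 h]; simp
    · rw [hUp0 h]; simp
  rw [deriv2L_apply, dVar_dVar_coefNS (B := 0), map_zero]
  · exact map_zero atEHom
  intro f hf
  rw [LinearMap.sub_apply, Module.End.mul_apply, Module.End.mul_apply, map_sub, map_sub,
    second_deriv hTp hTq hUp hUq hTq' hUq' (hf _ _) (hf _ _),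
    second_deriv hUp hUq hTp hTq hUq' hTq' (hf _ _) (hf _ _), (e1 f).1, (e1 f).2, (e2 f).1, (e2 f).2]
  simp

end Comm

end Formal

namespace SewingData.Regular

open Formal

/-- The index of the basis element belonging to a coordinate. -/
def idx : Coord → NSIndex
  | .a => .L 0
  | .A .zero j => .L j
  | .A .infty j => .L (-j)
  | .M .zero j => .G (j - 1)
  | .M .infty j => .G (-j)

lemma coordField_ofPos {s : Side} {k : Puncture} {w v : ℕ+ → Formal} (hw : IsFamily Gr.IsOdd w)
    (hv : ∀ j, IsMono (v j)) (h : ∀ j, w j = v j * oddVar s k j) :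
    CoordField (.ofPos (isFamily_evenVar s k) hw) s k 1 v (fun j => j) (fun j => j - 1) where
  isMono_u _ := .laurentMono (w := 0) rfl
  isMono_v := hv
  injective_μ i j h := by simpa using h
  injective_ν i j h := by simpa using h
  c_eq j := (SFam.ofPos_c _ _ j).trans (one_mul _).symm
  c_zero n hn := (SFam.isPos_ofPos _ _).1 n fun h => by
    obtain ⟨j, rfl⟩ := exists_coe_of_pos h
    exact hn j rfl
  e_eq j := by rw [sub_add_cancel]; exact (SFam.ofPos_e _ _ j).trans (h j)
  e_zero n hn := (SFam.isPos_ofPos _ _).2 n fun h => by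
    obtain ⟨j, rfl⟩ := exists_coe_of_pos h
    exact hn j (sub_add_cancel _ _)

lemma coordField_zeroField (s : Side) : CoordField (zeroField s) s .zero 1 1 (fun j => j)
    (fun j => j - 1) :=
  coordField_ofPos _ (fun _ => .laurentMono (w := 0) rfl) fun _ => (one_mul _).symm

lemma coordField_inftyField : CoordField inftyField .right .infty 1 1 (fun j => -j)
    (fun j => -j) where
  isMono_u _ := .laurentMono (w := 0) rfl
  isMono_v _ := .laurentMono (w := 0) rfl
  injective_μ i j h := by simpa using h
  injective_ν i j h := by simpa using h
  c_eq j := (inftyField_c j).trans (one_mul _).symm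
  c_zero n hn := if_neg fun h => by
    obtain ⟨j, hj⟩ := exists_coe_of_pos (neg_pos.mpr h)
    exact hn j (by omega)
  e_eq j := by rw [neg_add_eq_sub]; exact (inftyField_e j).trans (one_mul _).symm
  e_zero n hn := if_neg fun h => by
    obtain ⟨j, hj⟩ := exists_coe_of_pos (show 0 < 1 - n by omega)
    exact hn j (by omega)

lemma neg_I_mul (f : Formal) : -(Complex.I • (1 : Formal)) * f = -(Complex.I • f) := by
  rw [neg_mul, smul_mul_assoc, one_mul]

lemma coordField_inftyField' : CoordField inftyField' .left .infty 1 (fun _ => -(Complex.I • 1))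
    (fun j => j) (fun j => j - 1) :=
  coordField_ofPos _ (fun _ => ((IsMono.laurentMono (w := 0) rfl).smul _).neg)
    fun _ => (neg_I_mul _).symm

lemma coordField_inftyFieldRight : CoordField inftyFieldRight .right .infty 1
    (fun _ => -(Complex.I • 1)) (fun j => j) (fun j => j - 1) :=
  coordField_ofPos _ (fun _ => ((IsMono.laurentMono (w := 0) rfl).smul _).neg)
    fun _ => (neg_I_mul _).symm

lemma pw_alpha (n : ℤ) : sAlpha.pw n = laurentMono (n, 0, 0) := by
  rw [sAlpha, Scalar.pw_mono]
  congr 1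
  ext <;> simp

lemma isMono_pw_alpha (n : ℤ) : IsMono (sAlpha.pw n) := by
  rw [pw_alpha]
  exact .laurentMono rfl

lemma isMono_pw_alpha_inv (n : ℤ) : IsMono ((sAlpha⁻¹).pw n) := by
  rw [pw_inv]
  exact isMono_pw_alpha _

lemma atE_pw_alpha (n : ℤ) : atE (sAlpha.pw n) = 1 := by
  rw [pw_alpha, atE_laurentMono]

lemma atE_pw_alpha_inv (n : ℤ) : atE ((sAlpha⁻¹).pw n) = 1 := by
  rw [pw_inv, atE_pw_alpha]

end SewingData.Regular

namespace Formal

lemma IsMono.mul {g h : Formal} (hg : IsMono g) (hh : IsMono h) : IsMono (g * h) := by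
  obtain ⟨c, w, hw, rfl⟩ := hg
  obtain ⟨d, w', hw', rfl⟩ := hh
  refine ⟨c * d, w + w', by simp [hw, hw'], ?_⟩
  rw [smul_mul_smul_comm, laurentMono_mul]

lemma CoordField.twist {F : SFam} {s : Side} {k : Puncture} {u v : ℕ+ → Formal} {μ ν : ℕ+ → ℤ}
    (h : CoordField F s k u v μ ν) {σ : Scalar} (hσ : ∀ n, IsMono (σ.pw n)) :
    CoordField (F.twist σ) s k (fun j => σ.pw (2 * μ j) * u j)
      (fun j => σ.pw (2 * (ν j + 1) - 1) * v j) μ ν where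
  isMono_u j := (hσ _).mul (h.isMono_u j)
  isMono_v j := (hσ _).mul (h.isMono_v j)
  injective_μ := h.injective_μ
  injective_ν := h.injective_ν
  c_eq j := (congrArg (σ.pw (2 * μ j) * ·) (h.c_eq j)).trans (mul_assoc _ _ _).symm
  c_zero n hn := (congrArg (σ.pw (2 * n) * ·) (h.c_zero n hn)).trans (mul_zero _)
  e_eq j := (congrArg (σ.pw (2 * (ν j + 1) - 1) * ·) (h.e_eq j)).trans (mul_assoc _ _ _).symm
  e_zero n hn := (congrArg (σ.pw (2 * n - 1) * ·) (h.e_zero n hn)).trans (mul_zero _)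

end Formal

namespace NS0

lemma basisBracket_skew (i j : NSIndex) :
    basisBracket i j = -(j.act i.sgn • basisBracket j i) := by
  rcases i with m | m <;> rcases j with n | n <;>
    simp only [basisBracket, NSIndex.act, NSIndex.sgn, one_smul, neg_neg, neg_smul]
  · rw [add_comm n m, ← neg_smul, neg_sub]
  · rw [show n + (m + 1) = m + (n + 1) by ring]

end NS0

namespace SewingData

open Formal

/-- The coordinates of the sewn supersphere. -/
def phi (S : SewingData) : Coord → Formal
  | .a => S.lam
  | .A k j => S.phiEven k j
  | .M k j => S.phiOdd k j

namespace Regular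

/-- The factor relating a coordinate to a basis element of the Neveu–Schwarz algebra. -/
def factor : Coord → ℂ
  | .a => 2
  | _ => 1

/-- The linear part of a coordinate of the sewn supersphere. -/
def linPart : Coord → Formal
  | .a => laurentMono (1, 1, 0)
  | .A .zero j => evenVar .left .zero j + sAlpha.pw (2 * j) * evenVar .right .zero j
  | .A .infty j => evenVar .left .infty j + sAlpha.pw (2 * -j) * evenVar .right .infty j
  | .M .zero j => oddVar .left .zero j + sAlpha.pw (2 * j - 1) * oddVar .right .zero j
  | .M .infty j => oddVar .left .infty j + sAlpha.pw (2 * (1 - j) - 1) * oddVar .right .infty j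

/-- The quadratic part of a coordinate of the sewn supersphere that does not come from `Ψ`. -/
def bchPart : Coord → Formal
  | .a => 0
  | .A .zero j => coefL j zeroComm
  | .A .infty j => coefL j inftyComm
  | .M .zero j => coefG j zeroComm
  | .M .infty j => Complex.I • coefG j inftyComm

/-- The quadratic part of a coordinate of the sewn supersphere that comes from `Ψ`. -/
def sewPart : Coord → Formal
  | .a => (2 : ℂ)⁻¹ • (laurentMono (1, 1, 0) * coefL 0 sewComm)
  | p => coefNS (idx p) sewComm

variable {S : SewingData} (h : S.Regular) (hS : S.IsSewing)

include h hS in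
/-- The coordinates of the sewn supersphere to second order. -/
lemma phi_mem (r : Coord) :
    S.phi r - (linPart r - sewPart r - (2 : ℂ)⁻¹ • bchPart r) ∈ I 3 := by
  rcases r with _ | ⟨_ | _, j⟩ | ⟨_ | _, j⟩
  · have := h.lam_mem hS
    rwa [show linPart .a - sewPart .a - (2 : ℂ)⁻¹ • bchPart .a = laurentMono (1, 1, 0)
      - (2 : ℂ)⁻¹ • (laurentMono (1, 1, 0) * coefL 0 sewComm) by
        rw [linPart, sewPart, bchPart, smul_zero, sub_zero]]
  · exact h.phiInfty_even_mem hS j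
  · exact h.phiZero_even_mem hS j
  · have := h.phiInfty_odd_mem hS j
    rw [div_eq_inv_mul, mul_smul] at this
    have e : sewPart (.M .infty j) = coefG (1 - j) sewComm := by
      rw [sewPart, idx, coefNS, neg_add_eq_sub]
      simp
    rwa [linPart, e, bchPart]
  · have := h.phiZero_odd_mem hS j
    have e : sewPart (.M .zero j) = coefG j sewComm := by
      rw [sewPart, idx, coefNS, sub_add_cancel]
      simp
    rwa [linPart, e, bchPart]

lemma zeroComm_mem : zeroComm ∈ K 2 :=
  sub_mem (mul_mem_K (SFam.op_mem_K _) (SFam.op_mem_K _))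
    (mul_mem_K (SFam.op_mem_K _) (SFam.op_mem_K _))

lemma inftyComm_mem : inftyComm ∈ K 2 :=
  sub_mem (mul_mem_K (SFam.op_mem_K _) (SFam.op_mem_K _))
    (mul_mem_K (SFam.op_mem_K _) (SFam.op_mem_K _))

lemma coefNS_mem_I {n : ℕ} {T : Formal.Op} (hT : T ∈ K n) (r : NSIndex) :
    coefNS r T ∈ I n := by
  cases r
  · exact coefL_mem_I hT
  · exact coefG_mem_I hT

lemma sewPart_mem (r : Coord) : sewPart r ∈ I 2 := by
  cases r
  · exact Submodule.smul_mem _ _ (mul_mem_I_left _ (coefL_mem_I sewComm_mem))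
  all_goals exact coefNS_mem_I sewComm_mem _

lemma bchPart_mem (r : Coord) : bchPart r ∈ I 2 := by
  rcases r with _ | ⟨_ | _, j⟩ | ⟨_ | _, j⟩
  · exact Submodule.zero_mem _
  · exact coefL_mem_I inftyComm_mem
  · exact coefL_mem_I zeroComm_mem
  · exact Submodule.smul_mem _ _ (coefG_mem_I inftyComm_mem)
  · exact coefG_mem_I zeroComm_mem

include h hS in
lemma phi_sub_linPart_mem (r : Coord) : S.phi r - linPart r ∈ I 2 := by
  have h1 := sub_mem (sub_mem (I_anti (show 2 ≤ 3 by norm_num)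
    (h.phi_mem hS r)) (sewPart_mem r)) (Submodule.smul_mem _ (2 : ℂ)⁻¹ (bchPart_mem r))
  convert h1 using 1
  abel

/-! ### Second derivatives of the linear parts -/

lemma dVar_one (s : Side) (p : Coord) : dVar s p 1 = 0 := by
  cases p with
  | a =>
    cases s
    · exact (congrArg _ laurentMono_zero.symm).trans
        ((dLaurent_laurentMono _ _ _).trans (by simp))
    · exact (congrArg _ laurentMono_zero.symm).trans
        ((dLaurent_laurentMono _ _ _).trans (by simp))
  | A k j => exact (IsMono.laurentMono (w := 0) rfl).dVar_eq_zero s nofun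
  | M k j => exact (IsMono.laurentMono (w := 0) rfl).dVar_eq_zero s nofun

/-- The variable of the side `s` that corresponds to a coordinate. -/
def var (s : Side) : Coord → Formal
  | .a => 0
  | .A k j => evenVar s k j
  | .M k j => oddVar s k j

open scoped Classical in
lemma dVar_var (s t : Side) (p q : Coord) (hq : q ≠ .a) :
    dVar s p (var t q) = if s = t ∧ p = q then 1 else 0 := by
  cases q with
  | a => exact absurd rfl hq
  | A k j => exact dVar_evenVar _ _ _ _ _
  | M k j => exact dVar_oddVar _ _ _ _ _

/-- The exponent of `α₀^{1/2}` in the linear part of a coordinate of the sewn supersphere. -/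
def exponent : Coord → ℤ
  | .a => 0
  | .A .zero j => 2 * j
  | .A .infty j => 2 * -j
  | .M .zero j => 2 * j - 1
  | .M .infty j => 2 * (1 - j) - 1

lemma linPart_eq {r : Coord} (hr : r ≠ .a) :
    linPart r = var .left r + laurentMono (exponent r, 0, 0) * var .right r := by
  rw [← pw_alpha]
  rcases r with _ | ⟨_ | _, j⟩ | ⟨_ | _, j⟩
  · exact absurd rfl hr
  all_goals rfl

lemma isMono_linPart_a : IsMono (linPart .a) := .laurentMono rfl

lemma dVar_dVar_var (s t : Side) (p q : Coord) (u : Side) (r : Coord) (hr : r ≠ .a) :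
    dVar s p (dVar t q (var u r)) = 0 := by
  rw [dVar_var _ _ _ _ hr]
  split_ifs
  · exact dVar_one _ _
  · exact map_zero _

lemma atE_zero : atE 0 = 0 := map_zero atEHom

lemma deriv2L_linPart {s t : Side} {p q : Coord} (hp : p ≠ .a) (hq : q ≠ .a) (r : Coord) :
    deriv2L s p t q (linPart r) = 0 := by
  rw [deriv2L_apply]
  by_cases hr : r = .a
  · subst hr
    rw [isMono_linPart_a.dVar_eq_zero t hq, map_zero, atE_zero]
  · have h1 : IsMono (laurentMono (exponent r, 0, 0)) := .laurentMono rfl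
    rw [linPart_eq hr, map_add, map_add, h1.dVar_mul t hq, h1.dVar_mul s hp,
      dVar_dVar_var _ _ _ _ _ _ hr, dVar_dVar_var _ _ _ _ _ _ hr, mul_zero, add_zero, atE_zero]

lemma dVar_a_mul (s : Side) (w : ℤ × ℤ × ℤ) (u : Side) {r : Coord} (hr : r ≠ .a) :
    dVar s .a (laurentMono w * var u r) = dVar s .a (laurentMono w) * var u r := by
  rw [(isVarDeriv_dVar s .a).mul_even _ _ (isEven_laurentMono w), dVar_var _ _ _ _ hr,
    if_neg fun h => hr h.2.symm, mul_zero, add_zero]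

lemma dVar_a_laurentMono (s : Side) (w : ℤ × ℤ × ℤ) (hw : w.2.2 = 0) :
    IsMono (dVar s .a (laurentMono w)) := by
  cases s
  · change IsMono (dLaurent _ _ _)
    rw [dLaurent_laurentMono]
    exact (IsMono.laurentMono (by simpa using hw)).smul _
  · change IsMono (dLaurent _ _ _)
    rw [dLaurent_laurentMono]
    exact (IsMono.laurentMono (by simpa using hw)).smul _

open scoped Classical in
lemma deriv2L_a_linPart {q : Coord} (hq : q ≠ .a) (r : Coord) :
    deriv2L .left .a .right q (linPart r) = if q = r then (exponent q : ℂ) • 1 else 0 := by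
  rw [deriv2L_apply]
  by_cases hr : r = .a
  · subst hr
    rw [isMono_linPart_a.dVar_eq_zero _ hq, map_zero, atE_zero, if_neg hq]
  · have h1 : IsMono (laurentMono (exponent r, 0, 0)) := .laurentMono rfl
    rw [linPart_eq hr, map_add, h1.dVar_mul _ hq, dVar_var _ _ _ _ hr, dVar_var _ _ _ _ hr,
      if_neg (by rintro ⟨⟨⟩, -⟩), zero_add]
    by_cases h : q = r
    · subst h
      rw [if_pos ⟨rfl, rfl⟩, if_pos rfl, mul_one]
      change atE (dLaurent _ _ _) = _
      rw [dLaurent_laurentMono, atE_eq, map_smul, ← atE_eq, atE_laurentMono]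
      rfl
    · rw [if_neg fun h' => h h'.2, if_neg h, mul_zero, map_zero, atE_zero]

lemma deriv2L_linPart_a {q : Coord} (hq : q ≠ .a) (t : Side) (r : Coord) :
    deriv2L .left q t .a (linPart r) = 0 := by
  rw [deriv2L_apply]
  by_cases hr : r = .a
  · subst hr
    rw [linPart, (dVar_a_laurentMono t (1, 1, 0) rfl).dVar_eq_zero _ hq, atE_zero]
  · rw [linPart_eq hr, map_add, dVar_a_mul _ _ _ hr, map_add, dVar_dVar_var _ _ _ _ _ _ hr,
      (dVar_a_laurentMono t _ rfl).dVar_mul _ hq, dVar_var _ _ _ _ hr,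
      if_neg (by rintro ⟨⟨⟩, -⟩), mul_zero, add_zero, atE_zero]

/-! ### Second derivatives of the coordinates of the sewn supersphere -/

include h hS in
lemma deriv2L_phi {s t : Side} {p q : Coord} (hp : p ≠ .a) (hq : q ≠ .a) (r : Coord) :
    deriv2L s p t q (S.phi r)
      = -deriv2L s p t q (sewPart r) - (2 : ℂ)⁻¹ • deriv2L s p t q (bchPart r) := by
  have h1 := deriv2L_of_mem_I (h.phi_mem hS r) s p t q
  rw [map_sub, sub_eq_zero, map_sub, map_sub, map_smul, deriv2L_linPart hp hq, zero_sub] at h1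
  exact h1

lemma deriv2L_mono_mul {g : Formal} (hg : IsMono g) {s t : Side} {p q : Coord} (hp : p ≠ .a)
    (hq : q ≠ .a) (f : Formal) : deriv2L s p t q (g * f) = atE g * deriv2L s p t q f := by
  rw [deriv2L_apply, hg.dVar_mul t hq, hg.dVar_mul s hp, atE_mul, deriv2L_apply]

lemma deriv2L_sewPart {s t : Side} {p q : Coord} (hp : p ≠ .a) (hq : q ≠ .a) (r : Coord) :
    deriv2L s p t q (sewPart r) = (factor r)⁻¹ • deriv2L s p t q (coefNS (idx r) sewComm) := by
  cases r with
  | a =>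
    rw [sewPart, map_smul, deriv2L_mono_mul (.laurentMono rfl) hp hq, atE_laurentMono, one_mul]
    rfl
  | A k j => rw [factor, inv_one, one_smul, sewPart] <;> rintro ⟨⟩
  | M k j => rw [factor, inv_one, one_smul, sewPart] <;> rintro ⟨⟩

/-- The indices of `L` and `G` belonging to a coordinate in its local coordinate. -/
def idx' : Coord → NSIndex := coordIdx (fun j => j) fun j => j - 1

/-- The factor of the quadratic part. -/
def bchFactor : Coord → ℂ
  | .M .infty _ => Complex.I
  | _ => 1

lemma bchPart_eq_zero {r : Coord} (hr : r.At .zero) : bchPart r = coefNS (idx' r) zeroComm := by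
  rcases r with _ | ⟨_ | _, j⟩ | ⟨_ | _, j⟩
  · exact absurd hr id
  · cases hr
  · rfl
  · cases hr
  · rw [bchPart, idx', coordIdx, coefNS, sub_add_cancel]

lemma bchPart_eq_infty {r : Coord} (hr : r.At .infty) :
    bchPart r = bchFactor r • coefNS (idx' r) inftyComm := by
  rcases r with _ | ⟨_ | _, j⟩ | ⟨_ | _, j⟩
  · exact absurd hr id
  · rw [bchFactor, one_smul]
    · rfl
    · simp
  · cases hr
  · rw [bchPart, idx', coordIdx, coefNS, sub_add_cancel, bchFactor]
  · cases hr

lemma exists_at {r : Coord} (hr : r ≠ .a) : r.At .zero ∨ r.At .infty := by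
  rcases r with _ | ⟨_ | _, j⟩ | ⟨_ | _, j⟩ <;> simp_all [Coord.At]

lemma not_at {r : Coord} (hr : r.At .zero) : ¬r.At .infty := by
  rcases r with _ | ⟨_ | _, j⟩ | ⟨_ | _, j⟩ <;> simp_all [Coord.At]

lemma coordField_b : CoordField (inftyField.twist sAlpha) .right .infty
    (fun j => sAlpha.pw (2 * -j) * 1) (fun j => sAlpha.pw (2 * (-j + 1) - 1) * 1) (fun j => -j)
    (fun j => -j) := coordField_inftyField.twist isMono_pw_alpha

lemma coordField_z : CoordField ((zeroField .right).twist sAlpha) .right .zero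
    (fun j => sAlpha.pw (2 * j) * 1) (fun j => sAlpha.pw (2 * (j - 1 + 1) - 1) * 1) (fun j => j)
    (fun j => j - 1) := (coordField_zeroField .right).twist isMono_pw_alpha

lemma coordField_i : CoordField (inftyFieldRight.twist sAlpha⁻¹) .right .infty
    (fun j => (sAlpha⁻¹).pw (2 * j) * 1)
    (fun j => (sAlpha⁻¹).pw (2 * (j - 1 + 1) - 1) * -(Complex.I • 1)) (fun j => j)
    (fun j => j - 1) := coordField_inftyFieldRight.twist isMono_pw_alpha_inv

end Regular

end SewingData

namespace SewingData.Regular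

open Formal

variable {S : SewingData} (h : S.Regular) (hS : S.IsSewing)

lemma idx'_eq {r : Coord} (hr : r.At .zero) : idx' r = idx r := by
  rcases r with _ | ⟨_ | _, j⟩ | ⟨_ | _, j⟩ <;> first | rfl | cases hr

lemma coordIdx_b {r : Coord} (hr : r.At .infty) :
    coordIdx (fun j => -j) (fun j => -j) r = idx r := by
  rcases r with _ | ⟨_ | _, j⟩ | ⟨_ | _, j⟩ <;> first | rfl | cases hr

lemma basisBracket_idx_zero {p q r : Coord} (hp : p.At .zero) (hq : q.At .zero)
    (hr : ¬r.At .zero) : NS0.basisBracket (idx p) (idx q) (idx r) = 0 := by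
  rcases p with _ | ⟨_ | _, i⟩ | ⟨_ | _, i⟩ <;> rcases q with _ | ⟨_ | _, j⟩ | ⟨_ | _, j⟩ <;>
    rcases r with _ | ⟨_ | _, l⟩ | ⟨_ | _, l⟩ <;>
    simp only [Coord.At, reduceCtorEq, not_true_eq_false] at hp hq hr <;>
    simp only [idx, NS0.basisBracket, Finsupp.smul_apply, Finsupp.neg_apply, NS0.L_L_apply,
      NS0.L_G_apply, NS0.G_L_apply, NS0.G_G_apply, smul_zero, neg_zero] <;>
    first
    | rw [if_neg (by have := i.pos; have := j.pos; omega), smul_zero]; done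
    | rw [if_neg (by have := i.pos; have := j.pos; omega), smul_zero, neg_zero]

lemma basisBracket_idx_infty {p q r : Coord} (hp : p.At .infty) (hq : q.At .infty)
    (hr : ¬r.At .infty) : NS0.basisBracket (idx p) (idx q) (idx r) = 0 := by
  rcases p with _ | ⟨_ | _, i⟩ | ⟨_ | _, i⟩ <;> rcases q with _ | ⟨_ | _, j⟩ | ⟨_ | _, j⟩ <;>
    rcases r with _ | ⟨_ | _, l⟩ | ⟨_ | _, l⟩ <;>
    simp only [Coord.At, reduceCtorEq, not_true_eq_false] at hp hq hr <;>
    simp only [idx, NS0.basisBracket, Finsupp.smul_apply, Finsupp.neg_apply, NS0.L_L_apply,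
      NS0.L_G_apply, NS0.G_L_apply, NS0.G_G_apply, smul_zero, neg_zero] <;>
    first
    | rw [if_neg (by have := i.pos; have := j.pos; omega), smul_zero]; done
    | rw [if_neg (by have := i.pos; have := j.pos; omega), smul_zero, neg_zero]
    | rw [if_neg (by have := i.pos; have := j.pos; have := l.pos; omega), smul_zero]; done
    | rw [if_neg (by have := i.pos; have := j.pos; have := l.pos; omega), smul_zero, neg_zero]

lemma coordCoef_one {p : Coord} {k : Puncture} (hp : p.At k) : coordCoef 1 1 p = 1 := by
  rcases p with _ | _ | _
  · exact absurd hp id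
  all_goals rfl

lemma atE_coordCoef_b {p : Coord} {k : Puncture} (hp : p.At k) :
    atE (coordCoef (fun j => sAlpha.pw (2 * -j) * 1) (fun j => sAlpha.pw (2 * (-j + 1) - 1) * 1) p)
      = 1 := by
  rcases p with _ | _ | _
  · exact absurd hp id
  all_goals rw [coordCoef, mul_one, atE_pw_alpha]

lemma atE_coordCoef_z {p : Coord} {k : Puncture} (hp : p.At k) :
    atE (coordCoef (fun j => sAlpha.pw (2 * j) * 1)
      (fun j => sAlpha.pw (2 * (j - 1 + 1) - 1) * 1) p) = 1 := by
  rcases p with _ | _ | _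
  · exact absurd hp id
  all_goals rw [coordCoef, mul_one, atE_pw_alpha]

/-- The factor `-i` of the odd coordinates at `∞`. -/
def oddFactor : Coord → ℂ
  | .M _ _ => -Complex.I
  | _ => 1

lemma atE_coordCoef_i {p : Coord} {k : Puncture} (hp : p.At k) :
    atE (coordCoef (fun j => (sAlpha⁻¹).pw (2 * j) * 1)
      (fun j => (sAlpha⁻¹).pw (2 * (j - 1 + 1) - 1) * -(Complex.I • 1)) p) = oddFactor p • 1 := by
  cases p with
  | a => exact absurd hp id
  | A k j => rw [coordCoef, mul_one, atE_pw_alpha_inv, oddFactor, one_smul]; rintro _ _ ⟨⟩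
  | M k j =>
    rw [coordCoef, atE_mul, atE_pw_alpha_inv, one_mul, ← smul_neg, atE_eq, map_smul, map_neg, map_one,
      oddFactor, neg_smul, smul_neg]

lemma atE_coordCoef_i' {p : Coord} {k : Puncture} (hp : p.At k) :
    atE (coordCoef 1 (fun _ => -(Complex.I • 1)) p) = oddFactor p • 1 := by
  cases p with
  | a => exact absurd hp id
  | A k j => rw [coordCoef, oddFactor, one_smul]; exacts [atE_one, by rintro _ _ ⟨⟩]
  | M k j =>
    rw [coordCoef, ← smul_neg, atE_eq, map_smul, map_neg, map_one, oddFactor, neg_smul, smul_neg]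

lemma basisBracket_flip {p q r : Coord} (hp : p.At .infty) (hq : q.At .infty)
    (hr : r.At .infty) : bchFactor r * (oddFactor p * oddFactor q)
      * NS0.basisBracket (idx' p) (idx' q) (idx' r) = -NS0.basisBracket (idx p) (idx q) (idx r) := by
  have h1 : Complex.I * -Complex.I = 1 := by rw [mul_neg, Complex.I_mul_I, neg_neg]
  have h2 : -Complex.I * -Complex.I = -1 := by rw [neg_mul_neg, Complex.I_mul_I]
  rcases p with _ | ⟨_ | _, i⟩ | ⟨_ | _, i⟩ <;> rcases q with _ | ⟨_ | _, j⟩ | ⟨_ | _, j⟩ <;>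
    rcases r with _ | ⟨_ | _, l⟩ | ⟨_ | _, l⟩ <;>
    simp only [Coord.At, reduceCtorEq] at hp hq hr <;>
    simp only [idx, idx', coordIdx, NS0.basisBracket, Finsupp.smul_apply, Finsupp.neg_apply,
      NS0.L_L_apply, NS0.L_G_apply, NS0.G_L_apply, NS0.G_G_apply, smul_zero, neg_zero, bchFactor,
      oddFactor, mul_one, one_mul, h1, h2, mul_zero]
  · by_cases hl : (i + j : ℤ) = l
    · rw [if_pos hl, if_pos (by omega)]
      simp only [smul_eq_mul, mul_one]
      push_cast
      ring
    · rw [if_neg hl, if_neg (by omega), smul_zero, smul_zero, neg_zero]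
  · by_cases hl : (j - 1 + i : ℤ) = l - 1
    · rw [if_pos hl, if_pos (by omega)]
      simp only [smul_eq_mul, mul_one]
      push_cast
      ring
    · rw [if_neg hl, if_neg (by omega), smul_zero, smul_zero, neg_zero, neg_zero]
  · by_cases hl : (i - 1 + j : ℤ) = l - 1
    · rw [if_pos hl, if_pos (by omega)]
      simp only [smul_eq_mul, mul_one]
      push_cast
      ring
    · rw [if_neg hl, if_neg (by omega), smul_zero, smul_zero, neg_zero]
  · by_cases hl : (i - 1 + (j - 1 + 1) : ℤ) = l
    · rw [if_pos hl, if_pos (by omega), neg_one_mul]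
    · rw [if_neg hl, if_neg (by omega), smul_zero, mul_zero, neg_zero]

lemma comm_eq_neg {T U : Formal.Op} : T * U - U * T = -(U * T - T * U) := by
  rw [neg_sub]

lemma deriv2L_sewComm {p q : Coord} (hp : p.At .zero) (hq : q.At .infty) (r : NSIndex) :
    deriv2L .left p .right q (coefNS r sewComm) = NS0.basisBracket (idx p) (idx q) r • 1 := by
  rw [sewComm, deriv2L_comm (coordField_zeroField .left) coordField_b nofun hp hq,
    coordCoef_one hp, one_mul, atE_coordCoef_b hq, coordIdx_b hq]
  exact congrArg (NS0.basisBracket · (idx q) r • (1 : Lam)) (idx'_eq hp)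

lemma deriv2L_sewComm_eq_zero {s t : Side} {p q : Coord} (hp : p ≠ .a) (hq : q ≠ .a)
    (h1 : ¬(s = .left ∧ p.At .zero) ∨ ¬(t = .right ∧ q.At .infty))
    (h2 : ¬(t = .left ∧ q.At .zero) ∨ ¬(s = .right ∧ p.At .infty)) (r : NSIndex) :
    deriv2L s p t q (coefNS r sewComm) = 0 :=
  deriv2L_comm_eq_zero (coordField_zeroField .left) coordField_b hp hq h1 h2 r

lemma deriv2L_zeroComm {p q : Coord} (hp : p.At .zero) (hq : q.At .zero) (r : NSIndex) :
    deriv2L .left p .right q (coefNS r zeroComm) = NS0.basisBracket (idx p) (idx q) r • 1 := by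
  rw [zeroComm, deriv2L_comm (coordField_zeroField .left) coordField_z nofun hp hq,
    coordCoef_one hp, one_mul, atE_coordCoef_z hq, ← idx'_eq hp, ← idx'_eq hq]
  rfl

lemma deriv2L_zeroComm_eq_zero {s t : Side} {p q : Coord} (hp : p ≠ .a) (hq : q ≠ .a)
    (h1 : ¬(s = .left ∧ p.At .zero) ∨ ¬(t = .right ∧ q.At .zero))
    (h2 : ¬(t = .left ∧ q.At .zero) ∨ ¬(s = .right ∧ p.At .zero)) (r : NSIndex) :
    deriv2L s p t q (coefNS r zeroComm) = 0 :=
  deriv2L_comm_eq_zero (coordField_zeroField .left) coordField_z hp hq h1 h2 r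

lemma deriv2L_inftyComm {p q : Coord} (hp : p.At .infty) (hq : q.At .infty) (r : NSIndex) :
    deriv2L .left p .right q (coefNS r inftyComm)
      = -((oddFactor p * oddFactor q * NS0.basisBracket (idx' p) (idx' q) r) • 1) := by
  rw [inftyComm, comm_eq_neg, map_neg, map_neg,
    deriv2L_comm coordField_inftyField' coordField_i nofun hp hq, atE_mul,
    atE_coordCoef_i' hp, atE_coordCoef_i hq, smul_mul_smul_comm, mul_one, smul_smul, mul_comm]
  rfl

lemma deriv2L_inftyComm_eq_zero {s t : Side} {p q : Coord} (hp : p ≠ .a) (hq : q ≠ .a)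
    (h1 : ¬(s = .left ∧ p.At .infty) ∨ ¬(t = .right ∧ q.At .infty))
    (h2 : ¬(t = .left ∧ q.At .infty) ∨ ¬(s = .right ∧ p.At .infty)) (r : NSIndex) :
    deriv2L s p t q (coefNS r inftyComm) = 0 := by
  rw [inftyComm, comm_eq_neg, map_neg, map_neg,
    deriv2L_comm_eq_zero coordField_inftyField' coordField_i hp hq h1 h2, neg_zero]

lemma deriv2L_bchPart_eq_zero {s t : Side} {p q : Coord} (hp : p ≠ .a) (hq : q ≠ .a)
    (h1 : ∀ k, (¬(s = .left ∧ p.At k) ∨ ¬(t = .right ∧ q.At k)) ∧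
      (¬(t = .left ∧ q.At k) ∨ ¬(s = .right ∧ p.At k))) (r : Coord) :
    deriv2L s p t q (bchPart r) = 0 := by
  by_cases hr : r = .a
  · subst hr
    exact map_zero _
  rcases exists_at hr with hr | hr
  · rw [bchPart_eq_zero hr, deriv2L_zeroComm_eq_zero hp hq (h1 _).1 (h1 _).2]
  · rw [bchPart_eq_infty hr, map_smul, deriv2L_inftyComm_eq_zero hp hq (h1 _).1 (h1 _).2, smul_zero]

include h hS in
lemma deriv2L_same_side (s : Side) {p q : Coord} (hp : p ≠ .a) (hq : q ≠ .a) (r : Coord) :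
    deriv2L s p s q (S.phi r) = 0 := by
  rw [h.deriv2L_phi hS hp hq, deriv2L_sewPart hp hq, deriv2L_sewComm_eq_zero hp hq,
    deriv2L_bchPart_eq_zero hp hq, smul_zero, smul_zero, neg_zero, sub_zero]
  all_goals cases s <;> simp

include h hS in
lemma deriv2L_zero_infty {p q : Coord} (hp : p.At .zero) (hq : q.At .infty) (r : Coord) :
    deriv2L .left p .right q (S.phi r)
      = -(((factor r)⁻¹ * NS0.basisBracket (idx p) (idx q) (idx r)) • 1) := by
  rw [h.deriv2L_phi hS hp.ne_a hq.ne_a, deriv2L_sewPart hp.ne_a hq.ne_a, deriv2L_sewComm hp hq,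
    deriv2L_bchPart_eq_zero hp.ne_a hq.ne_a, smul_zero, sub_zero, smul_smul]
  intro k
  refine ⟨?_, .inl (by rintro ⟨⟨⟩, -⟩)⟩
  cases k
  · exact .inl fun h => not_at hp h.2
  · exact .inr fun h => not_at h.2 hq

include h hS in
lemma deriv2L_same {k : Puncture} {p q : Coord} (hp : p.At k) (hq : q.At k) (r : Coord) :
    deriv2L .left p .right q (S.phi r)
      = -(((2 : ℂ)⁻¹ * ((factor r)⁻¹ * NS0.basisBracket (idx p) (idx q) (idx r))) • 1) := by
  have h1 : deriv2L .left p .right q (bchPart r)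
      = ((factor r)⁻¹ * NS0.basisBracket (idx p) (idx q) (idx r)) • 1 := by
    by_cases hr : r = .a
    · subst hr
      have : NS0.basisBracket (idx p) (idx q) (idx .a) = 0 := by
        cases k
        · exact basisBracket_idx_infty hp hq id
        · exact basisBracket_idx_zero hp hq id
      rw [this, mul_zero, zero_smul]
      exact map_zero _
    have hf : factor r = 1 := by cases r <;> first | rfl | exact absurd rfl hr
    rw [hf, inv_one, one_mul]
    rcases exists_at hr with hr | hr
    · rw [bchPart_eq_zero hr]
      cases k
      · rw [deriv2L_zeroComm_eq_zero hp.ne_a hq.ne_a (.inl fun h => not_at h.2 hp)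
          (.inl (by rintro ⟨⟨⟩, -⟩)), basisBracket_idx_infty hp hq (not_at hr), zero_smul]
      · rw [deriv2L_zeroComm hp hq, idx'_eq hr]
    · rw [bchPart_eq_infty hr, map_smul]
      cases k
      · rw [deriv2L_inftyComm hp hq, smul_neg, smul_smul, ← mul_assoc, basisBracket_flip hp hq hr,
          neg_smul, neg_neg]
      · rw [deriv2L_inftyComm_eq_zero hp.ne_a hq.ne_a (.inl fun h => not_at hp h.2)
          (.inl (by rintro ⟨⟨⟩, -⟩)), basisBracket_idx_zero hp hq (fun h => not_at h hr), zero_smul,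
          smul_zero]
  rw [h.deriv2L_phi hS hp.ne_a hq.ne_a, h1, deriv2L_sewPart hp.ne_a hq.ne_a,
    deriv2L_sewComm_eq_zero hp.ne_a hq.ne_a, smul_zero, neg_zero, zero_sub, smul_smul]
  · cases k
    · exact .inl fun h => not_at h.2 hp
    · exact .inr fun h => not_at hq h.2
  · exact .inl (by rintro ⟨⟨⟩, -⟩)

lemma idx_injective : Function.Injective idx := by
  rintro (_ | ⟨_ | _, i⟩ | ⟨_ | _, i⟩) (_ | ⟨_ | _, j⟩ | ⟨_ | _, j⟩) h <;>
    simp only [idx, NSIndex.L.injEq, NSIndex.G.injEq, reduceCtorEq] at h <;>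
    first
    | rfl
    | (have := i.pos; have := j.pos; omega)
    | (have := i.pos; omega)
    | (have := j.pos; omega)
    | (have : i = j := PNat.eq (by omega); rw [this])

include h hS in
lemma deriv2L_a {q : Coord} (hq : q ≠ .a) (r : Coord) :
    deriv2L .left .a .right q (S.phi r)
      = -((2 * ((factor r)⁻¹ * NS0.basisBracket (idx .a) (idx q) (idx r))) • 1) := by
  have h1 := deriv2L_a_left (h.phi_sub_linPart_mem hS r) .left .right q
  rw [map_sub, sub_eq_zero, deriv2L_a_linPart hq] at h1
  rw [h1]
  by_cases hqr : q = r
  · subst hqr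
    have hf : factor q = 1 := by cases q <;> first | rfl | exact absurd rfl hq
    rw [if_pos rfl, hf, ← neg_smul]
    congr 1
    rcases q with _ | ⟨_ | _, i⟩ | ⟨_ | _, i⟩
    · exact absurd rfl hq
    all_goals
      simp only [idx, NS0.basisBracket, Finsupp.smul_apply, Finsupp.neg_apply, NS0.L_L_apply,
        NS0.G_G_apply, zero_add, add_zero, if_true, smul_eq_mul, exponent]
      push_cast
      ring
  · rw [if_neg hqr]
    have h2 : NS0.basisBracket (idx .a) (idx q) (idx r) = 0 := by
      have h3 := idx_injective.ne hqr
      have h4 : idx .a = .L 0 := rfl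
      rw [h4]
      generalize idx q = m at h3
      generalize idx r = n at h3
      cases m <;> cases n <;>
        simp only [NS0.basisBracket, Finsupp.smul_apply, Finsupp.neg_apply, NS0.L_L_apply,
          NS0.G_G_apply, NS0.L_G_apply, NS0.G_L_apply, zero_add, add_zero, smul_zero, neg_zero]
      · rw [if_neg fun h => h3 (congrArg _ h), smul_zero]
      · rw [if_neg fun h => h3 (congrArg _ h), smul_zero, neg_zero]
    rw [h2, mul_zero, mul_zero, zero_smul, neg_zero]

include h hS in
lemma deriv2L_right_a {q : Coord} (hq : q ≠ .a) (t : Side) (r : Coord) :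
    deriv2L .left q t .a (S.phi r) = 0 := by
  have h1 := deriv2L_a_right (h.phi_sub_linPart_mem hS r) .left t q
  rwa [map_sub, sub_eq_zero, deriv2L_linPart_a hq] at h1

end SewingData.Regular

namespace NS0

lemma basisBracket_idx_skew (p q : Coord) (n : NSIndex) :
    basisBracket (SewingData.Regular.idx q) (SewingData.Regular.idx p) n
      = -((SewingData.Regular.idx p).act q.sgn
        * basisBracket (SewingData.Regular.idx p) (SewingData.Regular.idx q) n) := by
  have h : (SewingData.Regular.idx q).sgn = q.sgn := by
    rcases q with _ | ⟨_ | _, j⟩ | ⟨_ | _, j⟩ <;> rfl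
  rw [basisBracket_skew, h]
  rfl

end NS0

namespace SewingData.Regular

open Formal

variable {S : SewingData} (h : S.Regular) (hS : S.IsSewing)

include h hS in
/-- The bracket of two partial derivatives, applied to the coordinates. -/
lemma coordBracket_phi (p q r : Coord) : coordBracket (S.phi r) p q
    = -((factor p * factor q * ((factor r)⁻¹ * NS0.basisBracket (idx p) (idx q) (idx r))) • 1) := by
  have hAA := fun k i j => h.deriv2L_same hS (k := k) (p := .A k i) (q := .A k j) rfl rfl r
  have hAM := fun k i j => h.deriv2L_same hS (k := k) (p := .A k i) (q := .M k j) rfl rfl r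
  have hMA := fun k i j => h.deriv2L_same hS (k := k) (p := .M k i) (q := .A k j) rfl rfl r
  have hMM := fun k i j => h.deriv2L_same hS (k := k) (p := .M k i) (q := .M k j) rfl rfl r
  have gAA := fun i j => h.deriv2L_zero_infty hS (p := .A .zero i) (q := .A .infty j) rfl rfl r
  have gAM := fun i j => h.deriv2L_zero_infty hS (p := .A .zero i) (q := .M .infty j) rfl rfl r
  have gMA := fun i j => h.deriv2L_zero_infty hS (p := .M .zero i) (q := .A .infty j) rfl rfl r
  have gMM := fun i j => h.deriv2L_zero_infty hS (p := .M .zero i) (q := .M .infty j) rfl rfl r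
  have sAA := fun s k l i j => h.deriv2L_same_side hS s (p := .A k i) (q := .A l j)
    nofun nofun r
  have sAM := fun s k l i j => h.deriv2L_same_side hS s (p := .A k i) (q := .M l j)
    nofun nofun r
  have sMA := fun s k l i j => h.deriv2L_same_side hS s (p := .M k i) (q := .A l j)
    nofun nofun r
  have sMM := fun s k l i j => h.deriv2L_same_side hS s (p := .M k i) (q := .M l j)
    nofun nofun r
  have aA := fun k i => h.deriv2L_a hS (q := .A k i) nofun r
  have aM := fun k i => h.deriv2L_a hS (q := .M k i) nofun r
  have Aa := fun k i t => h.deriv2L_right_a hS (q := .A k i) nofun t r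
  have Ma := fun k i t => h.deriv2L_right_a hS (q := .M k i) nofun t r
  have zAA := fun k l i j => NS0.basisBracket_idx_skew (.A k i) (.A l j) (idx r)
  have zAM := fun k l i j => NS0.basisBracket_idx_skew (.A k i) (.M l j) (idx r)
  have zMM := fun k l i j => NS0.basisBracket_idx_skew (.M k i) (.M l j) (idx r)
  have zaA := fun k i => NS0.basisBracket_idx_skew .a (.A k i) (idx r)
  have zaM := fun k i => NS0.basisBracket_idx_skew .a (.M k i) (idx r)
  have iA : ∀ k j, ∃ n, idx (.A k j) = .L n := fun k j => by cases k <;> exact ⟨_, rfl⟩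
  have iM : ∀ k j, ∃ n, idx (.M k j) = .G n := fun k j => by cases k <;> exact ⟨_, rfl⟩
  have tA : ∀ k j s, (idx (.A k j)).act s = 1 := fun k j s => by cases k <;> rfl
  have tM : ∀ k j s, (idx (.M k j)).act s = s := fun k j s => by cases k <;> rfl
  have ta : ∀ s, (idx .a).act s = 1 := fun s => rfl
  rcases p with _ | ⟨_ | _, i⟩ | ⟨_ | _, i⟩ <;> rcases q with _ | ⟨_ | _, j⟩ | ⟨_ | _, j⟩ <;>
    simp only [coordBracket, coordBracket.zeroInfty, coordBracket.zeroInftyM,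
      coordBracket.zeroMInfty, deriv2_eq, hAA, hAM, hMA, hMM, gAA, gAM, gMA, gMM, sAA, sAM, sMA, sMM,
      aA, aM, Aa, Ma, ite_self, sub_zero, add_zero, factor]
  · have h0 : NS0.basisBracket (idx .a) (idx .a) (idx r) = 0 := by
      simp [idx, NS0.basisBracket]
    rw [h0, mul_zero, mul_zero, zero_smul, neg_zero]
  all_goals first
    | module
    | ((first | rw [zaA] | rw [zaM] | rw [zAA] | rw [zAM] | rw [zMM])
       simp only [tA, tM, ta, Coord.sgn]
       module)

end SewingData.Regular

namespace Gr

variable {τ K : Type} [LinearOrder τ] [CommRing K]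

/-- The power of the parity automorphism by which an operator of the given parity is moved past
an element. -/
def twist (s : ZMod 2) : Gr τ K →+* Gr τ K := if s = 0 then RingHom.id _ else parityAut

lemma twist_zero (f : Gr τ K) : twist 0 f = f := rfl

lemma twist_one (f : Gr τ K) : twist 1 f = parityAut f := rfl

lemma twist_add (s t : ZMod 2) (f : Gr τ K) : twist (s + t) f = twist s (twist t f) := by
  fin_cases s <;> fin_cases t
  · rfl
  · rfl
  · rfl
  · exact (parityAut_parityAut f).symm

end Gr

/-- The parity of a coordinate. -/
def Coord.grade : Coord → ZMod 2
  | .M _ _ => 1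
  | _ => 0

namespace Lam

section Incl

variable (K : Type) [CommRing K] [Algebra ℂ K]

lemma incl_map (c : Lam) (S : Finset ℕ) :
    incl K c (S.map OddVar.zetaEmb) = algebraMap ℂ K (c S) := by
  rw [incl, if_pos]
  · congr 2
    ext i
    simp [OddVar.zetaEmb]
  · intro p hp
    obtain ⟨i, _, rfl⟩ := Finset.mem_map.mp hp
    exact ⟨i, rfl⟩

lemma exists_map_of_forall {S : Finset OddVar} (h : ∀ p ∈ S, ∃ i, p = OddVar.zeta i) :
    ∃ T : Finset ℕ, S = T.map OddVar.zetaEmb := by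
  refine ⟨S.preimage OddVar.zeta OddVar.zeta_injective.injOn, ?_⟩
  ext p
  simp only [Finset.mem_map, Finset.mem_preimage]
  refine ⟨fun hp => ?_, ?_⟩
  · obtain ⟨i, rfl⟩ := h p hp
    exact ⟨i, hp, rfl⟩
  · rintro ⟨i, hi, rfl⟩
    exact hi

lemma incl_of_not {S : Finset OddVar} (h : ¬∀ p ∈ S, ∃ i, p = OddVar.zeta i) (c : Lam) :
    incl K c S = 0 := if_neg h

lemma incl_ext {f : Gr OddVar K} {c : Lam}
    (h : ∀ S : Finset ℕ, f (S.map OddVar.zetaEmb) = algebraMap ℂ K (c S))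
    (h' : ∀ S : Finset OddVar, (¬∀ p ∈ S, ∃ i, p = OddVar.zeta i) → f S = 0) : incl K c = f := by
  ext S
  by_cases hS : ∀ p ∈ S, ∃ i, p = OddVar.zeta i
  · obtain ⟨T, rfl⟩ := exists_map_of_forall hS
    rw [incl_map, h]
  · rw [incl_of_not K hS, h' S hS]

/-- The inclusion of `⋀_∞` as an algebra homomorphism. -/
def inclHom : Lam →ₐ[ℂ] Gr OddVar K :=
  AlgHom.ofLinearMap
    { toFun := incl K
      map_add' := fun c d => incl_ext K
        (fun S => by rw [Gr.add_apply, Gr.add_apply, incl_map, incl_map, map_add])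
        fun S hS => by rw [Gr.add_apply, incl_of_not K hS, incl_of_not K hS, add_zero]
      map_smul' := fun r c => incl_ext K
        (fun S => by
          rw [RingHom.id_apply, Gr.smul_apply, Gr.smul_apply, incl_map, smul_eq_mul, map_mul,
            Algebra.smul_def])
        fun S hS => by rw [RingHom.id_apply, Gr.smul_apply, incl_of_not K hS, smul_zero] }
    (incl_ext K (fun S => by
        rw [Gr.one_apply, Gr.one_apply]
        by_cases hS : S = ∅
        · simp [hS]
        · rw [if_neg hS, if_neg (by simpa using hS), map_zero])
      fun S hS => by
        rw [Gr.one_apply, if_neg]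
        rintro rfl
        simp at hS)
    fun c d => incl_ext K
      (fun S => by
        change (incl K c * incl K d) _ = _
        rw [Formal.mul_apply_map _ Formal.zeta_lt_zeta, Gr.mul_apply, map_sum]
        refine Finset.sum_congr rfl fun T _ => ?_
        rw [incl_map, incl_map, map_mul, map_mul, map_intCast])
      fun S hS => by
        change (incl K c * incl K d) _ = _
        rw [Gr.mul_apply]
        refine Finset.sum_eq_zero fun T hT => ?_
        by_cases h1 : ∀ p ∈ T, ∃ i, p = OddVar.zeta i
        · rw [incl_of_not K (S := S \ T), mul_zero, mul_zero]
          refine fun h2 => hS fun p hp => ?_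
          by_cases hpT : p ∈ T
          · exact h1 p hpT
          · exact h2 p (Finset.mem_sdiff.mpr ⟨hp, hpT⟩)
        · rw [incl_of_not K h1, zero_mul, mul_zero]

lemma parityAut_incl (c : Lam) : Gr.parityAut (incl K c) = incl K (Gr.parityAut c) := by
  refine (incl_ext K (fun S => ?_) fun S hS => ?_).symm
  · rw [Gr.parityAut_apply, Gr.parityAut_apply, Finset.card_map, incl_map, map_mul, map_pow, map_neg,
      map_one]
  · rw [Gr.parityAut_apply, incl_of_not K hS, mul_zero]

end Incl

/-- An element of `⋀_∞` annihilated by all generators vanishes. -/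
lemma eq_zero_of_gen_mul {c : Lam} (h : ∀ u : ℕ, Gr.gen u * c = 0) : c = 0 := by
  ext S
  obtain ⟨u, hu⟩ := Infinite.exists_notMem_finset S
  have h1 := congrFun (h u) (insert u S)
  rw [Gr.gen_mul_apply, if_pos (Finset.mem_insert_self _ _), Finset.erase_insert hu] at h1
  have h2 : ((shuffleSign {u} S : ℤ) : ℂ) ≠ 0 := by
    unfold shuffleSign
    norm_num
  exact (mul_eq_zero.mp h1).resolve_left h2

end Lam

namespace Formal

lemma atE_incl (c : Lam) : atE (Lam.incl _ c) = c := by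
  ext S
  rw [atE_apply, Lam.incl_map, IsScalarTower.algebraMap_apply ℂ Laurent FormalCoeff]
  change evalOneHom (MvPowerSeries.constantCoeff (MvPowerSeries.C _)) = _
  rw [MvPowerSeries.constantCoeff_C]
  exact evalOne_single _ _

lemma atE_twist (s : ZMod 2) (f : Formal) : atE (Gr.twist s f) = Gr.twist s (atE f) := by
  fin_cases s
  · rfl
  · ext S
    change atE (Gr.parityAut f) S = Gr.parityAut (atE f) S
    rw [atE_apply, Gr.parityAut_apply, Gr.parityAut_apply, Finset.card_map, map_mul, map_pow,
      map_neg, map_one, atE_apply]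

lemma exists_cf_incl (c : Lam) (q : Idx) : ∃ z : ℂ,
    cf q (Lam.incl _ c) = AddMonoidAlgebra.single 0 z ∧ (q.2 ≠ 0 → z = 0) ∧
      ((¬∀ p ∈ q.1, ∃ i, p = OddVar.zeta i) → z = 0) := by
  by_cases hq : ∀ p ∈ q.1, ∃ i, p = OddVar.zeta i
  · obtain ⟨T, hT⟩ := Lam.exists_map_of_forall hq
    have h1 : cf q (Lam.incl _ c)
        = MvPowerSeries.coeff q.2 (MvPowerSeries.C (AddMonoidAlgebra.single 0 (c T) : Laurent)) := by
      change MvPowerSeries.coeff q.2 (Lam.incl _ c q.1) = _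
      rw [hT, Lam.incl_map, IsScalarTower.algebraMap_apply ℂ Laurent FormalCoeff]
      rfl
    rw [MvPowerSeries.coeff_C] at h1
    split_ifs at h1 with h2
    · exact ⟨_, h1, fun h => absurd h2 h, fun h => absurd hq h⟩
    · exact ⟨0, by rw [h1, AddMonoidAlgebra.single_zero], fun _ => rfl, fun _ => rfl⟩
  · refine ⟨0, ?_, fun _ => rfl, fun _ => rfl⟩
    change MvPowerSeries.coeff q.2 (Lam.incl _ c q.1) = _
    rw [Lam.incl_of_not _ hq, map_zero, AddMonoidAlgebra.single_zero]

lemma dVar_incl (s : Side) (p : Coord) (c : Lam) : dVar s p (Lam.incl _ c) = 0 := by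
  have hl : ∀ u (n : ℤ × ℤ × ℤ →+ ℤ), dLaurent u n (Lam.incl _ c) = 0 := fun u n => by
    refine cf_ext fun q => ?_
    obtain ⟨z, hz, _⟩ := exists_cf_incl c q
    rw [dLaurent, cf_lift, hz, Laurent.derivL_single, map_zero, Int.cast_zero, zero_mul,
      AddMonoidAlgebra.single_zero, map_zero]
  have hA : ∀ v, dEven v (Lam.incl _ c) = 0 := fun v => by
    refine cf_ext fun q => ?_
    obtain ⟨z, hz, h1, _⟩ := exists_cf_incl c (q.1, q.2 + Finsupp.single v 1)
    rw [cf_dEven, hz, h1, AddMonoidAlgebra.single_zero, smul_zero, map_zero]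
    intro h
    have := DFunLike.congr_fun h v
    simp at this
  have hM : ∀ s k j, dOdd (.formal s k j) (Lam.incl _ c) = 0 := fun s k j => by
    refine cf_ext fun q => ?_
    obtain ⟨z, hz, _, h1⟩ := exists_cf_incl c (insert (.formal s k j) q.1, q.2)
    rw [cf_dOdd, hz, h1, AddMonoidAlgebra.single_zero, smul_zero, ite_self, map_zero]
    intro h
    obtain ⟨i, hi⟩ := h _ (Finset.mem_insert_self _ _)
    cases hi
  cases p with
  | a => cases s <;> exact hl _ _
  | A k j => cases s <;> exact hA _
  | M k j => cases s <;> exact hM _ _ _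

lemma dVar_mul (s : Side) (p : Coord) (f g : Formal) :
    dVar s p (f * g) = dVar s p f * g + Gr.twist p.grade f * dVar s p g := by
  cases p with
  | a => cases s <;> exact dLaurent_mul _ _ _ _
  | A k j => cases s <;> exact dEven_mul _ _ _
  | M k j => cases s <;> exact dOdd_mul _ _ _

lemma dVar_twist (s : Side) (p : Coord) (t : ZMod 2) (f : Formal) :
    dVar s p (Gr.twist t f) = (-1 : ℂ) ^ (p.grade.val * t.val) • Gr.twist t (dVar s p f) := by
  have h1 : ∀ g : Formal, g = (-1 : ℂ) ^ 0 • g := fun g => by simp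
  have h2 : ∀ v (f : Formal), dEven v (par f) = par (dEven v f) := fun v f => by
    refine cf_ext fun q => ?_
    rw [cf_dEven, cf_par, cf_par, cf_dEven]
    exact smul_comm _ _ _
  fin_cases t
  · cases p <;> exact h1 _
  · cases p with
    | a => cases s <;> exact (par_lift _ _).symm.trans (h1 _)
    | A k j => cases s <;> exact (h2 _ _).trans (h1 _)
    | M k j =>
      have h3 : ∀ q, dOdd q (par f) = (-1 : ℂ) ^ 1 • par (dOdd q f) := fun q => by
        rw [par_dOdd, pow_one, neg_smul, one_smul, neg_neg]
      cases s <;> exact h3 _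

end Formal

namespace SD1

lemma induction {P : SD1 → Prop} (const : ∀ c, P (const c)) (coord : ∀ p, P (coord p))
    (aInv : P aInv) (add : ∀ F G, P F → P G → P (F + G)) (mul : ∀ F G, P F → P G → P (F * G))
    (F : SD1) : P F := by
  obtain ⟨F, hF⟩ := F
  refine Algebra.adjoin_induction (p := fun x hx => P ⟨x, hx⟩) ?_ (fun r => ?_)
    (fun x y hx hy h1 h2 => add _ _ h1 h2) (fun x y hx hy h1 h2 => mul _ _ h1 h2) hF
  · rintro x ((⟨c, rfl⟩ | ⟨p, rfl⟩) | rfl)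
    · exact const c
    · exact coord p
    · exact aInv
  · exact const (algebraMap ℂ Lam r)

/-- The evaluation at a point. -/
def evalHom (Q : SK1) : SD1 →ₐ[ℂ] Lam := (Pi.evalAlgHom ℂ (fun _ : SK1 => Lam) Q).comp SD1.val

lemma eval_eq (F : SD1) (Q : SK1) : eval F Q = evalHom Q F := rfl

lemma ext {F G : SD1} (h : ∀ Q, eval F Q = eval G Q) : F = G := Subtype.ext (funext h)

lemma a_mul_aInv : coord .a * aInv = 1 := ext fun Q => Ring.mul_inverse_cancel _ Q.a_unit

lemma algHom_ext {A : Type} [Ring A] [Algebra ℂ A] {f g : SD1 →ₐ[ℂ] A}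
    (const : ∀ c, f (const c) = g (SD1.const c)) (coord : ∀ p, f (coord p) = g (SD1.coord p)) :
    f = g := by
  refine AlgHom.ext fun F => induction (P := fun F => f F = g F) const coord ?_ (fun F G h1 h2 => ?_) (fun F G h1 h2 => ?_) F
  · have h1 : f SD1.aInv * f (SD1.coord .a) = 1 := by
      rw [← map_mul, ← map_one f]
      exact congrArg f (ext fun Q => Ring.inverse_mul_cancel _ Q.a_unit)
    have h2 : g (SD1.coord .a) * g SD1.aInv = 1 := by rw [← map_mul, a_mul_aInv, map_one]
    rw [← coord] at h2
    exact left_inv_eq_right_inv h1 h2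
  · rw [map_add, map_add, h1, h2]
  · rw [map_mul, map_mul, h1, h2]

/-- The parity automorphism, on superfunctions. -/
def parityHom : (SK1 → Lam) →ₐ[ℂ] (SK1 → Lam) :=
  AlgHom.compLeft ({ Gr.parityAut with
    commutes' := fun r => by
      rw [Algebra.algebraMap_eq_smul_one]
      exact (Gr.parityAut_smul r 1).trans (congrArg _ (map_one Gr.parityAut)) } : Lam →ₐ[ℂ] Lam) SK1

lemma parityHom_mem (F : SD1) : parityHom F.1 ∈ SD1 := by
  refine induction (P := fun F => parityHom F.1 ∈ SD1) (fun c => ?_) (fun p => ?_) ?_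
    (fun F G h1 h2 => ?_) (fun F G h1 h2 => ?_) F
  · exact (const (Gr.parityAut c)).2
  · have h1 : ∀ f : SK1 → Lam, (∀ Q, (f Q).IsEven) → f ∈ SD1 → parityHom f ∈ SD1 := fun f hf h => by
      convert h using 1
      exact funext fun Q => Gr.parityAut_of_isEven (hf Q)
    cases p with
    | a => exact h1 _ (fun Q => Q.a_even) (coord .a).2
    | A k j => exact h1 _ (fun Q => (Q.mem_H k).1 j) (coord (.A k j)).2
    | M k j =>
      convert (-coord (.M k j)).2 using 1
      exact funext fun Q => Gr.parityAut_of_isOdd ((Q.mem_H k).2.1 j)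
  · convert aInv.2 using 1
    exact funext fun Q => Gr.parityAut_of_isEven
      (Gr.isEven_of_mul_eq_one Q.a_even (Ring.mul_inverse_cancel _ Q.a_unit))
  · exact (map_add parityHom F.1 G.1).symm ▸ add_mem h1 h2
  · exact (map_mul parityHom F.1 G.1).symm ▸ mul_mem h1 h2

/-- The parity automorphism of the algebra of supermeromorphic superfunctions. -/
def conj : SD1 →ₐ[ℂ] SD1 := (parityHom.comp SD1.val).codRestrict SD1 parityHom_mem

lemma eval_conj (F : SD1) (Q : SK1) : eval (conj F) Q = Gr.parityAut (eval F Q) := rfl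

lemma conj_conj (F : SD1) : conj (conj F) = F := ext fun _ => Gr.parityAut_parityAut _

lemma isEven_iff (F : SD1) : IsEven F ↔ conj F = F :=
  ⟨fun h => ext fun Q => Gr.parityAut_of_isEven (h Q), fun h Q => Gr.isEven_iff.mpr (by
    rw [← eval_conj, h])⟩

lemma isOdd_iff (F : SD1) : IsOdd F ↔ conj F = -F :=
  ⟨fun h => ext fun Q => Gr.parityAut_of_isOdd (h Q), fun h Q => Gr.isOdd_iff.mpr (by
    rw [← eval_conj, h]; rfl)⟩

end SD1

/-- The tangent vectors of a given parity. -/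
def gradedTangent (s : ZMod 2) : Submodule ℂ (SD1 →ₗ[ℂ] Lam) :=
  if s = 0 then evenTangent else oddTangent

open SD1

lemma mem_gradedTangent_iff {s : ZMod 2} {D : SD1 →ₗ[ℂ] Lam} : D ∈ gradedTangent s ↔
    (∀ F c, D (F * SD1.const c) = D F * c) ∧
      ∀ F G, D (F * G) = D F * eval G SK1.e + Gr.twist s (eval F SK1.e) * D G := by
  obtain rfl | rfl : s = 0 ∨ s = 1 := by revert s; decide
  · rfl
  · refine ⟨fun h => ⟨h.1, fun F G => ?_⟩, fun h => ⟨h.1, fun F G hF => ?_, fun F G hF => ?_⟩⟩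
    · have he : IsEven (F + conj F) := (isEven_iff _).mpr (by rw [map_add, conj_conj, add_comm])
      have ho : IsOdd (F - conj F) := (isOdd_iff _).mpr (by rw [map_sub, conj_conj, neg_sub])
      have h1 := h.2.1 _ G he
      have h2 := h.2.2 _ G ho
      rw [eval_eq _ SK1.e, eval_eq _ SK1.e, map_add, add_mul, map_add, map_add] at h1
      rw [eval_eq _ SK1.e, eval_eq _ SK1.e, map_sub, sub_mul, map_sub, map_sub] at h2
      change D (F * G) = D F * evalHom SK1.e G + evalHom SK1.e (conj F) * D G
      have h3 : (2 : ℂ) • D (F * G)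
          = (2 : ℂ) • (D F * evalHom SK1.e G + evalHom SK1.e (conj F) * D G) := by
        have h4 := congrArg₂ (· + ·) h1 h2
        simp only [add_mul, sub_mul] at h4
        rw [two_smul, two_smul]
        calc D (F * G) + D (F * G)
            = D (F * G) + D (conj F * G) + (D (F * G) - D (conj F * G)) := by abel
          _ = _ := h4
          _ = _ := by abel
      exact smul_right_injective _ two_ne_zero h3
    · rw [h.2, Gr.twist_one, Gr.parityAut_of_isEven (hF _)]
    · rw [h.2, Gr.twist_one, Gr.parityAut_of_isOdd (hF _), neg_mul, sub_eq_add_neg]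

lemma gradedTangent_one {s : ZMod 2} {D : SD1 →ₗ[ℂ] Lam} (hD : D ∈ gradedTangent s) : D 1 = 0 := by
  have h := (mem_gradedTangent_iff.mp hD).2 1 1
  rw [mul_one, eval_eq, map_one (evalHom _), map_one (Gr.twist s), mul_one, one_mul] at h
  exact left_eq_add.mp h

lemma gradedTangent_eq_zero {s : ZMod 2} {D : SD1 →ₗ[ℂ] Lam} (hD : D ∈ gradedTangent s)
    (h : ∀ p, D (SD1.coord p) = 0) : D = 0 := by
  obtain ⟨h1, h2⟩ := mem_gradedTangent_iff.mp hD
  have h0 := gradedTangent_one hD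
  refine LinearMap.ext fun F => SD1.induction (P := fun F => D F = 0) (fun c => ?_) h ?_
    (fun F G hF hG => ?_) (fun F G hF hG => ?_) F
  · rw [← one_mul (const c), h1, h0, zero_mul]
  · have h3 := h2 (SD1.coord .a) aInv
    rw [a_mul_aInv, h0, h, zero_mul, zero_add, show eval (SD1.coord .a) SK1.e = 1 from rfl, map_one,
      one_mul] at h3
    exact h3.symm
  · rw [map_add, hF, hG, add_zero]
  · rw [h2, hF, hG, zero_mul, mul_zero, add_zero]

lemma gradedTangent_ext {s : ZMod 2} {D E : SD1 →ₗ[ℂ] Lam} (hD : D ∈ gradedTangent s)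
    (hE : E ∈ gradedTangent s) (h : ∀ p, D (SD1.coord p) = E (SD1.coord p)) : D = E :=
  sub_eq_zero.mp (gradedTangent_eq_zero (sub_mem hD hE) fun p => by
    rw [LinearMap.sub_apply, h, sub_self])

lemma even_inf_odd {D : SD1 →ₗ[ℂ] Lam} (h0 : D ∈ gradedTangent 0) (h1 : D ∈ gradedTangent 1) :
    D = 0 := by
  refine LinearMap.ext fun F => Lam.eq_zero_of_gen_mul fun u => ?_
  have h2 := (mem_gradedTangent_iff.mp h0).2 (const (Gr.gen u)) F
  rw [(mem_gradedTangent_iff.mp h1).2] at h2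
  have h3 : eval (const (Gr.gen u)) SK1.e = Gr.gen u := rfl
  rw [h3, Gr.twist_one, Gr.parityAut_of_isOdd (Gr.isOdd_gen u), Gr.twist_zero, add_right_inj,
    neg_mul] at h2
  have h4 : (2 : ℂ) • (Gr.gen u * D F) = 0 := by
    rw [two_smul]
    nth_rewrite 1 [← h2]
    exact neg_add_cancel _
  exact (smul_eq_zero.mp h4).resolve_left two_ne_zero

lemma isPartial_iff (pd : Coord → (SD1 →ₗ[ℂ] Lam)) : IsPartial pd ↔
    (∀ p, pd p ∈ gradedTangent p.grade) ∧
      ∀ p q, pd p (SD1.coord q) = open scoped Classical in if p = q then 1 else 0 := by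
  refine ⟨fun h => ⟨fun p => ?_, h.2.2⟩, fun h => ⟨fun p hp => ?_, fun p hp => ?_, h.2⟩⟩
  · cases p with
    | a => exact h.1 _ not_false
    | A k j => exact h.1 _ not_false
    | M k j => exact h.2.1 _ trivial
  · have := h.1 p
    cases p with
    | a => exact this
    | A k j => exact this
    | M k j => exact absurd trivial hp
  · have := h.1 p
    cases p with
    | a => exact hp.elim
    | A k j => exact hp.elim
    | M k j => exact this

lemma isPartial_unique {pd pd' : Coord → (SD1 →ₗ[ℂ] Lam)} (h : IsPartial pd) (h' : IsPartial pd') :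
    pd = pd' := by
  rw [isPartial_iff] at h h'
  exact funext fun p => gradedTangent_ext (h.1 p) (h'.1 p) fun q => by rw [h.2, h'.2]

section

open Formal SD1

/-- `sub F = F(v)`: the substitution of superseries `v p` for the coordinates. -/
structure IsSubst (v : Coord → Formal) (sub : SD1 →ₐ[ℂ] Formal) : Prop where
  const : ∀ c, sub (SD1.const c) = Lam.incl _ c
  coord : ∀ p, sub (SD1.coord p) = v p

/-- The superseries `v p` take the values of the coordinates at `e`. -/
def IsCentered (v : Coord → Formal) : Prop := ∀ p, atE (v p) = eval (SD1.coord p) SK1.e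

namespace IsSubst

variable {v : Coord → Formal} {sub : SD1 →ₐ[ℂ] Formal} (hs : IsSubst v sub) (hv : IsCentered v)

include hs hv

lemma atE_sub (F : SD1) : atE (sub F) = eval F SK1.e :=
  DFunLike.congr_fun (SD1.algHom_ext (f := atEHom.comp sub) (g := evalHom SK1.e)
    (fun c => (congrArg atE (hs.const c)).trans (atE_incl c))
    fun p => (congrArg atE (hs.coord p)).trans (hv p)) F

omit hs hv in
/-- The first derivatives at `e` of a substitution. -/
def deriv1 (sub : SD1 →ₐ[ℂ] Formal) (s : Side) (p : Coord) : SD1 →ₗ[ℂ] Lam :=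
  atEHom.toLinearMap ∘ₗ dVar s p ∘ₗ sub.toLinearMap

omit hs hv in
lemma deriv1_apply (s : Side) (p : Coord) (F : SD1) :
    deriv1 sub s p F = atE (dVar s p (sub F)) := rfl

lemma deriv1_mem (s : Side) (p : Coord) : deriv1 sub s p ∈ gradedTangent p.grade := by
  refine mem_gradedTangent_iff.mpr ⟨fun F c => ?_, fun F G => ?_⟩
  · rw [deriv1_apply, deriv1_apply, map_mul, hs.const, dVar_mul, dVar_incl, mul_zero, add_zero,
      atE_mul, atE_incl]
  · rw [deriv1_apply, deriv1_apply, deriv1_apply, map_mul, dVar_mul, atE_eq, map_add, ← atE_eq,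
      ← atE_eq, atE_mul, atE_mul, atE_twist, hs.atE_sub hv, hs.atE_sub hv]

omit hv in
lemma deriv1_coord (s : Side) (p q : Coord) : deriv1 sub s p (SD1.coord q) = atE (dVar s p (v q)) := by
  rw [deriv1_apply, hs.coord]

omit hs hv in
/-- The supercommutator of two second derivatives at `e` of a substitution. -/
def deriv2 (sub : SD1 →ₐ[ℂ] Formal) (s t s' t' : Side) (p q : Coord) : SD1 →ₗ[ℂ] Lam :=
  (deriv2L s p t q - (-1 : ℂ) ^ (p.grade.val * q.grade.val) • deriv2L s' q t' p) ∘ₗ sub.toLinearMap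

omit hv in
lemma deriv2L_mul (s t : Side) (p q : Coord) (F G : SD1) :
    deriv2L s p t q (sub (F * G)) = deriv2L s p t q (sub F) * atE (sub G)
      + Gr.twist p.grade (deriv1 sub t q F) * deriv1 sub s p G
      + (-1 : ℂ) ^ (p.grade.val * q.grade.val) • (Gr.twist q.grade (deriv1 sub s p F) * deriv1 sub t q G)
      + Gr.twist (p.grade + q.grade) (atE (sub F)) * deriv2L s p t q (sub G) := by
  simp only [deriv2L_apply, deriv1_apply]
  rw [map_mul, dVar_mul, map_add, dVar_mul, dVar_mul, dVar_twist, Gr.twist_add]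
  simp only [atE_eq, map_add, map_mul, smul_mul_assoc, map_smul]
  simp only [← atE_eq, atE_twist]
  abel

lemma deriv2_mem {s t s' t' : Side} {p q : Coord} (h1 : deriv1 sub s p = deriv1 sub t' p)
    (h2 : deriv1 sub t q = deriv1 sub s' q) :
    deriv2 sub s t s' t' p q ∈ gradedTangent (p.grade + q.grade) := by
  have hε : ∀ f : Lam, (-1 : ℂ) ^ (p.grade.val * q.grade.val)
      • (-1 : ℂ) ^ (p.grade.val * q.grade.val) • f = f := fun f => by
    rw [smul_smul, ← pow_add, ← two_mul, pow_mul, neg_one_sq, one_pow, one_smul]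
  have hsub : ∀ F, deriv2 sub s t s' t' p q F = deriv2L s p t q (sub F)
      - (-1 : ℂ) ^ (p.grade.val * q.grade.val) • deriv2L s' q t' p (sub F) := fun F => rfl
  refine mem_gradedTangent_iff.mpr ⟨fun F c => ?_, fun F G => ?_⟩
  · have h0 : ∀ s p t q, deriv2L s p t q (sub (F * SD1.const c)) = deriv2L s p t q (sub F) * c :=
      fun s p t q => by
        rw [deriv2L_apply, map_mul, hs.const, dVar_mul, dVar_incl, mul_zero, add_zero, dVar_mul,
          dVar_incl, mul_zero, add_zero, atE_mul, atE_incl]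
        rfl
    rw [hsub, hsub, h0, h0, sub_mul, smul_mul_assoc]
  · rw [hsub, hsub, hsub, hs.deriv2L_mul, hs.deriv2L_mul, h1, h2, mul_comm q.grade.val,
      add_comm q.grade, smul_add, smul_add, smul_add, hε, hs.atE_sub hv, hs.atE_sub hv, sub_mul, mul_sub,
      smul_mul_assoc, mul_smul_comm]
    abel

end IsSubst

set_option maxHeartbeats 1000000 in
/-- The bracket of two partial derivatives is a supercommutator of second derivatives. -/
lemma exists_coordBracket_eq (p q : Coord) : ∃ s t s' t' : Side, ∀ f : Formal,
    coordBracket f p q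
      = deriv2L s p t q f - (-1 : ℂ) ^ (p.grade.val * q.grade.val) • deriv2L s' q t' p f := by
  have e0 : ∀ g : Lam, (-1 : ℂ) ^ 0 • g = g := fun g => by rw [pow_zero, one_smul]
  have e1 : ∀ g : Lam, (-1 : ℂ) ^ 1 • g = -g := fun g => by rw [pow_one, neg_one_smul]
  have v0 : (0 : ZMod 2).val = 0 := rfl
  have v1 : (1 : ZMod 2).val = 1 := rfl
  rcases p with _ | ⟨_ | _, j⟩ | ⟨_ | _, j⟩ <;> rcases q with _ | ⟨_ | _, k⟩ | ⟨_ | _, k⟩ <;>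
    simp only [coordBracket, coordBracket.zeroInfty, coordBracket.zeroInftyM,
      coordBracket.zeroMInfty, deriv2_eq, Coord.grade, v0, v1, mul_zero, zero_mul, mul_one, e0, e1,
      sub_neg_eq_add, neg_sub] <;>
    first
    | exact ⟨.left, .right, .left, .right, fun f => by with_reducible rfl⟩
    | exact ⟨.left, .right, .left, .left, fun f => by with_reducible rfl⟩
    | exact ⟨.left, .left, .left, .right, fun f => by with_reducible rfl⟩
    | exact ⟨.left, .left, .left, .right, fun f => by with_reducible exact add_comm _ _⟩
    | exact ⟨.left, .left, .left, .left, fun f => by with_reducible exact (sub_self _).symm⟩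
    | (by_cases hjk : k ≤ j <;> simp only [hjk, if_true, if_false, neg_sub] <;>
        first
        | exact ⟨.left, .right, .right, .right, fun f => by with_reducible rfl⟩
        | exact ⟨.left, .right, .left, .left, fun f => by with_reducible rfl⟩)
    | (by_cases hjk : j ≤ k <;> simp only [hjk, if_true, if_false, neg_sub] <;>
        first
        | exact ⟨.right, .right, .left, .right, fun f => by with_reducible rfl⟩
        | exact ⟨.left, .left, .left, .right, fun f => by with_reducible rfl⟩)

namespace SewingData.Regular

variable {S : SewingData} (h : S.Regular) (hS : S.IsSewing)

lemma atE_var (s : Side) (r : Coord) : atE (var s r) = 0 := by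
  cases r with
  | a => exact atE_zero
  | A k j =>
    exact atE_of_mem_I (mem_I_one_of_isFormal (isFormal_evenVar s k j)
      ((isFamily_evenVar s k).noConstantTerm j))
  | M k j =>
    exact atE_of_mem_I (mem_I_one_of_isFormal (isFormal_oddVar s k j)
      ((isFamily_oddVar s k).noConstantTerm j))

open scoped Classical in
lemma atE_dVar_linPart (s : Side) (p r : Coord) :
    atE (dVar s p (linPart r)) = if p = r then 1 else 0 := by
  by_cases hr : r = .a
  · subst hr
    split_ifs with hp
    · subst hp
      cases s
      · change atE (dLaurent _ _ _) = _
        rw [linPart, dLaurent_laurentMono, atE_eq, map_smul, ← atE_eq, atE_laurentMono]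
        exact (congrArg (· • (1 : Lam)) Int.cast_one).trans (one_smul ℂ _)
      · change atE (dLaurent _ _ _) = _
        rw [linPart, dLaurent_laurentMono, atE_eq, map_smul, ← atE_eq, atE_laurentMono]
        exact (congrArg (· • (1 : Lam)) Int.cast_one).trans (one_smul ℂ _)
    · rw [isMono_linPart_a.dVar_eq_zero _ hp, atE_zero]
  · have h1 : IsMono (laurentMono (exponent r, 0, 0)) := .laurentMono rfl
    rw [linPart_eq hr, map_add]
    by_cases hp : p = .a
    · subst hp
      rw [dVar_a_mul _ _ _ hr, dVar_var _ _ _ _ hr, if_neg fun h => hr h.2.symm, if_neg (Ne.symm hr),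
        zero_add, atE_mul, atE_var, mul_zero]
    · rw [h1.dVar_mul _ hp, dVar_var _ _ _ _ hr, dVar_var _ _ _ _ hr]
      by_cases hpr : p = r
      · cases s
        · simp [hpr, atE_one]
        · simp [hpr, atE_laurentMono]
      · simp [hpr, atE_zero]

open scoped Classical in
include h hS in
lemma atE_dVar_phi (s : Side) (p r : Coord) :
    atE (dVar s p (S.phi r)) = if p = r then 1 else 0 := by
  have h1 := atE_of_mem_I (dVar_mem_I (s := s) (p := p) (h.phi_sub_linPart_mem hS r))
  rw [map_sub, atE_eq, map_sub, sub_eq_zero, ← atE_eq, ← atE_eq] at h1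
  rw [h1, atE_dVar_linPart]

include h hS in
lemma isCentered_phi : IsCentered S.phi := fun r => by
  have h1 := atE_of_mem_I (I_anti one_le_two (h.phi_sub_linPart_mem hS r))
  rw [atE_eq, map_sub, sub_eq_zero, ← atE_eq, ← atE_eq] at h1
  rw [h1]
  by_cases hr : r = .a
  · subst hr
    exact atE_laurentMono _
  · rw [linPart_eq hr, atE_eq, map_add, ← atE_eq, ← atE_eq, atE_mul, atE_var, atE_var, mul_zero,
      add_zero]
    cases r with
    | a => exact absurd rfl hr
    | A k j => rfl
    | M k j => rfl

end SewingData.Regular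

end

/-! ### Nilpotent points of the moduli space -/

lemma csum_apply_eq_sum {ι τ σ R : Type} [CommRing R] {F : ι → Gr τ (MvPowerSeries σ R)}
    {S : Finset τ} (s : Finset ι) (h : ∀ i, i ∉ s → F i S = 0) : csum F S = ∑ i ∈ s, F i S := by
  refine MvPowerSeries.ext fun d => ?_
  rw [map_sum]
  refine finsum_eq_sum_of_support_subset _ fun i hi => ?_
  by_contra hs
  exact hi ((congrArg _ (h i hs)).trans (map_zero _))

/-- The number of odd generators other than `φ` in a monomial. -/
def degOdd (S : Finset OddVar) : ℕ := (S.erase .phi).card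

/-- All coefficients are polynomials in `x`, and all terms have degree at least `m` in the odd
generators other than `φ`. -/
structure IsPolyX (m : ℕ) (f : Gr OddVar (PowerSeries ℂ)) : Prop where
  poly : ∀ S, f S ∈ (Polynomial.coeToPowerSeries.ringHom (R := ℂ)).range
  deg : ∀ S, degOdd S < m → f S = 0

namespace IsPolyX

variable {m n : ℕ} {f g : Gr OddVar (PowerSeries ℂ)}

lemma add (hf : IsPolyX m f) (hg : IsPolyX m g) : IsPolyX m (f + g) where
  poly S := add_mem (hf.poly S) (hg.poly S)
  deg S hS := by rw [Gr.add_apply, hf.deg S hS, hg.deg S hS, add_zero]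

lemma neg (hf : IsPolyX m f) : IsPolyX m (-f) where
  poly S := neg_mem (hf.poly S)
  deg S hS := (congrArg Neg.neg (hf.deg S hS)).trans neg_zero

lemma sub (hf : IsPolyX m f) (hg : IsPolyX m g) : IsPolyX m (f - g) := sub_eq_add_neg f g ▸ hf.add hg.neg

lemma smul (c : ℂ) (hf : IsPolyX m f) : IsPolyX m (c • f) where
  poly S := by
    obtain ⟨p, hp⟩ := hf.poly S
    refine ⟨c • p, ?_⟩
    rw [Gr.smul_apply, ← hp, Polynomial.coeToPowerSeries.ringHom_apply,
      Polynomial.coeToPowerSeries.ringHom_apply, Polynomial.coe_smul]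
  deg S hS := by rw [Gr.smul_apply, hf.deg S hS, smul_zero]

lemma mul (hf : IsPolyX m f) (hg : IsPolyX n g) : IsPolyX (m + n) (f * g) where
  poly S := sum_mem fun T _ => mul_mem (intCast_mem _ _) (mul_mem (hf.poly _) (hg.poly _))
  deg S hS := by
    rw [Gr.mul_apply]
    refine Finset.sum_eq_zero fun T hT => ?_
    have h1 : degOdd S = degOdd T + degOdd (S \ T) := by
      unfold degOdd
      rw [← Finset.card_union_of_disjoint]
      · congr 1
        rw [← Finset.erase_union_distrib, Finset.union_sdiff_of_subset (Finset.mem_powerset.mp hT)]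
      · exact Finset.disjoint_sdiff.mono (Finset.erase_subset _ _) (Finset.erase_subset _ _)
    by_cases h2 : degOdd T < m
    · rw [hf.deg T h2, zero_mul, mul_zero]
    · rw [hg.deg _ (by omega), mul_zero, mul_zero]

lemma mono {S : Finset OddVar} {a : PowerSeries ℂ}
    (ha : a ∈ (Polynomial.coeToPowerSeries.ringHom (R := ℂ)).range) : IsPolyX 0 (Gr.mono S a) where
  poly T := by
    unfold Gr.mono
    split_ifs
    · exact ha
    · exact zero_mem _
  deg T hT := absurd hT (Nat.not_lt_zero _)

lemma xpow (k : ℤ) : IsPolyX 0 (sx powX k) :=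
  mono (pow_mem (show PowerSeries.X ∈ (Polynomial.coeToPowerSeries.ringHom (R := ℂ)).range from
    ⟨Polynomial.X, Polynomial.coe_X⟩) _)

lemma phi : IsPolyX 0 (sphi (PowerSeries ℂ)) := mono (one_mem _)

lemma dx (hf : IsPolyX m f) : IsPolyX m (sdx powX f) where
  poly S := by
    obtain ⟨p, hp⟩ := hf.poly S
    refine ⟨Polynomial.derivative p, ?_⟩
    change _ = PowerSeries.derivative ℂ (f S)
    rw [← hp]
    exact (PowerSeries.derivative_coe p).symm
  deg S hS := by
    change PowerSeries.derivative ℂ (f S) = 0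
    rw [hf.deg S hS, map_zero]

lemma dphi (hf : IsPolyX m f) : IsPolyX m (sdphi f) where
  poly S := by
    change Gr.leftDeriv _ _ _ ∈ _
    unfold Gr.leftDeriv
    split_ifs
    · exact zero_mem _
    · exact mul_mem (intCast_mem _ _) (hf.poly _)
  deg S hS := by
    change Gr.leftDeriv _ _ _ = _
    unfold Gr.leftDeriv
    split_ifs with h
    · rfl
    · rw [hf.deg, mul_zero]
      unfold degOdd at *
      rwa [Finset.erase_insert_eq_erase]

lemma L (n : ℤ) (hf : IsPolyX m f) : IsPolyX m (opL powX n f) := by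
  have h1 := (xpow (n + 1)).mul hf.dx
  have h2 := (phi.mul ((xpow n).mul hf.dphi)).smul (((n : ℂ) + 1) / 2)
  simp only [zero_add] at h1 h2
  exact (h1.add h2).neg

lemma G (n : ℤ) (hf : IsPolyX m f) : IsPolyX m (opG powX n f) := by
  have h1 := (xpow n).mul (hf.dphi.sub (zero_add m ▸ phi.mul hf.dx))
  rw [zero_add] at h1
  exact h1.neg

lemma const {c : Lam} (hc : c ∅ = 0) : IsPolyX 1 (Lam.incl (PowerSeries ℂ) c) where
  poly S := by
    by_cases hS : ∀ p ∈ S, ∃ i, p = OddVar.zeta i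
    · obtain ⟨T, rfl⟩ := Lam.exists_map_of_forall hS
      rw [Lam.incl_map]
      exact ⟨Polynomial.C (c T), Polynomial.coe_C _⟩
    · rw [Lam.incl_of_not _ hS]
      exact zero_mem _
  deg S hS := by
    by_cases hS' : ∀ p ∈ S, ∃ i, p = OddVar.zeta i
    · obtain ⟨T, rfl⟩ := Lam.exists_map_of_forall hS'
      rw [Lam.incl_map]
      have h1 : OddVar.phi ∉ T.map OddVar.zetaEmb := fun h => by
        obtain ⟨i, hi⟩ := hS' _ h
        cases hi
      have h2 : T = ∅ := by
        unfold degOdd at hS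
        rw [Finset.erase_eq_of_notMem h1, Finset.card_map] at hS
        exact Finset.card_eq_zero.mp (by omega)
      rw [h2, hc, map_zero]
    · exact Lam.incl_of_not _ hS' c

lemma convergesNearZero (hf : IsPolyX m f) : ConvergesNearZero f := by
  refine ⟨1, one_pos, fun S => ?_⟩
  obtain ⟨p, hp⟩ := hf.poly S
  refine summable_of_finite_support (p.support.finite_toSet.subset fun n hn => ?_)
  by_contra h
  refine hn ?_
  change ‖PowerSeries.coeff n (f S)‖ * 1 ^ n = 0
  rw [← hp, Polynomial.coeToPowerSeries.ringHom_apply, Polynomial.coeff_coe,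
    Polynomial.notMem_support_iff.mp h, norm_zero, zero_mul]

lemma field {A M : ℕ+ → Lam} (hA : ∀ j, A j ∅ = 0) (hM : ∀ j, M j ∅ = 0)
    (hfin : {j | A j ≠ 0 ∨ M j ≠ 0}.Finite) (hf : IsPolyX m f) :
    IsPolyX (m + 1) (posOp powX (fun j => Lam.incl _ (A j)) (fun j => Lam.incl _ (M j)) f) := by
  let F : ℕ+ → Gr OddVar (PowerSeries ℂ) := fun j =>
    Lam.incl _ (A j) * opL powX (j : ℤ) f + Lam.incl _ (M j) * opG powX (j : ℤ) f
  have h1 : ∀ S, posOp powX (fun j => Lam.incl _ (A j)) (fun j => Lam.incl _ (M j)) f S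
      = ∑ j ∈ hfin.toFinset, F j S := fun S =>
    csum_apply_eq_sum (F := F) _ fun j hj => by
      simp only [Set.Finite.mem_toFinset, Set.mem_setOf_eq, not_or, not_not] at hj
      have h0 : F j = 0 := by
        simp only [F, hj.1, hj.2, Lam.incl_zero, zero_mul, add_zero]
      rw [h0]
      rfl
  have h2 : ∀ j : ℕ+, IsPolyX (m + 1) (F j) := fun j => by
    rw [add_comm m 1]
    exact ((const (hA j)).mul (hf.L j)).add ((const (hM j)).mul (hf.G j))
  exact ⟨fun S => h1 S ▸ sum_mem fun j _ => (h2 j).poly S,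
    fun S hS => (h1 S).trans (Finset.sum_eq_zero fun j _ => (h2 j).deg S hS)⟩

lemma exp {T : Gr OddVar (PowerSeries ℂ) → Gr OddVar (PowerSeries ℂ)}
    (hT : ∀ m f, IsPolyX m f → IsPolyX (m + 1) (T f)) (hf : IsPolyX 0 f) : IsPolyX 0 (expOp T f) := by
  have h1 : ∀ n, IsPolyX n (T^[n] f) := fun n => by
    induction n with
    | zero => exact hf
    | succ n ih =>
      rw [Function.iterate_succ_apply']
      exact hT n _ ih
  refine ⟨fun S => ?_, fun S hS => absurd hS (Nat.not_lt_zero _)⟩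
  have h2 := csum_apply_eq_sum (F := fun n : ℕ => ((n.factorial : ℂ)⁻¹) • T^[n] f) (S := S)
    (Finset.range (degOdd S + 1)) fun n hn => ((h1 n).smul _).deg S (by simpa using hn)
  change csum _ S ∈ _
  rw [h2]
  exact sum_mem fun n _ => ((h1 n).smul _).poly S

end IsPolyX

lemma inH_of_nilpotent {A M : ℕ+ → Lam} (hA : ∀ j, (A j).IsEven) (hA' : ∀ j, A j ∅ = 0)
    (hM : ∀ j, (M j).IsOdd) (hfin : {j | A j ≠ 0 ∨ M j ≠ 0}.Finite) : InH A M := by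
  have hM' : ∀ j, M j ∅ = 0 := fun j => by
    by_contra h
    simpa using hM j ∅ h
  have hT := fun m f (hf : IsPolyX m f) => (hf.field hA' hM' hfin).neg
  exact ⟨hA, hM, (IsPolyX.exp hT (IsPolyX.xpow 1)).convergesNearZero,
    (IsPolyX.exp hT IsPolyX.phi).convergesNearZero⟩

/-! ### Words in supercommuting elements -/

section Words

variable {ι R : Type} [Ring R] {m : ι → R}

/-- The members of a family commute up to sign. -/
def SignCommute (m : ι → R) : Prop := ∀ i j, ∃ ε : ℤˣ, m i * m j = ε • (m j * m i)

lemma SignCommute.prod_perm (hm : SignCommute m) {l l' : List ι} (h : l.Perm l') :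
    ∃ ε : ℤˣ, (l.map m).prod = ε • (l'.map m).prod := by
  induction h with
  | nil => exact ⟨1, (one_smul _ _).symm⟩
  | cons x _ ih =>
    obtain ⟨ε, h⟩ := ih
    exact ⟨ε, by rw [List.map_cons, List.prod_cons, h, mul_smul_comm, List.map_cons, List.prod_cons]⟩
  | swap x y l =>
    obtain ⟨ε, h⟩ := hm y x
    exact ⟨ε, by simp only [List.map_cons, List.prod_cons, ← mul_assoc, h, smul_mul_assoc]⟩
  | trans _ _ ih1 ih2 =>
    obtain ⟨ε, h⟩ := ih1
    obtain ⟨ε', h'⟩ := ih2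
    exact ⟨ε * ε', by rw [h, h', mul_smul]⟩

/-- The product of the members of a family over a multiset, in an unspecified order. -/
def word (m : ι → R) (κ : Multiset ι) : R := (κ.toList.map m).prod

lemma word_zero : word m 0 = 1 := by simp [word]

lemma SignCommute.word_cons (hm : SignCommute m) (i : ι) (κ : Multiset ι) :
    ∃ ε : ℤˣ, word m (i ::ₘ κ) = ε • (m i * word m κ) := by
  have h : (i ::ₘ κ).toList.Perm (i :: κ.toList) := by
    rw [← Multiset.coe_eq_coe, Multiset.coe_toList, ← Multiset.cons_coe, Multiset.coe_toList]
  obtain ⟨ε, h'⟩ := hm.prod_perm h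
  exact ⟨ε, h'⟩

lemma SignCommute.mul_word (hm : SignCommute m) (i : ι) (κ : Multiset ι) :
    m i * word m κ = word m (i ::ₘ κ) ∨ m i * word m κ = -word m (i ::ₘ κ) := by
  obtain ⟨ε, h⟩ := hm.word_cons i κ
  rcases Int.units_eq_one_or ε with rfl | rfl
  · exact .inl (by rw [h, one_smul])
  · exact .inr (by rw [h, Units.neg_smul, one_smul, neg_neg])

lemma SignCommute.word_eq_zero (hm : SignCommute m) {i : ι} (hi : m i * m i = 0) {κ : Multiset ι} :
    word m (i ::ₘ i ::ₘ κ) = 0 := by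
  obtain ⟨ε, h⟩ := hm.word_cons i (i ::ₘ κ)
  obtain ⟨ε', h'⟩ := hm.word_cons i κ
  rw [h, h', mul_smul_comm, ← mul_assoc, hi, zero_mul, smul_zero, smul_zero]

lemma map_word {R' F : Type} [Ring R'] [FunLike F R R'] [RingHomClass F R R'] (f : F)
    (κ : Multiset ι) : f (word m κ) = word (fun i => f (m i)) κ := by
  rw [word, map_list_prod, List.map_map]
  rfl

lemma word_congr {m' : ι → R} {κ : Multiset ι} (h : ∀ i ∈ κ, m i = m' i) :
    word m κ = word m' κ := by
  unfold word
  rw [List.map_congr_left fun i hi => h i (Multiset.mem_toList.mp hi)]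

lemma word_smul {A : Type} [CommRing A] [Algebra A R] (t : ι → A) (κ : Multiset ι) :
    word (fun i => t i • m i) κ = (κ.map t).prod • word m κ := by
  have h1 : ∀ l : List ι, (l.map fun i => t i • m i).prod = (l.map t).prod • (l.map m).prod :=
    fun l => by
      induction l with
      | nil => simp
      | cons i l ih =>
        simp only [List.map_cons, List.prod_cons, ih, smul_mul_smul_comm]
  have h2 : (κ.map t).prod = (κ.toList.map t).prod := by
    conv_lhs => rw [← Multiset.coe_toList κ, Multiset.map_coe, Multiset.prod_coe]
  rw [word, h1, h2]
  rfl

open scoped Classical in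
lemma prod_map_erase {i : ι} (hi : ∀ x, m i * x = x * m i) {l : List ι} (h : i ∈ l) :
    m i * ((l.erase i).map m).prod = (l.map m).prod := by
  induction l with
  | nil => simp at h
  | cons j l ih =>
    by_cases hj : j = i
    · subst hj
      simp
    · rw [List.erase_cons_tail (by simpa using hj), List.map_cons, List.prod_cons, ← mul_assoc, hi,
        mul_assoc, ih ((List.mem_cons.mp h).resolve_left (Ne.symm hj)), List.map_cons, List.prod_cons]

open scoped Classical in
/-- The change of a product under a perturbation of square zero of one of the elements. -/
lemma prod_map_update {i : ι} (hi : ∀ x, m i * x = x * m i) {η : R} (hη : ∀ x, η * x = x * η)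
    (hη2 : η * η = 0) (l : List ι) : (l.map (Function.update m i (m i + η))).prod
      = (l.map m).prod + l.count i • (η * ((l.erase i).map m).prod) := by
  induction l with
  | nil => simp
  | cons j l ih =>
    rw [List.map_cons, List.prod_cons, ih, List.map_cons, List.prod_cons]
    by_cases hj : j = i
    · subst hj
      rw [Function.update_self, List.erase_cons_head, List.count_cons_self, add_mul, mul_add, mul_add,
        mul_smul_comm, mul_smul_comm, ← mul_assoc η η, hη2, zero_mul, smul_zero, add_zero,
        ← mul_assoc (m j) η, hi η, mul_assoc, succ_nsmul, add_assoc]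
      by_cases h : j ∈ l
      · rw [prod_map_erase hi h]
      · rw [List.count_eq_zero_of_not_mem h, zero_smul, zero_smul]
    · rw [Function.update_of_ne hj, List.erase_cons_tail (by simpa using hj),
        List.count_cons_of_ne hj, mul_add, mul_smul_comm, List.map_cons, List.prod_cons,
        ← mul_assoc, ← hη, mul_assoc]

end Words

/-! ### Nilpotent values of the coordinates -/

/-- Values of the coordinates of a point of `SK(1)` that is nilpotent up to the scale. -/
structure IsNilpotentPoint (n : Coord → Lam) : Prop where
  a : ∃ z : ℂ, z ≠ 0 ∧ n .a = z • 1
  even : ∀ p, p.grade = 0 → (n p).IsEven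
  odd : ∀ p, p.grade = 1 → (n p).IsOdd
  nilpotent : ∀ k j, n (.A k j) ∅ = 0
  finite : {p | n p ≠ 0}.Finite

lemma Coord.grade_cases (p : Coord) : p.grade = 0 ∨ p.grade = 1 := by
  cases p
  · exact .inl rfl
  · exact .inl rfl
  · exact .inr rfl

lemma signCommute_of_parity {τ K : Type} [LinearOrder τ] [CommRing K] {m : Coord → Gr τ K}
    (he : ∀ p, p.grade = 0 → (m p).IsEven) (ho : ∀ p, p.grade = 1 → (m p).IsOdd) : SignCommute m := by
  intro p q
  rcases p.grade_cases with hp | hp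
  · exact ⟨1, by rw [one_smul, Gr.commute_of_isEven (he p hp)]⟩
  · rcases q.grade_cases with hq | hq
    · exact ⟨1, by rw [one_smul, Gr.commute_of_isEven (he q hq)]⟩
    · exact ⟨-1, by
        rw [Gr.odd_mul_comm (ho p hp), Gr.parityAut_of_isOdd (ho q hq), neg_mul, Units.neg_smul,
          one_smul]⟩

namespace IsNilpotentPoint

variable {n : Coord → Lam}

lemma exists_point (hn : IsNilpotentPoint n) : ∃ Q : SK1, ∀ p, Coord.fn p Q = n p := by
  obtain ⟨z, hz, ha⟩ := hn.a
  have hfin : ∀ k, {j : ℕ+ | n (.A k j) ≠ 0 ∨ n (.M k j) ≠ 0}.Finite := fun k => by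
    refine ((hn.finite.preimage (f := Coord.A k) ?_).union
      (hn.finite.preimage (f := Coord.M k) ?_)).subset fun j hj => hj
    · rintro i - j - h
      cases h
      rfl
    · rintro i - j - h
      cases h
      rfl
  refine ⟨⟨n .a, fun k j => n (.A k j), fun k j => n (.M k j), hn.even _ rfl, ?_,
    fun k => inH_of_nilpotent (fun j => hn.even _ rfl) (fun j => hn.nilpotent k j)
      (fun j => hn.odd _ rfl) (hfin k)⟩, fun p => by cases p <;> rfl⟩
  rw [ha, ← Algebra.algebraMap_eq_smul_one]
  exact (isUnit_iff_ne_zero.mpr hz).map (algebraMap ℂ Lam)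

lemma scale (hn : IsNilpotentPoint n) {t : Coord → ℂ} (ht : t .a ≠ 0) :
    IsNilpotentPoint fun p => t p • n p where
  a := by
    obtain ⟨z, hz, ha⟩ := hn.a
    exact ⟨t .a * z, mul_ne_zero ht hz, by rw [ha, smul_smul]⟩
  even p hp := (hn.even p hp).smul _
  odd p hp := (hn.odd p hp).smul _
  nilpotent k j := by rw [Gr.smul_apply, hn.nilpotent, smul_zero]
  finite := hn.finite.subset fun p hp h => hp (by rw [h, smul_zero])

lemma signCommute (hn : IsNilpotentPoint n) : SignCommute n := signCommute_of_parity hn.even hn.odd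

open scoped Classical in
lemma update (hn : IsNilpotentPoint n) {p : Coord} (hp : p ≠ .a) {c : Lam}
    (he : p.grade = 0 → c.IsEven) (ho : p.grade = 1 → c.IsOdd) (h0 : c ∅ = 0) :
    IsNilpotentPoint (Function.update n p (n p + c)) where
  a := by rw [Function.update_of_ne (Ne.symm hp)]; exact hn.a
  even q hq := by
    by_cases h : q = p
    · subst h
      rw [Function.update_self]
      exact (hn.even q hq).add (he hq)
    · rw [Function.update_of_ne h]
      exact hn.even q hq
  odd q hq := by
    by_cases h : q = p
    · subst h
      rw [Function.update_self]
      exact (hn.odd q hq).add (ho hq)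
    · rw [Function.update_of_ne h]
      exact hn.odd q hq
  nilpotent k j := by
    by_cases h : .A k j = p
    · subst h
      rw [Function.update_self, Gr.add_apply, hn.nilpotent, h0, add_zero]
    · rw [Function.update_of_ne h]
      exact hn.nilpotent k j
  finite := by
    refine (hn.finite.union (Set.finite_singleton p)).subset fun q hq => ?_
    by_cases h : q = p
    · exact .inr h
    · rw [Set.mem_setOf_eq, Function.update_of_ne h] at hq
      exact .inl hq

lemma one : IsNilpotentPoint (fun p => open scoped Classical in if p = .a then 1 else 0) where
  a := ⟨1, one_ne_zero, by rw [if_pos rfl, one_smul]⟩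
  even p _ := by
    split_ifs
    · exact Gr.isEven_one
    · exact Gr.isEven_zero
  odd p hp := by
    rw [if_neg]
    · exact Gr.isOdd_zero
    · rintro rfl
      exact absurd hp (by decide)
  nilpotent k j := by rw [if_neg nofun]; rfl
  finite := (Set.finite_singleton Coord.a).subset fun p hp => by
    by_contra h
    exact hp (if_neg h)

end IsNilpotentPoint

lemma gen_empty (u : ℕ) : (Gr.gen u : Lam) ∅ = 0 := by
  change (if (∅ : Finset ℕ) = {u} then (1 : ℂ) else 0) = 0
  rw [if_neg (Finset.singleton_ne_empty u).symm]

lemma Lam.eq_zero_of_mul_gen {c : Lam} (h : ∀ u : ℕ, c * Gr.gen u = 0) : c = 0 := by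
  have h1 : Gr.parityAut c = 0 := Lam.eq_zero_of_gen_mul fun u => by
    rw [Gr.odd_mul_comm (Gr.isOdd_gen u), Gr.parityAut_parityAut, h]
  rw [← Gr.parityAut_parityAut c, h1, map_zero]

open scoped Classical in
/-- A constant that annihilates all values of a word without repeated odd letters vanishes. -/
lemma eq_zero_of_mul_word {κ : Multiset Coord} (hκ : ∀ p, p.grade = 1 → κ.count p ≤ 1) {c : Lam}
    (h : ∀ n, IsNilpotentPoint n → c * word n κ = 0) : c = 0 := by
  induction κ using Multiset.induction generalizing c with
  | empty => simpa [word_zero] using h _ .one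
  | cons p κ ih =>
    have hκ' : ∀ q, q.grade = 1 → κ.count q ≤ 1 := fun q hq =>
      (Multiset.count_le_of_le q (Multiset.le_cons_self κ p)).trans (hκ q hq)
    have h1 : ∀ n, IsNilpotentPoint n → c * (n p * word n κ) = 0 := fun n hn => by
      obtain ⟨ε, hε⟩ := hn.signCommute.word_cons p κ
      have := h n hn
      rwa [hε, mul_smul_comm, smul_eq_zero_iff_eq] at this
    rcases p.grade_cases with hp | hp
    · by_cases hpa : p = .a
      · subst hpa
        refine ih hκ' fun n hn => ?_
        obtain ⟨z, hz, ha⟩ := hn.a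
        have := h1 n hn
        rw [ha, smul_mul_assoc, one_mul, mul_smul_comm] at this
        exact (smul_eq_zero.mp this).resolve_left hz
      · refine Lam.eq_zero_of_mul_gen fun u => Lam.eq_zero_of_mul_gen fun v => ih hκ' fun n hn => ?_
        have hη : (Gr.gen u * Gr.gen v : Lam).IsEven := (Gr.isOdd_gen u).mul (Gr.isOdd_gen v)
        have hη2 : (Gr.gen u * Gr.gen v * (Gr.gen u * Gr.gen v) : Lam) = 0 := by
          rw [← Gr.commute_of_isEven hη, mul_assoc, ← mul_assoc (Gr.gen v),
            Gr.odd_mul_comm (Gr.isOdd_gen v) (Gr.gen u), Gr.parityAut_of_isOdd (Gr.isOdd_gen u)]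
          simp only [neg_mul, mul_neg, mul_assoc, (Gr.isOdd_gen (K := ℂ) v).mul_self, mul_zero, neg_zero]
        have hn' := hn.update hpa (fun _ => hη) (fun h' => absurd (hp.symm.trans h') (by decide))
          (by rw [Gr.gen_mul_apply, if_neg (Finset.notMem_empty u)])
        have h2 := h1 _ hn
        have h3 := h1 _ hn'
        have h4 := fun l => prod_map_update (m := n) (Gr.commute_of_isEven (hn.even p hp))
          (Gr.commute_of_isEven hη) hη2 l
        have h5 := h4 (p :: κ.toList)
        rw [List.map_cons, List.prod_cons, List.map_cons, List.prod_cons, List.erase_cons_head,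
          List.count_cons_self] at h5
        change c * (_ * (κ.toList.map _).prod) = 0 at h3
        rw [h5, mul_add] at h3
        change c * (n p * (κ.toList.map n).prod) = 0 at h2
        rw [h2, zero_add, mul_smul_comm, ← mul_assoc, ← mul_assoc,
          ← Nat.cast_smul_eq_nsmul ℂ] at h3
        exact (smul_eq_zero.mp h3).resolve_left (Nat.cast_ne_zero.mpr (Nat.succ_ne_zero _))
    · have hpκ : p ∉ κ := fun hmem => by
        have h2 := hκ p hp
        rw [Multiset.count_cons_self] at h2
        have h3 := Multiset.one_le_count_iff_mem.mpr hmem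
        omega
      refine Lam.eq_zero_of_mul_gen fun u => ih hκ' fun n hn => ?_
      have hpa : p ≠ .a := by
        rintro rfl
        exact absurd hp (by decide)
      have hn' := hn.update hpa (fun h' => absurd (h'.symm.trans hp) (by decide))
        (fun _ => Gr.isOdd_gen u) (gen_empty u)
      have h2 := h1 _ hn'
      rw [Function.update_self, add_mul, mul_add,
        word_congr (m' := n) fun q hq => Function.update_of_ne (fun h' => hpκ (by rwa [← h'])) _ _,
        h1 _ hn, zero_add, ← mul_assoc] at h2
      exact h2

section

open Formal SD1

/-- The monomials in the values of the coordinates are linearly independent. -/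
lemma mul_word_eq_zero {C : Multiset Coord →₀ Lam}
    (h : ∀ n, IsNilpotentPoint n → (C.sum fun κ c => c * word n κ) = 0) (κ : Multiset Coord)
    {n : Coord → Lam} (hn : IsNilpotentPoint n) : C κ * word n κ = 0 := by
  classical
  ext S
  let P : MvPolynomial Coord ℂ := ∑ κ ∈ C.support,
    MvPolynomial.monomial (Multiset.toFinsupp κ) ((C κ * word n κ) S)
  have hP : P * MvPolynomial.X .a = 0 := by
    refine MvPolynomial.funext fun t => ?_
    rw [map_mul, MvPolynomial.eval_X, map_zero]
    by_cases ht : t .a = 0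
    · rw [ht, mul_zero]
    · have h1 := congrFun (h _ (hn.scale ht)) S
      have h2 : MvPolynomial.eval t P = 0 := by
        refine Eq.trans ?_ h1
        rw [map_sum, Finsupp.sum]
        let evS : Lam →+ ℂ := { toFun := fun f => f S, map_zero' := rfl, map_add' := fun _ _ => rfl }
        refine Eq.trans ?_ (map_sum evS _ C.support).symm
        refine Finset.sum_congr rfl fun κ _ => ?_
        change _ = (C κ * word (fun p => t p • n p) κ) S
        rw [word_smul, mul_smul_comm, Gr.smul_apply, MvPolynomial.eval_monomial, smul_eq_mul, mul_comm]
        congr 1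
        conv_rhs => rw [← Multiset.toFinsupp_toMultiset κ]
        rw [Finsupp.toMultiset_map, Finsupp.prod_toMultiset, Finsupp.prod_mapDomain_index
          (fun _ => pow_zero _) fun _ _ _ => pow_add _ _ _]
      rw [h2, zero_mul]
  have hP0 : P = 0 := (mul_eq_zero.mp hP).resolve_right (MvPolynomial.X_ne_zero _)
  have h3 := congrArg (MvPolynomial.coeff (Multiset.toFinsupp κ)) hP0
  rw [MvPolynomial.coeff_sum, MvPolynomial.coeff_zero] at h3
  simp only [MvPolynomial.coeff_monomial, EmbeddingLike.apply_eq_iff_eq, Finset.sum_ite_eq'] at h3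
  by_cases hκ : κ ∈ C.support
  · rwa [if_pos hκ] at h3
  · rw [Finsupp.notMem_support_iff.mp hκ, zero_mul]

namespace Substitution

/-- The constant superfunctions, as an algebra homomorphism. -/
def constHom : Lam →ₐ[ℂ] SD1 where
  toFun := const
  map_one' := rfl
  map_mul' _ _ := rfl
  map_zero' := rfl
  map_add' _ _ := rfl
  commutes' _ := rfl

/-- The constants in the product of `SD(1)` and the superseries. -/
def cst : Lam →ₐ[ℂ] SD1 × Formal := constHom.prod (Lam.inclHom _)

variable (v : Coord → Formal)

/-- A coordinate together with the superseries substituted for it. -/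
def letter (p : Coord) : SD1 × Formal := (coord p, v p)

/-- The sum of constants times words in the coordinates. -/
def lin : (Multiset Coord →₀ Lam) →+ SD1 × Formal :=
  Finsupp.liftAddHom fun κ =>
    (AddMonoidHom.mulRight (word (letter v) κ)).comp (cst : Lam →+ SD1 × Formal)

lemma lin_single (κ : Multiset Coord) (c : Lam) :
    lin v (Finsupp.single κ c) = cst c * word (letter v) κ :=
  Finsupp.liftAddHom_apply_single _ _ _

lemma lin_apply (C : Multiset Coord →₀ Lam) :
    lin v C = C.sum fun κ c => cst c * word (letter v) κ := rfl

variable {v} (hu : IsUnit (v .a)) (he : ∀ p, p.grade = 0 → (v p).IsEven)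
  (ho : ∀ p, p.grade = 1 → (v p).IsOdd)

lemma coord_isEven {p : Coord} (hp : p.grade = 0) (Q : SK1) : (eval (coord p) Q).IsEven := by
  cases p with
  | a => exact Q.a_even
  | A k j => exact (Q.mem_H k).1 j
  | M k j => exact absurd (show (1 : ZMod 2) = 0 from hp) (by decide)

lemma coord_isOdd {p : Coord} (hp : p.grade = 1) (Q : SK1) : (eval (coord p) Q).IsOdd := by
  cases p with
  | a => exact absurd hp (by decide)
  | A k j => exact absurd (show (0 : ZMod 2) = 1 from hp) (by decide)
  | M k j => exact (Q.mem_H k).2.1 j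

include he in
lemma letter_comm {p : Coord} (hp : p.grade = 0) (x : SD1 × Formal) :
    letter v p * x = x * letter v p :=
  Prod.ext (SD1.ext fun Q => Gr.commute_of_isEven (coord_isEven hp Q) _)
    (Gr.commute_of_isEven (he p hp) _)

include he ho

lemma signCommute_letter : SignCommute (letter v) := by
  intro p q
  rcases p.grade_cases with hp | hp
  · exact ⟨1, by rw [one_smul, letter_comm he hp]⟩
  · rcases q.grade_cases with hq | hq
    · exact ⟨1, by rw [one_smul, letter_comm he hq]⟩
    · refine ⟨-1, ?_⟩
      rw [Units.neg_smul, one_smul]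
      refine Prod.ext (SD1.ext fun Q => ?_) ?_
      · exact (Gr.odd_mul_comm (coord_isOdd hp Q) _).trans (by
          change Gr.parityAut (eval (coord q) Q) * eval (coord p) Q = _
          rw [Gr.parityAut_of_isOdd (coord_isOdd hq Q), neg_mul]
          rfl)
      · exact (Gr.odd_mul_comm (ho p hp) _).trans (by
          change Gr.parityAut (v q) * v p = _
          rw [Gr.parityAut_of_isOdd (ho q hq), neg_mul]
          rfl)

lemma letter_mul_cst (p : Coord) (c : Lam) :
    letter v p * cst c = cst (Gr.twist p.grade c) * letter v p := by
  rcases p.grade_cases with hp | hp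
  · rw [letter_comm he hp, hp, Gr.twist_zero]
  · rw [hp, Gr.twist_one]
    refine Prod.ext (SD1.ext fun Q => ?_) ?_
    · exact Gr.odd_mul_comm (coord_isOdd hp Q) _
    · refine (Gr.odd_mul_comm (ho p hp) _).trans ?_
      exact congrArg (· * v p) (Lam.parityAut_incl _ c)

lemma mul_lin_mem {y : SD1 × Formal} (hy : (∃ c, y = cst c) ∨ ∃ p, y = letter v p)
    {x : SD1 × Formal} (hx : x ∈ (lin v).range) : y * x ∈ (lin v).range := by
  obtain ⟨C, rfl⟩ := hx
  induction C using Finsupp.induction_linear with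
  | zero => rw [map_zero, mul_zero]; exact zero_mem _
  | add f g hf hg => rw [map_add, mul_add]; exact add_mem hf hg
  | single κ c =>
    rw [lin_single, ← mul_assoc]
    rcases hy with ⟨d, rfl⟩ | ⟨p, rfl⟩
    · rw [← map_mul, ← lin_single]
      exact ⟨_, rfl⟩
    · rw [letter_mul_cst he ho, mul_assoc]
      rcases (signCommute_letter he ho).mul_word p κ with h | h
      · rw [h, ← lin_single]
        exact ⟨_, rfl⟩
      · rw [h]
        refine (mul_neg (cst _) _).symm ▸ neg_mem ?_
        rw [← lin_single]
        exact ⟨_, rfl⟩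

/-- A sum of words that vanishes as a superfunction vanishes. -/
lemma eq_zero_of_fst {x : SD1 × Formal} (hx : x ∈ (lin v).range) (h : x.1 = 0) : x = 0 := by
  classical
  obtain ⟨C, rfl⟩ := hx
  have h0 : ∀ n, IsNilpotentPoint n → (C.sum fun κ c => c * word n κ) = 0 := fun n hn => by
    obtain ⟨Q, hQ⟩ := hn.exists_point
    have h1 : (evalHom Q).toRingHom (RingHom.fst SD1 Formal (lin v C)) = 0 := by
      change evalHom Q (lin v C).1 = 0
      rw [h, map_zero]
    rw [lin_apply, map_finsuppSum, map_finsuppSum] at h1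
    rw [← h1]
    refine Finset.sum_congr rfl fun κ _ => ?_
    change C κ * word n κ = evalHom Q (RingHom.fst SD1 Formal (cst (C κ) * word (letter v) κ))
    rw [map_mul, map_mul, map_word, map_word]
    refine congrArg (C κ * ·) ?_
    exact word_congr fun p _ => (hQ p).symm
  rw [lin_apply]
  refine Finset.sum_eq_zero fun κ _ => ?_
  by_cases hκ : ∀ p, p.grade = 1 → κ.count p ≤ 1
  · change cst (C κ) * word (letter v) κ = 0
    rw [eq_zero_of_mul_word hκ fun n hn => mul_word_eq_zero h0 κ hn, map_zero, zero_mul]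
  · push Not at hκ
    obtain ⟨p, hp, h2⟩ := hκ
    obtain ⟨κ', rfl⟩ := Multiset.exists_cons_of_mem (Multiset.one_le_count_iff_mem.mp (by omega : 1 ≤ κ.count p))
    rw [Multiset.count_cons_self] at h2
    obtain ⟨κ'', rfl⟩ := Multiset.exists_cons_of_mem (Multiset.one_le_count_iff_mem.mp (by omega : 1 ≤ κ'.count p))
    change cst (C _) * word (letter v) _ = 0
    rw [(signCommute_letter he ho).word_eq_zero
      (Prod.ext (SD1.ext fun Q => (coord_isOdd hp Q).mul_self) (ho p hp).mul_self), mul_zero]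

omit ho he in
/-- The pairs of a superfunction and its substitution. -/
def graph (v : Coord → Formal) : Subalgebra ℂ (SD1 × Formal) :=
  Algebra.adjoin ℂ (Set.range cst ∪ Set.range (letter v) ∪ {(aInv, Ring.inverse (v .a))})

include hu in
lemma exists_pow_mul_mem {y : SD1 × Formal} (hy : y ∈ graph v) :
    ∃ N, letter v .a ^ N * y ∈ (lin v).range := by
  have ha : ∀ N x, letter v .a ^ N * x = x * letter v .a ^ N := fun N x => by
    have h1 : Commute (letter v .a) x := letter_comm he rfl x
    exact h1.pow_left N
  have hmem : ∀ N x, x ∈ (lin v).range → letter v .a ^ N * x ∈ (lin v).range := fun N x hx => by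
    induction N with
    | zero => rwa [pow_zero, one_mul]
    | succ N ih =>
      rw [pow_succ', mul_assoc]
      exact mul_lin_mem he ho (.inr ⟨_, rfl⟩) ih
  have hinv : letter v .a * (aInv, Ring.inverse (v .a)) = 1 :=
    Prod.ext a_mul_aInv (Ring.mul_inverse_cancel _ hu)
  suffices H : ∀ x, (∃ N, letter v .a ^ N * x ∈ (lin v).range) →
      ∃ N, letter v .a ^ N * (y * x) ∈ (lin v).range by
    have h1 : (1 : SD1 × Formal) ∈ (lin v).range :=
      ⟨Finsupp.single 0 1, by rw [lin_single, map_one, word_zero, mul_one]⟩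
    obtain ⟨N, hN⟩ := H 1 ⟨0, by rwa [pow_zero, one_mul]⟩
    exact ⟨N, by rwa [mul_one] at hN⟩
  refine Algebra.adjoin_induction (p := fun y _ => ∀ x, (∃ N, letter v .a ^ N * x ∈ (lin v).range) →
      ∃ N, letter v .a ^ N * (y * x) ∈ (lin v).range) ?_ ?_ ?_ ?_ hy
  · rintro y hy x ⟨N, hN⟩
    have h2 : ((∃ c, y = cst c) ∨ ∃ p, y = letter v p) →
        ∃ N, letter v .a ^ N * (y * x) ∈ (lin v).range := fun h => ⟨N, by
      rw [← mul_assoc, ha, mul_assoc]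
      exact mul_lin_mem he ho h hN⟩
    rcases hy with (⟨c, rfl⟩ | ⟨p, rfl⟩) | rfl
    · exact h2 (.inl ⟨c, rfl⟩)
    · exact h2 (.inr ⟨p, rfl⟩)
    · refine ⟨N + 1, ?_⟩
      rw [pow_succ, ← mul_assoc, mul_assoc _ (letter v .a), hinv, mul_one]
      exact hN
  · rintro r x ⟨N, hN⟩
    refine ⟨N, ?_⟩
    rw [← mul_assoc, ha, mul_assoc]
    exact mul_lin_mem he ho (.inl ⟨algebraMap ℂ Lam r, (cst.commutes r).symm⟩) hN
  · rintro y z - - hy hz x hx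
    obtain ⟨N, hN⟩ := hy x hx
    obtain ⟨N', hN'⟩ := hz x hx
    refine ⟨N + N', ?_⟩
    rw [add_mul, mul_add]
    refine add_mem ?_ ?_
    · rw [add_comm N, pow_add, mul_assoc]
      exact hmem _ _ hN
    · rw [pow_add, mul_assoc]
      exact hmem _ _ hN'
  · rintro y z - - hy hz x hx
    obtain ⟨N, hN⟩ := hy _ (hz x hx)
    exact ⟨N, by rwa [mul_assoc]⟩

include hu in
lemma graph_fst_injective : Function.Injective ((AlgHom.fst ℂ SD1 Formal).comp (graph v).val) := by
  refine (injective_iff_map_eq_zero _).mpr ?_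
  rintro ⟨⟨F, f⟩, hy⟩ (h : F = 0)
  subst h
  obtain ⟨N, hN⟩ := exists_pow_mul_mem hu he ho hy
  have h1 := congrArg Prod.snd (eq_zero_of_fst he ho hN (mul_zero _))
  have h2 : f = 0 := (hu.pow N).mul_right_eq_zero.mp h1
  exact Subtype.ext (Prod.ext rfl h2)

omit hu he ho in
lemma graph_fst_surjective : Function.Surjective ((AlgHom.fst ℂ SD1 Formal).comp (graph v).val) := by
  have hs : ∀ y ∈ Set.range cst ∪ Set.range (letter v) ∪ {(aInv, Ring.inverse (v .a))},
      y ∈ graph v := fun y hy => Algebra.subset_adjoin hy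
  refine SD1.induction (fun c => ?_) (fun p => ?_) ?_ ?_ ?_
  · exact ⟨⟨cst c, hs _ (.inl (.inl ⟨c, rfl⟩))⟩, rfl⟩
  · exact ⟨⟨letter v p, hs _ (.inl (.inr ⟨p, rfl⟩))⟩, rfl⟩
  · exact ⟨⟨_, hs _ (.inr rfl)⟩, rfl⟩
  · rintro _ _ ⟨x, rfl⟩ ⟨y, rfl⟩
    exact ⟨x + y, map_add _ x y⟩
  · rintro _ _ ⟨x, rfl⟩ ⟨y, rfl⟩
    exact ⟨x * y, map_mul _ x y⟩

include hu in
lemma exists_isSubst : ∃ sub, IsSubst v sub := by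
  let e := AlgEquiv.ofBijective _ ⟨graph_fst_injective hu he ho, graph_fst_surjective⟩
  refine ⟨((AlgHom.snd ℂ SD1 Formal).comp (graph v).val).comp e.symm.toAlgHom,
    fun c => ?_, fun p => ?_⟩
  · have h1 : e.symm (const c) = ⟨cst c, Algebra.subset_adjoin (.inl (.inl ⟨c, rfl⟩))⟩ :=
      (AlgEquiv.symm_apply_eq e).mpr rfl
    change ((AlgHom.snd ℂ SD1 Formal).comp (graph v).val) (e.symm (const c)) = _
    rw [h1]
    rfl
  · have h1 : e.symm (coord p) = ⟨letter v p, Algebra.subset_adjoin (.inl (.inr ⟨p, rfl⟩))⟩ :=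
      (AlgEquiv.symm_apply_eq e).mpr rfl
    change ((AlgHom.snd ℂ SD1 Formal).comp (graph v).val) (e.symm (coord p)) = _
    rw [h1]
    rfl

end Substitution

end

namespace NS0

/-- The parity of a basis element. -/
def parity : NSIndex → ZMod 2
  | .L _ => 0
  | .G _ => 1

/-- The grading into even and odd elements. -/
def grade (s : ZMod 2) : Submodule ℂ NS0 := Finsupp.supported ℂ ℂ {i | parity i = s}

lemma grade_induction {s : ZMod 2} {P : NS0 → Prop} (single : ∀ i, parity i = s → P (.single i 1))
    (zero : P 0) (add : ∀ u v, P u → P v → P (u + v)) (smul : ∀ (c : ℂ) u, P u → P (c • u))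
    {u : NS0} (hu : u ∈ grade s) : P u := by
  rw [grade, Finsupp.supported_eq_span_single] at hu
  refine Submodule.span_induction ?_ zero (fun u v _ _ => add u v) (fun c u _ => smul c u) hu
  rintro _ ⟨i, hi, rfl⟩
  exact single i hi

lemma bracket_single (i j : NSIndex) :
    bracket (Finsupp.single i 1) (Finsupp.single j 1) = basisBracket i j := by
  rw [bracket, Finsupp.linearCombination_single, one_smul, Finsupp.linearCombination_single, one_smul]

lemma bracket_L_L (m n : ℤ) : bracket (L m) (L n) = ((m : ℂ) - n) • L (m + n) :=
  bracket_single _ _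

lemma bracket_G_L (m n : ℤ) : bracket (G m) (L n) = ((m : ℂ) - ((n : ℂ) - 1) / 2) • G (m + n) :=
  bracket_single _ _

lemma bracket_L_G (m n : ℤ) : bracket (L n) (G m) = -(((m : ℂ) - ((n : ℂ) - 1) / 2) • G (m + n)) :=
  bracket_single _ _

lemma bracket_G_G (m n : ℤ) : bracket (G m) (G n) = (2 : ℂ) • L (m + (n + 1)) :=
  bracket_single _ _

lemma basisBracket_mem (i j : NSIndex) : basisBracket i j ∈ grade (parity i + parity j) := by
  have h : ∀ i : NSIndex, ∀ s, parity i = s → (Finsupp.single i 1 : NS0) ∈ grade s := fun i s hi =>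
    Finsupp.single_mem_supported ℂ _ hi
  rcases i with m | m <;> rcases j with n | n
  · exact Submodule.smul_mem _ _ (h (.L _) _ rfl)
  · exact neg_mem (Submodule.smul_mem _ _ (h (.G _) _ rfl))
  · exact Submodule.smul_mem _ _ (h (.G _) _ rfl)
  · exact Submodule.smul_mem _ _ (h (.L _) _ rfl)

/-- The cyclic sum of the super Jacobi identity. -/
def jacobiator (i j k : ZMod 2) (u v w : NS0) : NS0 :=
  (-1 : ℂ) ^ (i.val * k.val) • bracket (bracket u v) w
    + (-1 : ℂ) ^ (j.val * i.val) • bracket (bracket v w) u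
    + (-1 : ℂ) ^ (k.val * j.val) • bracket (bracket w u) v

lemma jacobiator_rotate (i j k : ZMod 2) (u v w : NS0) :
    jacobiator i j k u v w = jacobiator j k i v w u := by
  unfold jacobiator
  abel

lemma jacobiator_eq_zero_of_left {i j k : ZMod 2} {v w : NS0}
    (h : ∀ p, parity p = i → jacobiator i j k (.single p 1) v w = 0) {u : NS0} (hu : u ∈ grade i) :
    jacobiator i j k u v w = 0 := by
  refine grade_induction (P := fun u => jacobiator i j k u v w = 0) h ?_ (fun u v' hu hv => ?_)
    (fun c u hu => ?_) hu
  · simp [jacobiator]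
  · have h1 : jacobiator i j k (u + v') v w = jacobiator i j k u v w + jacobiator i j k v' v w := by
      simp only [jacobiator, map_add, LinearMap.add_apply, smul_add]
      abel
    rw [h1, hu, hv, add_zero]
  · rw [← smul_zero c, ← hu]
    simp only [jacobiator, map_smul, LinearMap.smul_apply, smul_add]
    simp only [smul_comm c]

lemma jacobiator_basis (p q r : NSIndex) : jacobiator (parity p) (parity q) (parity r)
    (.single p 1) (.single q 1) (.single r 1) = 0 := by
  have v0 : (0 : ZMod 2).val = 0 := rfl
  have v1 : (1 : ZMod 2).val = 1 := rfl
  have hL : ∀ n, (Finsupp.single (.L n) 1 : NS0) = L n := fun _ => rfl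
  have hG : ∀ n, (Finsupp.single (.G n) 1 : NS0) = G n := fun _ => rfl
  rcases p with a | a <;> rcases q with b | b <;> rcases r with c | c <;>
    simp only [jacobiator, parity, v0, v1, hL, hG, bracket_L_L, bracket_L_G, bracket_G_L, bracket_G_G,
      map_smul, map_neg, LinearMap.smul_apply, LinearMap.neg_apply, mul_zero, zero_mul, mul_one,
      pow_zero, pow_one]
  · rw [show b + c + a = a + b + c by ring, show c + a + b = a + b + c by ring]
    push_cast
    module
  · rw [show c + b + a = c + a + b by ring, show c + (a + b) = c + a + b by ring]
    push_cast
    module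
  · rw [show b + c + a = b + a + c by ring, show b + (c + a) = b + a + c by ring]
    push_cast
    module
  · rw [show b + (c + 1) + a = b + a + (c + 1) by ring, show c + a + (b + 1) = b + a + (c + 1) by ring]
    push_cast
    module
  · rw [show a + (b + c) = a + b + c by ring, show a + c + b = a + b + c by ring]
    push_cast
    module
  · rw [show a + b + (c + 1) = c + b + (a + 1) by ring, show c + (a + 1) + b = c + b + (a + 1) by ring]
    push_cast
    module
  · rw [show b + c + (a + 1) = a + (b + 1) + c by ring, show a + c + (b + 1) = a + (b + 1) + c by ring]
    push_cast
    module
  · rw [show c + (a + (b + 1)) = a + b + c + 1 by ring, show a + (b + (c + 1)) = a + b + c + 1 by ring,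
      show b + (c + (a + 1)) = a + b + c + 1 by ring]
    push_cast
    module

lemma isLieSuperalgebra : IsLieSuperalgebra grade bracket where
  isCompl := by
    have h : {i | parity i = 1} = {i : NSIndex | parity i = 0}ᶜ := by
      ext i
      rcases i with n | n <;> simp [parity]
    refine ⟨Finsupp.disjoint_supported_supported ?_, Finsupp.codisjoint_supported_supported ?_⟩
    · rw [h]; exact disjoint_compl_right
    · rw [h]; exact codisjoint_iff.mpr (Set.union_compl_self _)
  graded i j u hu v hv := by
    refine grade_induction (P := fun u => bracket u v ∈ grade (i + j)) (fun p hp => ?_) ?_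
      (fun u u' h h' => ?_) (fun c u h => ?_) hu
    · refine grade_induction (P := fun v => bracket _ v ∈ grade (i + j)) (fun q hq => ?_) ?_
        (fun u u' h h' => ?_) (fun c u h => ?_) hv
      · rw [bracket_single, ← hp, ← hq]
        exact basisBracket_mem p q
      · rw [map_zero]; exact zero_mem _
      · rw [map_add]; exact add_mem h h'
      · rw [map_smul]; exact Submodule.smul_mem _ _ h
    · rw [map_zero]; exact zero_mem _
    · rw [map_add]; exact add_mem h h'
    · rw [map_smul]; exact Submodule.smul_mem _ _ h
  skew i j u hu v hv := by
    refine grade_induction (P := fun u => bracket u v = -((-1 : ℂ) ^ (i.val * j.val) • bracket v u))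
      (fun p hp => ?_) ?_ (fun u u' h h' => ?_) (fun c u h => ?_) hu
    · refine grade_induction (P := fun v => bracket _ v
        = -((-1 : ℂ) ^ (i.val * j.val) • bracket v _)) (fun q hq => ?_) ?_
        (fun u u' h h' => ?_) (fun c u h => ?_) hv
      · rw [bracket_single, bracket_single, basisBracket_skew, ← hp, ← hq]
        congr 2
        rcases p with m | m <;> rcases q with n | n <;>
          simp [parity, NSIndex.act, NSIndex.sgn, ZMod.val_one]
      · simp
      · simp only [map_add, h, h', LinearMap.add_apply, smul_add, neg_add]
      · simp only [map_smul, h, LinearMap.smul_apply, smul_neg, smul_comm c]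
    · simp
    · simp only [map_add, h, h', LinearMap.add_apply, smul_add, neg_add]
    · simp only [map_smul, h, LinearMap.smul_apply, smul_neg, smul_comm c]
  jacobi i j k u hu v hv w hw := by
    refine jacobiator_eq_zero_of_left (fun p hp => ?_) hu
    rw [jacobiator_rotate]
    refine jacobiator_eq_zero_of_left (fun q hq => ?_) hv
    rw [jacobiator_rotate]
    refine jacobiator_eq_zero_of_left (fun r hr => ?_) hw
    rw [jacobiator_rotate, ← hp, ← hq, ← hr]
    exact jacobiator_basis p q r

end NS0

section

open Formal SD1 SewingData.Regular

/-! ### Existence and uniqueness of the partial derivatives and of the substitution -/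

/-- The formal variables of the left side, as values of the coordinates. -/
def leftVar : Coord → Formal
  | .a => alpha 1
  | p => var .left p

lemma isCentered_leftVar : IsCentered leftVar := fun p => by
  cases p with
  | a => exact atE_laurentMono _
  | A k j => exact atE_var .left (.A k j)
  | M k j => exact atE_var .left (.M k j)

open scoped Classical in
lemma atE_dVar_leftVar (p q : Coord) : atE (dVar .left p (leftVar q)) = if p = q then 1 else 0 := by
  by_cases hq : q = .a
  · subst hq
    by_cases hp : p = .a
    · subst hp
      change atE (dLaurent _ _ (laurentMono (1, 0, 0))) = _
      rw [dLaurent_laurentMono, atE_eq, map_smul, ← atE_eq, atE_laurentMono, if_pos rfl]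
      exact (congrArg (· • (1 : Lam)) Int.cast_one).trans (one_smul ℂ _)
    · rw [if_neg hp]
      exact (congrArg atE ((IsMono.laurentMono (w := (1, 0, 0)) rfl).dVar_eq_zero .left hp)).trans atE_zero
  · have h1 : leftVar q = var .left q := by
      cases q with
      | a => exact absurd rfl hq
      | A k j => rfl
      | M k j => rfl
    rw [h1, dVar_var _ _ _ _ hq]
    simp only [true_and]
    split_ifs
    · exact atE_one
    · exact atE_zero

lemma exists_isPartial : ∃ pd, IsPartial pd := by
  obtain ⟨sub, hs⟩ := Substitution.exists_isSubst (v := leftVar)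
    ⟨⟨laurentMono (1, 0, 0), laurentMono (-1, 0, 0), by rw [laurentMono_mul]; exact laurentMono_zero,
      by rw [laurentMono_mul]; exact laurentMono_zero⟩, rfl⟩
    (fun p hp => by
      cases p with
      | a => exact isEven_laurentMono _
      | A k j => exact isEven_evenVar _ _ _
      | M k j => exact absurd (show (1 : ZMod 2) = 0 from hp) (by decide))
    fun p hp => by
      cases p with
      | a => exact absurd (show (0 : ZMod 2) = 1 from hp) (by decide)
      | A k j => exact absurd (show (0 : ZMod 2) = 1 from hp) (by decide)
      | M k j => exact isOdd_oddVar _ _ _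
  exact ⟨fun p => IsSubst.deriv1 sub .left p, (isPartial_iff _).mpr
    ⟨fun p => hs.deriv1_mem isCentered_leftVar .left p, fun p q => by
      rw [hs.deriv1_coord, atE_dVar_leftVar]⟩⟩

namespace SewingData.Regular

variable {S : SewingData} (h : S.Regular) (hS : S.IsSewing)

include h hS in
lemma isUnit_lam : IsUnit S.lam := ⟨_, (h.zero_iff.mp hS.at_zero).1.symm⟩

include h hS in
lemma isSubstitution_iff {sub : SD1 →ₐ[ℂ] Formal} : IsSubstitution S sub ↔ IsSubst S.phi sub := by
  refine ⟨fun hs => ⟨hs.const, fun p => ?_⟩, fun hs => ⟨hs.const, hs.coord _, fun k j => hs.coord _,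
    fun k j => hs.coord _, ?_⟩⟩
  · cases p with
    | a => exact hs.a
    | A k j => exact hs.A k j
    | M k j => exact hs.M k j
  · have h1 : S.lam * sub SD1.aInv = 1 := by
      change S.phi .a * _ = 1
      rw [← hs.coord, ← map_mul, a_mul_aInv, map_one]
    exact (left_inv_eq_right_inv (Ring.inverse_mul_cancel _ (h.isUnit_lam hS)) h1).symm

include h hS in
lemma existsUnique_substitution : ∃! sub : SD1 →ₐ[ℂ] Formal, IsSubstitution S sub := by
  obtain ⟨sub, hs⟩ := Substitution.exists_isSubst (v := S.phi) (h.isUnit_lam hS)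
    (fun p hp => by
      cases p with
      | a => exact h.lam_even
      | A k j => exact (h.phiEven k).parity j
      | M k j => exact absurd (show (1 : ZMod 2) = 0 from hp) (by decide))
    fun p hp => by
      cases p with
      | a => exact absurd (show (0 : ZMod 2) = 1 from hp) (by decide)
      | A k j => exact absurd (show (0 : ZMod 2) = 1 from hp) (by decide)
      | M k j => exact (h.phiOdd k).parity j
  refine ⟨sub, (h.isSubstitution_iff hS).mpr hs, fun sub' hs' => ?_⟩
  have hs'' := (h.isSubstitution_iff hS).mp hs'
  exact SD1.algHom_ext (fun c => by rw [hs''.const, hs.const]) fun p => by rw [hs''.coord, hs.coord]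

/-! ### The isomorphism with the Neveu–Schwarz algebra -/

lemma idx_surjective : Function.Surjective idx := by
  rintro (n | n)
  · rcases n with (_ | n) | n
    · exact ⟨.a, rfl⟩
    · exact ⟨.A .zero n.succPNat, rfl⟩
    · exact ⟨.A .infty n.succPNat, rfl⟩
  · rcases n with n | n
    · exact ⟨.M .zero n.succPNat, by simp [idx]⟩
    · exact ⟨.M .infty n.succPNat, rfl⟩

/-- The coordinates correspond to the basis elements of the Neveu–Schwarz algebra. -/
def idxEquiv : Coord ≃ NSIndex := Equiv.ofBijective idx ⟨idx_injective, idx_surjective⟩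

lemma idxEquiv_symm_idx (p : Coord) : idxEquiv.symm (idx p) = p := idxEquiv.symm_apply_apply p

lemma factor_ne_zero (p : Coord) : factor p ≠ 0 := by
  cases p
  · exact two_ne_zero
  · exact one_ne_zero
  · exact one_ne_zero

lemma parity_idx (p : Coord) : NS0.parity (idx p) = p.grade := by
  rcases p with _ | ⟨_ | _, j⟩ | ⟨_ | _, j⟩ <;> rfl

end SewingData.Regular

section Iso

variable {pd : Coord → (SD1 →ₗ[ℂ] Lam)} (hpd : IsPartial pd)

/-- The linear map that sends the basis elements of the Neveu–Schwarz algebra to multiples of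
the partial derivatives. -/
def toTangent (pd : Coord → (SD1 →ₗ[ℂ] Lam)) : NS0 →ₗ[ℂ] (SD1 →ₗ[ℂ] Lam) :=
  Finsupp.linearCombination ℂ fun i => -((factor (idxEquiv.symm i))⁻¹ • pd (idxEquiv.symm i))

lemma toTangent_idx (p : Coord) :
    toTangent pd (Finsupp.single (idx p) 1) = -((factor p)⁻¹ • pd p) := by
  rw [toTangent, Finsupp.linearCombination_single, one_smul, idxEquiv_symm_idx]

include hpd

lemma toTangent_coord (u : NS0) (q : Coord) :
    toTangent pd u (SD1.coord q) = -(((factor q)⁻¹ * u (idx q)) • (1 : Lam)) := by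
  classical
  induction u using Finsupp.induction_linear with
  | zero => simp
  | add u v hu hv =>
    rw [map_add, LinearMap.add_apply, hu, hv, Finsupp.add_apply, mul_add, add_smul, neg_add]
  | single i c =>
    obtain ⟨p, rfl⟩ := idx_surjective i
    rw [← mul_one c, ← smul_eq_mul, ← Finsupp.smul_single, map_smul, toTangent_idx, Finsupp.smul_apply,
      Finsupp.single_apply, LinearMap.smul_apply, LinearMap.neg_apply, LinearMap.smul_apply,
      ((isPartial_iff pd).mp hpd).2]
    by_cases h : p = q
    · subst h
      simp only [if_true, smul_neg, smul_smul, smul_eq_mul, mul_one]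
      rw [mul_comm c]
    · rw [if_neg h, if_neg (idx_injective.ne h)]
      simp

lemma toTangent_injective : Function.Injective (toTangent pd) := by
  refine (injective_iff_map_eq_zero _).mpr fun u hu => Finsupp.ext fun i => ?_
  obtain ⟨p, rfl⟩ := idx_surjective i
  have h1 := toTangent_coord hpd u p
  rw [hu, LinearMap.zero_apply, eq_comm, neg_eq_zero] at h1
  have h2 := (smul_eq_zero.mp h1).resolve_right fun h3 => by
    have := congrFun h3 ∅
    rw [Gr.one_apply, if_pos rfl] at this
    exact one_ne_zero this
  exact (mul_eq_zero.mp h2).resolve_left (inv_ne_zero (factor_ne_zero p))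

lemma toTangent_mem {s : ZMod 2} {u : NS0} (hu : u ∈ NS0.grade s) :
    toTangent pd u ∈ gradedTangent s := by
  refine NS0.grade_induction (P := fun u => toTangent pd u ∈ gradedTangent s) (fun i hi => ?_) ?_
    (fun u v hu hv => ?_) (fun c u hu => ?_) hu
  · obtain ⟨p, rfl⟩ := idx_surjective i
    rw [toTangent_idx, ← hi, parity_idx]
    exact neg_mem (Submodule.smul_mem _ _ (((isPartial_iff pd).mp hpd).1 p))
  · rw [map_zero]; exact zero_mem _
  · rw [map_add]; exact add_mem hu hv
  · rw [map_smul]; exact Submodule.smul_mem _ _ hu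

omit hpd in
lemma range_toTangent : LinearMap.range (toTangent pd) = hatTangent pd := by
  refine le_antisymm ?_ (Submodule.span_le.mpr ?_)
  · rw [toTangent, Finsupp.range_linearCombination]
    refine Submodule.span_le.mpr ?_
    rintro _ ⟨i, rfl⟩
    exact neg_mem (Submodule.smul_mem _ _ (hatPartial pd _).2)
  · rintro _ ⟨p, rfl⟩
    refine ⟨factor p • Finsupp.single (idx p) 1, ?_⟩
    rw [map_smul, toTangent_idx, smul_neg, smul_inv_smul₀ (factor_ne_zero p)]

/-- The Neveu–Schwarz algebra as a space of tangent vectors. -/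
def hatIso : NS0 ≃ₗ[ℂ] hatTangent pd :=
  (LinearEquiv.ofInjective (toTangent pd) (toTangent_injective hpd)).trans
    (LinearEquiv.ofEq _ _ range_toTangent)

lemma coe_hatIso (u : NS0) : (hatIso hpd u).1 = toTangent pd u := rfl

lemma hatIso_idx (p : Coord) :
    hatIso hpd (Finsupp.single (idx p) 1) = -((factor p)⁻¹ • hatPartial pd p) :=
  Subtype.ext (toTangent_idx p)

lemma hatPartial_eq (p : Coord) :
    hatPartial pd p = hatIso hpd (-(factor p • Finsupp.single (idx p) 1)) := by
  rw [map_neg, map_smul, hatIso_idx, smul_neg, neg_neg, smul_inv_smul₀ (factor_ne_zero p)]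

lemma hatIso_L (n : ℤ) : hatIso hpd (NS0.L n) = calL pd n := by
  rcases n with (_ | n) | n
  · refine (hatIso_idx hpd .a).trans ?_
    rw [factor, inv_eq_one_div]
    rfl
  · refine (hatIso_idx hpd (.A .zero n.succPNat)).trans ?_
    change -((1 : ℂ)⁻¹ • hatPartial pd _) = _
    rw [inv_one, one_smul]
    rfl
  · refine (hatIso_idx hpd (.A .infty n.succPNat)).trans ?_
    change -((1 : ℂ)⁻¹ • hatPartial pd _) = _
    rw [inv_one, one_smul]
    rfl

lemma hatIso_G (n : ℤ) : hatIso hpd (NS0.G n) = calG pd n := by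
  rcases n with n | n
  · have h1 : NS0.G (.ofNat n) = Finsupp.single (idx (.M .zero n.succPNat)) 1 := by simp [idx, NS0.G]
    rw [h1, hatIso_idx]
    change -((1 : ℂ)⁻¹ • hatPartial pd _) = _
    rw [inv_one, one_smul]
    rfl
  · refine (hatIso_idx hpd (.M .infty n.succPNat)).trans ?_
    change -((1 : ℂ)⁻¹ • hatPartial pd _) = _
    rw [inv_one, one_smul]
    rfl

lemma mem_hatGrade_iff {s : ZMod 2} {u : NS0} : hatIso hpd u ∈ hatGrade pd s ↔ u ∈ NS0.grade s := by
  have hmem : ∀ s u, hatIso hpd u ∈ hatGrade pd s ↔ toTangent pd u ∈ gradedTangent s :=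
    fun s u => Iff.rfl
  refine ⟨fun hu => ?_, fun hu => (hmem s u).mpr (toTangent_mem hpd hu)⟩
  obtain ⟨x, hx, y, hy, rfl⟩ := Submodule.mem_sup.mp
    (NS0.isLieSuperalgebra.isCompl.sup_eq_top ▸ Submodule.mem_top :
      u ∈ NS0.grade 0 ⊔ NS0.grade 1)
  rw [hmem, map_add] at hu
  have hx' := toTangent_mem hpd hx
  have hy' := toTangent_mem hpd hy
  obtain rfl | rfl := (by decide : ∀ s : ZMod 2, s = 0 ∨ s = 1) s
  · have h1 : toTangent pd y = 0 := even_inf_odd ((Submodule.add_mem_iff_right _ hx').mp hu) hy'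
    rw [(injective_iff_map_eq_zero _).mp (toTangent_injective hpd) y h1, add_zero]
    exact hx
  · have h1 : toTangent pd x = 0 := even_inf_odd hx' ((Submodule.add_mem_iff_left _ hy').mp hu)
    rw [(injective_iff_map_eq_zero _).mp (toTangent_injective hpd) x h1, zero_add]
    exact hy

/-- The bracket of the Neveu–Schwarz algebra on tangent vectors. -/
def hatBracket : hatTangent pd →ₗ[ℂ] hatTangent pd →ₗ[ℂ] hatTangent pd :=
  (NS0.bracket.compl₁₂ (hatIso hpd).symm.toLinearMap (hatIso hpd).symm.toLinearMap).compr₂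
    (hatIso hpd).toLinearMap

lemma hatBracket_hatIso (u v : NS0) :
    hatBracket hpd (hatIso hpd u) (hatIso hpd v) = hatIso hpd (NS0.bracket u v) := by
  change hatIso hpd (NS0.bracket ((hatIso hpd).symm _) ((hatIso hpd).symm _)) = _
  rw [LinearEquiv.symm_apply_apply, LinearEquiv.symm_apply_apply]

lemma isLieSuperalgebra_hatBracket : IsLieSuperalgebra (hatGrade pd) (hatBracket hpd) where
  isCompl := by
    have h1 : ∀ s, hatGrade pd s = Submodule.orderIsoMapComap (hatIso hpd) (NS0.grade s) := fun s => by
      ext u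
      obtain ⟨x, rfl⟩ := (hatIso hpd).surjective u
      rw [mem_hatGrade_iff hpd]
      exact ⟨fun h => ⟨x, h, rfl⟩, fun ⟨y, hy, h⟩ => (hatIso hpd).injective h ▸ hy⟩
    rw [h1, h1]
    exact (Submodule.orderIsoMapComap (hatIso hpd)).isCompl NS0.isLieSuperalgebra.isCompl
  graded i j u hu v hv := by
    obtain ⟨x, rfl⟩ := (hatIso hpd).surjective u
    obtain ⟨y, rfl⟩ := (hatIso hpd).surjective v
    rw [mem_hatGrade_iff hpd] at hu hv
    rw [hatBracket_hatIso, mem_hatGrade_iff hpd]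
    exact NS0.isLieSuperalgebra.graded i j x hu y hv
  skew i j u hu v hv := by
    obtain ⟨x, rfl⟩ := (hatIso hpd).surjective u
    obtain ⟨y, rfl⟩ := (hatIso hpd).surjective v
    rw [mem_hatGrade_iff hpd] at hu hv
    rw [hatBracket_hatIso, hatBracket_hatIso, NS0.isLieSuperalgebra.skew i j x hu y hv, map_neg, map_smul]
  jacobi i j k u hu v hv w hw := by
    obtain ⟨x, rfl⟩ := (hatIso hpd).surjective u
    obtain ⟨y, rfl⟩ := (hatIso hpd).surjective v
    obtain ⟨z, rfl⟩ := (hatIso hpd).surjective w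
    rw [mem_hatGrade_iff hpd] at hu hv hw
    have h1 := congrArg (hatIso hpd) (NS0.isLieSuperalgebra.jacobi i j k x hu y hv z hw)
    rw [map_add, map_add, map_smul, map_smul, map_smul, map_zero] at h1
    simpa only [hatBracket_hatIso] using h1

end Iso

lemma hatTangent_le {pd : Coord → (SD1 →ₗ[ℂ] Lam)} (hpd : IsPartial pd) :
    hatTangent pd ≤ tangentSpace := by
  refine Submodule.span_le.mpr ?_
  rintro _ ⟨p, rfl⟩
  have h1 : evenTangent ≤ tangentSpace := le_sup_left
  have h2 : oddTangent ≤ tangentSpace := le_sup_right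
  by_cases hp : p.IsOdd
  · exact neg_mem (h2 (hpd.2.1 p hp))
  · exact neg_mem (h1 (hpd.1 p hp))

/-- The bracket is given by the second derivatives of the substitution. -/
lemma hatBracket_hatPartial {S : SewingData} (hS : S.IsSewing) {pd : Coord → (SD1 →ₗ[ℂ] Lam)}
    (hpd : IsPartial pd) {sub : SD1 →ₐ[ℂ] Formal} (hsub : IsSubstitution S sub) (p q : Coord) (F : SD1) :
    (hatBracket hpd (hatPartial pd p) (hatPartial pd q)).1 F = coordBracket (sub F) p q := by
  have h := hS.regular
  have hs := (h.isSubstitution_iff hS).mp hsub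
  have hc := h.isCentered_phi hS
  have hd : ∀ s t p, IsSubst.deriv1 sub s p = IsSubst.deriv1 sub t p := fun s t p =>
    gradedTangent_ext (hs.deriv1_mem hc s p) (hs.deriv1_mem hc t p) fun q => by
      rw [hs.deriv1_coord, hs.deriv1_coord, h.atE_dVar_phi hS, h.atE_dVar_phi hS]
  obtain ⟨s, t, s', t', hb⟩ := exists_coordBracket_eq p q
  have hb' : ∀ F, coordBracket (sub F) p q = IsSubst.deriv2 sub s t s' t' p q F := fun F => hb (sub F)
  have hbr : hatBracket hpd (hatPartial pd p) (hatPartial pd q)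
      = hatIso hpd ((factor p * factor q) • NS0.basisBracket (idx p) (idx q)) := by
    rw [hatPartial_eq hpd, hatPartial_eq hpd, hatBracket_hatIso]
    simp only [map_neg, map_smul, LinearMap.neg_apply, LinearMap.smul_apply, neg_neg,
      NS0.bracket_single, smul_smul, smul_neg]
    rw [mul_comm]
  rw [hbr, coe_hatIso, hb']
  refine DFunLike.congr_fun (gradedTangent_ext (s := p.grade + q.grade) ?_
    (hs.deriv2_mem hc (hd _ _ _) (hd _ _ _)) fun r => ?_) F
  · refine toTangent_mem hpd (Submodule.smul_mem _ _ ?_)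
    rw [← parity_idx, ← parity_idx]
    exact NS0.basisBracket_mem _ _
  · rw [toTangent_coord hpd, ← hb', hs.coord, h.coordBracket_phi hS, Finsupp.smul_apply, smul_eq_mul]
    congr 2
    ring

end

end

theorem mainTheorem12 :
    (∃ S : SewingData, S.IsSewing) ∧
    (∃! pd : Coord → (SD1 →ₗ[ℂ] Lam), IsPartial pd) ∧
    ∀ (S : SewingData) (pd : Coord → (SD1 →ₗ[ℂ] Lam)), S.IsSewing → IsPartial pd →
      (∃! sub : SD1 →ₐ[ℂ] Formal, IsSubstitution S sub) ∧
      ∀ sub : SD1 →ₐ[ℂ] Formal, IsSubstitution S sub →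
        hatTangent pd ≤ tangentSpace ∧
        ∃ br : hatTangent pd →ₗ[ℂ] hatTangent pd →ₗ[ℂ] hatTangent pd,
          (∀ p q F, (br (hatPartial pd p) (hatPartial pd q)).1 F = coordBracket (sub F) p q) ∧
          IsLieSuperalgebra (hatGrade pd) br ∧
          ∃ iso : NS0 ≃ₗ[ℂ] hatTangent pd,
            (∀ n, iso (NS0.L n) = calL pd n) ∧
            (∀ n, iso (NS0.G n) = calG pd n) ∧
            ∀ u v, iso (NS0.bracket u v) = br (iso u) (iso v) := by
  refine ⟨SewingData.exists_isSewing, ?_, fun S pd hS hpd => ⟨hS.regular.existsUnique_substitution hS,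
    fun sub hsub => ⟨hatTangent_le hpd, hatBracket hpd, hatBracket_hatPartial hS hpd hsub,
      isLieSuperalgebra_hatBracket hpd, hatIso hpd, hatIso_L hpd, hatIso_G hpd,
      fun u v => (hatBracket_hatIso hpd u v).symm⟩⟩⟩
  obtain ⟨pd, hpd⟩ := exists_isPartial
  exact ⟨pd, hpd, fun pd' hpd' => isPartial_unique hpd' hpd⟩
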